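/- **Setting.** Let $\mathfrak g$ be $\mathfrak{so}_{2n+1}$ ($n\ge1$), $\mathfrak{sp}_{2n}$ ($n\ge 1$) or $\mathfrak{so}_{2n}$ ($n\ge 2$), with simple roots $\alpha_i=\epsilon_i-\epsilon_{i+1}$ ($1\le i<n$) and $\alpha_n=\epsilon_n$, $2\epsilon_n$, $\epsilon_{n-1}+\epsilon_n$ respectively ($\epsilon_i$ orthonormal), $a_{ij}=2(\alpha_i,\alpha_j)/(\alpha_i,\alpha_i)$, and $d_i=1$ for all $i$, except $d_i=2$ for $i<n$ if $\mathfrak g=\mathfrak{so}_{2n+1}$ and $d_n=2$ if $\mathfrak g=\mathfrak{sp}_{2n}$. Let $U_v$ be the quantum group over $\mathbb Q(v)$ with generators $e_i,f_i,k_i^{\pm1}$ ($1\le i\le n$) and relations $k_ik_i^{-1}=k_i^{-1}k_i=1$, $k_ik_j=k_jk_i$, $k_ie_jk_i^{-1}=v^{d_ia_{ij}}e_j$, $k_if_jk_i^{-1}=v^{-d_ia_{ij}}f_j$, $e_if_j-f_je_i=\delta_{ij}\frac{k_i-k_i^{-1}}{v^{d_i}-v^{-d_i}}$ and the quantum Serre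 relations; $\Delta(e_i)=e_i\otimes1+k_i\otimes e_i$, $\Delta(f_i)=f_i\otimes k_i^{-1}+1\otimes f_i$, $\Delta(k_i)=k_i\otimes k_i$, with antipode $S(e_i)=-k_i^{-1}e_i$, $S(f_i)=-f_ik_i$, $S(k_i)=k_i^{-1}$; let $\tau$ be the anti-automorphism with $\tau(e_i)=f_i$, $\tau(f_i)=e_i$, $\tau(k_i)=k_i$. Let $\mathbf U$ be the $\mathbb Z[v,v^{-1}]$-subalgebra generated by all $k_i^{\pm1}$ and divided powers $e_i^{(m)},f_i^{(m)}$ ($m\ge 1$). Let $\kappa$ be a field that is a $\mathbb Z[v,v^{-1}]$-algebra, let $q\in\kappa^*$ be the image of $v$ if $\mathfrak g\ne\mathfrak{so}_{2n+1}$, and of $v^2$ if $\mathfrak g=\mathfrak{so}_{2n+1}$ (in which case $q^{1/2}$ denotes the image of $v$). Assume $q^2\ne1$. Put $\mathbf U_\kappa(\mathfrak g)=\mathbf U\otimes_{\mathbb Z[v,v^{-1}]}\kappa$, and write $S,\tau$ also for the induced maps. Let $N=2n+1$ for $\mathfrak{so}_{2n+1}$ and $N=2n$ otherwise, and $i'=N+1-i$.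 The natural representation $V$ of $\mathbf U_\kappa(\mathfrak g)$ has basis $v_1,\dots,v_N$; $k_i v_j=q^{(\alpha_i,\mathrm{wt}\,v_j)}v_j$ with $\mathrm{wt}(v_j)=-\mathrm{wt}(v_{j'})=\epsilon_j$ for $j\le n$, $\mathrm{wt}(v_{n+1})=0$ for $\mathfrak{so}_{2n+1}$; the nonzero values of the $e_i,f_i$ on basis vectors are: for $i<n$, $e_iv_{i+1}=v_i$, $e_iv_{i'}=-v_{(i+1)'}$, $f_iv_i=v_{i+1}$, $f_iv_{(i+1)'}=-v_{i'}$; for $\mathfrak{so}_{2n+1}$, $e_nv_{n+1}=v_n$, $e_nv_{n'}=-q^{-1/2}v_{n+1}$, $f_nv_n=[2]v_{n+1}$, $f_nv_{n+1}=-q^{1/2}[2]v_{n'}$ with $[2]=q^{1/2}+q^{-1/2}$; for $\mathfrak{sp}_{2n}$, $e_nv_{n'}=v_n$, $f_nv_n=v_{n'}$; for $\mathfrak{so}_{2n}$, $e_nv_{n'}=v_{n-1}$, $e_nv_{(n-1)'}=-v_n$, $f_nv_{n-1}=v_{n'}$, $f_nv_n=-v_{(n-1)'}$. (This is the base change to $\kappa$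 of the representation over $\mathbb Q(v)$ given by these formulas.) For $r\ge1$, $\mathbf U_\kappa(\mathfrak g)$ acts on $V^{\otimes r}$ from the left through $\Delta$; put $v_{\mathbf i}=v_{i_1}\otimes\cdots\otimes v_{i_r}$. Let $(\rho_1,\dots,\rho_N)$ be $(n-\frac12,\dots,\frac12,0,-\frac12,\dots,\frac12-n)$ for $\mathfrak{so}_{2n+1}$, $(n-1,\dots,1,0,0,-1,\dots,1-n)$ for $\mathfrak{so}_{2n}$, and $(n,\dots,1,-1,\dots,-n)$ for $\mathfrak{sp}_{2n}$; let $\varepsilon_i=-1$ if $\mathfrak g=\mathfrak{sp}_{2n}$ and $i>n$, and $\varepsilon_i=1$ otherwise. Let $\varrho=q^{2n},\,-q^{2n+1},\,q^{2n-1}$ for $\mathfrak{so}_{2n+1},\mathfrak{sp}_{2n},\mathfrak{so}_{2n}$. The Birman–Murakami–Wenzl algebra $\mathscr B_r(\varrho,q)$ is the $\kappa$-algebra generated by $T_i^{\pm1},E_i$ ($1\le i\le r-1$) with $T_i-T_i^{-1}=(q-q^{-1})(1-E_i)$, $(T_i-q)(T_i+q^{-1})(T_i-\varrho^{-1})=0$,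 $T_iT_{i+1}T_i=T_{i+1}T_iT_{i+1}$, $T_iT_j=T_jT_i$ for $|i-j|>1$, $E_iT_j^{\pm1}E_i=\varrho^{\pm1}E_i$ for $|i-j|=1$, $E_iT_i=T_iE_i=\varrho^{-1}E_i$. Let $\sigma$ be its anti-involution fixing all $T_i,E_i$, and $\tilde\sigma$ its anti-involution with $T_i\mapsto T_{r-i}$, $E_i\mapsto E_{r-i}$. Put $\delta=q-q^{-1}$ and define operators on $V\otimes V$, written on the right: $(v_k\otimes v_l)E=0$ if $k\ne l'$, and $(v_k\otimes v_{k'})E=\sum_{i=1}^N q^{\rho_{i'}-\rho_k}\varepsilon_{i'}\varepsilon_k\,v_i\otimes v_{i'}$; and, with $t_k=\delta\sum_{i>k}q^{\rho_i-\rho_k}\varepsilon_i\varepsilon_k\,v_{i'}\otimes v_i$, $$(v_k\otimes v_l)\breve R=\begin{cases}q\,v_k\otimes v_k,&k=l\ne l',\\ v_k\otimes v_k-t_k,&k=l=l',\\ v_l\otimes v_k,&k>l,\ k\ne l',\\ q^{-1}v_l\otimes v_k-t_k,&k>l,\ k=l',\\ v_l\otimes v_k+\delta v_k\otimes v_l,&k<l,\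 k\ne l',\\ q^{-1}v_l\otimes v_k+\delta v_k\otimes v_l-t_k,&k<l,\ k=l'.\end{cases}$$ **Statement.** There is a right action of $\mathscr B_r(\varrho,q)$ on $V^{\otimes r}$, commuting with the action of $\mathbf U_\kappa(\mathfrak g)$, in which $T_i$ and $E_i$ act by $\breve R$ and $E$ on the tensor factors $i,i+1$. For the resulting $(\mathbf U_\kappa(\mathfrak g),\mathscr B_r(\varrho,q))$-bimodule $V^{\otimes r}$: 1. Let $\mathfrak g=\mathfrak{so}_{2n+1}$. Make the linear dual $(V^{\otimes r})^*$ a bimodule by $(u\phi)(x)=\phi(S(u)x)$ and $(\phi b)(x)=\phi(x\tilde\sigma(b))$. The bilinear form on $V^{\otimes r}$ with $\langle v_{\mathbf i},v_{\mathbf j}\rangle=q^{-(\rho_{i_1}+\cdots+\rho_{i_r})}\delta_{\mathbf i,\mathbf j'}$, where $\mathbf j'=(j_r',\dots,j_1')$, is non-degenerate, and $x\mapsto\langle x,\cdot\rangle$ is an isomorphism of bimodules $V^{\otimes r}\cong(V^{\otimes r})^*$. 2. Let $\mathfrak g=\mathfrak{sp}_{2n}$ or $\mathfrak{so}_{2n}$.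 Let $(V^{\otimes r})^\circ$ be the linear dual with the bimodule structure $(u\phi)(x)=\phi(\tau(u)x)$ and $(\phi b)(x)=\phi(x\sigma(b))$. The bilinear form on $V^{\otimes r}$ with $\langle v_{\mathbf i},v_{\mathbf j}\rangle=q^{\beta(\mathbf i)}\delta_{\mathbf i,\mathbf j}$, where $\beta(\mathbf i)=\#\{s<t:\ i_s\ne i_t,\ i_s\ne i_t'\}+2\,\#\{s<t:\ i_s=i_t'\}$, is symmetric and non-degenerate, and $x\mapsto\langle x,\cdot\rangle$ is an isomorphism of bimodules $V^{\otimes r}\cong(V^{\otimes r})^\circ$. -/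

import Mathlib

open scoped TensorProduct
open LaurentPolynomial

namespace QG

set_option linter.unusedSimpArgs false
set_option linter.unusedTactic false
set_option linter.unreachableTactic false
set_option linter.unnecessarySeqFocus false

section

/-- The ring `𝒜 = ℤ[v, v⁻¹]` of integral Laurent polynomials. -/
abbrev LA := LaurentPolynomial ℤ
/-- The field `ℚ(v)`, as the field of fractions of `ℤ[v, v⁻¹]`. -/
abbrev QV := FractionRing LA

/-- The indeterminate `v` in `ℚ(v)`. -/
noncomputable def v : QV := algebraMap LA QV (T 1)

/-- The quantum integer `[m]_d = (v^{dm} - v^{-dm}) / (v^d - v^{-d})`. -/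
noncomputable def qnum (d m : ℕ) : QV :=
  (v ^ (d * m : ℤ) - v ^ (-(d * m) : ℤ)) / (v ^ (d : ℤ) - v ^ (-d : ℤ))

/-- The quantum factorial `[m]_d!`. -/
noncomputable def qfact (d m : ℕ) : QV := ∏ i ∈ Finset.range m, qnum d (i + 1)

/-- The quantum binomial coefficient of `m` over `s` with respect to `d`. -/
noncomputable def qbinom (d m s : ℕ) : QV := qfact d m / (qfact d s * qfact d (m - s))

theorem algebraMap_T (m : ℤ) : algebraMap LA QV (T m) = v ^ m := by
  have h1 : v * algebraMap LA QV (T (-1)) = 1 := by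
    rw [v, ← map_mul, ← T_add]; simp
  have hv : v ≠ 0 := left_ne_zero_of_mul_eq_one h1
  induction m using Int.induction_on with
  | zero => simp
  | succ k ih => rw [T_add, map_mul, ih, zpow_add_one₀ hv]; rfl
  | pred k ih =>
    rw [T_sub, map_mul, ih, zpow_sub_one₀ hv, ← eq_inv_of_mul_eq_one_right h1]

theorem v_ne_zero : v ≠ 0 := by
  have h1 : v * algebraMap LA QV (T (-1)) = 1 := by
    rw [v, ← map_mul, ← T_add]; simp
  exact left_ne_zero_of_mul_eq_one h1

theorem v_zpow_ne {m k : ℤ} (h : m ≠ k) : v ^ m ≠ v ^ k := by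
  rw [← algebraMap_T, ← algebraMap_T]
  intro h'
  have := IsFractionRing.injective LA QV h'
  have h2 := congrArg (fun p : LA => p.coeff m) this
  simp only [LaurentPolynomial.T, AddMonoidAlgebra.coeff_single, Finsupp.single_eq_same,
    Finsupp.single_eq_of_ne h] at h2
  exact one_ne_zero h2

theorem v_sub_ne {d : ℕ} (hd : d ≠ 0) : v ^ (d : ℤ) - v ^ (-d : ℤ) ≠ 0 :=
  sub_ne_zero.2 (v_zpow_ne (by omega))

theorem qnum_ne {d m : ℕ} (hd : d ≠ 0) (hm : m ≠ 0) : qnum d m ≠ 0 :=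
  div_ne_zero (sub_ne_zero.2 (v_zpow_ne (by
    have := Nat.mul_ne_zero hd hm
    have h2 : (d : ℤ) * m ≠ 0 := by exact_mod_cast this
    omega))) (v_sub_ne hd)

theorem qfact_ne {d : ℕ} (hd : d ≠ 0) (m : ℕ) : qfact d m ≠ 0 :=
  Finset.prod_ne_zero_iff.2 fun _ _ => qnum_ne hd (by omega)

theorem qfact_succ (d m : ℕ) : qfact d (m + 1) = qfact d m * qnum d (m + 1) := by
  rw [qfact, Finset.prod_range_succ, ← qfact]

theorem qnum_one {d : ℕ} (hd : d ≠ 0) : qnum d 1 = 1 := by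
  rw [qnum]; simpa using div_self (v_sub_ne hd)

theorem qnum_succ {d : ℕ} (hd : d ≠ 0) (a b : ℕ) :
    qnum d (a + b) = v ^ (-(d * b) : ℤ) * qnum d a + v ^ (d * a : ℤ) * qnum d b := by
  have h := v_sub_ne hd
  have hv := v_ne_zero
  rw [qnum, qnum, qnum, mul_div_assoc', mul_div_assoc', ← add_div]
  congr 1
  rw [mul_sub, mul_sub, ← zpow_add₀ hv, ← zpow_add₀ hv, ← zpow_add₀ hv, ← zpow_add₀ hv]
  push_cast
  ring_nf

section SerreAux
variable {F B : Type*} [Field F] [Ring B] [Algebra F B]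

theorem swap_assoc {x y : B} {c : F} (h : x * y = c • (y * x)) (z : B) :
    x * (y * z) = c • (y * (x * z)) := by
  rw [← mul_assoc, h, smul_mul_assoc, mul_assoc]

theorem serre_two_aux {t : F} (ht0 : t ≠ 0) {x₁ x₂ y₁ y₂ : B}
    (h1 : x₂ * x₁ = t ^ 2 • (x₁ * x₂))
    (h2 : x₂ * y₁ = t⁻¹ • (y₁ * x₂)) (h3 : y₂ * x₁ = t⁻¹ • (x₁ * y₂)) :
    (x₁ + x₂) * (x₁ + x₂) * (y₁ + y₂) - (t + t⁻¹) • ((x₁ + x₂) * (y₁ + y₂) * (x₁ + x₂))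
      + (y₁ + y₂) * (x₁ + x₂) * (x₁ + x₂) =
    (x₁ * x₁ * y₁ - (t + t⁻¹) • (x₁ * y₁ * x₁) + y₁ * x₁ * x₁) +
    (x₂ * x₂ * y₂ - (t + t⁻¹) • (x₂ * y₂ * x₂) + y₂ * x₂ * x₂) := by
  simp only [add_mul, mul_add, mul_assoc, h1, h2, h3, swap_assoc h1, swap_assoc h2, swap_assoc h3,
    mul_smul_comm, smul_mul_assoc, smul_smul, smul_add]
  match_scalars <;> field_simp <;> ring

theorem serre_three_aux {t : F} (ht0 : t ≠ 0) {x₁ x₂ y₁ y₂ : B}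
    (h1 : x₂ * x₁ = t ^ 2 • (x₁ * x₂))
    (h2 : x₂ * y₁ = (t⁻¹) ^ 2 • (y₁ * x₂)) (h3 : y₂ * x₁ = (t⁻¹) ^ 2 • (x₁ * y₂)) :
    (x₁ + x₂) * (x₁ + x₂) * (x₁ + x₂) * (y₁ + y₂)
      - (t ^ 2 + 1 + t⁻¹ ^ 2) • ((x₁ + x₂) * (x₁ + x₂) * (y₁ + y₂) * (x₁ + x₂))
      + (t ^ 2 + 1 + t⁻¹ ^ 2) • ((x₁ + x₂) * (y₁ + y₂) * (x₁ + x₂) * (x₁ + x₂))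
      - (y₁ + y₂) * (x₁ + x₂) * (x₁ + x₂) * (x₁ + x₂) =
    (x₁ * x₁ * x₁ * y₁ - (t ^ 2 + 1 + t⁻¹ ^ 2) • (x₁ * x₁ * y₁ * x₁)
      + (t ^ 2 + 1 + t⁻¹ ^ 2) • (x₁ * y₁ * x₁ * x₁) - y₁ * x₁ * x₁ * x₁) +
    (x₂ * x₂ * x₂ * y₂ - (t ^ 2 + 1 + t⁻¹ ^ 2) • (x₂ * x₂ * y₂ * x₂)
      + (t ^ 2 + 1 + t⁻¹ ^ 2) • (x₂ * y₂ * x₂ * x₂) - y₂ * x₂ * x₂ * x₂) := by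
  simp only [add_mul, mul_add, mul_assoc, h1, h2, h3, swap_assoc h1, swap_assoc h2, swap_assoc h3,
    mul_smul_comm, smul_mul_assoc, smul_smul, smul_add]
  match_scalars <;> field_simp <;> ring

end SerreAux

noncomputable def serre {B : Type*} [Semiring B] [Algebra QV B] (d m : ℕ) (x y : B) : B :=
  ∑ s ∈ Finset.range (m + 1), ((-1) ^ s * qbinom d m s) • (x ^ (m - s) * y * x ^ s)

theorem map_serre {B C : Type*} [Semiring B] [Algebra QV B] [Semiring C] [Algebra QV C] (φ : B →ₐ[QV] C) (d m : ℕ) (x y : B) :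
    φ (serre d m x y) = serre d m (φ x) (φ y) := by
  simp [serre]

section Serre
variable {B : Type*} [Ring B] [Algebra QV B]

theorem qbinom_zero {d : ℕ} (hd : d ≠ 0) (m : ℕ) : qbinom d m 0 = 1 := by
  have := qfact_ne hd m
  simpa [qbinom, qfact] using this

theorem qbinom_self {d : ℕ} (hd : d ≠ 0) (m : ℕ) : qbinom d m m = 1 := by
  have := qfact_ne hd m
  simpa [qbinom, qfact] using this

theorem qnum_two {d : ℕ} (hd : d ≠ 0) : qnum d 2 = v ^ (d : ℤ) + (v ^ (d : ℤ))⁻¹ := by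
  have := qnum_succ hd 1 1
  rw [qnum_one hd] at this
  rw [this]; simp [add_comm]

theorem qnum_three {d : ℕ} (hd : d ≠ 0) :
    qnum d 3 = (v ^ (d : ℤ)) ^ 2 + 1 + ((v ^ (d : ℤ))⁻¹) ^ 2 := by
  have := qnum_succ hd 2 1
  have hv : v ^ (d : ℤ) ≠ 0 := zpow_ne_zero _ v_ne_zero
  rw [qnum_one hd, qnum_two hd] at this
  rw [this, Nat.cast_one, mul_one, mul_one, zpow_neg, Nat.cast_two, zpow_mul, zpow_ofNat]
  field_simp
  ring

theorem serre_one {d : ℕ} (hd : d ≠ 0) (x y : B) : serre d 1 x y = x * y - y * x := by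
  simp [serre, Finset.sum_range_succ, qbinom_zero hd, qbinom_self hd, sub_eq_add_neg]

theorem serre_two {d : ℕ} (hd : d ≠ 0) (x y : B) : serre d 2 x y =
    x * x * y - (v ^ (d : ℤ) + (v ^ (d : ℤ))⁻¹) • (x * y * x) + y * x * x := by
  have h : qbinom d 2 1 = v ^ (d : ℤ) + (v ^ (d : ℤ))⁻¹ := by
    rw [← qnum_two hd]
    simp [qbinom, qfact, Finset.prod_range_succ, qnum_one hd]
  simp only [serre, Finset.sum_range_succ, qbinom_zero hd, qbinom_self hd, h, Finset.range_zero, Finset.sum_empty]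
  generalize v ^ (d : ℤ) + (v ^ (d : ℤ))⁻¹ = c
  simp [pow_two, mul_assoc, sub_eq_add_neg]

theorem serre_three {d : ℕ} (hd : d ≠ 0) (x y : B) : serre d 3 x y =
    x * x * x * y - ((v ^ (d : ℤ)) ^ 2 + 1 + ((v ^ (d : ℤ))⁻¹) ^ 2) • (x * x * y * x)
      + ((v ^ (d : ℤ)) ^ 2 + 1 + ((v ^ (d : ℤ))⁻¹) ^ 2) • (x * y * x * x) - y * x * x * x := by
  have h2 : qnum d 2 ≠ 0 := qnum_ne hd (by omega)
  have h1 : qbinom d 3 1 = (v ^ (d : ℤ)) ^ 2 + 1 + ((v ^ (d : ℤ))⁻¹) ^ 2 := by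
    rw [← qnum_three hd]
    simp [qbinom, qfact, Finset.prod_range_succ, qnum_one hd]
    field_simp
  have h2 : qbinom d 3 2 = (v ^ (d : ℤ)) ^ 2 + 1 + ((v ^ (d : ℤ))⁻¹) ^ 2 := by
    rw [← qnum_three hd]
    simp [qbinom, qfact, Finset.prod_range_succ, qnum_one hd]
    field_simp
  simp only [serre, Finset.sum_range_succ, qbinom_zero hd, qbinom_self hd, h1, h2, Finset.range_zero, Finset.sum_empty]
  generalize (v ^ (d : ℤ)) ^ 2 + 1 + ((v ^ (d : ℤ))⁻¹) ^ 2 = c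
  simp [pow_succ, mul_assoc, sub_eq_add_neg]

theorem serre_one_add {d : ℕ} (hd : d ≠ 0) {x₁ x₂ y₁ y₂ : B}
    (h2 : x₂ * y₁ = y₁ * x₂) (h3 : y₂ * x₁ = x₁ * y₂) :
    serre d 1 (x₁ + x₂) (y₁ + y₂) = serre d 1 x₁ y₁ + serre d 1 x₂ y₂ := by
  rw [serre_one hd, serre_one hd, serre_one hd]
  simp only [add_mul, mul_add, h2, h3]
  abel

theorem serre_two_add {d : ℕ} (hd : d ≠ 0) {t : QV} (ht : v ^ (d : ℤ) = t) {x₁ x₂ y₁ y₂ : B}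
    (h1 : x₂ * x₁ = t ^ 2 • (x₁ * x₂))
    (h2 : x₂ * y₁ = t⁻¹ • (y₁ * x₂)) (h3 : y₂ * x₁ = t⁻¹ • (x₁ * y₂)) :
    serre d 2 (x₁ + x₂) (y₁ + y₂) = serre d 2 x₁ y₁ + serre d 2 x₂ y₂ := by
  have ht0 : t ≠ 0 := ht ▸ zpow_ne_zero _ v_ne_zero
  rw [serre_two hd, serre_two hd, serre_two hd, ht]
  exact serre_two_aux ht0 h1 h2 h3

theorem serre_three_add {d : ℕ} (hd : d ≠ 0) {t : QV} (ht : v ^ (d : ℤ) = t) {x₁ x₂ y₁ y₂ : B}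
    (h1 : x₂ * x₁ = t ^ 2 • (x₁ * x₂))
    (h2 : x₂ * y₁ = (t⁻¹) ^ 2 • (y₁ * x₂)) (h3 : y₂ * x₁ = (t⁻¹) ^ 2 • (x₁ * y₂)) :
    serre d 3 (x₁ + x₂) (y₁ + y₂) = serre d 3 x₁ y₁ + serre d 3 x₂ y₂ := by
  have ht0 : t ≠ 0 := ht ▸ zpow_ne_zero _ v_ne_zero
  rw [serre_three hd, serre_three hd, serre_three hd, ht]
  exact serre_three_aux ht0 h1 h2 h3

end Serre

end

section

/-- The three classical types: `B` for `so_{2n+1}`, `C` for `sp_{2n}`, `D` for `so_{2n}`. -/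
inductive Ty | B | C | D

namespace Ty

/-- The least rank `n` for which the root system is defined. -/
def minRank : Ty → ℕ
  | B => 1
  | C => 1
  | D => 2

/-- The dimension `N` of the natural representation `V`. -/
def dimV (X : Ty) (n : ℕ) : ℕ :=
  match X with
  | B => 2 * n + 1
  | C => 2 * n
  | D => 2 * n

end Ty

variable (X : Ty) (n : ℕ)

/-- The last simple root: `ε_n`, `2 ε_n`, `ε_{n-1} + ε_n` in types `B`, `C`, `D`.
Indices are counted from `0`. -/
def lastRoot (k : Fin n) : ℤ :=
  match X with
  | .B => if k.val + 1 = n then 1 else 0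
  | .C => if k.val + 1 = n then 2 else 0
  | .D => if k.val + 1 = n ∨ k.val + 2 = n then 1 else 0

/-- The simple roots in the orthonormal basis `ε_1, …, ε_n`; `ε_i - ε_{i+1}` for `i < n`. -/
def simpleRoot (i k : Fin n) : ℤ :=
  if i.val + 1 < n then (if k = i then 1 else if k.val = i.val + 1 then -1 else 0)
  else lastRoot X n k

/-- The Cartan matrix `a_{ij} = 2 (α_i, α_j) / (α_i, α_i)`; the division is exact. -/
def cartan (i j : Fin n) : ℤ :=
  2 * (simpleRoot X n i ⬝ᵥ simpleRoot X n j) / (simpleRoot X n i ⬝ᵥ simpleRoot X n i)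

/-- The symmetrizers `d_i` of the Cartan matrix. -/
def dd (i : Fin n) : ℕ :=
  match X with
  | .B => if i.val + 1 < n then 2 else 1
  | .C => if i.val + 1 < n then 1 else 2
  | .D => 1

/-- The exponent `c` with `q = v ^ c`. -/
def qExp : ℕ :=
  match X with
  | .B => 2
  | .C => 1
  | .D => 1

variable {X n}

theorem dd_ne (i : Fin n) : dd X n i ≠ 0 := by
  cases X <;> simp only [dd] <;> (try split_ifs) <;> omega

theorem simpleRoot_dot (i : Fin n) (w : Fin n → ℤ) :
    simpleRoot X n i ⬝ᵥ w =
      if h : i.val + 1 < n then w i - w ⟨i.val + 1, h⟩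
      else match X with
        | .B => w i
        | .C => 2 * w i
        | .D => w i + if h : 2 ≤ n then w ⟨i.val - 1, by omega⟩ else 0 := by
  by_cases h : i.val + 1 < n
  · rw [dif_pos h]
    have : simpleRoot X n i = Pi.single i 1 - Pi.single ⟨i.val + 1, h⟩ 1 := by
      funext k
      simp only [simpleRoot, h, if_true, Pi.sub_apply, Pi.single_apply, Fin.ext_iff]
      split_ifs <;> omega
    rw [this]; simp [sub_dotProduct]
  · rw [dif_neg h]
    have hi : i.val + 1 = n := by omega
    cases X
    · have : simpleRoot .B n i = Pi.single i 1 := by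
        funext k
        simp only [simpleRoot, h, if_false, lastRoot, Pi.single_apply, Fin.ext_iff]
        split_ifs <;> omega
      rw [this]; simp
    · have : simpleRoot .C n i = Pi.single i 2 := by
        funext k
        simp only [simpleRoot, h, if_false, lastRoot, Pi.single_apply, Fin.ext_iff]
        split_ifs <;> omega
      rw [this]; simp
    · by_cases h2 : 2 ≤ n
      · have : simpleRoot .D n i = Pi.single i 1 + Pi.single ⟨i.val - 1, by omega⟩ 1 := by
          funext k
          simp only [simpleRoot, h, if_false, lastRoot, Pi.add_apply, Pi.single_apply, Fin.ext_iff]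
          split_ifs <;> omega
        rw [this]; simp [add_dotProduct, h2]
      · have : simpleRoot .D n i = Pi.single i 1 := by
          funext k
          simp only [simpleRoot, h, if_false, lastRoot, Pi.single_apply, Fin.ext_iff]
          split_ifs <;> omega
        rw [this]; simp [h2]

theorem cartan_spec (hn : X.minRank ≤ n) (i j : Fin n) : (dd X n i : ℤ) * cartan X n i j =
    qExp X * (simpleRoot X n i ⬝ᵥ simpleRoot X n j) := by
  cases X <;> simp only [Ty.minRank] at hn <;> simp only [cartan, dd, qExp, simpleRoot_dot] <;>
    simp only [simpleRoot, lastRoot, Fin.ext_iff] <;> split_ifs <;> first | omega | norm_num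

theorem cartan_symm (i j : Fin n) : (dd X n i : ℤ) * cartan X n i j =
    dd X n j * cartan X n j i := by
  by_cases h : i = j
  · rw [h]
  · have hn : X.minRank ≤ n := by
      have : i.val ≠ j.val := fun h' => h (Fin.ext h')
      cases X <;> simp only [Ty.minRank] <;> omega
    rw [cartan_spec hn, cartan_spec hn, dotProduct_comm]

theorem cartan_self (i : Fin n) : cartan X n i i = 2 := by
  cases X <;> simp only [cartan, simpleRoot_dot] <;>
      simp only [simpleRoot, lastRoot, Fin.ext_iff] <;> split_ifs <;> omega

theorem cartan_cases (i j : Fin n) (h : i ≠ j) :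
    cartan X n i j = 0 ∨ cartan X n i j = -1 ∨ cartan X n i j = -2 := by
  have h' : i.val ≠ j.val := fun h' => h (Fin.ext h')
  cases X <;> simp only [cartan, simpleRoot_dot] <;>
      simp only [simpleRoot, lastRoot, Fin.ext_iff] <;> split_ifs <;> omega

end

section

/-- Generators of the quantum group. -/
inductive Gen (n : ℕ)
  | e (i : Fin n)
  | f (i : Fin n)
  | k (i : Fin n)
  | kinv (i : Fin n)

section
variable (X : Ty) (n : ℕ)

/-- The free generators. -/
noncomputable abbrev fg {n : ℕ} (g : Gen n) : FreeAlgebra QV (Gen n) := FreeAlgebra.ι QV g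

/-- The defining relations of the quantum group over `ℚ(v)`. -/
inductive Rel : FreeAlgebra QV (Gen n) → FreeAlgebra QV (Gen n) → Prop
  | k_kinv (i) : Rel (fg (.k i) * fg (.kinv i)) 1
  | kinv_k (i) : Rel (fg (.kinv i) * fg (.k i)) 1
  | k_k (i j) : Rel (fg (.k i) * fg (.k j)) (fg (.k j) * fg (.k i))
  | k_e (i j) : Rel (fg (.k i) * fg (.e j) * fg (.kinv i))
      (v ^ (dd X n i * cartan X n i j : ℤ) • fg (.e j))
  | k_f (i j) : Rel (fg (.k i) * fg (.f j) * fg (.kinv i))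
      (v ^ (-(dd X n i * cartan X n i j) : ℤ) • fg (.f j))
  | e_f (i j) : Rel (fg (.e i) * fg (.f j) - fg (.f j) * fg (.e i))
      (if i = j then (v ^ (dd X n i : ℤ) - v ^ (-dd X n i : ℤ))⁻¹ • (fg (.k i) - fg (.kinv i)) else 0)
  | serre_e (i j) (h : i ≠ j) :
      Rel (serre (dd X n i) (1 - cartan X n i j).toNat (fg (.e i)) (fg (.e j))) 0
  | serre_f (i j) (h : i ≠ j) :
      Rel (serre (dd X n i) (1 - cartan X n i j).toNat (fg (.f i)) (fg (.f j))) 0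

/-- The quantum group `U_v(g)` over `ℚ(v)`. -/
def Uq : Type := RingQuot (Rel X n)

noncomputable instance : Ring (Uq X n) := inferInstanceAs (Ring (RingQuot (Rel X n)))
noncomputable instance : Algebra QV (Uq X n) := inferInstanceAs (Algebra QV (RingQuot (Rel X n)))
noncomputable instance : Algebra LA (Uq X n) := inferInstanceAs (Algebra LA (RingQuot (Rel X n)))
instance : IsScalarTower LA QV (Uq X n) :=
  inferInstanceAs (IsScalarTower LA QV (RingQuot (Rel X n)))

/-- The quotient map from the free algebra. -/
noncomputable def mkUq : FreeAlgebra QV (Gen n) →ₐ[QV] Uq X n := RingQuot.mkAlgHom QV (Rel X n)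

end

section
variable (X : Ty) {n : ℕ}

/-- The generators `e_i`, `f_i`, `k_i`, `k_i⁻¹` of the quantum group. -/
noncomputable def gen (g : Gen n) : Uq X n :=
  mkUq X n (FreeAlgebra.ι QV g)

/-- The defining relations, for a family of elements of an arbitrary algebra. -/
structure IsUqFamily {B : Type*} [Ring B] [Algebra QV B] (g : Gen n → B) : Prop where
  k_kinv (i) : g (.k i) * g (.kinv i) = 1
  kinv_k (i) : g (.kinv i) * g (.k i) = 1
  k_k (i j) : g (.k i) * g (.k j) = g (.k j) * g (.k i)
  k_e (i j) : g (.k i) * g (.e j) = v ^ (dd X n i * cartan X n i j : ℤ) • (g (.e j) * g (.k i))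
  k_f (i j) : g (.k i) * g (.f j) = v ^ (-(dd X n i * cartan X n i j) : ℤ) • (g (.f j) * g (.k i))
  e_f (i j) : g (.e i) * g (.f j) - g (.f j) * g (.e i) =
    if i = j then (v ^ (dd X n i : ℤ) - v ^ (-dd X n i : ℤ))⁻¹ • (g (.k i) - g (.kinv i)) else 0
  serre_e (i j) (h : i ≠ j) :
    serre (dd X n i) (1 - cartan X n i j).toNat (g (.e i)) (g (.e j)) = 0
  serre_f (i j) (h : i ≠ j) :
    serre (dd X n i) (1 - cartan X n i j).toNat (g (.f i)) (g (.f j)) = 0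

variable {X}

/-- The universal property of the quantum group. -/
noncomputable def liftUq {B : Type*} [Ring B] [Algebra QV B] (g : Gen n → B)
    (hg : IsUqFamily X g) : Uq X n →ₐ[QV] B :=
  RingQuot.liftAlgHom QV ⟨FreeAlgebra.lift QV g, by
    intro x y h
    cases h with
    | k_kinv i => simpa using hg.k_kinv i
    | kinv_k i => simpa using hg.kinv_k i
    | k_k i j => simpa using hg.k_k i j
    | k_e i j =>
      simp only [map_mul, map_smul, FreeAlgebra.lift_ι_apply]
      rw [hg.k_e, smul_mul_assoc, mul_assoc, hg.k_kinv, mul_one]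
    | k_f i j =>
      simp only [map_mul, map_smul, FreeAlgebra.lift_ι_apply]
      rw [hg.k_f, smul_mul_assoc, mul_assoc, hg.k_kinv, mul_one]
    | e_f i j =>
      have := hg.e_f i j
      split_ifs at this ⊢ <;>
        simpa only [map_sub, map_mul, map_smul, map_zero, FreeAlgebra.lift_ι_apply] using this
    | serre_e i j h => simpa only [map_serre, map_zero, FreeAlgebra.lift_ι_apply] using hg.serre_e i j h
    | serre_f i j h => simpa only [map_serre, map_zero, FreeAlgebra.lift_ι_apply] using hg.serre_f i j h⟩

theorem liftUq_gen {B : Type*} [Ring B] [Algebra QV B] (g : Gen n → B)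
    (hg : IsUqFamily X g) (x : Gen n) : liftUq g hg (gen X x) = g x := by
  have : liftUq g hg (gen X x) = FreeAlgebra.lift QV g (FreeAlgebra.ι QV x) :=
    RingQuot.liftAlgHom_mkAlgHom_apply _ _ _ _
  rw [this, FreeAlgebra.lift_ι_apply]

theorem rel_eq {x y : FreeAlgebra QV (Gen n)} (h : Rel X n x y) :
    mkUq X n x = mkUq X n y :=
  RingQuot.mkAlgHom_rel QV h

theorem mk_fg (g : Gen n) : mkUq X n (fg g) = gen X g := rfl

theorem gen_family : IsUqFamily X (gen X (n := n)) where
  k_kinv i := by simpa only [map_mul, map_one, mk_fg] using rel_eq (Rel.k_kinv (X := X) i)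
  kinv_k i := by simpa only [map_mul, map_one, mk_fg] using rel_eq (Rel.kinv_k (X := X) i)
  k_k i j := by simpa only [map_mul, map_one, mk_fg] using rel_eq (Rel.k_k (X := X) i j)
  k_e i j := by
    have := rel_eq (Rel.k_e (X := X) i j)
    have h2 : gen X (.kinv i) * gen X (.k i) = 1 := by simpa only [map_mul, map_one, mk_fg] using rel_eq (Rel.kinv_k (X := X) i)
    simp only [map_mul, map_smul, mk_fg] at this
    rw [← smul_mul_assoc, ← this, mul_assoc _ (gen X (.kinv i)), h2, mul_one]
  k_f i j := by
    have := rel_eq (Rel.k_f (X := X) i j)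
    have h2 : gen X (.kinv i) * gen X (.k i) = 1 := by simpa only [map_mul, map_one, mk_fg] using rel_eq (Rel.kinv_k (X := X) i)
    simp only [map_mul, map_smul, mk_fg] at this
    rw [← smul_mul_assoc, ← this, mul_assoc _ (gen X (.kinv i)), h2, mul_one]
  e_f i j := by
    have := rel_eq (Rel.e_f (X := X) i j)
    split_ifs at this ⊢ <;>
      simpa only [map_sub, map_mul, map_smul, map_zero, mk_fg] using this
  serre_e i j h := by
    have := rel_eq (Rel.serre_e (X := X) i j h)
    simpa only [map_serre, map_zero, mk_fg] using this
  serre_f i j h := by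
    have := rel_eq (Rel.serre_f (X := X) i j h)
    simpa only [map_serre, map_zero, mk_fg] using this

namespace IsUqFamily
variable {B : Type*} [Ring B] [Algebra QV B] {g : Gen n → B}

theorem kinv_x (hg : IsUqFamily X g) {i : Fin n} {x : B} {c : QV} (hc : c ≠ 0)
    (h : g (.k i) * x = c • (x * g (.k i))) : g (.kinv i) * x = c⁻¹ • (x * g (.kinv i)) := by
  have h1 : g (.kinv i) * (g (.k i) * x) * g (.kinv i) = x * g (.kinv i) := by
    rw [← mul_assoc, hg.kinv_k, one_mul]
  rw [h, mul_smul_comm, smul_mul_assoc, mul_assoc, mul_assoc, hg.k_kinv, mul_one] at h1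
  rw [← h1, smul_smul, inv_mul_cancel₀ hc, one_smul]

theorem kinv_kinv (hg : IsUqFamily X g) (i j : Fin n) : g (.kinv i) * g (.kinv j) = g (.kinv j) * g (.kinv i) := by
  have h := hg.kinv_x (i := j) (x := g (.k i)) (c := 1) one_ne_zero (by rw [one_smul, hg.k_k])
  have h2 := hg.kinv_x (i := i) (x := g (.kinv j)) (c := 1) one_ne_zero (by
    rw [one_smul]; simpa using h.symm)
  simpa using h2

theorem k_kinv' (hg : IsUqFamily X g) (i j : Fin n) : g (.k i) * g (.kinv j) = g (.kinv j) * g (.k i) := by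
  have h := hg.kinv_x (i := j) (x := g (.k i)) (c := 1) one_ne_zero (by rw [one_smul, hg.k_k])
  simpa using h.symm

theorem kinv_e (hg : IsUqFamily X g) (i j : Fin n) :
    g (.kinv i) * g (.e j) = v ^ (-(dd X n i * cartan X n i j) : ℤ) • (g (.e j) * g (.kinv i)) := by
  rw [zpow_neg]
  exact hg.kinv_x (zpow_ne_zero _ v_ne_zero) (hg.k_e i j)

theorem kinv_f (hg : IsUqFamily X g) (i j : Fin n) :
    g (.kinv i) * g (.f j) = v ^ (dd X n i * cartan X n i j : ℤ) • (g (.f j) * g (.kinv i)) := by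
  have := hg.kinv_x (zpow_ne_zero _ v_ne_zero) (hg.k_f i j)
  rwa [zpow_neg, inv_inv] at this

end IsUqFamily

section Hopf
variable (X n)

/-- A uniform statement for the compatibility of the quantum Serre relations with coproducts. -/
theorem serre_add_zero {B : Type*} [Ring B] [Algebra QV B] {i j : Fin n} (h : i ≠ j)
    {x₁ x₂ y₁ y₂ : B}
    (h1 : x₂ * x₁ = v ^ (dd X n i * cartan X n i i : ℤ) • (x₁ * x₂))
    (h2 : x₂ * y₁ = v ^ (dd X n i * cartan X n i j : ℤ) • (y₁ * x₂))
    (h3 : y₂ * x₁ = v ^ (dd X n j * cartan X n j i : ℤ) • (x₁ * y₂))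
    (hs₁ : serre (dd X n i) (1 - cartan X n i j).toNat x₁ y₁ = 0)
    (hs₂ : serre (dd X n i) (1 - cartan X n i j).toNat x₂ y₂ = 0) :
    serre (dd X n i) (1 - cartan X n i j).toNat (x₁ + x₂) (y₁ + y₂) = 0 := by
  rw [← cartan_symm] at h3
  rw [cartan_self] at h1
  have hd := dd_ne (X := X) i
  generalize dd X n i = d at *
  rw [← add_zero (0 : B)]
  nth_rw 1 [← hs₁]
  rw [← hs₂]
  clear hs₁ hs₂
  have e2 : v ^ ((d : ℤ) * 2) = (v ^ (d : ℤ)) ^ 2 := by rw [zpow_mul]; norm_cast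
  rw [e2] at h1
  rcases cartan_cases (X := X) i j h with h0 | h0 | h0 <;> rw [h0] at h2 h3 ⊢
  · simp only [mul_zero, zpow_zero, one_smul] at h2 h3
    exact serre_one_add hd h2 h3
  · rw [mul_neg_one, zpow_neg] at h2 h3
    exact serre_two_add hd rfl h1 h2 h3
  · have e3 : v ^ ((d : ℤ) * -2) = (v ^ (d : ℤ))⁻¹ ^ 2 := by
      rw [mul_neg, zpow_neg, e2, inv_pow]
    rw [e3] at h2 h3
    exact serre_three_add hd rfl h1 h2 h3

theorem serre_includeLeft {B C : Type*} [Ring B] [Algebra QV B] [Ring C] [Algebra QV C]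
    (d m : ℕ) (x y : B) : serre d m (x ⊗ₜ[QV] (1 : C)) (y ⊗ₜ[QV] (1 : C)) = serre d m x y ⊗ₜ 1 :=
  (map_serre (Algebra.TensorProduct.includeLeft : B →ₐ[QV] B ⊗[QV] C) d m x y).symm

theorem serre_includeRight {B C : Type*} [Ring B] [Algebra QV B] [Ring C] [Algebra QV C]
    (d m : ℕ) (x y : C) : serre d m ((1 : B) ⊗ₜ[QV] x) ((1 : B) ⊗ₜ[QV] y) = 1 ⊗ₜ serre d m x y :=
  (map_serre (Algebra.TensorProduct.includeRight : C →ₐ[QV] B ⊗[QV] C) d m x y).symm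

end Hopf

end

end

section

section
variable (X : Ty) {n : ℕ}

/-- Values of the comultiplication on generators. -/
noncomputable def comulGen : Gen n → Uq X n ⊗[QV] Uq X n
  | .e i => gen X (.e i) ⊗ₜ 1 + gen X (.k i) ⊗ₜ gen X (.e i)
  | .f i => gen X (.f i) ⊗ₜ gen X (.kinv i) + 1 ⊗ₜ gen X (.f i)
  | .k i => gen X (.k i) ⊗ₜ gen X (.k i)
  | .kinv i => gen X (.kinv i) ⊗ₜ gen X (.kinv i)

/-- Values of the counit on generators. -/
noncomputable def counitGen : Gen n → QV
  | .e _ => 0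
  | .f _ => 0
  | .k _ => 1
  | .kinv _ => 1

/-- Values of the antipode on generators. -/
noncomputable def antipodeGen : Gen n → (Uq X n)ᵐᵒᵖ
  | .e i => .op (-(gen X (.kinv i) * gen X (.e i)))
  | .f i => .op (-(gen X (.f i) * gen X (.k i)))
  | .k i => .op (gen X (.kinv i))
  | .kinv i => .op (gen X (.k i))

/-- Values of `τ` on generators: `e_i` and `f_i` are swapped, `k_i` is fixed. -/
noncomputable def tauGen : Gen n → (Uq X n)ᵐᵒᵖ
  | .e i => .op (gen X (.f i))
  | .f i => .op (gen X (.e i))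
  | .k i => .op (gen X (.k i))
  | .kinv i => .op (gen X (.kinv i))

theorem serre_tmul_kinv {B C : Type*} [Ring B] [Algebra QV B] [Ring C] [Algebra QV C]
    {d m : ℕ} (x y : B) (a b : C) (hab : a * b = b * a)
    (h : serre d m x y = 0) : serre d m (x ⊗ₜ[QV] a) (y ⊗ₜ[QV] b) = 0 := by
  have key : serre d m (x ⊗ₜ[QV] a) (y ⊗ₜ[QV] b) = serre d m x y ⊗ₜ (a ^ m * b) := by
    have hab' : Commute a b := hab
    simp only [serre, TensorProduct.sum_tmul, Algebra.TensorProduct.tmul_pow,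
      Algebra.TensorProduct.tmul_mul_tmul, TensorProduct.smul_tmul']
    refine Finset.sum_congr rfl fun s hs => ?_
    rw [Finset.mem_range] at hs
    have e : a ^ (m - s) * b * a ^ s = a ^ m * b := by
      rw [mul_assoc, ← (hab'.pow_left s).eq, ← mul_assoc, ← pow_add]
      congr 2; omega
    rw [e]
  rw [key, h, TensorProduct.zero_tmul]

theorem serre_kinv_tmul {B C : Type*} [Ring B] [Algebra QV B] [Ring C] [Algebra QV C]
    {d m : ℕ} (x y : B) (a b : C) (hab : a * b = b * a)
    (h : serre d m x y = 0) : serre d m (a ⊗ₜ[QV] x) (b ⊗ₜ[QV] y) = 0 := by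
  have key : serre d m (a ⊗ₜ[QV] x) (b ⊗ₜ[QV] y) = (a ^ m * b) ⊗ₜ serre d m x y := by
    have hab' : Commute a b := hab
    simp only [serre, TensorProduct.tmul_sum, Algebra.TensorProduct.tmul_pow,
      Algebra.TensorProduct.tmul_mul_tmul, ← TensorProduct.tmul_smul]
    refine Finset.sum_congr rfl fun s hs => ?_
    rw [Finset.mem_range] at hs
    have e : a ^ (m - s) * b * a ^ s = a ^ m * b := by
      rw [mul_assoc, ← (hab'.pow_left s).eq, ← mul_assoc, ← pow_add]
      congr 2; omega
    rw [e]
  rw [key, h, TensorProduct.tmul_zero]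

theorem comul_family : IsUqFamily X (comulGen X (n := n)) := by
  have G := gen_family (X := X) (n := n)
  constructor
  · intro i
    simp only [comulGen, Algebra.TensorProduct.tmul_mul_tmul, G.k_kinv]; rfl
  · intro i
    simp only [comulGen, Algebra.TensorProduct.tmul_mul_tmul, G.kinv_k]; rfl
  · intro i j
    simp only [comulGen, Algebra.TensorProduct.tmul_mul_tmul, G.k_k i j]
  · intro i j
    simp only [comulGen, mul_add, add_mul, Algebra.TensorProduct.tmul_mul_tmul, G.k_e, G.k_k i j, mul_one, one_mul, smul_add, TensorProduct.tmul_smul, TensorProduct.smul_tmul']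
  · intro i j
    simp only [comulGen, mul_add, add_mul, Algebra.TensorProduct.tmul_mul_tmul, G.k_f, G.k_kinv' i j, mul_one, one_mul, smul_add, TensorProduct.tmul_smul, TensorProduct.smul_tmul']
  · intro i j
    have hc : v ^ (dd X n i * cartan X n i j : ℤ) ≠ 0 := zpow_ne_zero _ v_ne_zero
    have h1 : (gen X (.k i) * gen X (.f j)) ⊗ₜ[QV] (gen X (.e i) * gen X (.kinv j)) =
        (gen X (.f j) * gen X (.k i)) ⊗ₜ[QV] (gen X (.kinv j) * gen X (.e i)) := by
      rw [G.k_f, G.kinv_e, ← cartan_symm, TensorProduct.smul_tmul]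
    have h2 := G.e_f i j
    simp only [comulGen, mul_add, add_mul, Algebra.TensorProduct.tmul_mul_tmul, mul_one, one_mul, h1]
    have h3 : ∀ a b c d e f : Uq X n ⊗[QV] Uq X n, a + b + (c + d) - (e + c + (b + f)) = a - e + (d - f) := by
      intros; abel
    trans (gen X (.e i) * gen X (.f j) - gen X (.f j) * gen X (.e i)) ⊗ₜ gen X (.kinv j) +
      gen X (.k i) ⊗ₜ (gen X (.e i) * gen X (.f j) - gen X (.f j) * gen X (.e i))
    · rw [TensorProduct.sub_tmul, TensorProduct.tmul_sub]; abel
    rw [h2]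
    split_ifs with h
    · subst h
      rw [TensorProduct.tmul_smul, ← TensorProduct.smul_tmul', ← smul_add, TensorProduct.sub_tmul, TensorProduct.tmul_sub]
      congr 1; abel
    · simp
  · intro i j h
    refine serre_add_zero X n h ?_ ?_ ?_ ?_ ?_
    · simp only [Algebra.TensorProduct.tmul_mul_tmul, G.k_e, mul_one, one_mul, TensorProduct.smul_tmul']
    · simp only [Algebra.TensorProduct.tmul_mul_tmul, G.k_e, mul_one, one_mul, TensorProduct.smul_tmul']
    · simp only [Algebra.TensorProduct.tmul_mul_tmul, G.k_e, mul_one, one_mul, TensorProduct.smul_tmul']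
    · rw [serre_includeLeft, G.serre_e i j h, TensorProduct.zero_tmul]
    · exact serre_kinv_tmul _ _ _ _ (G.k_k i j) (G.serre_e i j h)
  · intro i j h
    simp only [comulGen]
    rw [add_comm, add_comm (gen X (.f j) ⊗ₜ[QV] gen X (.kinv j))]
    refine serre_add_zero X n h ?_ ?_ ?_ ?_ ?_
    · simp only [Algebra.TensorProduct.tmul_mul_tmul, G.kinv_f, mul_one, one_mul, TensorProduct.tmul_smul]
    · simp only [Algebra.TensorProduct.tmul_mul_tmul, G.kinv_f, mul_one, one_mul, TensorProduct.tmul_smul]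
    · simp only [Algebra.TensorProduct.tmul_mul_tmul, G.kinv_f, mul_one, one_mul, TensorProduct.tmul_smul]
    · rw [serre_includeRight, G.serre_f i j h, TensorProduct.tmul_zero]
    · exact serre_tmul_kinv _ _ _ _ (G.kinv_kinv i j) (G.serre_f i j h)

theorem counit_family : IsUqFamily X (counitGen (n := n)) where
  k_kinv i := by simp [counitGen]
  kinv_k i := by simp [counitGen]
  k_k i j := by simp [counitGen]
  k_e i j := by simp [counitGen]
  k_f i j := by simp [counitGen]
  e_f i j := by simp [counitGen]
  serre_e i j h := by simp [counitGen, serre]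
  serre_f i j h := by simp [counitGen, serre]

theorem serre_op {d : ℕ} (hd : d ≠ 0) {B : Type*} [Ring B] [Algebra QV B]
    {m : ℕ} (hm : m = 1 ∨ m = 2 ∨ m = 3) {x y : B} (h : serre d m x y = 0) :
    serre d m (MulOpposite.op x) (MulOpposite.op y) = 0 := by
  apply MulOpposite.unop_injective
  rw [MulOpposite.unop_zero]
  rcases hm with rfl | rfl | rfl
  · rw [serre_one hd] at h ⊢
    rw [← neg_eq_zero, ← h]
    simp
  · rw [serre_two hd] at h ⊢
    rw [← h]
    generalize v ^ (d : ℤ) + (v ^ (d : ℤ))⁻¹ = c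
    simp only [MulOpposite.unop_add, MulOpposite.unop_sub, MulOpposite.unop_smul,
      MulOpposite.unop_mul, MulOpposite.unop_op, mul_assoc]
    abel
  · rw [serre_three hd] at h ⊢
    rw [← neg_eq_zero, ← h]
    generalize (v ^ (d : ℤ)) ^ 2 + 1 + ((v ^ (d : ℤ))⁻¹) ^ 2 = c
    simp only [MulOpposite.unop_add, MulOpposite.unop_sub, MulOpposite.unop_smul,
      MulOpposite.unop_mul, MulOpposite.unop_op, mul_assoc]
    abel

theorem serre_num (i j : Fin n) (h : i ≠ j) : (1 - cartan X n i j).toNat = 1 ∨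
    (1 - cartan X n i j).toNat = 2 ∨ (1 - cartan X n i j).toNat = 3 := by
  rcases cartan_cases (X := X) i j h with h0 | h0 | h0 <;> rw [h0] <;> simp

theorem tau_family : IsUqFamily X (tauGen X (n := n)) := by
  have G := gen_family (X := X) (n := n)
  constructor
  · intro i; simp only [tauGen, ← MulOpposite.op_mul, G.kinv_k, MulOpposite.op_one]
  · intro i; simp only [tauGen, ← MulOpposite.op_mul, G.k_kinv, MulOpposite.op_one]
  · intro i j; simp only [tauGen, ← MulOpposite.op_mul, G.k_k i j]
  · intro i j
    simp only [tauGen, ← MulOpposite.op_mul, ← MulOpposite.op_smul, G.k_f, smul_smul,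
      ← zpow_add₀ v_ne_zero, add_neg_cancel, zpow_zero, one_smul]
  · intro i j
    simp only [tauGen, ← MulOpposite.op_mul, ← MulOpposite.op_smul, G.k_e, smul_smul,
      ← zpow_add₀ v_ne_zero, neg_add_cancel, zpow_zero, one_smul]
  · intro i j
    simp only [tauGen, ← MulOpposite.op_mul, ← MulOpposite.op_sub, ← MulOpposite.op_smul, G.e_f j i]
    split_ifs with h1 h2 h2
    · subst h1; rfl
    · exact absurd h1.symm h2
    · exact absurd h2.symm h1
    · rfl
  · intro i j h
    exact serre_op (dd_ne i) (serre_num X i j h) (G.serre_f i j h)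
  · intro i j h
    exact serre_op (dd_ne i) (serre_num X i j h) (G.serre_e i j h)

theorem serre_twist_aux {F B : Type*} [Field F] [Ring B] [Algebra F B] {t c c' : F} (ht : t ≠ 0)
    {x y a b : B} (hab : b * a = a * b) (hxa : x * a = t ^ 2 • (a * x)) :
    ((x * b = b * x) → (y * a = a * y) → x * y - y * x = 0 →
      (c • (a * x)) * (c' • (b * y)) - (c' • (b * y)) * (c • (a * x)) = 0) ∧
    ((x * b = t⁻¹ • (b * x)) → (y * a = t⁻¹ • (a * y)) →
      x * x * y - (t + t⁻¹) • (x * y * x) + y * x * x = 0 →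
      (c • (a * x)) * (c • (a * x)) * (c' • (b * y))
        - (t + t⁻¹) • ((c • (a * x)) * (c' • (b * y)) * (c • (a * x)))
        + (c' • (b * y)) * (c • (a * x)) * (c • (a * x)) = 0) ∧
    ((x * b = (t⁻¹) ^ 2 • (b * x)) → (y * a = (t⁻¹) ^ 2 • (a * y)) →
      x * x * x * y - (t ^ 2 + 1 + t⁻¹ ^ 2) • (x * x * y * x)
        + (t ^ 2 + 1 + t⁻¹ ^ 2) • (x * y * x * x) - y * x * x * x = 0 →
      (c • (a * x)) * (c • (a * x)) * (c • (a * x)) * (c' • (b * y))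
        - (t ^ 2 + 1 + t⁻¹ ^ 2) • ((c • (a * x)) * (c • (a * x)) * (c' • (b * y)) * (c • (a * x)))
        + (t ^ 2 + 1 + t⁻¹ ^ 2) • ((c • (a * x)) * (c' • (b * y)) * (c • (a * x)) * (c • (a * x)))
        - (c' • (b * y)) * (c • (a * x)) * (c • (a * x)) * (c • (a * x)) = 0) := by
  have hab' : b * a = (1 : F) • (a * b) := by rw [one_smul, hab]
  refine ⟨fun h2 h3 h => ?_, fun h2 h3 h => ?_, fun h2 h3 h => ?_⟩
  · have h2' : x * b = (1 : F) • (b * x) := by rw [one_smul, h2]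
    have h3' : y * a = (1 : F) • (a * y) := by rw [one_smul, h3]
    trans (c * c') • (a * (b * (x * y - y * x)))
    · simp only [mul_add, mul_sub, mul_assoc, h2', h3', hab', swap_assoc h2', swap_assoc h3',
        swap_assoc hab', mul_smul_comm, smul_mul_assoc, smul_smul, smul_add, smul_sub]
      match_scalars <;> field_simp
    · rw [h, mul_zero, mul_zero, smul_zero]
  · trans (c * c * c') • (a * (a * (b * (x * x * y - (t + t⁻¹) • (x * y * x) + y * x * x))))
    · simp only [mul_add, mul_sub, mul_assoc, hxa, h2, h3, hab', swap_assoc h2, swap_assoc h3,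
        swap_assoc hab', swap_assoc hxa, mul_smul_comm, smul_mul_assoc, smul_smul, smul_add, smul_sub]
      match_scalars <;> field_simp
    · rw [h, mul_zero, mul_zero, mul_zero, smul_zero]
  · trans (c * c * c * c') • (a * (a * (a * (b * (x * x * x * y - (t ^ 2 + 1 + t⁻¹ ^ 2) • (x * x * y * x)
        + (t ^ 2 + 1 + t⁻¹ ^ 2) • (x * y * x * x) - y * x * x * x)))))
    · simp only [mul_add, mul_sub, mul_assoc, hxa, h2, h3, hab', swap_assoc h2, swap_assoc h3,
        swap_assoc hab', swap_assoc hxa, mul_smul_comm, smul_mul_assoc, smul_smul, smul_add, smul_sub]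
      match_scalars <;> field_simp
    · rw [h, mul_zero, mul_zero, mul_zero, mul_zero, smul_zero]

theorem serre_twist {B : Type*} [Ring B] [Algebra QV B] {i j : Fin n} (h : i ≠ j)
    {x y a b x' y' : B} (c c' : QV) (hx' : x' = c • (a * x)) (hy' : y' = c' • (b * y))
    (hab : b * a = a * b)
    (hxa : x * a = v ^ (dd X n i * cartan X n i i : ℤ) • (a * x))
    (hxb : x * b = v ^ (dd X n j * cartan X n j i : ℤ) • (b * x))
    (hya : y * a = v ^ (dd X n i * cartan X n i j : ℤ) • (a * y))
    (hs : serre (dd X n i) (1 - cartan X n i j).toNat x y = 0) :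
    serre (dd X n i) (1 - cartan X n i j).toNat x' y' = 0 := by
  subst hx' hy'
  rw [← cartan_symm] at hxb
  rw [cartan_self] at hxa
  have hd := dd_ne (X := X) i
  generalize dd X n i = d at *
  have e2 : v ^ ((d : ℤ) * 2) = (v ^ (d : ℤ)) ^ 2 := by rw [zpow_mul]; norm_cast
  rw [e2] at hxa
  have key := serre_twist_aux (c := c) (c' := c') (y := y) (zpow_ne_zero (d : ℤ) v_ne_zero) hab hxa
  rcases cartan_cases (X := X) i j h with h0 | h0 | h0 <;> rw [h0] at hxb hya hs ⊢
  · simp only [mul_zero, zpow_zero, one_smul] at hxb hya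
    exact (serre_one hd _ _).trans (key.1 hxb hya ((serre_one hd _ _).symm.trans hs))
  · rw [mul_neg_one, zpow_neg] at hxb hya
    exact (serre_two hd _ _).trans (key.2.1 hxb hya ((serre_two hd _ _).symm.trans hs))
  · have e3 : v ^ ((d : ℤ) * -2) = (v ^ (d : ℤ))⁻¹ ^ 2 := by
      rw [mul_neg, zpow_neg, e2, inv_pow]
    rw [e3] at hxb hya
    exact (serre_three hd _ _).trans (key.2.2 hxb hya ((serre_three hd _ _).symm.trans hs))

theorem flip_smul {B : Type*} [Ring B] [Algebra QV B] {x y : B} {m : ℤ}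
    (h : x * y = v ^ m • (y * x)) : y * x = v ^ (-m) • (x * y) := by
  rw [h, smul_smul, ← zpow_add₀ v_ne_zero, neg_add_cancel, zpow_zero, one_smul]

theorem antipode_family : IsUqFamily X (antipodeGen X (n := n)) := by
  have G := gen_family (X := X) (n := n)
  have ek : ∀ i j, gen X (.e i) * gen X (.k j) =
      v ^ (-(dd X n j * cartan X n j i) : ℤ) • (gen X (.k j) * gen X (.e i)) :=
    fun i j => flip_smul (G.k_e j i)
  have fk : ∀ i j, gen X (.f i) * gen X (.k j) =
      v ^ (dd X n j * cartan X n j i : ℤ) • (gen X (.k j) * gen X (.f i)) := fun i j => by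
    simpa using flip_smul (G.k_f j i)
  have el : ∀ i j, gen X (.e i) * gen X (.kinv j) =
      v ^ (dd X n j * cartan X n j i : ℤ) • (gen X (.kinv j) * gen X (.e i)) := fun i j => by
    simpa using flip_smul (G.kinv_e j i)
  constructor
  · intro i; simp only [antipodeGen, ← MulOpposite.op_mul, G.k_kinv, MulOpposite.op_one]
  · intro i; simp only [antipodeGen, ← MulOpposite.op_mul, G.kinv_k, MulOpposite.op_one]
  · intro i j; simp only [antipodeGen, ← MulOpposite.op_mul, G.kinv_kinv i j]
  · intro i j
    simp only [antipodeGen, ← MulOpposite.op_mul, ← MulOpposite.op_smul]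
    congr 1
    rw [mul_neg, neg_mul, smul_neg, mul_assoc, el, mul_smul_comm, ← mul_assoc,
      G.kinv_kinv j i, mul_assoc]
  · intro i j
    simp only [antipodeGen, ← MulOpposite.op_mul, ← MulOpposite.op_smul]
    congr 1
    rw [mul_neg, neg_mul, smul_neg, ← mul_assoc, G.kinv_f, smul_mul_assoc, smul_smul,
      ← zpow_add₀ v_ne_zero, neg_add_cancel, zpow_zero, one_smul, mul_assoc, mul_assoc, G.k_kinv']
  · intro i j
    simp only [antipodeGen, ← MulOpposite.op_mul, ← MulOpposite.op_sub, ← MulOpposite.op_smul]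
    have h1 : gen X (.f j) * gen X (.k j) * (gen X (.kinv i) * gen X (.e i)) =
        v ^ (dd X n j * cartan X n j j - dd X n i * cartan X n i j : ℤ) •
          (gen X (.k j) * gen X (.kinv i) * (gen X (.f j) * gen X (.e i))) := by
      rw [fk, smul_mul_assoc, mul_assoc, ← mul_assoc (gen X (.f j)),
        flip_smul (G.kinv_f i j), smul_mul_assoc, mul_smul_comm, smul_smul,
        ← zpow_add₀ v_ne_zero, ← sub_eq_add_neg]
      simp only [mul_assoc]
    have h2 : gen X (.kinv i) * gen X (.e i) * (gen X (.f j) * gen X (.k j)) =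
        v ^ (dd X n j * cartan X n j j - dd X n i * cartan X n i j : ℤ) •
          (gen X (.k j) * gen X (.kinv i) * (gen X (.e i) * gen X (.f j))) := by
      rw [fk, mul_smul_comm, mul_assoc, ← mul_assoc (gen X (.e i)), ek, smul_mul_assoc,
        mul_smul_comm, smul_smul, ← zpow_add₀ v_ne_zero, ← sub_eq_add_neg, cartan_symm i j,
        G.k_kinv' j i]
      simp only [mul_assoc]
    simp only [neg_mul_neg]
    rw [h1, h2, ← smul_sub, ← mul_sub, ← neg_sub (gen X (.e i) * _), G.e_f]
    split_ifs with h
    · subst h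
      rw [sub_self, zpow_zero, one_smul, G.k_kinv, one_mul, ← smul_neg, neg_sub]
    · simp
  · intro i j h
    refine serre_op (dd_ne i) (serre_num X i j h) ?_
    exact serre_twist X h (-1) (-1) (by simp) (by simp) (G.kinv_kinv j i) (el _ _) (el _ _) (el _ _)
      (G.serre_e i j h)
  · intro i j h
    refine serre_op (dd_ne i) (serre_num X i j h) ?_
    exact serre_twist X h (a := gen X (.k i)) (b := gen X (.k j)) (-v ^ (dd X n i * cartan X n i i : ℤ))
      (-v ^ (dd X n j * cartan X n j j : ℤ))
      (by rw [fk, neg_smul]) (by rw [fk, neg_smul])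
      (G.k_k j i) (fk _ _) (fk _ _) (fk _ _) (G.serre_f i j h)

/-- The comultiplication. -/
noncomputable def comul : Uq X n →ₐ[QV] Uq X n ⊗[QV] Uq X n := liftUq _ (comul_family X)
/-- The counit. -/
noncomputable def counit : Uq X n →ₐ[QV] QV := liftUq _ (counit_family X)
/-- The antipode, as a homomorphism to the opposite algebra. -/
noncomputable def antipode : Uq X n →ₐ[QV] (Uq X n)ᵐᵒᵖ := liftUq _ (antipode_family X)
/-- The anti-automorphism `τ`, as a homomorphism to the opposite algebra. -/
noncomputable def tau : Uq X n →ₐ[QV] (Uq X n)ᵐᵒᵖ := liftUq _ (tau_family X)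

end

end

section

/-- The divided power `x^m / [m]_d!`. -/
noncomputable def divPow {B : Type*} [Ring B] [Algebra QV B] (d m : ℕ) (x : B) : B :=
  (qfact d m)⁻¹ • x ^ m

section
variable (X : Ty) (n : ℕ)

/-- The elements `k_i^{±1}`, `e_i^{(m)}`, `f_i^{(m)}` with `m ≥ 1`. -/
def aGens : Set (Uq X n) :=
  {x | ∃ i : Fin n, x = gen X (.k i) ∨ x = gen X (.kinv i) ∨
    ∃ m : ℕ, 1 ≤ m ∧
      (x = divPow (dd X n i) m (gen X (.e i)) ∨ x = divPow (dd X n i) m (gen X (.f i)))}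

/-- The integral form of the quantum group: the `ℤ[v, v⁻¹]`-subalgebra generated by the
`k_i^{±1}`, `e_i^{(m)}`, `f_i^{(m)}`. -/
noncomputable def AForm : Subalgebra LA (Uq X n) := Algebra.adjoin LA (aGens X n)

variable {X n}

theorem k_mem (i : Fin n) : gen X (.k i) ∈ AForm X n :=
  Algebra.subset_adjoin ⟨i, .inl rfl⟩

theorem kinv_mem (i : Fin n) : gen X (.kinv i) ∈ AForm X n :=
  Algebra.subset_adjoin ⟨i, .inr (.inl rfl)⟩

theorem divPow_zero {B : Type*} [Ring B] [Algebra QV B] (d : ℕ) (x : B) : divPow d 0 x = 1 := by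
  simp [divPow, qfact]

theorem divPow_one {B : Type*} [Ring B] [Algebra QV B] {d : ℕ} (hd : d ≠ 0) (x : B) :
    divPow d 1 x = x := by
  simp [divPow, qfact, qnum_one hd]

theorem e_mem (i : Fin n) (m : ℕ) : divPow (dd X n i) m (gen X (.e i)) ∈ AForm X n := by
  rcases m with _ | m
  · rw [divPow_zero]; exact one_mem _
  · exact Algebra.subset_adjoin ⟨i, .inr (.inr ⟨m + 1, by omega, .inl rfl⟩)⟩

theorem f_mem (i : Fin n) (m : ℕ) : divPow (dd X n i) m (gen X (.f i)) ∈ AForm X n := by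
  rcases m with _ | m
  · rw [divPow_zero]; exact one_mem _
  · exact Algebra.subset_adjoin ⟨i, .inr (.inr ⟨m + 1, by omega, .inr rfl⟩)⟩

theorem v_smul_mem {B : Type*} [Ring B] [Algebra QV B] [Algebra LA B] [IsScalarTower LA QV B]
    (S : Subalgebra LA B) {x : B} (hx : x ∈ S) (z : ℤ) : v ^ z • x ∈ S := by
  rw [← algebraMap_T, algebraMap_smul]
  exact S.smul_mem hx _

theorem mul_pow_twist {B : Type*} [Ring B] [Algebra QV B] {a x : B} {p : ℤ}
    (h : x * a = v ^ p • (a * x)) (m : ℕ) : ∃ z : ℤ, (a * x) ^ m = v ^ z • (a ^ m * x ^ m) := by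
  have h2 : ∀ m : ℕ, x ^ m * a = v ^ (p * m) • (a * x ^ m) := by
    intro m
    induction m with
    | zero => simp
    | succ m ih =>
      rw [pow_succ, mul_assoc, h, mul_smul_comm, ← mul_assoc, ih, smul_mul_assoc, smul_smul,
        mul_assoc, ← pow_succ, ← zpow_add₀ v_ne_zero]
      congr 2; push_cast; ring
  induction m with
  | zero => exact ⟨0, by simp⟩
  | succ m ih =>
    obtain ⟨z, hz⟩ := ih
    refine ⟨z + p * m, ?_⟩
    rw [pow_succ, hz, smul_mul_assoc, mul_assoc, ← mul_assoc (x ^ m), h2, smul_mul_assoc,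
      mul_smul_comm, smul_smul, ← zpow_add₀ v_ne_zero, pow_succ, pow_succ]
    simp only [mul_assoc]

theorem antipode_mem {u : Uq X n} (hu : u ∈ AForm X n) :
    (antipode X u).unop ∈ AForm X n := by
  have G := gen_family (X := X) (n := n)
  change ((antipode X).restrictScalars LA) u ∈ (AForm X n).op
  revert u
  change AForm X n ≤ (AForm X n).op.comap ((antipode X).restrictScalars LA)
  refine Algebra.adjoin_le ?_
  rintro x ⟨i, rfl | rfl | ⟨m, hm, rfl | rfl⟩⟩
  · change (antipode X (gen X _)).unop ∈ AForm X n
    rw [antipode, liftUq_gen]; exact kinv_mem i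
  · change (antipode X (gen X _)).unop ∈ AForm X n
    rw [antipode, liftUq_gen]; exact k_mem i
  · change (antipode X (divPow _ _ (gen X _))).unop ∈ AForm X n
    rw [divPow, map_smul, map_pow, antipode, liftUq_gen, antipodeGen, ← MulOpposite.op_pow,
      MulOpposite.unop_smul, MulOpposite.unop_op, neg_pow, ← mul_smul_comm]
    obtain ⟨z, hz⟩ := mul_pow_twist (flip_smul (G.kinv_e i i)) m
    rw [hz, smul_comm, ← mul_smul_comm]
    exact mul_mem (pow_mem (neg_mem (one_mem _)) _)
      (v_smul_mem _ (mul_mem (pow_mem (kinv_mem i) _) (e_mem i m)) _)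
  · change (antipode X (divPow _ _ (gen X _))).unop ∈ AForm X n
    rw [divPow, map_smul, map_pow, antipode, liftUq_gen, antipodeGen, ← MulOpposite.op_pow,
      MulOpposite.unop_smul, MulOpposite.unop_op, neg_pow, ← mul_smul_comm]
    obtain ⟨z, hz⟩ := mul_pow_twist (G.k_f i i) m
    rw [hz, smul_comm, ← smul_mul_assoc]
    exact mul_mem (pow_mem (neg_mem (one_mem _)) _)
      (v_smul_mem _ (mul_mem (f_mem i m) (pow_mem (k_mem i) _)) _)

theorem tau_mem {u : Uq X n} (hu : u ∈ AForm X n) : (tau X u).unop ∈ AForm X n := by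
  change ((tau X).restrictScalars LA) u ∈ (AForm X n).op
  revert u
  change AForm X n ≤ (AForm X n).op.comap ((tau X).restrictScalars LA)
  refine Algebra.adjoin_le ?_
  rintro x ⟨i, rfl | rfl | ⟨m, hm, rfl | rfl⟩⟩
  · change (tau X (gen X _)).unop ∈ AForm X n
    rw [tau, liftUq_gen]; exact k_mem i
  · change (tau X (gen X _)).unop ∈ AForm X n
    rw [tau, liftUq_gen]; exact kinv_mem i
  · change (tau X (divPow _ _ (gen X _))).unop ∈ AForm X n
    rw [divPow, map_smul, map_pow, tau, liftUq_gen, tauGen, ← MulOpposite.op_pow]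
    exact f_mem i m
  · change (tau X (divPow _ _ (gen X _))).unop ∈ AForm X n
    rw [divPow, map_smul, map_pow, tau, liftUq_gen, tauGen, ← MulOpposite.op_pow]
    exact e_mem i m

variable (X n)

/-- Restriction of an anti-endomorphism to the integral form. -/
noncomputable def restrictOp (θ : Uq X n →ₐ[QV] (Uq X n)ᵐᵒᵖ)
    (h : ∀ {u}, u ∈ AForm X n → (θ u).unop ∈ AForm X n) : AForm X n →ₐ[LA] (AForm X n)ᵐᵒᵖ where
  toFun u := .op ⟨(θ u).unop, h u.2⟩
  map_one' := by apply MulOpposite.unop_injective; ext; simp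
  map_mul' a b := by apply MulOpposite.unop_injective; ext; simp
  map_zero' := by apply MulOpposite.unop_injective; ext; simp
  map_add' a b := by apply MulOpposite.unop_injective; ext; simp
  commutes' c := by
    apply MulOpposite.unop_injective; ext
    exact congrArg MulOpposite.unop ((θ.restrictScalars LA).commutes c)

section Kappa
variable (κ : Type*) [Field κ] [Algebra LA κ]

/-- The quantum group `U_κ(g) = κ ⊗ U(g)` over a field `κ` that is a `ℤ[v, v⁻¹]`-algebra. -/
abbrev UK := κ ⊗[LA] AForm X n

/-- Base change of an anti-endomorphism of the integral form. -/
noncomputable def baseOp (θ : AForm X n →ₐ[LA] (AForm X n)ᵐᵒᵖ) :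
    UK X n κ →ₐ[κ] (UK X n κ)ᵐᵒᵖ :=
  Algebra.TensorProduct.lift (Algebra.ofId κ _)
    ((Algebra.TensorProduct.includeRight.op).comp θ) fun a _ => Algebra.commutes a _

/-- The antipode of `U_κ(g)`. -/
noncomputable def antipodeK : UK X n κ →ₐ[κ] (UK X n κ)ᵐᵒᵖ :=
  baseOp X n κ (restrictOp X n (antipode X) antipode_mem)

/-- The anti-automorphism `τ` of `U_κ(g)`. -/
noncomputable def tauK : UK X n κ →ₐ[κ] (UK X n κ)ᵐᵒᵖ :=
  baseOp X n κ (restrictOp X n (tau X) tau_mem)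

end Kappa

theorem divPow_mul_self {B : Type*} [Ring B] [Algebra QV B] {d : ℕ} (hd : d ≠ 0) (m : ℕ) (x : B) :
    divPow d m x * x = qnum d (m + 1) • divPow d (m + 1) x := by
  rw [divPow, divPow, smul_smul, qfact_succ, mul_inv, mul_comm, mul_assoc,
    inv_mul_cancel₀ (qnum_ne hd (by omega)), mul_one, smul_mul_assoc, ← pow_succ]

theorem qnum_add' {d : ℕ} (hd : d ≠ 0) (a b : ℕ) :
    qnum d (a + b) = v ^ (d * b : ℤ) * qnum d a + v ^ (-(d * a) : ℤ) * qnum d b := by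
  rw [add_comm a b, qnum_succ hd]; ring

theorem divPow_add {B : Type*} [Ring B] [Algebra QV B] {d : ℕ} (hd : d ≠ 0) {x y : B}
    (h : y * x = v ^ (d * 2 : ℤ) • (x * y)) (m : ℕ) :
    divPow d m (x + y) = ∑ p ∈ Finset.HasAntidiagonal.antidiagonal m,
      v ^ (d * (p.1 * p.2) : ℤ) • (divPow d p.1 x * divPow d p.2 y) := by
  have h2 : ∀ b : ℕ, divPow d b y * x = v ^ (d * 2 * b : ℤ) • (x * divPow d b y) := by
    intro b
    have : y ^ b * x = v ^ (d * 2 * b : ℤ) • (x * y ^ b) := by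
      induction b with
      | zero => simp
      | succ m ih =>
        rw [pow_succ, mul_assoc, h, mul_smul_comm, ← mul_assoc, ih, smul_mul_assoc, smul_smul,
          mul_assoc x, ← zpow_add₀ v_ne_zero]
        congr 2; push_cast; ring
    rw [divPow, smul_mul_assoc, this, smul_comm, mul_smul_comm]
  induction m with
  | zero => simp [divPow_zero]
  | succ m ih =>
    have hq : qnum d (m + 1) ≠ 0 := qnum_ne hd (by omega)
    have key := divPow_mul_self hd m (x + y)
    rw [← inv_smul_eq_iff₀ hq] at key
    rw [← key, ih, inv_smul_eq_iff₀ hq, Finset.smul_sum]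
    have e1 : ∀ p ∈ Finset.HasAntidiagonal.antidiagonal (m + 1),
        qnum d (m + 1) • v ^ (d * (p.1 * p.2) : ℤ) • (divPow d p.1 x * divPow d p.2 y) =
        (v ^ (d * (p.1 * p.2) + d * p.2 : ℤ) * qnum d p.1) • (divPow d p.1 x * divPow d p.2 y) +
        (v ^ (d * (p.1 * p.2) - d * p.1 : ℤ) * qnum d p.2) • (divPow d p.1 x * divPow d p.2 y) := by
      intro p hp
      rw [Finset.HasAntidiagonal.mem_antidiagonal] at hp
      rw [← hp, qnum_add' hd, smul_smul, ← add_smul, zpow_add₀ v_ne_zero, sub_eq_add_neg,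
        zpow_add₀ v_ne_zero]
      congr 1; ring
    have q0 : qnum d 0 = 0 := by simp [qnum]
    rw [Finset.sum_congr rfl e1, Finset.sum_add_distrib, mul_add]
    congr 1
    · rw [Finset.Nat.sum_antidiagonal_succ]
      simp only [q0, mul_zero, zero_smul, zero_add]
      rw [Finset.sum_mul]
      refine Finset.sum_congr rfl fun p _ => ?_
      rw [smul_mul_assoc, mul_assoc (divPow d p.1 x), h2, mul_smul_comm,
        ← mul_assoc (divPow d p.1 x), divPow_mul_self hd,
        smul_mul_assoc, smul_smul, smul_smul, ← zpow_add₀ v_ne_zero]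
      congr 3; push_cast; ring
    · rw [Finset.Nat.sum_antidiagonal_succ']
      simp only [q0, mul_zero, zero_smul, zero_add]
      rw [Finset.sum_mul]
      refine Finset.sum_congr rfl fun p _ => ?_
      rw [smul_mul_assoc, mul_assoc (divPow d p.1 x), divPow_mul_self hd, mul_smul_comm, smul_smul]
      congr 3; push_cast; ring

/-- The `LA`-subalgebra generated by the `a ⊗ b` with `a`, `b` in the integral form. -/
noncomputable def AForm2 : Subalgebra LA (Uq X n ⊗[QV] Uq X n) :=
  Algebra.adjoin LA {x | ∃ a ∈ AForm X n, ∃ b ∈ AForm X n, x = a ⊗ₜ b}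

variable {X n}

theorem tmul_mem {a b : Uq X n} (ha : a ∈ AForm X n) (hb : b ∈ AForm X n) :
    a ⊗ₜ[QV] b ∈ AForm2 X n := Algebra.subset_adjoin ⟨a, ha, b, hb, rfl⟩

theorem comul_mem {u : Uq X n} (hu : u ∈ AForm X n) : comul X u ∈ AForm2 X n := by
  have G := gen_family (X := X) (n := n)
  change ((comul X).restrictScalars LA) u ∈ AForm2 X n
  revert u
  change AForm X n ≤ (AForm2 X n).comap ((comul X).restrictScalars LA)
  refine Algebra.adjoin_le ?_
  have hm : ∀ (i : Fin n) (m : ℕ) (x : Uq X n), comul X (divPow (dd X n i) m x) =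
      divPow (dd X n i) m (comul X x) := by
    intro i m x; rw [divPow, map_smul, map_pow, divPow]
  rintro x ⟨i, rfl | rfl | ⟨m, -, rfl | rfl⟩⟩
  · change comul X (gen X _) ∈ AForm2 X n
    rw [comul, liftUq_gen]; exact tmul_mem (k_mem i) (k_mem i)
  · change comul X (gen X _) ∈ AForm2 X n
    rw [comul, liftUq_gen]; exact tmul_mem (kinv_mem i) (kinv_mem i)
  · change comul X _ ∈ AForm2 X n
    rw [hm, comul, liftUq_gen, comulGen, divPow_add (dd_ne i)]
    · refine sum_mem fun p _ => v_smul_mem _ (mul_mem ?_ ?_) _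
      · rw [divPow, Algebra.TensorProduct.tmul_pow, one_pow, TensorProduct.smul_tmul']
        exact tmul_mem (e_mem i _) (one_mem _)
      · rw [divPow, Algebra.TensorProduct.tmul_pow, ← TensorProduct.tmul_smul]
        exact tmul_mem (pow_mem (k_mem i) _) (e_mem i _)
    · simp only [Algebra.TensorProduct.tmul_mul_tmul, G.k_e, cartan_self, mul_one, one_mul,
        TensorProduct.smul_tmul']
  · change comul X _ ∈ AForm2 X n
    rw [hm, comul, liftUq_gen, comulGen, add_comm, divPow_add (dd_ne i)]
    · refine sum_mem fun p _ => v_smul_mem _ (mul_mem ?_ ?_) _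
      · rw [divPow, Algebra.TensorProduct.tmul_pow, one_pow, ← TensorProduct.tmul_smul]
        exact tmul_mem (one_mem _) (f_mem i _)
      · rw [divPow, Algebra.TensorProduct.tmul_pow, TensorProduct.smul_tmul']
        exact tmul_mem (f_mem i _) (pow_mem (kinv_mem i) _)
    · simp only [Algebra.TensorProduct.tmul_mul_tmul, G.kinv_f, cartan_self, mul_one, one_mul,
        TensorProduct.tmul_smul]

end

end

section

/-- The matrix with entry `c` in row `a` and column `b` (counted from `0`). -/
def matUnit {R : Type*} [Zero R] (N a b : ℕ) (c : R) : Matrix (Fin N) (Fin N) R :=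
  fun x y => if x.val = a ∧ y.val = b then c else 0

section
variable (X : Ty) {n : ℕ}

/-- The weight of the basis vector `v_k` of `V`, in the basis `ε_1, …, ε_n`. -/
def wt (k : Fin (X.dimV n)) (m : Fin n) : ℤ :=
  if k.val = m.val then 1 else if k.val + m.val + 1 = X.dimV n then -1 else 0

/-- The matrices of the generators on the natural representation over `ℚ(v)`. Rows and columns
are counted from `0`, so `v_k` has index `k - 1` and the index of `v_{k'}` is `N - k`. -/
noncomputable def natGen : Gen n → Matrix (Fin (X.dimV n)) (Fin (X.dimV n)) QV
  | .e i =>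
    if i.val + 1 < n then
      matUnit _ i.val (i.val + 1) 1 + matUnit _ (X.dimV n - 2 - i.val) (X.dimV n - 1 - i.val) (-1)
    else match X with
      | .B => matUnit _ (n - 1) n 1 + matUnit _ n (n + 1) (-v⁻¹)
      | .C => matUnit _ (n - 1) n 1
      | .D => matUnit _ (n - 2) n 1 + matUnit _ (n - 1) (n + 1) (-1)
  | .f i =>
    if i.val + 1 < n then
      matUnit _ (i.val + 1) i.val 1 + matUnit _ (X.dimV n - 1 - i.val) (X.dimV n - 2 - i.val) (-1)
    else match X with
      | .B => matUnit _ n (n - 1) (qnum 1 2) + matUnit _ (n + 1) n (-(v * qnum 1 2))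
      | .C => matUnit _ n (n - 1) 1
      | .D => matUnit _ n (n - 2) 1 + matUnit _ (n + 1) (n - 1) (-1)
  | .k i => Matrix.diagonal fun a => v ^ (qExp X * (simpleRoot X n i ⬝ᵥ wt X a) : ℤ)
  | .kinv i => Matrix.diagonal fun a => v ^ (-(qExp X * (simpleRoot X n i ⬝ᵥ wt X a)) : ℤ)

theorem matUnit_mul_same {R : Type*} [Semiring R] {N a b b' d : ℕ} (c c' : R) (h : b = b')
    (hb : b < N) : matUnit N a b c * matUnit N b' d c' = matUnit N a d (c * c') := by
  subst h
  ext x y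
  rw [Matrix.mul_apply, Finset.sum_eq_single ⟨b, hb⟩]
  · simp only [matUnit]; split_ifs <;> simp_all
  · intro z _ hz
    have : z.val ≠ b := fun h => hz (Fin.ext h)
    simp [matUnit, this]
  · simp

theorem matUnit_mul_ne {R : Type*} [Semiring R] {N a b b' d : ℕ} (c c' : R) (h : b ≠ b') :
    matUnit N a b c * matUnit N b' d c' = 0 := by
  ext x y
  rw [Matrix.mul_apply]
  refine Finset.sum_eq_zero fun z _ => ?_
  simp only [matUnit]
  split_ifs <;> first | omega | simp

theorem matUnit_zero {R : Type*} [Zero R] (N a b : ℕ) : matUnit N a b (0 : R) = 0 := by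
  ext; simp [matUnit]

variable {X}

/-- Matrices that shift weights by `β`. -/
def HasWeight (M : Matrix (Fin (X.dimV n)) (Fin (X.dimV n)) QV) (β : Fin n → ℤ) : Prop :=
  ∀ a b, M a b ≠ 0 → wt X a = wt X b + β

theorem HasWeight.k_mul {M : Matrix (Fin (X.dimV n)) (Fin (X.dimV n)) QV} {β : Fin n → ℤ}
    (h : HasWeight M β) (i : Fin n) : natGen X (.k i) * M =
      v ^ (qExp X * (simpleRoot X n i ⬝ᵥ β) : ℤ) • (M * natGen X (.k i)) := by
  ext a b
  simp only [natGen, Matrix.diagonal_mul, Matrix.smul_apply, Matrix.mul_diagonal, smul_eq_mul]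
  by_cases h0 : M a b = 0
  · simp [h0]
  · rw [h a b h0, dotProduct_add, mul_add, zpow_add₀ v_ne_zero]; ring

theorem matUnit_weight {p q : ℕ} {c : QV} {β : Fin n → ℤ} (hp : p < X.dimV n) (hq : q < X.dimV n)
    (h : wt X ⟨p, hp⟩ = wt X ⟨q, hq⟩ + β) : HasWeight (matUnit (X.dimV n) p q c) β := by
  intro a b hab
  by_cases h' : a.val = p ∧ b.val = q
  · have ha : a = ⟨p, hp⟩ := Fin.ext h'.1
    have hb : b = ⟨q, hq⟩ := Fin.ext h'.2
    rw [ha, hb, h]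
  · simp [matUnit, h'] at hab

theorem HasWeight.add {M M' : Matrix (Fin (X.dimV n)) (Fin (X.dimV n)) QV} {β : Fin n → ℤ}
    (h : HasWeight M β) (h' : HasWeight M' β) : HasWeight (M + M') β := by
  intro a b hab
  by_cases h0 : M a b = 0
  · exact h' a b (by simpa [h0] using hab)
  · exact h a b h0

theorem e_weight (hn : X.minRank ≤ n) (i : Fin n) :
    HasWeight (natGen X (.e i)) (simpleRoot X n i) := by
  simp only [natGen]
  have hi := i.2
  cases X <;> simp only [Ty.minRank] at hn <;> split_ifs with h <;> (try simp only []) <;>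
    (try refine HasWeight.add ?_ ?_) <;>
    (refine matUnit_weight (by simp only [Ty.dimV]; omega) (by simp only [Ty.dimV]; omega) ?_) <;>
    funext m <;>
    simp only [wt, simpleRoot, lastRoot, Pi.add_apply, h, if_true, if_false, Fin.ext_iff, Ty.dimV] <;>
    split_ifs <;> omega

theorem f_weight (hn : X.minRank ≤ n) (i : Fin n) :
    HasWeight (natGen X (.f i)) (-simpleRoot X n i) := by
  simp only [natGen]
  have hi := i.2
  cases X <;> simp only [Ty.minRank] at hn <;> split_ifs with h <;> (try simp only []) <;>
    (try refine HasWeight.add ?_ ?_) <;>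
    (refine matUnit_weight (by simp only [Ty.dimV]; omega) (by simp only [Ty.dimV]; omega) ?_) <;>
    funext m <;>
    simp only [wt, simpleRoot, lastRoot, Pi.add_apply, Pi.neg_apply, h, if_true, if_false, Fin.ext_iff, Ty.dimV] <;>
    split_ifs <;> omega

end

end

section

section
variable {X : Ty} {n : ℕ}

theorem qdiv_one {d : ℕ} (hd : d ≠ 0) {m : ℤ} (hm : m = d) :
    (v ^ (d : ℤ) - v ^ (-d : ℤ))⁻¹ * (v ^ m - v ^ (-m)) = 1 := by
  rw [hm, inv_mul_cancel₀ (v_sub_ne hd)]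

theorem qdiv_neg {d : ℕ} (hd : d ≠ 0) {m : ℤ} (hm : m = -d) :
    (v ^ (d : ℤ) - v ^ (-d : ℤ))⁻¹ * (v ^ m - v ^ (-m)) = -1 := by
  rw [hm, neg_neg, ← neg_sub (v ^ (d : ℤ)), mul_neg, inv_mul_cancel₀ (v_sub_ne hd)]

theorem qdiv_zero {d : ℕ} {m : ℤ} (hm : m = 0) :
    (v ^ (d : ℤ) - v ^ (-d : ℤ))⁻¹ * (v ^ m - v ^ (-m)) = 0 := by
  rw [hm]; simp

theorem qdiv_two {m : ℤ} (hm : m = 2) :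
    (v ^ ((1 : ℕ) : ℤ) - v ^ (-(1 : ℕ) : ℤ))⁻¹ * (v ^ m - v ^ (-m)) = qnum 1 2 := by
  rw [hm, mul_comm, ← div_eq_mul_inv, qnum]
  norm_num

theorem qdiv_neg_two {m : ℤ} (hm : m = -2) :
    (v ^ ((1 : ℕ) : ℤ) - v ^ (-(1 : ℕ) : ℤ))⁻¹ * (v ^ m - v ^ (-m)) = -qnum 1 2 := by
  rw [← qdiv_two rfl, hm, neg_neg, ← mul_neg, neg_sub]

theorem dimV_eq (X : Ty) (n : ℕ) : X.dimV n = match X with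
  | .B => 2 * n + 1
  | .C => 2 * n
  | .D => 2 * n := rfl

theorem two_mul_le_dimV (X : Ty) (n : ℕ) : 2 * n ≤ X.dimV n := by
  cases X <;> simp only [Ty.dimV] <;> omega

theorem matUnit_diag {R : Type*} [Zero R] (N a : ℕ) (c : R) :
    matUnit N a a c = Matrix.diagonal fun x => if x.val = a then c else 0 := by
  ext x y
  by_cases h : x = y
  · subst h; simp [matUnit]
  · rw [Matrix.diagonal_apply_ne _ h, matUnit, if_neg]
    exact fun h' => h (Fin.ext (h'.1.trans h'.2.symm))

theorem diag_aux {N d : ℕ} {A B : Fin N → QV} {p : Fin N → ℤ}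
    (h : ∀ b, A b - B b = (v ^ (d : ℤ) - v ^ (-d : ℤ))⁻¹ * (v ^ p b - v ^ (-p b))) :
    Matrix.diagonal A - Matrix.diagonal B = (v ^ (d : ℤ) - v ^ (-d : ℤ))⁻¹ •
      (Matrix.diagonal (fun b => v ^ p b) - Matrix.diagonal fun b => v ^ (-p b)) := by
  rw [Matrix.diagonal_sub, Matrix.diagonal_sub, ← Matrix.diagonal_smul]
  congr 1; funext b; exact h b

theorem nat_ef_same_lt (i : Fin n) (h : i.val + 1 < n) :
    natGen X (.e i) * natGen X (.f i) - natGen X (.f i) * natGen X (.e i) =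
      (v ^ (dd X n i : ℤ) - v ^ (-dd X n i : ℤ))⁻¹ • (natGen X (.k i) - natGen X (.kinv i)) := by
  have hN := two_mul_le_dimV X n
  obtain ⟨N, hNN⟩ : ∃ N, N = X.dimV n := ⟨_, rfl⟩
  have hd : dd X n i = qExp X := by cases X <;> simp [dd, qExp, h]
  have hd0 := dd_ne (X := X) i
  simp (disch := omega) only [natGen, h, if_true, add_mul, mul_add, matUnit_mul_same,
    matUnit_mul_ne, mul_one, neg_mul_neg, add_zero, zero_add, matUnit_diag, Matrix.diagonal_add]
  refine diag_aux fun b => ?_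
  have hp : simpleRoot X n i ⬝ᵥ wt X b = if b.val = i.val ∨ b.val + i.val + 2 = N then 1
      else if b.val = i.val + 1 ∨ b.val + i.val + 1 = N then -1 else 0 := by
    rw [simpleRoot_dot, dif_pos h]
    simp only [wt]
    split_ifs <;> omega
  rw [hp]
  by_cases h1 : b.val = i.val ∨ b.val + i.val + 2 = N
  · rw [if_pos h1, qdiv_one hd0 (by rw [hd, mul_one])]
    rcases h1 with h1 | h1 <;> simp (disch := omega) only [if_pos, if_neg] <;> norm_num
  rw [if_neg h1]
  by_cases h2 : b.val = i.val + 1 ∨ b.val + i.val + 1 = N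
  · rw [if_pos h2, qdiv_neg hd0 (by rw [hd, mul_neg, mul_one])]
    rcases h2 with h2 | h2 <;> simp (disch := omega) only [if_pos, if_neg] <;> norm_num
  · rw [if_neg h2, qdiv_zero (by rw [mul_zero])]
    simp (disch := omega) only [if_neg]
    norm_num

theorem nat_ef_same (hn : X.minRank ≤ n) (i : Fin n) :
    natGen X (.e i) * natGen X (.f i) - natGen X (.f i) * natGen X (.e i) =
      (v ^ (dd X n i : ℤ) - v ^ (-dd X n i : ℤ))⁻¹ • (natGen X (.k i) - natGen X (.kinv i)) := by
  by_cases h : i.val + 1 < n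
  · exact nat_ef_same_lt i h
  have hi := i.2
  have hv := v_ne_zero
  have hN := dimV_eq X n
  cases X <;> simp only [Ty.minRank] at hn <;> simp only [] at hN <;>
    simp (disch := omega) only [natGen, h, if_false, add_mul, mul_add, matUnit_mul_same,
      matUnit_mul_ne, mul_one, neg_mul_neg, add_zero, zero_add, matUnit_diag,
      Matrix.diagonal_add] <;>
    refine diag_aux fun b => ?_ <;>
    simp only [simpleRoot_dot, h, dif_neg, not_false_eq_true, dif_pos, hn, dd, qExp, if_false] <;>
    simp only [wt]
  · by_cases h1 : b.val + 1 = n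
    · rw [qdiv_two (by split_ifs <;> omega)]
      simp (disch := omega) only [if_pos, if_neg]
      norm_num
    by_cases h2 : b.val = n
    · rw [qdiv_zero (by split_ifs <;> omega)]
      simp (disch := omega) only [if_pos, if_neg]
      field_simp
      try ring
    by_cases h3 : b.val = n + 1
    · rw [qdiv_neg_two (by split_ifs <;> omega)]
      simp (disch := omega) only [if_pos, if_neg]
      field_simp
      try ring
    · rw [qdiv_zero (by split_ifs <;> omega)]
      simp (disch := omega) only [if_neg]
      norm_num
  · by_cases h1 : b.val + 1 = n
    · rw [qdiv_one (by omega) (by split_ifs <;> omega)]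
      simp (disch := omega) only [if_pos, if_neg]
      norm_num
    by_cases h2 : b.val = n
    · rw [qdiv_neg (by omega) (by split_ifs <;> omega)]
      simp (disch := omega) only [if_pos, if_neg]
      norm_num
    · rw [qdiv_zero (by split_ifs <;> omega)]
      simp (disch := omega) only [if_neg]
      norm_num
  · by_cases h1 : b.val + 1 = n ∨ b.val + 2 = n
    · rw [qdiv_one (by omega) (by split_ifs <;> omega)]
      rcases h1 with h1 | h1 <;> simp (disch := omega) only [if_pos, if_neg] <;> norm_num
    by_cases h2 : b.val = n ∨ b.val = n + 1
    · rw [qdiv_neg (by omega) (by split_ifs <;> omega)]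
      rcases h2 with h2 | h2 <;> simp (disch := omega) only [if_pos, if_neg] <;> norm_num
    · rw [qdiv_zero (by split_ifs <;> omega)]
      simp (disch := omega) only [if_neg]
      norm_num

set_option maxHeartbeats 2000000 in
theorem nat_ef_ne (hn : X.minRank ≤ n) (i j : Fin n) (hij : i ≠ j) :
    natGen X (.e i) * natGen X (.f j) - natGen X (.f j) * natGen X (.e i) = 0 := by
  have hi := i.2
  have hj := j.2
  have hij' : i.val ≠ j.val := fun h => hij (Fin.ext h)
  have hN := dimV_eq X n
  by_cases h : i.val + 1 < n
  · by_cases h' : j.val + 1 < n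
    · have hN := two_mul_le_dimV X n
      simp (disch := omega) only [natGen, h, h', if_true, add_mul, mul_add, matUnit_mul_ne, add_zero, sub_zero]
    · by_cases h2 : i.val + 2 = n
      · cases X <;> simp only [Ty.minRank] at hn <;> simp only [] at hN <;>
        simp (disch := omega) only [natGen, h, h', if_true, if_false, add_mul, mul_add, matUnit_mul_ne,
          matUnit_mul_same, add_zero, zero_add, sub_zero] <;>
        (try (ext a b; simp only [Matrix.sub_apply, Matrix.add_apply, matUnit, Matrix.zero_apply]; split_ifs <;> first | omega | norm_num))
      · cases X <;> simp only [Ty.minRank] at hn <;> simp only [] at hN <;>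
        simp (disch := omega) only [natGen, h, h', if_true, if_false, add_mul, mul_add, matUnit_mul_ne,
          add_zero, sub_zero]
  · have h' : j.val + 1 < n := by omega
    by_cases h2 : j.val + 2 = n
    · cases X <;> simp only [Ty.minRank] at hn <;> simp only [] at hN <;>
      simp (disch := omega) only [natGen, h, h', if_true, if_false, add_mul, mul_add, matUnit_mul_ne,
        matUnit_mul_same, add_zero, zero_add, sub_zero] <;>
      (try (ext a b; simp only [Matrix.sub_apply, Matrix.add_apply, matUnit, Matrix.zero_apply]; split_ifs <;> first | omega | norm_num))
    · cases X <;> simp only [Ty.minRank] at hn <;> simp only [] at hN <;>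
      simp (disch := omega) only [natGen, h, h', if_true, if_false, add_mul, mul_add, matUnit_mul_ne,
        add_zero, sub_zero]

theorem dot_lt (i j : Fin n) (hij : i.val ≠ j.val) (h : i.val + 1 < n) (h' : j.val + 1 < n) :
    simpleRoot X n i ⬝ᵥ simpleRoot X n j =
      if i.val + 1 = j.val ∨ j.val + 1 = i.val then -1 else 0 := by
  rw [simpleRoot_dot, dif_pos h]
  simp only [simpleRoot, h', if_true, Fin.ext_iff]
  split_ifs <;> omega

theorem dot_self_lt (i : Fin n) (h : i.val + 1 < n) :
    simpleRoot X n i ⬝ᵥ simpleRoot X n i = 2 := by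
  rw [simpleRoot_dot, dif_pos h]
  simp only [simpleRoot, h, if_true, Fin.ext_iff]
  split_ifs <;> omega

theorem dot_last (hn : X.minRank ≤ n) (i j : Fin n) (h : ¬ i.val + 1 < n) (h' : j.val + 1 < n) :
    simpleRoot X n i ⬝ᵥ simpleRoot X n j = match X with
      | .B => if j.val + 1 = i.val then -1 else 0
      | .C => if j.val + 1 = i.val then -2 else 0
      | .D => if j.val + 2 = i.val then -1 else 0 := by
  rw [simpleRoot_dot, dif_neg h]
  have hi := i.2
  cases X <;> simp only [Ty.minRank] at hn <;>
    simp only [simpleRoot, h', if_true, Fin.ext_iff, hn, dif_pos] <;> split_ifs <;> omega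

theorem dot_self_last (hn : X.minRank ≤ n) (i : Fin n) (h : ¬ i.val + 1 < n) :
    simpleRoot X n i ⬝ᵥ simpleRoot X n i = match X with
      | .B => 1
      | .C => 4
      | .D => 2 := by
  rw [simpleRoot_dot, dif_neg h]
  have hi := i.2
  cases X <;> simp only [Ty.minRank] at hn <;>
    simp only [simpleRoot, lastRoot, h, if_false, hn, dif_pos] <;> split_ifs <;> omega

theorem cartan_val (hn : X.minRank ≤ n) (i j : Fin n) (hij : i ≠ j) : cartan X n i j =
    if i.val + 1 = j.val then
      (if j.val + 1 = n then match X with | .B => -1 | .C => -2 | .D => 0 else -1)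
    else if j.val + 1 = i.val then
      (if i.val + 1 = n then match X with | .B => -2 | .C => -1 | .D => 0 else -1)
    else if i.val + 2 = j.val then
      (if j.val + 1 = n then match X with | .B => 0 | .C => 0 | .D => -1 else 0)
    else if j.val + 2 = i.val then
      (if i.val + 1 = n then match X with | .B => 0 | .C => 0 | .D => -1 else 0)
    else 0 := by
  have hij' : i.val ≠ j.val := fun h => hij (Fin.ext h)
  have hi := i.2
  have hj := j.2
  rw [cartan]
  by_cases h : i.val + 1 < n
  · rw [dot_self_lt i h]
    by_cases h' : j.val + 1 < n
    · rw [dot_lt i j hij' h h']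
      split_ifs <;> omega
    · rw [dotProduct_comm, dot_last hn j i h' h]
      cases X <;> simp only [] <;> split_ifs <;> omega
  · have h' : j.val + 1 < n := by omega
    rw [dot_self_last hn i h, dot_last hn i j h h']
    cases X <;> simp only [] <;> split_ifs <;> omega

theorem serre_of_sq {B : Type*} [Ring B] [Algebra QV B] {d : ℕ} (hd : d ≠ 0) {m : ℕ} {x y : B}
    (h : m = 1 ∧ x * y = y * x ∨ m = 2 ∧ x * x = 0 ∧ x * y * x = 0 ∨ m = 3 ∧ x * x = 0 ∨
      m = 3 ∧ x * x * x = 0 ∧ x * y * x = 0) : serre d m x y = 0 := by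
  rcases h with ⟨rfl, h⟩ | ⟨rfl, h, h'⟩ | ⟨rfl, h⟩ | ⟨rfl, h, h'⟩
  · rw [serre_one hd, h, sub_self]
  · rw [serre_two hd, h, h', mul_assoc, h]; simp
  · rw [serre_three hd, h, mul_assoc (x * y), h, mul_assoc (y * x), h]; simp
  · rw [serre_three hd, h, h', mul_assoc (x * x), mul_assoc x x, ← mul_assoc x y x, h',
      mul_assoc (y * x), mul_assoc y, ← mul_assoc x x x, h]
    simp

theorem nat_e_sq (hn : X.minRank ≤ n) (i : Fin n) (h : X ≠ .B ∨ i.val + 1 < n) :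
    natGen X (.e i) * natGen X (.e i) = 0 := by
  have hi := i.2
  have hN := dimV_eq X n
  by_cases h' : i.val + 1 < n <;> cases X <;> simp only [Ty.minRank] at hn <;> simp only [] at hN <;>
    first
    | (simp (disch := omega) only [natGen, h', if_true, if_false, add_mul, mul_add, matUnit_mul_ne, add_zero]; done)
    | (exfalso; simp_all; omega)

theorem nat_f_sq (hn : X.minRank ≤ n) (i : Fin n) (h : X ≠ .B ∨ i.val + 1 < n) :
    natGen X (.f i) * natGen X (.f i) = 0 := by
  have hi := i.2
  have hN := dimV_eq X n
  by_cases h' : i.val + 1 < n <;> cases X <;> simp only [Ty.minRank] at hn <;> simp only [] at hN <;>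
    first
    | (simp (disch := omega) only [natGen, h', if_true, if_false, add_mul, mul_add, matUnit_mul_ne, add_zero]; done)
    | (exfalso; simp_all; omega)

theorem nat_e_sqB (hn : 1 ≤ n) (i : Fin n) (h : ¬ i.val + 1 < n) :
    natGen .B (.e i) * natGen .B (.e i) = matUnit _ (n - 1) (n + 1) (-v⁻¹) ∧
    natGen .B (.e i) * natGen .B (.e i) * natGen .B (.e i) = 0 := by
  have hN := dimV_eq .B n
  simp only [] at hN
  have h1 : natGen .B (.e i) * natGen .B (.e i) = matUnit _ (n - 1) (n + 1) (-v⁻¹) := by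
    simp (disch := omega) only [natGen, h, if_false, add_mul, mul_add, matUnit_mul_ne,
      matUnit_mul_same, add_zero, zero_add, one_mul]
  refine ⟨h1, ?_⟩
  rw [h1]
  simp (disch := omega) only [natGen, h, if_false, add_mul, mul_add, matUnit_mul_ne, add_zero]

theorem nat_f_sqB (hn : 1 ≤ n) (i : Fin n) (h : ¬ i.val + 1 < n) :
    natGen .B (.f i) * natGen .B (.f i) =
      matUnit _ (n + 1) (n - 1) (-(v * qnum 1 2) * qnum 1 2) ∧
    natGen .B (.f i) * natGen .B (.f i) * natGen .B (.f i) = 0 := by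
  have hN := dimV_eq .B n
  simp only [] at hN
  have h1 : natGen .B (.f i) * natGen .B (.f i) =
      matUnit _ (n + 1) (n - 1) (-(v * qnum 1 2) * qnum 1 2) := by
    simp (disch := omega) only [natGen, h, if_false, add_mul, mul_add, matUnit_mul_ne,
      matUnit_mul_same, add_zero, zero_add, one_mul]
  refine ⟨h1, ?_⟩
  rw [h1]
  simp (disch := omega) only [natGen, h, if_false, add_mul, mul_add, matUnit_mul_ne, add_zero]

end

end

section

section
variable {X : Ty} {n : ℕ}

set_option maxHeartbeats 2000000 in
theorem nat_comm (hn : X.minRank ≤ n) (i j : Fin n) (hij : i ≠ j) (h0 : cartan X n i j = 0) :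
    natGen X (.e i) * natGen X (.e j) = natGen X (.e j) * natGen X (.e i) ∧
    natGen X (.f i) * natGen X (.f j) = natGen X (.f j) * natGen X (.f i) := by
  have hi := i.2
  have hj := j.2
  have hij' : i.val ≠ j.val := fun h => hij (Fin.ext h)
  have hN := dimV_eq X n
  by_cases hh : i.val + 1 < n ∧ j.val + 1 < n
  · obtain ⟨h, h'⟩ := hh
    have hN' := two_mul_le_dimV X n
    have h1 : i.val + 1 ≠ j.val ∧ j.val + 1 ≠ i.val := by
      rw [cartan_val hn i j hij] at h0
      constructor <;> intro h1 <;> split_ifs at h0 <;> omega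
    simp (disch := omega) only [natGen, h, h', if_true, add_mul, mul_add, matUnit_mul_ne, add_zero,
      and_self]
  rw [cartan_val hn i j hij] at h0
  by_cases h : i.val + 1 < n <;> by_cases h' : j.val + 1 < n <;> (try (exfalso; omega)) <;>
    cases X <;> simp only [Ty.minRank] at hn <;> simp only [] at hN h0 <;>
    simp only [natGen, h, h', if_true, if_false] <;>
    (split_ifs at h0 <;> (try omega) <;>
      simp (disch := omega) only [add_mul, mul_add, matUnit_mul_ne, matUnit_mul_same, add_zero,
        zero_add, mul_one, one_mul, and_self] <;>
      (try (constructor <;> (congr 1 <;> omega))))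

set_option maxHeartbeats 2000000 in
theorem nat_eje (hn : X.minRank ≤ n) (i j : Fin n) (hij : i ≠ j)
    (h0 : cartan X n i j = -1 ∨ cartan X n i j = -2 ∧ X = .B) :
    natGen X (.e i) * natGen X (.e j) * natGen X (.e i) = 0 ∧
    natGen X (.f i) * natGen X (.f j) * natGen X (.f i) = 0 := by
  have hi := i.2
  have hj := j.2
  have hij' : i.val ≠ j.val := fun h => hij (Fin.ext h)
  have hN := dimV_eq X n
  by_cases hh : i.val + 1 < n ∧ j.val + 1 < n
  · obtain ⟨h, h'⟩ := hh
    have hN' := two_mul_le_dimV X n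
    simp only [natGen, h, h', if_true]
    rcases Nat.lt_trichotomy (i.val + 1) j.val with h1 | h1 | h1 <;>
      rcases Nat.lt_trichotomy (j.val + 1) i.val with h2 | h2 | h2 <;> (try (exfalso; omega)) <;>
      simp (disch := omega) only [add_mul, mul_add, matUnit_mul_ne, matUnit_mul_same, zero_mul,
        add_zero, zero_add, mul_one, one_mul, and_self]
  rw [cartan_val hn i j hij] at h0
  by_cases h : i.val + 1 < n <;> by_cases h' : j.val + 1 < n <;> (try (exfalso; omega)) <;>
    cases X <;> simp only [Ty.minRank] at hn <;> simp only [and_true, and_false, or_false, reduceCtorEq] at hN h0 <;>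
    simp only [natGen, h, h', if_true, if_false] <;>
    (split_ifs at h0 <;> (try omega) <;>
      simp (disch := omega) only [add_mul, mul_add, matUnit_mul_ne, matUnit_mul_same, zero_mul, add_zero,
        zero_add, mul_one, one_mul, and_self])

theorem nat_serre (hn : X.minRank ≤ n) (i j : Fin n) (hij : i ≠ j) :
    serre (dd X n i) (1 - cartan X n i j).toNat (natGen X (.e i)) (natGen X (.e j)) = 0 ∧
    serre (dd X n i) (1 - cartan X n i j).toNat (natGen X (.f i)) (natGen X (.f j)) = 0 := by
  rcases cartan_cases (X := X) i j hij with h0 | h0 | h0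
  · have := nat_comm hn i j hij h0
    exact ⟨serre_of_sq (dd_ne i) (.inl ⟨by rw [h0]; rfl, this.1⟩),
      serre_of_sq (dd_ne i) (.inl ⟨by rw [h0]; rfl, this.2⟩)⟩
  · have := nat_eje hn i j hij (.inl h0)
    have hs : X ≠ .B ∨ i.val + 1 < n := by
      by_contra! h
      obtain ⟨rfl, h⟩ := h
      rw [cartan_val hn i j hij] at h0
      have := j.2
      have hij' : i.val ≠ j.val := fun h => hij (Fin.ext h)
      simp only [] at h0
      split_ifs at h0 <;> omega
    exact ⟨serre_of_sq (dd_ne i) (.inr (.inl ⟨by rw [h0]; rfl, nat_e_sq hn i hs, this.1⟩)),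
      serre_of_sq (dd_ne i) (.inr (.inl ⟨by rw [h0]; rfl, nat_f_sq hn i hs, this.2⟩))⟩
  · by_cases hs : X ≠ .B ∨ i.val + 1 < n
    · exact ⟨serre_of_sq (dd_ne i) (.inr (.inr (.inl ⟨by rw [h0]; rfl, nat_e_sq hn i hs⟩))),
        serre_of_sq (dd_ne i) (.inr (.inr (.inl ⟨by rw [h0]; rfl, nat_f_sq hn i hs⟩)))⟩
    · push Not at hs
      obtain ⟨rfl, h⟩ := hs
      have := nat_eje hn i j hij (.inr ⟨h0, rfl⟩)
      exact ⟨serre_of_sq (dd_ne i) (.inr (.inr (.inr ⟨by rw [h0]; rfl,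
          (nat_e_sqB hn i (by omega)).2, this.1⟩))),
        serre_of_sq (dd_ne i) (.inr (.inr (.inr ⟨by rw [h0]; rfl,
          (nat_f_sqB hn i (by omega)).2, this.2⟩)))⟩

theorem nat_family (hn : X.minRank ≤ n) : IsUqFamily X (natGen X (n := n)) where
  k_kinv i := by
    rw [natGen, natGen, Matrix.diagonal_mul_diagonal, ← Matrix.diagonal_one]
    congr 1; funext a
    rw [← zpow_add₀ v_ne_zero, add_neg_cancel, zpow_zero]
  kinv_k i := by
    rw [natGen, natGen, Matrix.diagonal_mul_diagonal, ← Matrix.diagonal_one]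
    congr 1; funext a
    rw [← zpow_add₀ v_ne_zero, neg_add_cancel, zpow_zero]
  k_k i j := by
    rw [natGen, natGen, Matrix.diagonal_mul_diagonal, Matrix.diagonal_mul_diagonal]
    congr 1; funext a; rw [mul_comm]
  k_e i j := by rw [cartan_spec hn]; exact (e_weight hn j).k_mul i
  k_f i j := by
    rw [cartan_spec hn, ← mul_neg, ← dotProduct_neg]; exact (f_weight hn j).k_mul i
  e_f i j := by
    split_ifs with h
    · subst h; exact nat_ef_same hn i
    · exact nat_ef_ne hn i j h
  serre_e i j h := (nat_serre hn i j h).1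
  serre_f i j h := (nat_serre hn i j h).2

/-- The natural representation over `ℚ(v)`. -/
noncomputable def natRep (hn : X.minRank ≤ n) :
    Uq X n →ₐ[QV] Matrix (Fin (X.dimV n)) (Fin (X.dimV n)) QV := liftUq _ (nat_family hn)

/-- The representation on `V^{⊗ r}` over `ℚ(v)`, in the basis of the `v_i`: the trivial one for
`r = 0`, and `V ⊗ V^{⊗ r}` through the comultiplication for `r + 1`. -/
noncomputable def tensorRep (hn : X.minRank ≤ n) : (r : ℕ) →
    Uq X n →ₐ[QV] Matrix (Fin r → Fin (X.dimV n)) (Fin r → Fin (X.dimV n)) QV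
  | 0 => (Algebra.ofId QV _).comp (counit X)
  | r + 1 =>
    (Matrix.reindexAlgEquiv QV QV (Fin.consEquiv fun _ : Fin (r + 1) => Fin (X.dimV n))).toAlgHom.comp
      ((Matrix.kroneckerAlgEquiv (Fin (X.dimV n)) (Fin r → Fin (X.dimV n)) QV).toAlgHom.comp
        ((Algebra.TensorProduct.map (natRep hn) (tensorRep hn r)).comp (comul X)))

section Base
variable (κ : Type*) [Field κ] [Algebra LA κ]

/-- The Laurent polynomials with nonzero image in `κ`. -/
noncomputable def nonzeroIn : Submonoid LA := (nonZeroDivisors κ).comap (algebraMap LA κ)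

theorem nonzeroIn_le : nonzeroIn κ ≤ nonZeroDivisors LA := by
  intro a ha
  rw [mem_nonZeroDivisors_iff_ne_zero]
  rintro rfl
  have : algebraMap LA κ 0 ∈ nonZeroDivisors κ := ha
  rw [mem_nonZeroDivisors_iff_ne_zero, map_zero] at this
  exact this rfl

/-- The local ring in `ℚ(v)` of the fractions whose denominator has nonzero image in `κ`. -/
noncomputable def locRing : Subalgebra LA QV :=
  Localization.subalgebra.ofField QV (nonzeroIn κ) (nonzeroIn_le κ)

instance : IsLocalization (nonzeroIn κ) (locRing κ) :=
  Localization.subalgebra.isLocalization_ofField QV (nonzeroIn κ) (nonzeroIn_le κ)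

theorem isUnit_of_nonzeroIn (a : nonzeroIn κ) : IsUnit (Algebra.ofId LA κ a) :=
  (nonZeroDivisors.ne_zero a.2).isUnit

/-- The canonical map. -/
noncomputable def specialize : locRing κ →ₐ[LA] κ :=
  IsLocalization.liftAlgHom (M := nonzeroIn κ) (f := Algebra.ofId LA κ) (isUnit_of_nonzeroIn κ)

/-- The image of `v` in `κ`, as a unit. -/
noncomputable def vU : κˣ where
  val := algebraMap LA κ (T 1)
  inv := algebraMap LA κ (T (-1))
  val_inv := by rw [← map_mul, ← T_add]; simp
  inv_val := by rw [← map_mul, ← T_add]; simp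

variable (X) in
/-- The image of `q = v ^ c` in `κ`, as a unit. -/
noncomputable def qU : κˣ := vU κ ^ qExp X

theorem v_zpow_mem (z : ℤ) : v ^ z ∈ locRing κ := by
  rw [← algebraMap_T]; exact Subalgebra.algebraMap_mem _ _

theorem qtwo_mem : qnum 1 2 ∈ locRing κ := by
  rw [qnum_two (by omega), ← zpow_neg]
  exact add_mem (v_zpow_mem κ _) (v_zpow_mem κ _)

theorem qtwo_inv_mem (h : (qU .B κ : κ) ^ 2 ≠ 1) : (qnum 1 2)⁻¹ ∈ locRing κ := by
  have h1 : qnum 1 2 = algebraMap LA QV (T 1 + T (-1)) := by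
    rw [qnum_two (by omega), map_add, algebraMap_T, algebraMap_T]; simp
  refine ⟨1, T 1 + T (-1), ?_, by rw [map_one, one_mul, h1]⟩
  change algebraMap LA κ (T 1 + T (-1)) ∈ nonZeroDivisors κ
  rw [mem_nonZeroDivisors_iff_ne_zero]
  intro h2
  apply h
  have h3 : algebraMap LA κ (T 1) * algebraMap LA κ (T 1 + T (-1)) = 0 := by rw [h2, mul_zero]
  rw [← map_mul, mul_add, ← T_add, ← T_add, map_add] at h3
  have h4 : (qU .B κ : κ) + 1 = 0 := by
    have h5 : (qU .B κ : κ) = algebraMap LA κ (T (1 + 1)) := by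
      rw [T_add, map_mul, ← pow_two]; rfl
    rw [h5, ← h3]; simp
  rw [eq_neg_of_add_eq_zero_left h4]; ring

theorem matUnit_mem {N a b : ℕ} {c : QV} (hc : c ∈ locRing κ) :
    matUnit N a b c ∈ (locRing κ).matrix := by
  intro x y
  simp only [matUnit]
  split_ifs
  · exact hc
  · exact zero_mem (locRing κ)

theorem natGen_mem (g : Gen n) : natGen X g ∈ (locRing κ).matrix := by
  have hv := v_zpow_mem κ 1
  have hv' := v_zpow_mem κ (-1)
  rw [zpow_one] at hv
  rw [zpow_neg_one] at hv'
  have h2 := qtwo_mem κ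
  have h1 := one_mem (locRing κ)
  cases g with
  | e i =>
    simp only [natGen]
    split_ifs
    · exact add_mem (matUnit_mem κ h1) (matUnit_mem κ (neg_mem h1))
    · cases X
      · exact add_mem (matUnit_mem κ h1) (matUnit_mem κ (neg_mem hv'))
      · exact matUnit_mem κ h1
      · exact add_mem (matUnit_mem κ h1) (matUnit_mem κ (neg_mem h1))
  | f i =>
    simp only [natGen]
    split_ifs
    · exact add_mem (matUnit_mem κ h1) (matUnit_mem κ (neg_mem h1))
    · cases X
      · exact add_mem (matUnit_mem κ h2) (matUnit_mem κ (neg_mem (mul_mem hv h2)))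
      · exact matUnit_mem κ h1
      · exact add_mem (matUnit_mem κ h1) (matUnit_mem κ (neg_mem h1))
  | k i =>
    intro x y
    simp only [natGen, Matrix.diagonal_apply]
    split_ifs
    · exact v_zpow_mem κ _
    · exact zero_mem (locRing κ)
  | kinv i =>
    intro x y
    simp only [natGen, Matrix.diagonal_apply]
    split_ifs
    · exact v_zpow_mem κ _
    · exact zero_mem (locRing κ)

theorem divPow_mem {B : Type*} [Ring B] [Algebra QV B] [Algebra LA B] [IsScalarTower LA QV B]
    (S : Subalgebra LA B) {d : ℕ} (hd : d ≠ 0) {x : B} (hx : x ∈ S)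
    (h : x * x = 0 ∨ d = 1 ∧ (qnum 1 2)⁻¹ • (x * x) ∈ S ∧ x * x * x = 0) (m : ℕ) :
    divPow d m x ∈ S := by
  match m with
  | 0 => rw [divPow_zero]; exact one_mem S
  | 1 => rw [divPow_one hd]; exact hx
  | 2 =>
    rcases h with h | ⟨rfl, h, -⟩
    · rw [divPow, pow_two, h, smul_zero]; exact zero_mem S
    · rw [divPow, pow_two]
      simpa [qfact, Finset.prod_range_succ, qnum_one] using h
  | m + 3 =>
    have : x ^ (m + 3) = 0 := by
      have h3 : x * x * x = 0 := by
        rcases h with h | ⟨-, -, h⟩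
        · rw [h, zero_mul]
        · exact h
      rw [pow_add, pow_succ, pow_two, h3, mul_zero]
    rw [divPow, this, smul_zero]; exact zero_mem S

theorem natRep_mem (hn : X.minRank ≤ n) (hq : (qU X κ : κ) ^ 2 ≠ 1) {u : Uq X n} (hu : u ∈ AForm X n) :
    natRep hn u ∈ (locRing κ).matrix := by
  change ((natRep hn).restrictScalars LA) u ∈ (locRing κ).matrix
  revert u
  change AForm X n ≤ (locRing κ).matrix.comap ((natRep hn).restrictScalars LA)
  refine Algebra.adjoin_le ?_
  have hm : ∀ (i : Fin n) (m : ℕ) (x : Uq X n), natRep hn (divPow (dd X n i) m x) =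
      divPow (dd X n i) m (natRep hn x) := by
    intro i m x; rw [divPow, map_smul, map_pow, divPow]
  have hi := qtwo_inv_mem κ
  have hv := v_zpow_mem κ 1
  have hv' := v_zpow_mem κ (-1)
  rw [zpow_one] at hv
  rw [zpow_neg_one] at hv'
  have h2 := qtwo_mem κ
  have smulU : ∀ (a b : ℕ) (c d : QV), c • matUnit (X.dimV n) a b d = matUnit _ a b (c * d) := by
    intro a b c d; ext x y; simp [matUnit]
  rintro x ⟨i, rfl | rfl | ⟨m, -, rfl | rfl⟩⟩
  · change natRep hn (gen X _) ∈ (locRing κ).matrix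
    rw [natRep, liftUq_gen]; exact natGen_mem κ _
  · change natRep hn (gen X _) ∈ (locRing κ).matrix
    rw [natRep, liftUq_gen]; exact natGen_mem κ _
  · change natRep hn _ ∈ (locRing κ).matrix
    rw [hm, natRep, liftUq_gen]
    refine divPow_mem _ (dd_ne i) (natGen_mem κ _) ?_ m
    by_cases h : X ≠ .B ∨ i.val + 1 < n
    · exact .inl (nat_e_sq hn i h)
    · push Not at h
      obtain ⟨rfl, h⟩ := h
      have := nat_e_sqB hn i (by omega)
      refine .inr ⟨by simp only [dd]; rw [if_neg (by omega)], ?_, this.2⟩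
      rw [this.1, smulU]
      exact matUnit_mem κ (mul_mem (hi hq) (neg_mem hv'))
  · change natRep hn _ ∈ (locRing κ).matrix
    rw [hm, natRep, liftUq_gen]
    refine divPow_mem _ (dd_ne i) (natGen_mem κ _) ?_ m
    by_cases h : X ≠ .B ∨ i.val + 1 < n
    · exact .inl (nat_f_sq hn i h)
    · push Not at h
      obtain ⟨rfl, h⟩ := h
      have := nat_f_sqB hn i (by omega)
      refine .inr ⟨by simp only [dd]; rw [if_neg (by omega)], ?_, this.2⟩
      rw [this.1, smulU]
      exact matUnit_mem κ (mul_mem (hi hq) (mul_mem (neg_mem (mul_mem hv h2)) h2))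

theorem counit_mem {u : Uq X n} (hu : u ∈ AForm X n) : counit X u ∈ locRing κ := by
  change ((counit X).restrictScalars LA) u ∈ locRing κ
  revert u
  change AForm X n ≤ (locRing κ).comap ((counit X).restrictScalars LA)
  refine Algebra.adjoin_le ?_
  have hm : ∀ (i : Fin n) (m : ℕ) (x : Uq X n), counit X (divPow (dd X n i) m x) =
      divPow (dd X n i) m (counit X x) := by
    intro i m x; rw [divPow, map_smul, map_pow, divPow]
  rintro x ⟨i, rfl | rfl | ⟨m, -, rfl | rfl⟩⟩
  · change counit X (gen X _) ∈ locRing κ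
    rw [counit, liftUq_gen]; exact one_mem (locRing κ)
  · change counit X (gen X _) ∈ locRing κ
    rw [counit, liftUq_gen]; exact one_mem (locRing κ)
  · change counit X _ ∈ locRing κ
    rw [hm, counit, liftUq_gen]
    exact divPow_mem _ (dd_ne i) (zero_mem (locRing κ)) (.inl (by simp [counitGen])) m
  · change counit X _ ∈ locRing κ
    rw [hm, counit, liftUq_gen]
    exact divPow_mem _ (dd_ne i) (zero_mem (locRing κ)) (.inl (by simp [counitGen])) m

theorem tensorRep_mem (hn : X.minRank ≤ n) (hq : (qU X κ : κ) ^ 2 ≠ 1) (r : ℕ) {u : Uq X n}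
    (hu : u ∈ AForm X n) : tensorRep hn r u ∈ (locRing κ).matrix := by
  induction r generalizing u with
  | zero =>
    intro a b
    change algebraMap QV (Matrix (Fin 0 → Fin (X.dimV n)) (Fin 0 → Fin (X.dimV n)) QV)
      (counit X u) a b ∈ locRing κ
    rw [Matrix.algebraMap_matrix_apply]
    split_ifs
    · exact counit_mem κ hu
    · exact zero_mem (locRing κ)
  | succ r ih =>
    have key : ∀ w ∈ AForm2 X n, Matrix.kroneckerAlgEquiv (Fin (X.dimV n)) (Fin r → Fin (X.dimV n)) QV
        (Algebra.TensorProduct.map (natRep hn) (tensorRep hn r) w) ∈ (locRing κ).matrix := by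
      intro w hw
      change (((Matrix.kroneckerAlgEquiv (Fin (X.dimV n)) (Fin r → Fin (X.dimV n)) QV).toAlgHom.comp
        (Algebra.TensorProduct.map (natRep hn) (tensorRep hn r))).restrictScalars LA) w ∈
          (locRing κ).matrix
      revert w
      change AForm2 X n ≤ (locRing κ).matrix.comap (((Matrix.kroneckerAlgEquiv (Fin (X.dimV n))
        (Fin r → Fin (X.dimV n)) QV).toAlgHom.comp
        (Algebra.TensorProduct.map (natRep hn) (tensorRep hn r))).restrictScalars LA)
      refine Algebra.adjoin_le ?_
      rintro _ ⟨a, ha, b, hb, rfl⟩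
      rintro ⟨x, x'⟩ ⟨y, y'⟩
      exact (locRing κ).mul_mem (natRep_mem κ hn hq ha x y) (ih hb x' y')
    intro a b
    exact key _ (comul_mem hu) ((Fin.consEquiv _).symm a) ((Fin.consEquiv _).symm b)

/-- The action of the integral form on the lattice spanned by the `v_i` over the local ring. -/
noncomputable def latticeRep (hn : X.minRank ≤ n) (hq : (qU X κ : κ) ^ 2 ≠ 1) (r : ℕ) :
    AForm X n →ₐ[LA]
      Matrix (Fin r → Fin (X.dimV n)) (Fin r → Fin (X.dimV n)) (locRing κ) where
  toFun u := Matrix.of fun a b => ⟨tensorRep hn r u a b, tensorRep_mem κ hn hq r u.2 a b⟩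
  map_one' := by
    ext a b
    change tensorRep hn r 1 a b = (((1 : Matrix _ _ (locRing κ)) a b : locRing κ) : QV)
    rw [map_one, Matrix.one_apply, Matrix.one_apply]
    split_ifs <;> rfl
  map_mul' x y := by
    ext a b
    change tensorRep hn r ((x : Uq X n) * y) a b = (locRing κ).val (∑ c, _)
    rw [map_mul, Matrix.mul_apply, map_sum]
    rfl
  map_zero' := by
    ext a b
    change tensorRep hn r 0 a b = 0
    rw [map_zero, Matrix.zero_apply]
  map_add' x y := by
    ext a b
    change tensorRep hn r ((x : Uq X n) + y) a b = tensorRep hn r x a b + tensorRep hn r y a b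
    rw [map_add, Matrix.add_apply]
  commutes' c := by
    ext a b
    have := congrFun (congrFun (((tensorRep hn r).restrictScalars LA).commutes c) a) b
    rw [Matrix.algebraMap_matrix_apply] at this ⊢
    refine this.trans ?_
    split_ifs <;> rfl

/-- The action of `U_κ(g)` on `V^{⊗ r}` over `κ`, in the basis of the `v_i`: the base change of
the action over `ℚ(v)`. The assumption `q² ≠ 1` is needed in type `B` only, where `e_n^{(2)}` has
a matrix entry with denominator `[2]_1 = v + v⁻¹`. -/
noncomputable def matrixAction (hn : X.minRank ≤ n) (hq : (qU X κ : κ) ^ 2 ≠ 1) (r : ℕ) :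
    UK X n κ →ₐ[κ] Matrix (Fin r → Fin (X.dimV n)) (Fin r → Fin (X.dimV n)) κ :=
  Algebra.TensorProduct.lift (Algebra.ofId κ _)
    ((specialize κ).mapMatrix.comp (latticeRep κ hn hq r)) fun a _ => Algebra.commutes a _

end Base
end

end

section

section BMWdef
variable (R : Type*) [CommRing R] (ϱ q : Rˣ) (r : ℕ)

/-- Generators of the Birman-Murakami-Wenzl algebra; `T i` is the generator with index `i + 1`. -/
inductive BGen (r : ℕ)
  | T (i : Fin (r - 1))
  | Tinv (i : Fin (r - 1))
  | E (i : Fin (r - 1))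

variable {R r} in
/-- The defining relations of the Birman-Murakami-Wenzl algebra, for a family of elements. -/
inductive BRelOf {B : Type*} [Ring B] [Algebra R B] (g : BGen r → B) : B → B → Prop
  | T_Tinv (i) : BRelOf g (g (.T i) * g (.Tinv i)) 1
  | Tinv_T (i) : BRelOf g (g (.Tinv i) * g (.T i)) 1
  | skein (i) : BRelOf g (g (.T i) - g (.Tinv i)) (((q : R) - (q⁻¹ : Rˣ)) • (1 - g (.E i)))
  | cubic (i) : BRelOf g ((g (.T i) - algebraMap R B q) * (g (.T i) + algebraMap R B (q⁻¹ : Rˣ)) *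
      (g (.T i) - algebraMap R B (ϱ⁻¹ : Rˣ))) 0
  | braid (i j) (h : i.val + 1 = j.val) :
      BRelOf g (g (.T i) * g (.T j) * g (.T i)) (g (.T j) * g (.T i) * g (.T j))
  | far (i j) (h : i.val + 1 < j.val ∨ j.val + 1 < i.val) :
      BRelOf g (g (.T i) * g (.T j)) (g (.T j) * g (.T i))
  | ETE (i j) (h : i.val + 1 = j.val ∨ j.val + 1 = i.val) :
      BRelOf g (g (.E i) * g (.T j) * g (.E i)) ((ϱ : R) • g (.E i))
  | ETinvE (i j) (h : i.val + 1 = j.val ∨ j.val + 1 = i.val) :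
      BRelOf g (g (.E i) * g (.Tinv j) * g (.E i)) (((ϱ⁻¹ : Rˣ) : R) • g (.E i))
  | ET (i) : BRelOf g (g (.E i) * g (.T i)) (((ϱ⁻¹ : Rˣ) : R) • g (.E i))
  | TE (i) : BRelOf g (g (.T i) * g (.E i)) (((ϱ⁻¹ : Rˣ) : R) • g (.E i))

/-- The Birman-Murakami-Wenzl algebra `B_r(ϱ, q)` over `R`. -/
def BMW : Type _ := RingQuot (BRelOf ϱ q (FreeAlgebra.ι R (X := BGen r)))

noncomputable instance : Ring (BMW R ϱ q r) :=
  inferInstanceAs (Ring (RingQuot (BRelOf ϱ q (FreeAlgebra.ι R (X := BGen r)))))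
noncomputable instance : Algebra R (BMW R ϱ q r) :=
  inferInstanceAs (Algebra R (RingQuot (BRelOf ϱ q (FreeAlgebra.ι R (X := BGen r)))))

/-- The quotient map from the free algebra. -/
noncomputable def mkBMW : FreeAlgebra R (BGen r) →ₐ[R] BMW R ϱ q r :=
  RingQuot.mkAlgHom R (BRelOf ϱ q (FreeAlgebra.ι R (X := BGen r)))

variable {r}

/-- The generators `T_i`, `T_i⁻¹`, `E_i`. -/
noncomputable def bgen (g : BGen r) : BMW R ϱ q r := mkBMW R ϱ q r (FreeAlgebra.ι R g)

variable {R ϱ q}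

theorem BRelOf.map {B C : Type*} [Ring B] [Algebra R B] [Ring C] [Algebra R C] {g : BGen r → B}
    (φ : B →ₐ[R] C) {x y : B} (h : BRelOf ϱ q g x y) : BRelOf ϱ q (φ ∘ g) (φ x) (φ y) := by
  cases h <;> simp only [map_mul, map_sub, map_add, map_smul, map_one, map_zero,
    AlgHom.commutes] <;> constructor <;> assumption

/-- The universal property of the Birman-Murakami-Wenzl algebra. -/
noncomputable def liftBMW {B : Type*} [Ring B] [Algebra R B] (g : BGen r → B)
    (hg : ∀ x y, BRelOf ϱ q g x y → x = y) : BMW R ϱ q r →ₐ[R] B :=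
  RingQuot.liftAlgHom R ⟨FreeAlgebra.lift R g, fun x y h => hg _ _ (by
    have := h.map (FreeAlgebra.lift R g)
    rwa [FreeAlgebra.ι_comp_lift] at this)⟩

theorem liftBMW_bgen {B : Type*} [Ring B] [Algebra R B] (g : BGen r → B)
    (hg : ∀ x y, BRelOf ϱ q g x y → x = y) (x : BGen r) :
    liftBMW g hg (bgen R ϱ q x) = g x := by
  refine (RingQuot.liftAlgHom_mkAlgHom_apply R _ _ _).trans ?_
  exact FreeAlgebra.lift_ι_apply g x

theorem mkBMW_rel {a b : FreeAlgebra R (BGen r)}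
    (h : BRelOf ϱ q (FreeAlgebra.ι R (X := BGen r)) a b) : mkBMW R ϱ q r a = mkBMW R ϱ q r b :=
  RingQuot.mkAlgHom_rel R h

theorem bgen_rel {x y : BMW R ϱ q r} (h : BRelOf ϱ q (bgen R ϱ q) x y) : x = y := by
  have e : ∀ g : BGen r, mkBMW R ϱ q r (FreeAlgebra.ι R g) = bgen R ϱ q g := fun _ => rfl
  cases h with
  | T_Tinv i => simpa [e] using mkBMW_rel (.T_Tinv (ϱ := ϱ) (q := q) i)
  | Tinv_T i => simpa [e] using mkBMW_rel (.Tinv_T (ϱ := ϱ) (q := q) i)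
  | skein i =>
    have := mkBMW_rel (.skein (ϱ := ϱ) (q := q) i)
    simpa only [map_mul, map_sub, map_add, map_smul, map_one, map_zero, AlgHom.commutes, e] using this
  | cubic i =>
    have := mkBMW_rel (.cubic (ϱ := ϱ) (q := q) i)
    simpa only [map_mul, map_sub, map_add, map_smul, map_one, map_zero, AlgHom.commutes, e] using this
  | braid i j h => simpa [e] using mkBMW_rel (.braid (ϱ := ϱ) (q := q) i j h)
  | far i j h => simpa [e] using mkBMW_rel (.far (ϱ := ϱ) (q := q) i j h)
  | ETE i j h => simpa [e] using mkBMW_rel (.ETE (ϱ := ϱ) (q := q) i j h)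
  | ETinvE i j h => simpa [e] using mkBMW_rel (.ETinvE (ϱ := ϱ) (q := q) i j h)
  | ET i => simpa [e] using mkBMW_rel (.ET (ϱ := ϱ) (q := q) i)
  | TE i => simpa [e] using mkBMW_rel (.TE (ϱ := ϱ) (q := q) i)

theorem BRelOf.op {B : Type*} [Ring B] [Algebra R B] {g : BGen r → B}
    (hg : ∀ x y, BRelOf ϱ q g x y → x = y) {x y : Bᵐᵒᵖ}
    (h : BRelOf ϱ q (fun z => MulOpposite.op (g z)) x y) : x = y := by
  apply MulOpposite.unop_injective
  cases h with
  | T_Tinv i => exact hg _ _ (.Tinv_T i)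
  | Tinv_T i => exact hg _ _ (.T_Tinv i)
  | skein i => exact hg _ _ (.skein i)
  | cubic i =>
    refine Eq.trans ?_ (hg _ _ (.cubic i))
    have hc : ∀ a b : R, Commute (g (.T i) - algebraMap R B a) (g (.T i) - algebraMap R B b) := by
      intro a b
      have ha : Commute (algebraMap R B a) (g (.T i)) := Algebra.commutes a _
      have hb : Commute (algebraMap R B b) (g (.T i)) := Algebra.commutes b _
      have hab : Commute (algebraMap R B a) (algebraMap R B b) := Algebra.commutes a _
      exact ((Commute.refl _).sub_left ha).sub_right (hb.symm.sub_left hab)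
    have hn : g (.T i) + algebraMap R B ((q⁻¹ : Rˣ) : R) =
        g (.T i) - algebraMap R B (-((q⁻¹ : Rˣ) : R)) := by rw [map_neg, sub_neg_eq_add]
    change (g (.T i) - algebraMap R B _) * ((g (.T i) + algebraMap R B _) *
      (g (.T i) - algebraMap R B _)) = _
    rw [hn, (hc (-((q⁻¹ : Rˣ) : R)) q).eq,
      ((hc _ _).mul_right (hc _ _)).eq]
  | braid i j h =>
    refine Eq.trans ?_ ((hg _ _ (.braid i j h)).trans ?_)
    · exact (mul_assoc _ _ _).symm
    · exact mul_assoc _ _ _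
  | far i j h => exact hg _ _ (.far j i h.symm)
  | ETE i j h => exact (mul_assoc _ _ _).symm.trans (hg _ _ (.ETE i j h))
  | ETinvE i j h => exact (mul_assoc _ _ _).symm.trans (hg _ _ (.ETinvE i j h))
  | ET i => exact hg _ _ (.TE i)
  | TE i => exact hg _ _ (.ET i)

/-- The index `i ↦ r - i`. -/
def BGen.flip : BGen r → BGen r
  | .T i => .T i.rev
  | .Tinv i => .Tinv i.rev
  | .E i => .E i.rev

theorem BRelOf.flip {B : Type*} [Ring B] [Algebra R B] {g : BGen r → B}
    (hg : ∀ x y, BRelOf ϱ q g x y → x = y) {x y : B}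
    (h : BRelOf ϱ q (g ∘ BGen.flip) x y) : x = y := by
  cases h with
  | T_Tinv i => exact hg _ _ (.T_Tinv i.rev)
  | Tinv_T i => exact hg _ _ (.Tinv_T i.rev)
  | skein i => exact hg _ _ (.skein i.rev)
  | cubic i => exact hg _ _ (.cubic i.rev)
  | braid i j h =>
    exact (hg _ _ (.braid j.rev i.rev (by simp only [Fin.val_rev]; omega))).symm
  | far i j h => exact hg _ _ (.far i.rev j.rev (by simp only [Fin.val_rev]; omega))
  | ETE i j h => exact hg _ _ (.ETE i.rev j.rev (by simp only [Fin.val_rev]; omega))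
  | ETinvE i j h => exact hg _ _ (.ETinvE i.rev j.rev (by simp only [Fin.val_rev]; omega))
  | ET i => exact hg _ _ (.ET i.rev)
  | TE i => exact hg _ _ (.TE i.rev)

variable (R ϱ q r)

/-- The anti-involution fixing all `T_i` and `E_i`. -/
noncomputable def sigma : BMW R ϱ q r →ₐ[R] (BMW R ϱ q r)ᵐᵒᵖ :=
  liftBMW (fun z => MulOpposite.op (bgen R ϱ q z)) fun _ _ h => h.op fun _ _ => bgen_rel

/-- The automorphism with `T_i ↦ T_{r-i}`, `E_i ↦ E_{r-i}`. -/
noncomputable def gamma : BMW R ϱ q r →ₐ[R] BMW R ϱ q r :=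
  liftBMW (bgen R ϱ q ∘ BGen.flip) fun _ _ h => h.flip fun _ _ => bgen_rel

/-- The anti-involution `σ ∘ γ`. -/
noncomputable def sigmaTilde : BMW R ϱ q r →ₐ[R] (BMW R ϱ q r)ᵐᵒᵖ :=
  (sigma R ϱ q r).comp (gamma R ϱ q r)

end BMWdef

end

section

/-! ### Bimodules and their duals -/

/-- A left `A`-module and right `B`-module structure on `M` that commute: an `(A, B)`-bimodule.
The right action of `b` is `x ↦ (right b).unop x`. -/
structure Bimodule (κ A B M : Type*) [Field κ] [Ring A] [Algebra κ A] [Ring B] [Algebra κ B]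
    [AddCommGroup M] [Module κ M] where
  left : A →ₐ[κ] Module.End κ M
  right : B →ₐ[κ] (Module.End κ M)ᵐᵒᵖ
  comm : ∀ a b x, (right b).unop (left a x) = left a ((right b).unop x)

namespace Bimodule
variable {κ A B M M' : Type*} [Field κ] [Ring A] [Algebra κ A] [Ring B] [Algebra κ B]
  [AddCommGroup M] [Module κ M] [AddCommGroup M'] [Module κ M']

/-- A linear map that commutes with both actions. -/
def IsHom (P : Bimodule κ A B M) (P' : Bimodule κ A B M') (Φ : M →ₗ[κ] M') : Prop :=
  (∀ a x, Φ (P.left a x) = P'.left a (Φ x)) ∧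
    ∀ b x, Φ ((P.right b).unop x) = (P'.right b).unop (Φ x)

variable (κ M) in
/-- Transposition of endomorphisms. -/
def transpose : (Module.End κ M)ᵐᵒᵖ →ₐ[κ] Module.End κ (Module.Dual κ M) where
  toFun f := Module.Dual.transpose f.unop
  map_one' := rfl
  map_mul' _ _ := rfl
  map_zero' := by simp
  map_add' _ _ := by simp
  commutes' c := by
    ext f x
    simp only [Algebra.algebraMap_eq_smul_one, MulOpposite.unop_smul, map_smul]
    rfl

/-- The dual space with `(a f) x = f (θ(a) x)` and `(f b) x = f (x φ(b))`. -/
def dual (P : Bimodule κ A B M) (θ : A →ₐ[κ] Aᵐᵒᵖ) (φ : B →ₐ[κ] Bᵐᵒᵖ) :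
    Bimodule κ A B (Module.Dual κ M) where
  left := (transpose κ M).comp ((AlgHom.op P.left).comp θ)
  right := (AlgHom.op (transpose κ M)).comp ((AlgHom.op P.right).comp φ)
  comm a b f := by
    ext x
    exact congrArg f (P.comm (θ a).unop (φ b).unop x).symm

theorem dual_left_apply (P : Bimodule κ A B M) (θ : A →ₐ[κ] Aᵐᵒᵖ) (φ : B →ₐ[κ] Bᵐᵒᵖ) (a : A)
    (f : Module.Dual κ M) (x : M) : (P.dual θ φ).left a f x = f (P.left (θ a).unop x) := rfl

theorem dual_right_apply (P : Bimodule κ A B M) (θ : A →ₐ[κ] Aᵐᵒᵖ) (φ : B →ₐ[κ] Bᵐᵒᵖ) (b : B)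
    (f : Module.Dual κ M) (x : M) :
    ((P.dual θ φ).right b).unop f x = f ((P.right (φ b).unop).unop x) := rfl

end Bimodule

section Tensor
variable (X : Ty) (n : ℕ) (κ : Type*) [Field κ] [Algebra LA κ] (r : ℕ)

/-! ### The tensor space and the two actions on it -/

/-- The tensor space `V^{⊗ r}`. -/
abbrev TV : Type _ := PiTensorProduct κ fun _ : Fin r => Fin (X.dimV n) → κ

/-- The basis `v_i = v_{i_1} ⊗ ⋯ ⊗ v_{i_r}` of `V^{⊗ r}`. -/
noncomputable def vBasis : Module.Basis (Fin r → Fin (X.dimV n)) κ (TV X n κ r) :=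
  Basis.piTensorProduct fun _ => Pi.basisFun κ (Fin (X.dimV n))

variable {X n} in
/-- The left action of `U_κ(g)` on `V^{⊗ r}`. -/
noncomputable def actU (hn : X.minRank ≤ n) (hq : (qU X κ : κ) ^ 2 ≠ 1) :
    UK X n κ →ₐ[κ] Module.End κ (TV X n κ r) :=
  (Matrix.toLinAlgEquiv (vBasis X n κ r)).toAlgHom.comp (matrixAction κ hn hq r)

/-- The exponent `z` with `q ^ ρ_k = v ^ z`, where `k` is counted from `0`. -/
def rhoV (k : Fin (X.dimV n)) : ℤ :=
  match X with
  | .B => if k.val < n then 2 * (n : ℤ) - 2 * k.val - 1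
      else if k.val = n then 0 else 2 * (n : ℤ) - 2 * k.val + 1
  | .C => if k.val < n then (n : ℤ) - k.val else (n : ℤ) - 1 - k.val
  | .D => if k.val < n then (n : ℤ) - 1 - k.val else (n : ℤ) - k.val

/-- The signs `ε_k`. -/
def eps (k : Fin (X.dimV n)) : ℤ :=
  match X with
  | .B => 1
  | .C => if k.val < n then 1 else -1
  | .D => 1

/-- The parameter `ϱ` of the Birman-Murakami-Wenzl algebra. -/
noncomputable def varrho : κˣ :=
  match X with
  | .B => qU .B κ ^ (2 * n : ℤ)
  | .C => -qU .C κ ^ (2 * n + 1 : ℤ)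
  | .D => qU .D κ ^ (2 * n - 1 : ℤ)

/-- The Birman-Murakami-Wenzl algebra `B_r(ϱ, q)` acting on `V^{⊗ r}`. -/
abbrev BMWK : Type _ := BMW κ (varrho X n κ) (qU X κ) r

variable {X n}

/-- The coefficient `q^{ρ_b - ρ_k} ε_b ε_k`. -/
noncomputable def contractCoef (k b : Fin (X.dimV n)) : κ :=
  ((vU κ ^ (rhoV X n b - rhoV X n k) : κˣ) : κ) * (eps X n b * eps X n k : ℤ)

/-- The coordinates of `v_a ⊗ v_b`. -/
def pairVec (a b : Fin (X.dimV n)) : Fin (X.dimV n) × Fin (X.dimV n) → κ := Pi.single (a, b) 1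

/-- The coordinates of `(v_k ⊗ v_l) E`. -/
noncomputable def imageE (k l : Fin (X.dimV n)) : Fin (X.dimV n) × Fin (X.dimV n) → κ :=
  if k = l.rev then ∑ i, contractCoef κ k i.rev • pairVec κ i i.rev else 0

/-- The coordinates of `(v_k ⊗ v_l) Ř`. -/
noncomputable def imageR (k l : Fin (X.dimV n)) : Fin (X.dimV n) × Fin (X.dimV n) → κ :=
  let q : κ := qU X κ
  let δ : κ := q - q⁻¹
  let tail := δ • ∑ i ∈ Finset.Ioi k, contractCoef κ k i • pairVec κ i.rev i
  if k = l then
    if k = l.rev then pairVec κ k k - tail else q • pairVec κ k k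
  else if k = l.rev then
    if l < k then q⁻¹ • pairVec κ l k - tail
    else q⁻¹ • pairVec κ l k + δ • pairVec κ k l - tail
  else
    if l < k then pairVec κ l k else pairVec κ l k + δ • pairVec κ k l

/-- The operator on `V^{⊗ r}` that applies to the neighbouring tensor factors `m`, `m + 1` the
operator on `V ⊗ V` for which `v_k ⊗ v_l` has the image with coordinates `c k l`. -/
noncomputable def opAt
    (c : Fin (X.dimV n) → Fin (X.dimV n) → Fin (X.dimV n) × Fin (X.dimV n) → κ)
    (m : Fin (r - 1)) : Module.End κ (TV X n κ r) :=
  let s : Fin r := ⟨m, by omega⟩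
  let t : Fin r := ⟨m + 1, by omega⟩
  (vBasis X n κ r).constr κ fun i =>
    ∑ p, c (i s) (i t) p • vBasis X n κ r (Function.update (Function.update i s p.1) t p.2)

variable {κ r}

/-- `V^{⊗ r}` with the left action of `U_κ(g)` and the right action of `B_r(ϱ, q)` in which `T_m`
and `E_m` act by `Ř` and `E` on the tensor factors `m`, `m + 1`. -/
def IsTensorBimodule (hn : X.minRank ≤ n) (hq : (qU X κ : κ) ^ 2 ≠ 1)
    (P : Bimodule κ (UK X n κ) (BMWK X n κ r) (TV X n κ r)) : Prop :=
  P.left = actU κ r hn hq ∧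
  (∀ m, (P.right (bgen κ (varrho X n κ) (qU X κ) (.T m))).unop = opAt κ r (imageR κ) m) ∧
  ∀ m, (P.right (bgen κ (varrho X n κ) (qU X κ) (.E m))).unop = opAt κ r (imageE κ) m

/-! ### The two bilinear forms -/

variable (n κ r)

/-- The form with `⟨v_i, v_j⟩ = q^{-ρ_i} δ_{i, j'}` for `j' = (j_r', …, j_1')`. -/
noncomputable def formB : LinearMap.BilinForm κ (TV .B n κ r) :=
  Matrix.toBilin (vBasis .B n κ r) <| Matrix.of fun i j =>
    if i = fun s => (j s.rev).rev then ((vU κ ^ (-∑ s, rhoV .B n (i s)) : κˣ) : κ) else 0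

variable (X) {n r}

/-- `β(i) = #{s < t : i_s ≠ i_t, i_s ≠ i_t'} + 2 #{s < t : i_s = i_t'}`. -/
def beta (i : Fin r → Fin (X.dimV n)) : ℕ :=
  (Finset.univ.filter fun p : Fin r × Fin r =>
    p.1 < p.2 ∧ i p.1 ≠ i p.2 ∧ i p.1 ≠ (i p.2).rev).card +
  2 * (Finset.univ.filter fun p : Fin r × Fin r => p.1 < p.2 ∧ i p.1 = (i p.2).rev).card

variable (n r)

/-- The form with `⟨v_i, v_j⟩ = q^{β(i)} δ_{i, j}`. -/
noncomputable def formCD : LinearMap.BilinForm κ (TV X n κ r) :=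
  Matrix.toBilin (vBasis X n κ r) <| Matrix.diagonal fun i => (qU X κ : κ) ^ beta X i

end Tensor

end

end QG

/-! Since V^{⊗ r} has the basis of the v_i, the whole claim amounts to identities between matrices.
Braiding, contraction and the two Gram matrices have entries in ℤ[v, v⁻¹]; the integral quantum
group acts with entries in the local ring `locRing κ` inside ℚ(v). Every identity is proved over
ℚ(v), where it can be checked on the Chevalley generators and q - q⁻¹ can be cancelled, and is then
carried to κ (`pairRel`, `commute_matrixAction`, `transpose_matrixAction`).

Equivariance. Put g_k = q^{ρ_k} ε_k. The contraction sends v_k ⊗ v_{k'} to g_k⁻¹ times the invariant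
vector ∑ g_i v_{i'} ⊗ v_i, and the braiding is a flip with a triangular correction and a tail of
that same vector. On V a raising operator only moves basis vectors along arrows, and three patterns
of arrows occur (`TwoArrows`, `OneArrow`, `MiddleArrows`); for each of them commutation with the
coproduct is a finite check. The lowering operators follow from the symmetry v_a ⊗ v_b ↦ v_{b'} ⊗
v_{a'} (`commute_lowering`).

Relations. An operator that commutes with the quantum group is determined by few values: v_N is a
lowest and v_1 a highest weight vector, so v_N ⊗ v_1 generates V ⊗ V, and the v_N ⊗ v_a ⊗ v_1
generate V ⊗ V ⊗ V (`pair_eq_zero`, `triple_eq_zero`). No index precedes 1 or follows N, so on most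
of the vectors that arise the braiding is a flip up to a scalar, and the relations become short
computations (`two_relations`, `three_relations`). The inverse of T_i is read off from the skein
relation and the remaining relations are formal (`PairRel.bRelOf`).

Duality. With Gram matrix J, the map to the dual is a bimodule map as soon as Aᵀ J = J A', where A
and A' are the matrices of an element and of its image under the anti-homomorphism
(`exists_isHom_dual`). The T_i and E_i have symmetric matrices, are compatible with reversal of the
tensor factors, and preserve weights, while the Gram entries depend on the weight only; for β this
is the identity 2β(i) = r² - (wt i, wt i) (`two_mul_beta`). The iterated coproduct of e_i is the sum
of all K ⊗ ⋯ ⊗ K ⊗ E ⊗ 1 ⊗ ⋯ ⊗ 1, and both transposition and reversal change all its summands by one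
common scalar (`skewSum_transpose`, `skewSum_flipRev_swap`). This scalar accounts for the change of
the Gram entry along a root. -/

namespace QG

set_option linter.unusedSectionVars false
set_option linter.unusedSimpArgs false

/-! ### Braiding and contraction against a root vector with two separate arrows -/

section PairSpace
variable {F : Type*} [Field F] {N : ℕ}

/-- The basis vector `v_a ⊗ v_b` of `V ⊗ V`. -/
def pv (F : Type*) [Field F] {N : ℕ} (a b : Fin N) : Fin N × Fin N → F := Pi.single (a, b) 1

/-- The sum of the `g_i v_{i'} ⊗ v_i` with `i > k`. -/
def tailVec (g : Fin N → F) (k : Fin N) : Fin N × Fin N → F :=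
  ∑ i, (if k < i then g i else 0) • pv F i.rev i

/-- The invariant vector, the sum of all `g_i v_{i'} ⊗ v_i`. -/
def invVec (g : Fin N → F) : Fin N × Fin N → F := ∑ i, g i • pv F i.rev i

/-- The coefficient of `v_l ⊗ v_k` in the image of `v_k ⊗ v_l` under the braiding. -/
def flipCoef (q : F) (k l : Fin N) : F :=
  if k = l.rev then (if k = l then 1 else q⁻¹) else if k = l then q else 1

/-- The image of `v_k ⊗ v_l` under the braiding. -/
def braidVec (g : Fin N → F) (q : F) (k l : Fin N) : Fin N × Fin N → F :=
  flipCoef q k l • pv F l k + (if k < l then q - q⁻¹ else 0) • pv F k l -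
    (if k = l.rev then (q - q⁻¹) * (g k)⁻¹ else 0) • tailVec g k

/-- The image of `v_k ⊗ v_l` under the contraction. -/
def contractVec (g : Fin N → F) (k l : Fin N) : Fin N × Fin N → F :=
  (if k = l.rev then (g k)⁻¹ else 0) • invVec g

/-- A generator sending `v_k` to `c_k v_{φ(k)}` acts on `v_k ⊗ v_l` by this rule. -/
def IsTwisted (D : (Fin N × Fin N → F) →ₗ[F] (Fin N × Fin N → F)) (c K : Fin N → F)
    (φ : Fin N → Fin N) : Prop :=
  ∀ k l, D (pv F k l) = c k • pv F (φ k) l + (K k * c l) • pv F k (φ l)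

section TypeI
variable {g c K : Fin N → F} {q : F} {φ : Fin N → Fin N} {x y : Fin N}
  {D : (Fin N × Fin N → F) →ₗ[F] (Fin N × Fin N → F)}

/-- In v_{i'} ⊗ v_i one of the two factors must be the source of an arrow, so only i = x, y, x', y'
contribute, and their images lie on the two lines v_{x'} ⊗ v_y and v_y ⊗ v_{x'}. Taking arbitrary
weights w covers the invariant vector and its tails at once. -/
theorem sum_two_pairs (hD : IsTwisted D c K φ)
    (hxy : x ≠ y) (hxy' : x ≠ y.rev) (hx : x ≠ x.rev) (hy : y ≠ y.rev)
    (cx : c x = 1) (φx : φ x = y) (cy : c y.rev = -1) (φy : φ y.rev = x.rev)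
    (c0 : ∀ z, z ≠ x → z ≠ y.rev → c z = 0) (Kx : K x.rev = q) (Ky : K y = q) (w : Fin N → F) :
    D (∑ i, w i • pv F i.rev i) = (w x * q - w y) • pv F x.rev y +
      (w x.rev - q * w y.rev) • pv F y x.rev := by
  have hxy2 : x.rev ≠ y := fun h => hxy' (by rw [← h, Fin.rev_rev])
  have hxy3 : x.rev ≠ y.rev := fun h => hxy (Fin.rev_injective h)
  have key : ∀ i, w i • D (pv F i.rev i) =
      (if i = x then (w x * q) • pv F x.rev y else 0) + (if i = y then -(w y) • pv F x.rev y else 0) +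
      (if i = x.rev then w x.rev • pv F y x.rev else 0) +
      (if i = y.rev then -(q * w y.rev) • pv F y x.rev else 0) := by
    intro i
    rw [hD]
    by_cases h1 : i = x
    · subst h1
      simp only [hxy, hxy', hx, if_true, if_false, c0 _ hx.symm hxy3, cx, φx, Kx]
      module
    by_cases h2 : i = y
    · subst h2
      simp only [hxy2.symm, h1, hy, if_true, if_false, cy, φy, c0 _ h1 hy]
      module
    by_cases h3 : i = x.rev
    · subst h3
      simp only [h1, h2, hxy3, if_true, if_false, Fin.rev_rev, cx, φx, c0 _ h1 hxy3]
      module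
    by_cases h4 : i = y.rev
    · subst h4
      simp only [h1, h2, h3, if_true, if_false, Fin.rev_rev, cy, φy, Ky, c0 _ hxy.symm hy]
      module
    · have h5 : i.rev ≠ x := fun h => h3 (by rw [← h, Fin.rev_rev])
      have h6 : i.rev ≠ y.rev := fun h => h2 (Fin.rev_injective h)
      simp only [h1, h2, h3, h4, if_false, c0 _ h1 h4, c0 _ h5 h6]
      module
  simp only [map_sum, map_smul, key, Finset.sum_add_distrib, Finset.sum_ite_eq', Finset.mem_univ,
    if_true]
  module

/-- The facts on a simple root whose root vector has two separate arrows `x → y`, `y' → x'`. -/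
structure TwoArrows (g c K : Fin N → F) (q : F) (φ : Fin N → Fin N) (x y : Fin N) : Prop where
  xy : x ≠ y
  xy' : x ≠ y.rev
  xx : x ≠ x.rev
  cx : c x = 1
  φx : φ x = y
  cy : c y.rev = -1
  φy : φ y.rev = x.rev
  c0 : ∀ z, z ≠ x → z ≠ y.rev → c z = 0
  Kx : K x = q⁻¹
  Kx' : K x.rev = q
  Ky : K y = q
  Ky' : K y.rev = q⁻¹
  K0 : ∀ z, z ≠ x → z ≠ y → z ≠ x.rev → z ≠ y.rev → K z = 1
  gy : g y = q * g x
  gx : g x.rev = q * g y.rev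
  lt : y < x
  lt' : y < x.rev
  order : x < x.rev ∨ x.rev < x ∧ g x.rev = g x
  block : ∀ z, z ≠ x → z ≠ y → z ≠ x.rev → z ≠ y.rev →
    ((z < x ∧ z < y) ∨ (x < z ∧ y < z)) ∧ ((z < x.rev ∧ z < y.rev) ∨ (x.rev < z ∧ y.rev < z))

theorem TwoArrows.yy (h : TwoArrows g c K q φ x y) : y ≠ y.rev := by
  have h1 := h.lt
  have h2 := h.lt'
  rw [← Fin.rev_lt_rev, Fin.rev_rev] at h2
  rw [Fin.lt_def] at *
  intro h3
  rw [← h3] at h2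
  omega

/-- The relations g_y = q g_x and g_{x'} = q g_{y'} are exactly what makes both remaining
coefficients cancel. -/
theorem TwoArrows.invVec_eq_zero (h : TwoArrows g c K q φ x y) (hD : IsTwisted D c K φ) :
    D (invVec g) = 0 := by
  rw [invVec, sum_two_pairs hD h.xy h.xy' h.xx h.yy h.cx h.φx h.cy h.φy h.c0 h.Kx' h.Ky,
    h.gy, h.gx]
  module

theorem TwoArrows.tailVec_eq (h : TwoArrows g c K q φ x y) (hD : IsTwisted D c K φ) (k : Fin N) :
    D (tailVec g k) = ((if k < x then g x else 0) * q - (if k < y then q * g x else 0)) •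
      pv F x.rev y + ((if k < x.rev then q * g y.rev else 0) -
        q * (if k < y.rev then g y.rev else 0)) • pv F y x.rev := by
  rw [tailVec, sum_two_pairs hD h.xy h.xy' h.xx h.yy h.cx h.φx h.cy h.φy h.c0 h.Kx' h.Ky,
    h.gy, h.gx]

/-- The left side vanishes with the image of the invariant vector. On the right two terms meet only
for (k, l) = (x, y') and (y', x), where they cancel by the relations between the g; otherwise no
arrow produces a pair of dual indices. -/
theorem TwoArrows.contract (h : TwoArrows g c K q φ x y) (hD : IsTwisted D c K φ) (hq : q ≠ 0)
    (hg : ∀ i, g i ≠ 0) (k l : Fin N) :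
    D (contractVec g k l) = c k • contractVec g (φ k) l + (K k * c l) • contractVec g k (φ l) := by
  have hy := h.yy
  have hxy2 : x.rev ≠ y := fun e => h.xy' (by rw [← e, Fin.rev_rev])
  have hxy3 : x.rev ≠ y.rev := fun e => h.xy (Fin.rev_injective e)
  rw [contractVec, map_smul, h.invVec_eq_zero hD, smul_zero, contractVec, contractVec]
  have gx0 := hg x
  have gy0 := hg y.rev
  by_cases hk1 : k = x
  · subst hk1
    by_cases hl : l = y.rev
    · subst hl
      simp only [h.cx, h.cy, h.φx, h.φy, h.Kx, h.gy, Fin.rev_rev, if_true]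
      match_scalars
      field_simp
      ring
    by_cases hl2 : l = k
    · subst hl2
      simp only [h.cx, h.φx, hxy2.symm, h.xy', if_false]; module
    · have hl3 : y ≠ l.rev := fun e => hl (by rw [e, Fin.rev_rev])
      simp only [h.φx, h.c0 l hl2 hl, hl3, if_false]; module
  by_cases hk2 : k = y.rev
  · subst hk2
    by_cases hl : l = x
    · subst hl
      simp only [h.cx, h.cy, h.φx, h.φy, h.Ky', h.gx, if_true]
      match_scalars
      field_simp
      ring
    by_cases hl2 : l = y.rev
    · subst hl2
      have : y.rev ≠ x := hk1
      simp only [h.cy, h.φy, Fin.rev_rev, hxy2, this, if_false]; module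
    · have hl3 : x.rev ≠ l.rev := fun e => hl (Fin.rev_injective e).symm
      simp only [h.φy, h.c0 l hl hl2, hl3, if_false]; module
  rw [h.c0 k hk1 hk2]
  by_cases hl : l = x
  · subst hl
    have : k ≠ y.rev := hk2
    simp only [h.φx, this, if_false]; module
  by_cases hl : l = y.rev
  · subst hl
    simp only [h.φy, Fin.rev_rev, hk1, if_false]; module
  rw [h.c0 l (by assumption) (by assumption)]
  module

/-- By `block` no foreign index separates y from x, so the two tails differ by the term at x and,
when x' < x, by the term at x'. The latter order occurs for the last root in type D. -/
theorem TwoArrows.tailVec_y (h : TwoArrows g c K q φ x y) :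
    tailVec g y = tailVec g x + g x • pv F x.rev x +
      (if x.rev < x then g x.rev else 0) • pv F x x.rev := by
  have key : ∀ i, (if y < i then g i else 0) • pv F i.rev i =
      (if x < i then g i else 0) • pv F i.rev i + (if i = x then g x • pv F x.rev x else 0) +
      (if i = x.rev then (if x.rev < x then g x.rev else 0) • pv F x x.rev else 0) := by
    intro i
    have l1 := h.lt
    have l2 := h.lt'
    have l4 : x < y.rev := by rw [← Fin.rev_lt_rev, Fin.rev_rev]; exact l2
    have xx := h.xx
    by_cases h1 : i = x
    · subst h1; simp [xx, l1]
    by_cases h3 : i = x.rev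
    · subst h3
      rcases h.order with h4 | ⟨h4, -⟩ <;> simp [h1, l2, h4, h4.not_gt]
    by_cases h2 : i = y
    · subst h2; simp [h1, h3, l1.not_gt]
    by_cases h4 : i = y.rev
    · subst h4; simp [h1, h3, l4, l1.trans l4]
    · rcases h.block i h1 h2 h3 h4 with ⟨⟨h5, h6⟩ | ⟨h5, h6⟩, ⟨h7, h8⟩ | ⟨h7, h8⟩⟩ <;>
        simp [h1, h3, h5, h6, h5.not_gt, h6.not_gt]
  simp only [tailVec, key, Finset.sum_add_distrib, Finset.sum_ite_eq', Finset.mem_univ, if_true]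

/-- The companion of `TwoArrows.tailVec_y` for the arrow y' → x'. -/
theorem TwoArrows.tailVec_x' (h : TwoArrows g c K q φ x y) :
    tailVec g x.rev = tailVec g y.rev + g y.rev • pv F y y.rev +
      (if x.rev < x then g x else 0) • pv F x.rev x := by
  have key : ∀ i, (if x.rev < i then g i else 0) • pv F i.rev i =
      (if y.rev < i then g i else 0) • pv F i.rev i +
      (if i = y.rev then g y.rev • pv F y y.rev else 0) +
      (if i = x then (if x.rev < x then g x else 0) • pv F x.rev x else 0) := by
    intro i
    have l1 := h.lt
    have l2 := h.lt'
    have l3 : x.rev < y.rev := Fin.rev_lt_rev.2 l1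
    have l4 : x < y.rev := by rw [← Fin.rev_lt_rev, Fin.rev_rev]; exact l2
    have xx := h.xx
    by_cases h1 : i = x
    · subst h1
      rcases h.order with h4 | ⟨h4, -⟩ <;> simp [h.xy', h4, h4.not_gt, l4.not_gt]
    by_cases h3 : i = y.rev
    · subst h3; simp [h1, l3]
    by_cases h2 : i = y
    · subst h2; simp [h1, h3, l2.not_gt, (l1.trans l4).not_gt]
    by_cases h4 : i = x.rev
    · subst h4; simp [h1, h3, l3.not_gt]
    · rcases h.block i h1 h2 h4 h3 with ⟨⟨h5, h6⟩ | ⟨h5, h6⟩, ⟨h7, h8⟩ | ⟨h7, h8⟩⟩ <;>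
        simp [h1, h3, h7, h8, h7.not_gt, h8.not_gt]
  rw [tailVec, Finset.sum_congr rfl fun i _ => key i]
  simp only [tailVec, Finset.sum_add_distrib, Finset.sum_ite_eq', Finset.mem_univ, if_true]

-- If k and l are both among x, y, x', y', the identity is a comparison of coefficients in which all
-- tails are reduced to those at x and y'. If one index is foreign, it lies on the same side of both
-- ends of each arrow and has K = 1, so that source and target are braided past it by the same rule.
set_option maxHeartbeats 1600000 in
theorem TwoArrows.braid (h : TwoArrows g c K q φ x y) (hD : IsTwisted D c K φ) (hq : q ≠ 0)
    (hg : ∀ i, g i ≠ 0) (k l : Fin N) :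
    D (braidVec g q k l) = c k • braidVec g q (φ k) l + (K k * c l) • braidVec g q k (φ l) := by
  have xy := h.xy
  have yx := h.xy.symm
  have xy' := h.xy'
  have y'x := h.xy'.symm
  have xx := h.xx
  have x'x := h.xx.symm
  have yy := h.yy
  have y'y := h.yy.symm
  have x'y : x.rev ≠ y := fun e => xy' (by rw [← e, Fin.rev_rev])
  have yx' := x'y.symm
  have x'y' : x.rev ≠ y.rev := fun e => h.xy (Fin.rev_injective e)
  have y'x' := x'y'.symm
  have cy0 := h.c0 y yx yy
  have cx0 := h.c0 x.rev x'x x'y'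
  have l1 := h.lt
  have l2 := h.lt'
  have l3 : x.rev < y.rev := Fin.rev_lt_rev.2 l1
  have l4 : x < y.rev := by rw [← Fin.rev_lt_rev, Fin.rev_rev]; exact l2
  have l5 := l1.trans l4
  have n1 := l1.not_gt
  have n2 := l2.not_gt
  have n3 := l3.not_gt
  have n4 := l4.not_gt
  have n5 := l5.not_gt
  have hT := h.tailVec_eq hD
  have gx0 := hg x
  have gy0 := hg y.rev
  have hty := h.tailVec_y
  have htx := h.tailVec_x'
  have hcx := h.cx
  have hcy := h.cy
  have hφx := h.φx
  have hφy := h.φy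
  have hgy := h.gy
  have hgx := h.gx
  have hKx := h.Kx
  have hKx' := h.Kx'
  have hKy := h.Ky
  have hKy' := h.Ky'
  by_cases hk1 : k = x ∨ k = y ∨ k = x.rev ∨ k = y.rev
  · by_cases hl1 : l = x ∨ l = y ∨ l = x.rev ∨ l = y.rev
    -- The relative order of x and x' decides which of these vectors receive a triangular correction
    -- and which terms the tails contain.
    · rcases h.order with o1 | ⟨o1, o2⟩
      · have o3 := o1.not_gt
        rcases hk1 with rfl | rfl | rfl | rfl <;> rcases hl1 with rfl | rfl | rfl | rfl
        all_goals
          simp only [braidVec, flipCoef, map_sub, map_add, map_smul, hT, hD _ _,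
            xy, yx, xy', y'x, xx, x'x, yy, y'y, x'y, yx', x'y', y'x', cy0, cx0, l1, l2, l3, l4, l5,
            n1, n2, n3, n4, n5, hty, htx, hcx, hcy, hφx, hφy, hgx, hgy, hKx, hKx', hKy, hKy', o1, o3,
            if_true, if_false, Fin.rev_rev, lt_self_iff_false]
          match_scalars <;> field_simp <;> ring
      · have o3 := o1.not_gt
        -- With g_{x'} = g_x, all four values of g are expressed through g_{y'} alone.
        have o4 : g x = q * g y.rev := by rw [← o2, hgx]
        rcases hk1 with rfl | rfl | rfl | rfl <;> rcases hl1 with rfl | rfl | rfl | rfl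
        all_goals
          simp only [braidVec, flipCoef, map_sub, map_add, map_smul, hT, hD _ _,
            xy, yx, xy', y'x, xx, x'x, yy, y'y, x'y, yx', x'y', y'x', cy0, cx0, l1, l2, l3, l4, l5,
            n1, n2, n3, n4, n5, hty, htx, hcx, hcy, hφx, hφy, hgx, hgy, hKx, hKx', hKy, hKy', o1, o3,
            o4, if_true, if_false, Fin.rev_rev, lt_self_iff_false]
          match_scalars <;> field_simp <;> ring
    · push Not at hl1
      obtain ⟨a1, a2, a3, a4⟩ := hl1
      have b1 : x ≠ l.rev := fun e => a3 (by rw [e, Fin.rev_rev])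
      have b2 : y ≠ l.rev := fun e => a4 (by rw [e, Fin.rev_rev])
      have b3 : x.rev ≠ l.rev := fun e => a1 (Fin.rev_injective e).symm
      have b4 : y.rev ≠ l.rev := fun e => a2 (Fin.rev_injective e).symm
      have hl0 := h.c0 l a1 a4
      have hK := h.K0 l a1 a2 a3 a4
      rcases h.block l a1 a2 a3 a4 with ⟨⟨m1, m2⟩ | ⟨m1, m2⟩, ⟨m3, m4⟩ | ⟨m3, m4⟩⟩ <;>
        rcases hk1 with rfl | rfl | rfl | rfl <;>
        simp only [braidVec, flipCoef, map_sub, map_add, map_smul, hD _ _, hcx, hcy, hφx, hφy,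
          cx0, cy0, hl0, hK, a1.symm, a2.symm, a3.symm, a4.symm, b1, b2, b3, b4, m1, m2, m3, m4,
          m1.not_gt, m2.not_gt, m3.not_gt, m4.not_gt, if_true, if_false] <;>
        module
  · push Not at hk1
    obtain ⟨a1, a2, a3, a4⟩ := hk1
    have hk0 := h.c0 k a1 a4
    have hK := h.K0 k a1 a2 a3 a4
    -- The tail beyond a foreign index contains both ends of an arrow or neither, so it is killed
    -- for the same reason as the full invariant vector.
    have hTk : D (tailVec g k) = 0 := by
      rw [hT]
      rcases h.block k a1 a2 a3 a4 with ⟨⟨m1, m2⟩ | ⟨m1, m2⟩, ⟨m3, m4⟩ | ⟨m3, m4⟩⟩ <;>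
        simp only [m1, m2, m3, m4, m1.not_gt, m2.not_gt, m3.not_gt, m4.not_gt, if_true, if_false] <;>
        module
    by_cases hl1 : l = x ∨ l = y ∨ l = x.rev ∨ l = y.rev
    · rcases h.block k a1 a2 a3 a4 with ⟨⟨m1, m2⟩ | ⟨m1, m2⟩, ⟨m3, m4⟩ | ⟨m3, m4⟩⟩ <;>
        rcases hl1 with rfl | rfl | rfl | rfl <;>
        simp only [braidVec, flipCoef, map_sub, map_add, map_smul, hD _ _, hcx, hcy, hφx, hφy,
          cx0, cy0, hk0, hK, a1, a2, a3, a4, m1, m2, m3, m4,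
          m1.not_gt, m2.not_gt, m3.not_gt, m4.not_gt, if_true, if_false, Fin.rev_rev] <;>
        module
    · push Not at hl1
      obtain ⟨b1, b2, b3, b4⟩ := hl1
      simp only [braidVec, map_sub, map_add, map_smul, hD _ _, hk0, h.c0 l b1 b4, hTk]
      module

end TypeI
end PairSpace

/-! ### Root vectors with a single arrow, and with a chain of two arrows through the middle index -/

section PairSpace
variable {F : Type*} [Field F] {N : ℕ}

section TypeC
variable {g c K : Fin N → F} {q : F} {φ : Fin N → Fin N} {y : Fin N}
  {D : (Fin N × Fin N → F) →ₗ[F] (Fin N × Fin N → F)}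

/-- The facts on a simple root whose root vector has the single arrow `y' → y`. -/
structure OneArrow (g c K : Fin N → F) (q : F) (φ : Fin N → Fin N) (y : Fin N) : Prop where
  cy : c y.rev = 1
  φy : φ y.rev = y
  c0 : ∀ z, z ≠ y.rev → c z = 0
  Ky : K y = q * q
  Ky' : K y.rev = q⁻¹ * q⁻¹
  K0 : ∀ z, z ≠ y → z ≠ y.rev → K z = 1
  gy : g y = -(q * q * g y.rev)
  lt : y < y.rev
  block : ∀ z, z ≠ y → z ≠ y.rev → (z < y ∧ z < y.rev) ∨ (y < z ∧ y.rev < z)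

/-- Only i = y and i = y' involve the source y' of the arrow, and both lead to v_y ⊗ v_y. -/
theorem OneArrow.map_sum_pairs (h : OneArrow g c K q φ y) (hD : IsTwisted D c K φ)
    (w : Fin N → F) :
    D (∑ i, w i • pv F i.rev i) = (w y + q * q * w y.rev) • pv F y y := by
  have hy := h.lt.ne
  have key : ∀ i, w i • D (pv F i.rev i) =
      (if i = y then w y • pv F y y else 0) +
      (if i = y.rev then (q * q * w y.rev) • pv F y y else 0) := by
    intro i
    rw [hD]
    by_cases h1 : i = y
    · subst h1
      simp only [hy, if_true, if_false, h.cy, h.φy, h.c0 _ hy]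
      module
    by_cases h2 : i = y.rev
    · subst h2
      simp only [h1, if_true, if_false, Fin.rev_rev, h.cy, h.φy, h.Ky, h.c0 _ hy]
      module
    · have h5 : i.rev ≠ y.rev := fun e => h1 (Fin.rev_injective e)
      simp only [h1, h2, if_false, h.c0 _ h2, h.c0 _ h5]
      module
  simp only [map_sum, map_smul, key, Finset.sum_add_distrib, Finset.sum_ite_eq', Finset.mem_univ,
    if_true]
  module

theorem OneArrow.tailVec_eq (h : OneArrow g c K q φ y) (hD : IsTwisted D c K φ) (k : Fin N) :
    D (tailVec g k) = ((if k < y then -(q * q * g y.rev) else 0) +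
      q * q * (if k < y.rev then g y.rev else 0)) • pv F y y := by
  rw [tailVec, h.map_sum_pairs hD, h.gy]

/-- The sign in g_y = -q² g_{y'}, which comes from ε, kills the image of the invariant vector and
makes the two terms for k = l = y' cancel. -/
theorem OneArrow.contract (h : OneArrow g c K q φ y) (hD : IsTwisted D c K φ) (hq : q ≠ 0)
    (hg : ∀ i, g i ≠ 0) (k l : Fin N) :
    D (contractVec g k l) = c k • contractVec g (φ k) l + (K k * c l) • contractVec g k (φ l) := by
  have hy := h.lt.ne
  have hI : D (invVec g) = 0 := by
    rw [invVec, h.map_sum_pairs hD, h.gy]; module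
  have g0 := hg y.rev
  rw [contractVec, map_smul, hI, smul_zero, contractVec, contractVec]
  by_cases hk : k = y.rev
  · subst hk
    by_cases hl : l = y.rev
    · subst hl
      simp only [h.cy, h.φy, h.Ky', h.gy, Fin.rev_rev, if_true]
      match_scalars
      field_simp
      ring
    · have hl2 : y ≠ l.rev := fun e => hl (by rw [e, Fin.rev_rev])
      simp only [h.φy, h.c0 l hl, hl2, if_false]; module
  · rw [h.c0 k hk]
    by_cases hl : l = y.rev
    · subst hl
      simp only [h.φy, hk, if_false]; module
    · rw [h.c0 l hl]; module

/-- The pattern of `TwoArrows.braid` with the two indices y, y' in place of four; they are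
neighbours as seen from every other index, so their tails differ by one term. -/
theorem OneArrow.braid (h : OneArrow g c K q φ y) (hD : IsTwisted D c K φ) (hq : q ≠ 0)
    (hg : ∀ i, g i ≠ 0) (k l : Fin N) :
    D (braidVec g q k l) = c k • braidVec g q (φ k) l + (K k * c l) • braidVec g q k (φ l) := by
  have yy := h.lt.ne
  have y'y := h.lt.ne'
  have l1 := h.lt
  have n1 := l1.not_gt
  have hT := h.tailVec_eq hD
  have gy0 := hg y.rev
  have hcy := h.cy
  have hφy := h.φy
  have hgy := h.gy
  have hKy := h.Ky
  have hKy' := h.Ky'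
  have cy0 := h.c0 y yy
  have hty : tailVec g y = tailVec g y.rev + g y.rev • pv F y y.rev := by
    have key : ∀ i, (if y < i then g i else 0) • pv F i.rev i =
        (if y.rev < i then g i else 0) • pv F i.rev i +
        (if i = y.rev then g y.rev • pv F y y.rev else 0) := by
      intro i
      by_cases h1 : i = y.rev
      · subst h1; simp [l1]
      by_cases h2 : i = y
      · subst h2; simp [yy, n1]
      · rcases h.block i h2 h1 with ⟨m1, m2⟩ | ⟨m1, m2⟩ <;>
          simp [h1, m1, m2, m1.not_gt, m2.not_gt]
    rw [tailVec, Finset.sum_congr rfl fun i _ => key i]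
    simp only [tailVec, Finset.sum_add_distrib, Finset.sum_ite_eq', Finset.mem_univ, if_true]
  by_cases hk1 : k = y ∨ k = y.rev
  · by_cases hl1 : l = y ∨ l = y.rev
    · rcases hk1 with rfl | rfl <;> rcases hl1 with rfl | rfl
      all_goals
        simp only [braidVec, flipCoef, map_sub, map_add, map_smul, hT, hD _ _, yy, y'y, cy0, l1, n1,
          hty, hcy, hφy, hgy, hKy, hKy', if_true, if_false, Fin.rev_rev, lt_self_iff_false]
        match_scalars <;> field_simp <;> ring
    · push Not at hl1
      obtain ⟨a1, a2⟩ := hl1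
      have b1 : y ≠ l.rev := fun e => a2 (by rw [e, Fin.rev_rev])
      have b2 : y.rev ≠ l.rev := fun e => a1 (Fin.rev_injective e).symm
      have hl0 := h.c0 l a2
      have hK := h.K0 l a1 a2
      rcases h.block l a1 a2 with ⟨m1, m2⟩ | ⟨m1, m2⟩ <;> rcases hk1 with rfl | rfl <;>
        simp only [braidVec, flipCoef, map_sub, map_add, map_smul, hD _ _, hcy, hφy, cy0, hl0, hK,
          a1.symm, a2.symm, b1, b2, m1, m2, m1.not_gt, m2.not_gt, if_true, if_false] <;>
        module
  · push Not at hk1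
    obtain ⟨a1, a2⟩ := hk1
    have hk0 := h.c0 k a2
    have hK := h.K0 k a1 a2
    have hTk : D (tailVec g k) = 0 := by
      rw [hT]
      rcases h.block k a1 a2 with ⟨m1, m2⟩ | ⟨m1, m2⟩ <;>
        simp only [m1, m2, m1.not_gt, m2.not_gt, if_true, if_false] <;> module
    by_cases hl1 : l = y ∨ l = y.rev
    · rcases h.block k a1 a2 with ⟨m1, m2⟩ | ⟨m1, m2⟩ <;> rcases hl1 with rfl | rfl <;>
        simp only [braidVec, flipCoef, map_sub, map_add, map_smul, hD _ _, hcy, hφy, cy0, hk0, hK,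
          a1, a2, m1, m2, m1.not_gt, m2.not_gt, if_true, if_false, Fin.rev_rev] <;>
        module
    · push Not at hl1
      simp only [braidVec, map_sub, map_add, map_smul, hD _ _, hk0, h.c0 l hl1.2, hTk]
      module

end TypeC

section TypeB
variable {g c K : Fin N → F} {s : F} {φ : Fin N → Fin N} {y m : Fin N}
  {D : (Fin N × Fin N → F) →ₗ[F] (Fin N × Fin N → F)}

/-- The facts on a simple root whose root vector has the arrows `y' → m → y` with `m = m'`. -/
structure MiddleArrows (g c K : Fin N → F) (s : F) (φ : Fin N → Fin N) (y m : Fin N) : Prop where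
  mm : m.rev = m
  cm : c m = 1
  φm : φ m = y
  cy : c y.rev = -s⁻¹
  φy : φ y.rev = m
  c0 : ∀ z, z ≠ m → z ≠ y.rev → c z = 0
  Ky : K y = s * s
  Km : K m = 1
  Ky' : K y.rev = s⁻¹ * s⁻¹
  K0 : ∀ z, z ≠ y → z ≠ m → z ≠ y.rev → K z = 1
  gy : g y = s
  gm : g m = 1
  gy' : g y.rev = s⁻¹
  lt : y < m
  block : ∀ z, z ≠ y → z ≠ m → z ≠ y.rev →
    (z < y ∧ z < m ∧ z < y.rev) ∨ (y < z ∧ m < z ∧ y.rev < z)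

theorem MiddleArrows.lt' (h : MiddleArrows g c K s φ y m) : m < y.rev := by
  rw [← h.mm]; exact Fin.rev_lt_rev.2 h.lt

/-- Only i = y, m, y' contribute. The self-dual index m gives v_m ⊗ v_m, whose image has a component
on each of the two lines. -/
theorem MiddleArrows.map_sum_pairs (h : MiddleArrows g c K s φ y m) (hD : IsTwisted D c K φ)
    (hs : s ≠ 0) (w : Fin N → F) :
    D (∑ i, w i • pv F i.rev i) = (w m - s⁻¹ * w y) • pv F m y +
      (w m - s * w y.rev) • pv F y m := by
  have l1 := h.lt
  have l2 := h.lt'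
  have y'm := l2.ne'
  have ym := l1.ne
  have yy := (l1.trans l2).ne
  have cy0 := h.c0 y ym yy
  have key : ∀ i, w i • D (pv F i.rev i) =
      (if i = y then -(s⁻¹ * w y) • pv F m y else 0) +
      (if i = m then w m • pv F m y + w m • pv F y m else 0) +
      (if i = y.rev then -(s * w y.rev) • pv F y m else 0) := by
    intro i
    rw [hD]
    by_cases h1 : i = y
    · subst h1
      simp only [yy, ym, if_true, if_false, h.cy, h.φy, cy0]
      module
    by_cases h3 : i = m
    · subst h3
      simp only [h1, l2.ne, if_true, if_false, h.mm, h.φm, h.cm, h.Km]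
      module
    by_cases h2 : i = y.rev
    · subst h2
      simp only [h1, h3, if_true, if_false, Fin.rev_rev, h.cy, h.φy, h.Ky, cy0]
      match_scalars <;> field_simp <;> ring
    · have h5 : i.rev ≠ y.rev := fun e => h1 (Fin.rev_injective e)
      have h6 : i.rev ≠ m := fun e => h3 (by rw [← h.mm, ← e, Fin.rev_rev])
      simp only [h1, h2, h3, if_false, h.c0 _ h3 h2, h.c0 _ h6 h5]
      module
  simp only [map_sum, map_smul, key, Finset.sum_add_distrib, Finset.sum_ite_eq', Finset.mem_univ,
    if_true]
  module

/-- The values g = s, 1, s⁻¹ along the chain y, m, y' kill the image of the invariant vector; on the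
right the nontrivial cancellations are at (m, y') and (y', m). -/
theorem MiddleArrows.contract (h : MiddleArrows g c K s φ y m) (hD : IsTwisted D c K φ)
    (hs : s ≠ 0) (k l : Fin N) :
    D (contractVec g k l) = c k • contractVec g (φ k) l + (K k * c l) • contractVec g k (φ l) := by
  have l1 := h.lt
  have l2 := h.lt'
  have y'm := l2.ne'
  have ym := l1.ne
  have yy := (l1.trans l2).ne
  have hI : D (invVec g) = 0 := by
    rw [invVec, h.map_sum_pairs hD hs, h.gy, h.gm, h.gy']
    match_scalars <;> field_simp <;> ring
  rw [contractVec, map_smul, hI, smul_zero, contractVec, contractVec]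
  by_cases hk : k = m
  · subst hk
    by_cases hl : l = k
    · subst hl
      simp only [h.φm, h.mm, ym, l2.ne, if_false]; module
    by_cases hl : l = y.rev
    · subst hl
      simp only [h.cm, h.cy, h.φy, h.φm, h.Km, h.gy, h.gm, h.mm, Fin.rev_rev, if_true]
      match_scalars <;> field_simp <;> ring
    · have hl2 : y ≠ l.rev := fun e => hl (by rw [e, Fin.rev_rev])
      rw [h.c0 l (by assumption) hl]
      simp only [h.φm, hl2, if_false]; module
  by_cases hk2 : k = y.rev
  · subst hk2
    by_cases hl : l = m
    · subst hl
      simp only [h.cm, h.cy, h.φy, h.φm, h.Ky', h.gy', h.gm, h.mm, if_true]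
      match_scalars <;> field_simp <;> ring
    have hl2 : m ≠ l.rev := fun e => hl (by rw [← h.mm, e, Fin.rev_rev])
    by_cases hl3 : l = y.rev
    · subst hl3
      simp only [h.φy, h.mm, y'm, hl2, if_false]; module
    · rw [h.c0 l hl hl3]
      simp only [h.φy, hl2, if_false]; module
  · rw [h.c0 k hk hk2]
    by_cases hl : l = m
    · subst hl
      simp only [h.φm, hk2, if_false]; module
    by_cases hl : l = y.rev
    · subst hl
      simp only [h.φy, h.mm, hk, if_false]; module
    · rw [h.c0 l (by assumption) hl]; module

-- The pattern of `TwoArrows.braid` for the three indices y < m < y'; here q is written as s * s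
-- because the arrows involve q^{1/2}. All tails are reduced to the one at y'.
set_option maxHeartbeats 800000 in
theorem MiddleArrows.braid (h : MiddleArrows g c K s φ y m) (hD : IsTwisted D c K φ)
    (hs : s ≠ 0) (k l : Fin N) :
    D (braidVec g (s * s) k l) =
      c k • braidVec g (s * s) (φ k) l + (K k * c l) • braidVec g (s * s) k (φ l) := by
  have l1 := h.lt
  have l2 := h.lt'
  have l3 := l1.trans l2
  have y'm := l2.ne'
  have my' := l2.ne
  have ym := l1.ne
  have my := l1.ne'
  have yy := l3.ne
  have y'y := l3.ne'
  have n1 := l1.not_gt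
  have n2 := l2.not_gt
  have n3 := l3.not_gt
  have hT : ∀ k, D (tailVec g k) = ((if k < m then 1 else 0) - s⁻¹ * (if k < y then s else 0)) •
      pv F m y + ((if k < m then 1 else 0) - s * (if k < y.rev then s⁻¹ else 0)) • pv F y m := by
    intro k
    rw [tailVec, h.map_sum_pairs hD hs, h.gy, h.gm, h.gy']
  have hmm := h.mm
  have hcm := h.cm
  have hφm := h.φm
  have hcy := h.cy
  have hφy := h.φy
  have hgy := h.gy
  have hgm := h.gm
  have hgy' := h.gy'
  have hKy := h.Ky
  have hKm := h.Km
  have hKy' := h.Ky'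
  have cy0 := h.c0 y ym yy
  have htm : tailVec g m = tailVec g y.rev + s⁻¹ • pv F y y.rev := by
    have key : ∀ i, (if m < i then g i else 0) • pv F i.rev i =
        (if y.rev < i then g i else 0) • pv F i.rev i +
        (if i = y.rev then s⁻¹ • pv F y y.rev else 0) := by
      intro i
      by_cases h1 : i = y.rev
      · subst h1; simp [l2, hgy']
      by_cases h2 : i = y
      · subst h2; simp [yy, n1, n3]
      by_cases h3 : i = m
      · subst h3; simp [my', n2]
      · rcases h.block i h2 h3 h1 with ⟨m1, m2, m3⟩ | ⟨m1, m2, m3⟩ <;>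
          simp [h1, m2, m3, m2.not_gt, m3.not_gt]
    rw [tailVec, Finset.sum_congr rfl fun i _ => key i]
    simp only [tailVec, Finset.sum_add_distrib, Finset.sum_ite_eq', Finset.mem_univ, if_true]
  have hty : tailVec g y = tailVec g y.rev + s⁻¹ • pv F y y.rev + pv F m m := by
    have key : ∀ i, (if y < i then g i else 0) • pv F i.rev i =
        (if m < i then g i else 0) • pv F i.rev i + (if i = m then pv F m m else 0) := by
      intro i
      by_cases h1 : i = y.rev
      · subst h1; simp [l2, l3, y'm]
      by_cases h2 : i = y
      · subst h2; simp [ym, n1]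
      by_cases h3 : i = m
      · subst h3; simp [l1, hmm, hgm]
      · rcases h.block i h2 h3 h1 with ⟨m1, m2, m3⟩ | ⟨m1, m2, m3⟩ <;>
          simp [h3, m1, m2, m1.not_gt, m2.not_gt]
    rw [← htm, tailVec, Finset.sum_congr rfl fun i _ => key i]
    simp only [tailVec, Finset.sum_add_distrib, Finset.sum_ite_eq', Finset.mem_univ, if_true]
  by_cases hk1 : k = y ∨ k = m ∨ k = y.rev
  · by_cases hl1 : l = y ∨ l = m ∨ l = y.rev
    · rcases hk1 with rfl | rfl | rfl <;> rcases hl1 with rfl | rfl | rfl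
      all_goals
        simp only [braidVec, flipCoef, map_sub, map_add, map_smul, hT, hD _ _, yy, y'y, ym, my, y'm,
          my', cy0, l1, l2, l3, n1, n2, n3, hty, htm, hcy, hφy, hgy, hKy, hKy', hcm, hφm, hgm, hKm,
          hgy', hmm, if_true, if_false, Fin.rev_rev, lt_self_iff_false]
        match_scalars <;> field_simp <;> ring
    · push Not at hl1
      obtain ⟨a1, a2, a3⟩ := hl1
      have b1 : y ≠ l.rev := fun e => a3 (by rw [e, Fin.rev_rev])
      have b2 : y.rev ≠ l.rev := fun e => a1 (Fin.rev_injective e).symm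
      have b3 : m ≠ l.rev := fun e => a2 (by rw [← hmm, e, Fin.rev_rev])
      have hl0 := h.c0 l a2 a3
      have hK := h.K0 l a1 a2 a3
      rcases h.block l a1 a2 a3 with ⟨m1, m2, m3⟩ | ⟨m1, m2, m3⟩ <;>
        rcases hk1 with rfl | rfl | rfl <;>
        simp only [braidVec, flipCoef, map_sub, map_add, map_smul, hD _ _, hcy, hφy, hcm, hφm, cy0,
          hl0, hK, a1.symm, a2.symm, a3.symm, b1, b2, b3, m1, m2, m3, m1.not_gt, m2.not_gt,
          m3.not_gt, if_true, if_false] <;>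
        module
  · push Not at hk1
    obtain ⟨a1, a2, a3⟩ := hk1
    have hk0 := h.c0 k a2 a3
    have hK := h.K0 k a1 a2 a3
    have hTk : D (tailVec g k) = 0 := by
      rw [hT]
      rcases h.block k a1 a2 a3 with ⟨m1, m2, m3⟩ | ⟨m1, m2, m3⟩ <;>
        simp only [m1, m2, m3, m1.not_gt, m2.not_gt, m3.not_gt, if_true, if_false] <;>
        match_scalars <;> field_simp <;> ring
    by_cases hl1 : l = y ∨ l = m ∨ l = y.rev
    · rcases h.block k a1 a2 a3 with ⟨m1, m2, m3⟩ | ⟨m1, m2, m3⟩ <;>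
        rcases hl1 with rfl | rfl | rfl <;>
        simp only [braidVec, flipCoef, map_sub, map_add, map_smul, hD _ _, hcy, hφy, hcm, hφm, cy0,
          hk0, hK, a1, a2, a3, m1, m2, m3, m1.not_gt, m2.not_gt, m3.not_gt, if_true, if_false,
          Fin.rev_rev, hmm] <;>
        module
    · push Not at hl1
      simp only [braidVec, map_sub, map_add, map_smul, hD _ _, hk0, h.c0 l hl1.2.1 hl1.2.2, hTk]
      module

end TypeB
end PairSpace

/-! ### The raising operators of the natural representation as arrows -/

section NaturalArrows
variable {X : Ty} {n : ℕ}

/-- The matrix that sends `v_k` to `c_k v_{φ(k)}`. -/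
def arrowMat {F : Type*} [Zero F] {N : ℕ} (c : Fin N → F) (φ : Fin N → Fin N) :
    Matrix (Fin N) (Fin N) F := Matrix.of fun a b => if a = φ b then c b else 0

section GeneralField
variable (κ : Type*) [Field κ]

theorem eps_mul_self (k : Fin (X.dimV n)) : eps X n k * eps X n k = 1 := by
  cases X <;> simp only [eps] <;> (try split_ifs) <;> rfl

theorem eps_cast_mul_self (k : Fin (X.dimV n)) : ((eps X n k : ℤ) : κ) * (eps X n k : ℤ) = 1 := by
  exact_mod_cast congrArg (Int.cast (R := κ)) (eps_mul_self k)

variable [Algebra LA κ]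

/-- The scalar `q^{ρ_k} ε_k`. -/
noncomputable def gc (k : Fin (X.dimV n)) : κ :=
  ((vU κ ^ rhoV X n k : κˣ) : κ) * (eps X n k : ℤ)

theorem gc_ne_zero (k : Fin (X.dimV n)) : gc κ k ≠ 0 :=
  mul_ne_zero (Units.ne_zero _) (left_ne_zero_of_mul_eq_one (eps_cast_mul_self κ k))

/-- The signs are their own inverses, so the coefficient is a quotient g_b / g_k. This separation of
variables lets contraction and tail be written through one fixed vector. -/
theorem contractCoef_eq (k b : Fin (X.dimV n)) : contractCoef κ k b = (gc κ k)⁻¹ * gc κ b := by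
  have h : ((eps X n k : ℤ) : κ)⁻¹ = (eps X n k : ℤ) :=
    inv_eq_of_mul_eq_one_left (eps_cast_mul_self κ k)
  rw [contractCoef, gc, gc, mul_inv, h, Units.val_zpow_eq_zpow_val, Units.val_zpow_eq_zpow_val,
    Units.val_zpow_eq_zpow_val, zpow_sub₀ (Units.ne_zero _)]
  push_cast
  ring

/-- The six cases in the definition of the braiding merge into one formula: a flip, a term for k <
l, and a tail for k = l'. -/
theorem imageR_eq (k l : Fin (X.dimV n)) :
    imageR κ k l = braidVec (gc κ) (qU X κ : κ) k l := by
  have ht : ∑ i ∈ Finset.Ioi k, contractCoef κ k i • pairVec κ i.rev i =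
      (gc κ k)⁻¹ • tailVec (gc κ) k := by
    rw [tailVec, Finset.smul_sum, ← Finset.sum_filter_add_sum_filter_not Finset.univ (k < ·)]
    have h2 : ∑ i with ¬ k < i, (gc κ k)⁻¹ • (if k < i then gc κ i else 0) • pv κ i.rev i = 0 :=
      Finset.sum_eq_zero fun i hi => by simp [(Finset.mem_filter.1 hi).2]
    rw [h2, add_zero]
    refine Finset.sum_congr (by ext; simp) fun i hi => ?_
    rw [if_pos (Finset.mem_filter.1 hi).2, contractCoef_eq, smul_smul]
    rfl
  have hp : ∀ a b : Fin (X.dimV n), pairVec κ a b = pv κ a b := fun _ _ => rfl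
  simp only [imageR, ht]
  simp only [braidVec, flipCoef, hp]
  generalize tailVec (gc κ) k = t
  generalize (qU X κ : κ) = q
  by_cases h1 : k = l.rev
  · by_cases h2 : k = l
    · subst h2
      simp only [← h1, if_true, lt_self_iff_false, if_false]; module
    · by_cases h3 : l < k
      · have h4 : ¬ k < l := h3.not_gt
        simp only [← h1, h2, h3, h4, if_true, if_false]; module
      · have h4 : k < l := lt_of_le_of_ne (not_lt.1 h3) h2
        simp only [← h1, h2, h3, h4, if_true, if_false]; module
  · by_cases h2 : k = l
    · subst h2
      simp only [h1, if_true, lt_self_iff_false, if_false]; module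
    · by_cases h3 : l < k
      · have h4 : ¬ k < l := h3.not_gt
        simp only [h1, h2, h3, h4, if_true, if_false]; module
      · have h4 : k < l := lt_of_le_of_ne (not_lt.1 h3) h2
        simp only [h1, h2, h3, h4, if_true, if_false]; module

theorem imageE_eq (k l : Fin (X.dimV n)) : imageE κ k l = contractVec (gc κ) k l := by
  rw [imageE, contractVec]
  split_ifs with h
  -- The two sums run over dual indices, hence the substitution i ↦ i'.
  · rw [invVec, Finset.smul_sum, ← Equiv.sum_comp Fin.revPerm]
    refine Finset.sum_congr rfl fun i _ => ?_
    simp only [Fin.revPerm_apply, Fin.rev_rev]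
    rw [contractCoef_eq, smul_smul]
    rfl
  · rw [zero_smul]

theorem gc_shift {k l : Fin (X.dimV n)} (z : ℤ) (h : rhoV X n k = z + rhoV X n l)
    (h2 : eps X n k = eps X n l) : gc κ k = (vU κ : κ) ^ z * gc κ l := by
  rw [gc, gc, h, h2, zpow_add, Units.val_mul, Units.val_zpow_eq_zpow_val, mul_assoc]

end GeneralField

theorem vU_QV : (vU QV : QV) = v := rfl

theorem qU_QV : (qU X QV : QV) = v ^ qExp X := by
  rw [qU, Units.val_pow_eq_pow_val, vU_QV]

theorem qU_zpow (z : ℤ) : (qU X QV : QV) ^ z = v ^ (qExp X * z : ℤ) := by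
  rw [qU_QV, zpow_mul, zpow_natCast]

/-- The eigenvalues of `k_i` on the natural representation. -/
noncomputable def kEig (i : Fin n) (a : Fin (X.dimV n)) : QV :=
  v ^ (qExp X * (simpleRoot X n i ⬝ᵥ wt X a) : ℤ)

theorem kEig_eq {i : Fin n} {a : Fin (X.dimV n)} {z : ℤ}
    (h : (simpleRoot X n i ⬝ᵥ wt X a) = z) : kEig i a = (qU X QV : QV) ^ z := by
  rw [qU_zpow, kEig, h]

/-- Braiding and contraction are equivariant for the root vector given by `c`, `K`, `φ`. -/
def Equivariant {F : Type*} [Field F] {N : ℕ} (g : Fin N → F) (q : F) (c K : Fin N → F)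
    (φ : Fin N → Fin N) : Prop :=
  ∀ D, IsTwisted D c K φ → ∀ k l : Fin N,
    (D (braidVec g q k l) = c k • braidVec g q (φ k) l + (K k * c l) • braidVec g q k (φ l)) ∧
    D (contractVec g k l) = c k • contractVec g (φ k) l + (K k * c l) • contractVec g k (φ l)

/-- For i < n the arrows are i + 1 → i and i' → (i + 1)', with x < x', in all three types. -/
theorem exists_arrows_lt (i : Fin n) (h : i.val + 1 < n) : ∃ c φ,
    natGen X (.e i) = arrowMat c φ ∧ Equivariant (gc QV) (qU X QV : QV) c (kEig i) φ := by
  have hN := two_mul_le_dimV X n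
  obtain ⟨N, hNN⟩ : ∃ N, X.dimV n = N := ⟨_, rfl⟩
  obtain ⟨x, hx⟩ : ∃ x : Fin (X.dimV n), x.val = i.val + 1 := ⟨⟨i.val + 1, by omega⟩, rfl⟩
  obtain ⟨y, hy⟩ : ∃ y : Fin (X.dimV n), y.val = i.val := ⟨⟨i.val, by omega⟩, rfl⟩
  let c : Fin (X.dimV n) → QV := fun z => if z = x then 1 else if z = y.rev then -1 else 0
  let φ : Fin (X.dimV n) → Fin (X.dimV n) := fun z => if z = x then y else x.rev
  have hdot : ∀ b, simpleRoot X n i ⬝ᵥ wt X b = if b.val = i.val ∨ b.val + i.val + 2 = N then 1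
      else if b.val = i.val + 1 ∨ b.val + i.val + 1 = N then -1 else 0 := by
    intro b
    rw [simpleRoot_dot, dif_pos h]
    simp only [wt]
    split_ifs <;> omega
  have hxy' : x ≠ y.rev := by
    simp only [Fin.ext_iff, Fin.val_rev, ne_eq]; omega
  -- Between neighbouring indices within one half of the basis ρ drops by exactly 1 and ε is
  -- constant; the excluded steps across the middle are the irregular ones.
  have hr : ∀ a b : Fin (X.dimV n), a.val + 1 = b.val → b.val < n ∨ X.dimV n ≤ a.val + n →
      gc QV a = (qU X QV : QV) * gc QV b := by
    intro a b hab hb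
    have := a.2
    have := b.2
    rw [qU_QV, ← zpow_natCast, ← vU_QV]
    apply gc_shift
    · cases X <;> simp only [rhoV, qExp, Ty.dimV] at * <;> split_ifs <;> omega
    · cases X <;> simp only [eps, Ty.dimV] at * <;> split_ifs <;> omega
  have H : TwoArrows (gc QV) c (kEig i) (qU X QV : QV) φ x y := by
    constructor
    case xy' => exact hxy'
    case cx => exact if_pos rfl
    case φx => exact if_pos rfl
    case cy => exact (if_neg hxy'.symm).trans (if_pos rfl)
    case φy => exact if_neg hxy'.symm
    case c0 => exact fun z h1 h2 => (if_neg h1).trans (if_neg h2)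
    case Kx =>
      rw [kEig_eq (z := -1), zpow_neg_one]
      simp only [hdot]; split_ifs <;> omega
    case Ky' =>
      rw [kEig_eq (z := -1), zpow_neg_one]
      simp only [hdot, Fin.val_rev]; split_ifs <;> omega
    case Kx' =>
      rw [kEig_eq (z := 1), zpow_one]
      simp only [hdot, Fin.val_rev]; split_ifs <;> omega
    case Ky =>
      rw [kEig_eq (z := 1), zpow_one]
      simp only [hdot]; split_ifs <;> omega
    case K0 =>
      intro z h1 h2 h3 h4
      rw [kEig_eq (z := 0), zpow_zero]
      simp only [Fin.ext_iff, Fin.val_rev, ne_eq] at h1 h2 h3 h4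
      simp only [hdot]; split_ifs <;> omega
    case gy => exact hr _ _ (by omega) (by omega)
    case gx =>
      exact hr _ _ (by simp only [Fin.val_rev]; omega) (by simp only [Fin.val_rev]; omega)
    case block =>
      intro z h1 h2 h3 h4
      simp only [Fin.ext_iff, Fin.val_rev, ne_eq] at h1 h2 h3 h4
      have := z.2
      simp only [Fin.lt_def, Fin.val_rev]
      omega
    all_goals simp only [Fin.ext_iff, Fin.lt_def, Fin.val_rev, ne_eq]; omega
  refine ⟨c, φ, ?_, fun D hD k l => ⟨H.braid hD (Units.ne_zero _) (gc_ne_zero _) k l,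
    H.contract hD (Units.ne_zero _) (gc_ne_zero _) k l⟩⟩
  ext a b
  simp only [natGen, h, if_true, arrowMat, Matrix.add_apply, matUnit, Matrix.of_apply, c, φ, hx, hy,
    Fin.ext_iff, Fin.val_rev, apply_ite Fin.val]
  split_ifs <;> first | omega | simp

/-- The last root of type D has the arrows n' → n - 1 and (n - 1)' → n. Here x = n' comes after x' =
n, and g_{x'} = g_x because ρ vanishes at both. -/
theorem exists_arrows_D (hn : 2 ≤ n) (i : Fin n) (h : ¬ i.val + 1 < n) : ∃ c φ,
    natGen .D (.e i) = arrowMat c φ ∧ Equivariant (gc QV) (qU .D QV : QV) c (kEig i) φ := by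
  have hi := i.2
  have hN : Ty.D.dimV n = 2 * n := rfl
  obtain ⟨x, hx⟩ : ∃ x : Fin (Ty.D.dimV n), x.val = n := ⟨⟨n, by omega⟩, rfl⟩
  obtain ⟨y, hy⟩ : ∃ y : Fin (Ty.D.dimV n), y.val + 2 = n := ⟨⟨n - 2, by omega⟩, by simp; omega⟩
  let c : Fin (Ty.D.dimV n) → QV := fun z => if z = x then 1 else if z = y.rev then -1 else 0
  let φ : Fin (Ty.D.dimV n) → Fin (Ty.D.dimV n) := fun z => if z = x then y else x.rev
  have hdot : ∀ b, simpleRoot .D n i ⬝ᵥ wt .D b = if b.val + 2 = n ∨ b.val + 1 = n then 1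
      else if b.val = n ∨ b.val = n + 1 then -1 else 0 := by
    intro b
    rw [simpleRoot_dot, dif_neg h]
    simp only [wt, hn, dif_pos]
    split_ifs <;> omega
  have hxy' : x ≠ y.rev := by
    simp only [Fin.ext_iff, Fin.val_rev, ne_eq]; omega
  have hr : ∀ (a b : Fin (Ty.D.dimV n)) (z : ℕ), rhoV .D n a = z + rhoV .D n b →
      gc QV a = (qU .D QV : QV) ^ z * gc QV b := by
    intro a b z hab
    rw [qU_QV, ← vU_QV, ← pow_mul, ← zpow_natCast]
    exact gc_shift _ _ (by rw [hab, qExp]; push_cast; ring) rfl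
  have H : TwoArrows (gc QV) c (kEig i) (qU .D QV : QV) φ x y := by
    constructor
    case xy' => exact hxy'
    case cx => exact if_pos rfl
    case φx => exact if_pos rfl
    case cy => exact (if_neg hxy'.symm).trans (if_pos rfl)
    case φy => exact if_neg hxy'.symm
    case c0 => exact fun z h1 h2 => (if_neg h1).trans (if_neg h2)
    case Kx =>
      rw [kEig_eq (z := -1), zpow_neg_one]
      simp only [hdot]; split_ifs <;> omega
    case Ky' =>
      rw [kEig_eq (z := -1), zpow_neg_one]
      simp only [hdot, Fin.val_rev]; split_ifs <;> omega
    case Kx' =>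
      rw [kEig_eq (z := 1), zpow_one]
      simp only [hdot, Fin.val_rev]; split_ifs <;> omega
    case Ky =>
      rw [kEig_eq (z := 1), zpow_one]
      simp only [hdot]; split_ifs <;> omega
    case K0 =>
      intro z h1 h2 h3 h4
      rw [kEig_eq (z := 0), zpow_zero]
      simp only [Fin.ext_iff, Fin.val_rev, ne_eq] at h1 h2 h3 h4
      simp only [hdot]; split_ifs <;> omega
    case gy =>
      rw [hr y x 1 (by simp only [rhoV]; split_ifs <;> omega), pow_one]
    case gx =>
      rw [hr x.rev y.rev 1 (by simp only [rhoV, Fin.val_rev]; split_ifs <;> omega), pow_one]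
    case order =>
      refine .inr ⟨by simp only [Fin.lt_def, Fin.val_rev]; omega, ?_⟩
      rw [hr x.rev x 0 (by simp only [rhoV, Fin.val_rev]; split_ifs <;> omega), pow_zero, one_mul]
    case block =>
      intro z h1 h2 h3 h4
      simp only [Fin.ext_iff, Fin.val_rev, ne_eq] at h1 h2 h3 h4
      simp only [Fin.lt_def, Fin.val_rev]
      omega
    all_goals simp only [Fin.ext_iff, Fin.lt_def, Fin.val_rev, ne_eq]; omega
  refine ⟨c, φ, ?_, fun D hD k l => ⟨H.braid hD (Units.ne_zero _) (gc_ne_zero _) k l,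
    H.contract hD (Units.ne_zero _) (gc_ne_zero _) k l⟩⟩
  ext a b
  simp only [natGen, h, if_false, arrowMat, Matrix.add_apply, matUnit, Matrix.of_apply, c, φ,
    Fin.ext_iff, Fin.val_rev, apply_ite Fin.val]
  split_ifs <;> first | omega | simp

/-- The last root of type C has the single arrow n' → n, and q² appears because the root is 2ε_n. -/
theorem exists_arrows_C (i : Fin n) (h : ¬ i.val + 1 < n) : ∃ c φ,
    natGen .C (.e i) = arrowMat c φ ∧ Equivariant (gc QV) (qU .C QV : QV) c (kEig i) φ := by
  have hi := i.2
  have hN : Ty.C.dimV n = 2 * n := rfl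
  obtain ⟨y, hy⟩ : ∃ y : Fin (Ty.C.dimV n), y.val + 1 = n := ⟨⟨n - 1, by omega⟩, by simp; omega⟩
  let c : Fin (Ty.C.dimV n) → QV := fun z => if z = y.rev then 1 else 0
  let φ : Fin (Ty.C.dimV n) → Fin (Ty.C.dimV n) := fun _ => y
  have hdot : ∀ b, simpleRoot .C n i ⬝ᵥ wt .C b = if b.val + 1 = n then 2
      else if b.val = n then -2 else 0 := by
    intro b
    rw [simpleRoot_dot, dif_neg h]
    simp only [wt]
    split_ifs <;> omega
  have H : OneArrow (gc QV) c (kEig i) (qU .C QV : QV) φ y := by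
    constructor
    case cy => exact if_pos rfl
    case φy => rfl
    case c0 => exact fun z h1 => if_neg h1
    case Ky =>
      rw [kEig_eq (z := 2)]
      · exact (zpow_ofNat _ 2).trans (pow_two _)
      simp only [hdot]; split_ifs <;> omega
    case Ky' =>
      rw [kEig_eq (z := -2), zpow_neg, ← mul_inv]
      · exact congrArg _ ((zpow_ofNat _ 2).trans (pow_two _))
      simp only [hdot, Fin.val_rev]; split_ifs <;> omega
    case K0 =>
      intro z h1 h2
      rw [kEig_eq (z := 0), zpow_zero]
      simp only [Fin.ext_iff, Fin.val_rev, ne_eq] at h1 h2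
      simp only [hdot]; split_ifs <;> omega
    -- ρ takes the values 1 and -1 at n and n', and ε changes sign between them.
    case gy =>
      have h1 : rhoV .C n y = 1 := by simp only [rhoV]; split_ifs <;> omega
      have h2 : rhoV .C n y.rev = -1 := by
        simp only [rhoV, Fin.val_rev]; split_ifs <;> omega
      have h3 : eps .C n y = 1 := by simp only [eps]; split_ifs <;> omega
      have h4 : eps .C n y.rev = -1 := by simp only [eps, Fin.val_rev]; split_ifs <;> omega
      have h5 := v_ne_zero
      rw [gc, gc, h1, h2, h3, h4, zpow_one, zpow_neg_one, Units.val_inv_eq_inv_val, qU_QV, vU_QV,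
        qExp, pow_one]
      field_simp
      simp
    case block =>
      intro z h1 h2
      simp only [Fin.ext_iff, Fin.val_rev, ne_eq] at h1 h2
      simp only [Fin.lt_def, Fin.val_rev]
      omega
    all_goals simp only [Fin.lt_def, Fin.val_rev]; omega
  refine ⟨c, φ, ?_, fun D hD k l => ⟨H.braid hD (Units.ne_zero _) (gc_ne_zero _) k l,
    H.contract hD (Units.ne_zero _) (gc_ne_zero _) k l⟩⟩
  ext a b
  simp only [natGen, h, if_false, arrowMat, matUnit, Matrix.of_apply, c, φ,
    Fin.ext_iff, Fin.val_rev]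
  split_ifs <;> first | omega | simp

/-- The last root of type B has the chain n' → n + 1 → n with s = v = q^{1/2}. -/
theorem exists_arrows_B (i : Fin n) (h : ¬ i.val + 1 < n) : ∃ c φ,
    natGen .B (.e i) = arrowMat c φ ∧ Equivariant (gc QV) (qU .B QV : QV) c (kEig i) φ := by
  have hi := i.2
  have hN : Ty.B.dimV n = 2 * n + 1 := rfl
  obtain ⟨m, hm⟩ : ∃ m : Fin (Ty.B.dimV n), m.val = n := ⟨⟨n, by omega⟩, rfl⟩
  obtain ⟨y, hy⟩ : ∃ y : Fin (Ty.B.dimV n), y.val + 1 = n := ⟨⟨n - 1, by omega⟩, by simp; omega⟩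
  let c : Fin (Ty.B.dimV n) → QV := fun z => if z = m then 1 else if z = y.rev then -v⁻¹ else 0
  let φ : Fin (Ty.B.dimV n) → Fin (Ty.B.dimV n) := fun z => if z = m then y else m
  have hdot : ∀ b, simpleRoot .B n i ⬝ᵥ wt .B b = if b.val + 1 = n then 1
      else if b.val = n + 1 then -1 else 0 := by
    intro b
    rw [simpleRoot_dot, dif_neg h]
    simp only [wt]
    split_ifs <;> omega
  have hmy' : y.rev ≠ m := by
    simp only [Fin.ext_iff, Fin.val_rev, ne_eq]; omega
  have hqv : (qU .B QV : QV) = v * v := by rw [qU_QV, qExp, pow_two]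
  have H : MiddleArrows (gc QV) c (kEig i) v φ y m := by
    constructor
    case cm => exact if_pos rfl
    case φm => exact if_pos rfl
    case cy => exact (if_neg hmy').trans (if_pos rfl)
    case φy => exact if_neg hmy'
    case c0 => exact fun z h1 h2 => (if_neg h1).trans (if_neg h2)
    case Ky =>
      rw [kEig_eq (z := 1), zpow_one, hqv]
      simp only [hdot]; split_ifs <;> omega
    case Km =>
      rw [kEig_eq (z := 0), zpow_zero]
      simp only [hdot]; split_ifs <;> omega
    case Ky' =>
      rw [kEig_eq (z := -1), zpow_neg_one, hqv, mul_inv]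
      simp only [hdot, Fin.val_rev]; split_ifs <;> omega
    case K0 =>
      intro z h1 h2 h3
      rw [kEig_eq (z := 0), zpow_zero]
      simp only [Fin.ext_iff, Fin.val_rev, ne_eq] at h1 h2 h3
      simp only [hdot]; split_ifs <;> omega
    case gy =>
      have h1 : rhoV .B n y = 1 := by simp only [rhoV]; split_ifs <;> omega
      rw [gc, h1, zpow_one, vU_QV, eps, Int.cast_one, mul_one]
    case gm =>
      have h1 : rhoV .B n m = 0 := by simp only [rhoV]; split_ifs <;> omega
      rw [gc, h1, zpow_zero, Units.val_one, eps, Int.cast_one, mul_one]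
    case gy' =>
      have h1 : rhoV .B n y.rev = -1 := by
        simp only [rhoV, Fin.val_rev]; split_ifs <;> omega
      rw [gc, h1, zpow_neg_one, Units.val_inv_eq_inv_val, vU_QV, eps, Int.cast_one, mul_one]
    case block =>
      intro z h1 h2 h3
      simp only [Fin.ext_iff, Fin.val_rev, ne_eq] at h1 h2 h3
      simp only [Fin.lt_def, Fin.val_rev]
      omega
    all_goals simp only [Fin.ext_iff, Fin.lt_def, Fin.val_rev]; omega
  refine ⟨c, φ, ?_, fun D hD k l => ⟨?_, H.contract hD v_ne_zero k l⟩⟩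
  · ext a b
    simp only [natGen, h, if_false, arrowMat, Matrix.add_apply, matUnit, Matrix.of_apply, c, φ, hm,
      Fin.ext_iff, Fin.val_rev, apply_ite Fin.val]
    split_ifs <;> first | omega | simp
  · rw [hqv]
    exact H.braid hD v_ne_zero k l

/-- The root vectors `e_i` are given by arrows for which the braiding and the contraction are
equivariant. -/
theorem exists_arrows (hn : X.minRank ≤ n) (i : Fin n) : ∃ c φ,
    natGen X (.e i) = arrowMat c φ ∧ Equivariant (gc QV) (qU X QV : QV) c (kEig i) φ := by
  by_cases h : i.val + 1 < n
  · exact exists_arrows_lt i h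
  · cases X
    · exact exists_arrows_B i h
    · exact exists_arrows_C i h
    · exact exists_arrows_D hn i h

end NaturalArrows

/-! ### Kronecker products along a splitting of the tensor factors -/

section Glue
open scoped Kronecker
variable {R : Type*} [CommRing R] {α β γ : Type*} [Fintype α] [Fintype β] [Fintype γ]
  [DecidableEq α] [DecidableEq β] [DecidableEq γ]

/-- The Kronecker product of two matrices, with the index set identified along `σ`. -/
def glue (σ : γ ≃ α × β) (A : Matrix α α R) (M : Matrix β β R) : Matrix γ γ R :=
  (A ⊗ₖ M).submatrix σ σ

theorem glue_apply (σ : γ ≃ α × β) (A : Matrix α α R) (M : Matrix β β R) (a b : γ) :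
    glue σ A M a b = A (σ a).1 (σ b).1 * M (σ a).2 (σ b).2 := rfl

theorem glue_mul (σ : γ ≃ α × β) (A A' : Matrix α α R) (M M' : Matrix β β R) :
    glue σ A M * glue σ A' M' = glue σ (A * A') (M * M') := by
  rw [glue, glue, glue, Matrix.submatrix_mul_equiv, Matrix.mul_kronecker_mul]

theorem glue_one (σ : γ ≃ α × β) : glue σ (1 : Matrix α α R) 1 = 1 := by
  rw [glue, Matrix.one_kronecker_one, Matrix.submatrix_one_equiv]

theorem glue_add_left (σ : γ ≃ α × β) (A A' : Matrix α α R) (M : Matrix β β R) :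
    glue σ (A + A') M = glue σ A M + glue σ A' M := by
  ext; simp [glue_apply, add_mul]

theorem glue_add_right (σ : γ ≃ α × β) (A : Matrix α α R) (M M' : Matrix β β R) :
    glue σ A (M + M') = glue σ A M + glue σ A M' := by
  ext; simp [glue_apply, mul_add]

theorem glue_smul_left (σ : γ ≃ α × β) (c : R) (A : Matrix α α R) (M : Matrix β β R) :
    glue σ (c • A) M = c • glue σ A M := by
  ext; simp [glue_apply, mul_assoc]

theorem glue_smul_right (σ : γ ≃ α × β) (c : R) (A : Matrix α α R) (M : Matrix β β R) :
    glue σ A (c • M) = c • glue σ A M := by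
  ext; simp [glue_apply, mul_left_comm]

/-- Separation of the first tensor factor. -/
def split1 (ι : Type*) (r : ℕ) : (Fin (r + 1) → ι) ≃ ι × (Fin r → ι) :=
  (Fin.consEquiv fun _ : Fin (r + 1) => ι).symm

/-- Separation of the first two tensor factors. -/
def split2 (ι : Type*) (r : ℕ) : (Fin (r + 2) → ι) ≃ (ι × ι) × (Fin r → ι) :=
  (split1 ι (r + 1)).trans ((Equiv.prodCongr (.refl _) (split1 ι r)).trans
    (Equiv.prodAssoc _ _ _).symm)

/-- Separation of the first three tensor factors. -/
def split3 (ι : Type*) (r : ℕ) : (Fin (r + 3) → ι) ≃ (ι × ι × ι) × (Fin r → ι) :=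
  (split1 ι (r + 2)).trans ((Equiv.prodCongr (.refl _) (split2 ι r)).trans
    (Equiv.prodAssoc _ _ _).symm)

variable {ι : Type*} [Fintype ι] [DecidableEq ι] {r : ℕ}

/-- Associativity of the tensor product: two single factors are regrouped as one pair, to which an
operator on V ⊗ V applies. -/
theorem glue1_glue1 (A B : Matrix ι ι R) (M : Matrix (Fin r → ι) (Fin r → ι) R) :
    glue (split1 ι (r + 1)) A (glue (split1 ι r) B M) = glue (split2 ι r) (A ⊗ₖ B) M := by
  ext a b
  exact (mul_assoc _ _ _).symm

theorem glue1_glue2 (A : Matrix ι ι R) (P : Matrix (ι × ι) (ι × ι) R)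
    (M : Matrix (Fin r → ι) (Fin r → ι) R) :
    glue (split1 ι (r + 2)) A (glue (split2 ι r) P M) = glue (split3 ι r) (A ⊗ₖ P) M := by
  ext a b
  exact (mul_assoc _ _ _).symm

/-- The action of a matrix on the first two of three tensor factors. -/
def firstTwo (P : Matrix (ι × ι) (ι × ι) R) : Matrix (ι × ι × ι) (ι × ι × ι) R :=
  glue (Equiv.prodAssoc ι ι ι).symm P 1

/-- The action of a matrix on the last two of three tensor factors. -/
def lastTwo (P : Matrix (ι × ι) (ι × ι) R) : Matrix (ι × ι × ι) (ι × ι × ι) R :=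
  glue (.refl _) 1 P

theorem glue2_glue1 (P : Matrix (ι × ι) (ι × ι) R) (M : Matrix (Fin r → ι) (Fin r → ι) R) :
    glue (split2 ι (r + 1)) P (glue (split1 ι r) 1 M) = glue (split3 ι r) (firstTwo P) M := by
  ext a b
  exact (mul_assoc _ _ _).symm

/-- The action of a matrix on the tensor factors `m` and `m + 1`. -/
def opMat (P : Matrix (ι × ι) (ι × ι) R) :
    (r m : ℕ) → Matrix (Fin r → ι) (Fin r → ι) R
  | r + 2, 0 => glue (split2 ι r) P 1
  | r + 1, m + 1 => glue (split1 ι r) 1 (opMat P r m)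
  | 1, 0 => 0
  | 0, _ => 0

theorem opMat_zero (P : Matrix (ι × ι) (ι × ι) R) (r : ℕ) :
    opMat P (r + 2) 0 = glue (split2 ι r) P 1 := rfl

theorem opMat_succ (P : Matrix (ι × ι) (ι × ι) R) (r m : ℕ) :
    opMat P (r + 1) (m + 1) = glue (split1 ι r) 1 (opMat P r m) := by
  rw [opMat]

end Glue

/-! ### From equivariance to commuting matrices, and the symmetry that yields the lowering operators
-/

section PairCommute
open scoped Kronecker
variable {F : Type*} [Field F] {N : ℕ}

/-- The matrix of the operator on `V ⊗ V` that sends `v_k ⊗ v_l` to `c k l`. -/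
def pairMat {R ι : Type*} (c : ι → ι → ι × ι → R) : Matrix (ι × ι) (ι × ι) R :=
  Matrix.of fun p i => c i.1 i.2 p

theorem pairMat_mulVec (c : Fin N → Fin N → Fin N × Fin N → F) (k l : Fin N) :
    (pairMat c).mulVec (pv F k l) = c k l := by
  rw [pv, Matrix.mulVec_single_one]; rfl

theorem ext_pv {A B : Matrix (Fin N × Fin N) (Fin N × Fin N) F}
    (h : ∀ k l, A.mulVec (pv F k l) = B.mulVec (pv F k l)) : A = B := by
  refine Matrix.ext_of_mulVec_single fun ⟨k, l⟩ => h k l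

theorem pv_apply (a b k l : Fin N) : pv F k l (a, b) = if a = k ∧ b = l then 1 else 0 := by
  rw [pv, Pi.single_apply]
  simp only [Prod.mk.injEq]

theorem kronecker_mulVec_pv (A B : Matrix (Fin N) (Fin N) F) (k l a b : Fin N) :
    (A ⊗ₖ B).mulVec (pv F k l) (a, b) = A a k * B b l := by
  rw [pv, Matrix.mulVec_single_one]; rfl

theorem isTwisted_arrowMat (c K : Fin N → F) (φ : Fin N → Fin N) :
    IsTwisted (arrowMat c φ ⊗ₖ 1 + Matrix.diagonal K ⊗ₖ arrowMat c φ).mulVecLin c K φ := by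
  intro k l
  ext ⟨a, b⟩
  simp only [Matrix.mulVecLin_apply, Matrix.add_mulVec, Pi.add_apply, kronecker_mulVec_pv,
    Pi.smul_apply, pv_apply, arrowMat, Matrix.of_apply, Matrix.one_apply, Matrix.diagonal_apply,
    smul_eq_mul]
  congr 1
  · rw [ite_and]; split_ifs <;> simp
  · rw [ite_and]
    by_cases h : a = k
    · subst h; split_ifs <;> simp
    · simp [h]

theorem Equivariant.commute {g : Fin N → F} {q : F} {c K : Fin N → F} {φ : Fin N → Fin N}
    (h : Equivariant g q c K φ) :
    Commute (pairMat (braidVec g q))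
      (arrowMat c φ ⊗ₖ 1 + Matrix.diagonal K ⊗ₖ arrowMat c φ) ∧
    Commute (pairMat (contractVec g))
      (arrowMat c φ ⊗ₖ 1 + Matrix.diagonal K ⊗ₖ arrowMat c φ) := by
  have hD := isTwisted_arrowMat c K φ
  have h' := h _ hD
  simp only [IsTwisted, Matrix.mulVecLin_apply] at hD h'
  constructor <;> refine ext_pv fun k l => ?_ <;>
    rw [← Matrix.mulVec_mulVec, ← Matrix.mulVec_mulVec, hD, Matrix.mulVec_add, Matrix.mulVec_smul,
      Matrix.mulVec_smul, pairMat_mulVec, pairMat_mulVec, pairMat_mulVec]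
  · exact (h' k l).1.symm
  · exact (h' k l).2.symm

theorem tailVec_apply (g : Fin N → F) (k a b : Fin N) :
    tailVec g k (a, b) = if a = b.rev ∧ k < b then g b else 0 := by
  simp only [tailVec, Finset.sum_apply, Pi.smul_apply, pv_apply, smul_eq_mul]
  rw [Finset.sum_eq_single b]
  · by_cases h1 : a = b.rev <;> by_cases h2 : k < b <;> simp [h1, h2]
  · intro i _ hi
    simp [hi.symm]
  · simp

theorem invVec_apply (g : Fin N → F) (a b : Fin N) :
    invVec g (a, b) = if a = b.rev then g b else 0 := by
  simp only [invVec, Finset.sum_apply, Pi.smul_apply, pv_apply, smul_eq_mul]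
  rw [Finset.sum_eq_single b]
  · by_cases h1 : a = b.rev <;> simp [h1]
  · intro i _ hi
    simp [hi.symm]
  · simp

theorem braidVec_apply (g : Fin N → F) (q : F) (k l a b : Fin N) :
    braidVec g q k l (a, b) = (if a = l ∧ b = k then flipCoef q k l else 0) +
      (if a = k ∧ b = l ∧ k < l then q - q⁻¹ else 0) -
      if k = l.rev ∧ a = b.rev ∧ k < b then (q - q⁻¹) * (g k)⁻¹ * g b else 0 := by
  simp only [braidVec, Pi.sub_apply, Pi.add_apply, Pi.smul_apply, tailVec_apply, pv_apply,
    smul_eq_mul]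
  congr 1
  · congr 1
    · split_ifs <;> simp
    · simp only [ite_and]; split_ifs <;> simp
  · simp only [ite_and]; split_ifs <;> simp

theorem contractVec_apply (g : Fin N → F) (k l a b : Fin N) :
    contractVec g k l (a, b) = if k = l.rev ∧ a = b.rev then (g k)⁻¹ * g b else 0 := by
  simp only [contractVec, Pi.smul_apply, invVec_apply, smul_eq_mul, ite_and]
  split_ifs <;> simp

/-- The involution `(a, b) ↦ (b', a')`. -/
def swapRev (N : ℕ) : (Fin N × Fin N) ≃ (Fin N × Fin N) :=
  (Equiv.prodComm _ _).trans (Equiv.prodCongr Fin.revPerm Fin.revPerm)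

theorem swapRev_apply (a b : Fin N) : swapRev N (a, b) = (b.rev, a.rev) := rfl

theorem flipCoef_rev (q : F) (k l : Fin N) : flipCoef q l.rev k.rev = flipCoef q k l := by
  have h1 : l.rev = k.rev.rev ↔ k = l.rev := by rw [Fin.rev_rev, eq_comm]
  have h2 : l.rev = k.rev ↔ k = l := by rw [Fin.rev_inj, eq_comm]
  simp only [flipCoef, h1, h2]

/-- Reversing both the order of the factors and the order of the basis preserves every inequality in
the braiding, and in the tail it replaces the condition k < b by b' < k', which is the same. -/
theorem braidVec_rev (g : Fin N → F) (q : F) (k l a b : Fin N) :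
    braidVec g q l.rev k.rev (b.rev, a.rev) = braidVec g q k l (a, b) := by
  rw [braidVec_apply, braidVec_apply, flipCoef_rev]
  simp only [Fin.rev_inj, Fin.rev_rev, Fin.rev_lt_rev]
  congr 1
  · congr 1
    · simp only [and_comm]
    · by_cases h1 : a = k <;> by_cases h2 : b = l <;> simp [h1, h2]
  · by_cases h1 : k = l.rev
    · by_cases h2 : a = b.rev
      · subst h1 h2
        simp only [Fin.rev_rev]
        have : (l.rev < b) ↔ b.rev < l := by rw [← Fin.rev_lt_rev, Fin.rev_rev]
        simp [this]
      · have : ¬ b.rev = a := fun h => h2 h.symm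
        simp [h2, this]
    · have : ¬ l.rev = k := fun h => h1 h.symm
      simp [h1, this]

theorem contractVec_rev (g : Fin N → F) (k l a b : Fin N) :
    contractVec g l.rev k.rev (b.rev, a.rev) = contractVec g k l (a, b) := by
  rw [contractVec_apply, contractVec_apply]
  simp only [Fin.rev_rev]
  by_cases h1 : k = l.rev
  · by_cases h2 : a = b.rev
    · subst h1 h2; simp
    · have : ¬ b.rev = a := fun h => h2 h.symm
      simp [h2, this]
  · have : ¬ l.rev = k := fun h => h1 h.symm
    simp [h1, this]

theorem pairMat_submatrix {c : Fin N → Fin N → Fin N × Fin N → F}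
    (h : ∀ k l a b, c l.rev k.rev (b.rev, a.rev) = c k l (a, b)) :
    (pairMat c).submatrix (swapRev N) (swapRev N) = pairMat c := by
  ext ⟨a, b⟩ ⟨k, l⟩
  exact h k l a b

/-- Flips preserve the product K_k K_l, and for dual indices that product is 1, so the tails and the
invariant vector are fixed. -/
theorem commute_diagonal {K : Fin N → F} (hK : ∀ i, K i.rev * K i = 1) (g : Fin N → F) (q : F) :
    Commute (pairMat (braidVec g q)) (Matrix.diagonal K ⊗ₖ Matrix.diagonal K) ∧
    Commute (pairMat (contractVec g)) (Matrix.diagonal K ⊗ₖ Matrix.diagonal K) := by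
  have hp : ∀ k l, (Matrix.diagonal K ⊗ₖ Matrix.diagonal K).mulVec (pv F k l) =
      (K k * K l) • pv F k l := by
    intro k l
    ext ⟨a, b⟩
    rw [kronecker_mulVec_pv, Pi.smul_apply, pv_apply, Matrix.diagonal_apply, Matrix.diagonal_apply]
    by_cases h1 : a = k <;> by_cases h2 : b = l <;> simp_all
  have hs : ∀ w : Fin N → F, (Matrix.diagonal K ⊗ₖ Matrix.diagonal K).mulVec
      (∑ i, w i • pv F i.rev i) = ∑ i, w i • pv F i.rev i := by
    intro w
    simp only [Matrix.mulVec_sum, Matrix.mulVec_smul, hp, hK, one_smul]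
  constructor <;> refine ext_pv fun k l => ?_ <;>
    rw [← Matrix.mulVec_mulVec, ← Matrix.mulVec_mulVec, hp, Matrix.mulVec_smul, pairMat_mulVec]
  · by_cases hkl : k = l.rev
    · subst hkl
      rw [hK, one_smul]
      simp only [braidVec, Matrix.mulVec_add, Matrix.mulVec_sub, Matrix.mulVec_smul, hp, tailVec,
        hs, hK, mul_comm (K l), one_smul]
    · simp only [braidVec, if_neg hkl, Matrix.mulVec_add, Matrix.mulVec_sub, Matrix.mulVec_smul, hp,
        Matrix.mulVec_zero, zero_smul, mul_comm (K l)]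
      module
  · by_cases hkl : k = l.rev
    · subst hkl
      rw [hK, one_smul, contractVec, Matrix.mulVec_smul, invVec, hs]
    · rw [contractVec, if_neg hkl, zero_smul, smul_zero, Matrix.mulVec_zero]

/-- The symmetry v_a ⊗ v_b ↦ v_{b'} ⊗ v_{a'} turns the coproduct e ⊗ 1 + K ⊗ e into the coproduct of
a multiple of f, since it exchanges the factors and turns e into f and K into its inverse. An
operator fixed by the symmetry commutes with both or neither. -/
theorem commute_lowering {P : Matrix (Fin N × Fin N) (Fin N × Fin N) F}
    (hP : P.submatrix (swapRev N) (swapRev N) = P) {e : Matrix (Fin N) (Fin N) F} {K : Fin N → F}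
    (h : Commute P (e ⊗ₖ 1 + Matrix.diagonal K ⊗ₖ e)) {μ : F} {f : Matrix (Fin N) (Fin N) F}
    (hf : f = μ • e.submatrix Fin.rev Fin.rev) {K' : Fin N → F} (hK : ∀ i, K' i = K i.rev) :
    Commute P (f ⊗ₖ Matrix.diagonal K' + 1 ⊗ₖ f) := by
  have h1 : f ⊗ₖ Matrix.diagonal K' + 1 ⊗ₖ f =
      μ • (e ⊗ₖ 1 + Matrix.diagonal K ⊗ₖ e).submatrix (swapRev N) (swapRev N) := by
    subst hf
    ext ⟨a, b⟩ ⟨k, l⟩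
    simp only [Matrix.add_apply, Matrix.kroneckerMap_apply, Matrix.smul_apply,
      Matrix.submatrix_apply, swapRev_apply, Matrix.one_apply, Matrix.diagonal_apply, Fin.rev_inj,
      hK, smul_eq_mul]
    ring
  rw [h1]
  refine Commute.smul_right ?_ μ
  have := congrArg (fun M => M.submatrix (swapRev N) (swapRev N)) h.eq
  simp only [← Matrix.submatrix_mul_equiv _ _ _ (swapRev N), hP] at this
  exact this

end PairCommute

/-! ### Braiding and contraction commute with the quantum group on all tensor powers -/

section NaturalRep
open scoped Kronecker
variable {X : Ty} {n : ℕ}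

theorem wt_rev (a : Fin (X.dimV n)) : wt X a.rev = -wt X a := by
  funext m
  have h1 := two_mul_le_dimV X n
  have h2 := m.2
  have h3 := a.2
  simp only [wt, Pi.neg_apply, Fin.val_rev]
  split_ifs <;> omega

theorem kEig_rev (i : Fin n) (a : Fin (X.dimV n)) : kEig i a.rev = (kEig i a)⁻¹ := by
  rw [kEig, kEig, wt_rev, dotProduct_neg, mul_neg, zpow_neg]

theorem kEig_ne_zero (i : Fin n) (a : Fin (X.dimV n)) : kEig i a ≠ 0 := zpow_ne_zero _ v_ne_zero

theorem natGen_k (i : Fin n) : natGen X (.k i) = Matrix.diagonal (kEig i) := rfl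

theorem natGen_kinv (i : Fin n) :
    natGen X (.kinv i) = Matrix.diagonal fun a => kEig i (Fin.rev a) := by
  simp only [kEig_rev]
  simp only [kEig, natGen, zpow_neg]

/-- The scalar `μ` for which `f_i` is `μ` times the image of `e_i` under `v_k ↦ v_{k'}`. -/
noncomputable def lowerCoef (X : Ty) {n : ℕ} (i : Fin n) : QV :=
  if i.val + 1 < n then -1 else match X with
    | .B => -(v * qnum 1 2)
    | .C => 1
    | .D => -1

theorem lowerCoef_ne_zero (i : Fin n) : lowerCoef X i ≠ 0 := by
  have h1 : (-1 : QV) ≠ 0 := neg_ne_zero.2 one_ne_zero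
  unfold lowerCoef
  split_ifs
  · exact h1
  · cases X
    · exact neg_ne_zero.2 (mul_ne_zero v_ne_zero (qnum_ne one_ne_zero two_ne_zero))
    · exact one_ne_zero
    · exact h1

theorem natGen_f (hn : X.minRank ≤ n) (i : Fin n) : natGen X (.f i) =
    lowerCoef X i • (natGen X (.e i)).submatrix Fin.rev Fin.rev := by
  have h1 := two_mul_le_dimV X n
  have hi := i.2
  have hv := v_ne_zero
  ext a b
  have ha := a.2
  have hb := b.2
  by_cases h : i.val + 1 < n
  · simp only [natGen, lowerCoef, h, if_true, Matrix.smul_apply, Matrix.submatrix_apply,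
      Matrix.add_apply, matUnit, Fin.val_rev, smul_eq_mul]
    split_ifs <;> first | omega | simp
  · have hN := dimV_eq X n
    cases X <;> simp only [Ty.minRank] at hn <;> simp only [] at hN <;>
      simp only [natGen, lowerCoef, h, if_false, Matrix.smul_apply, Matrix.submatrix_apply,
        Matrix.add_apply, matUnit, Fin.val_rev, smul_eq_mul] <;>
      split_ifs <;> first | omega | (simp; done) | (simp; field_simp)

/-- The matrices of the generators on `V ⊗ V`. -/
noncomputable def pairGen (X : Ty) {n : ℕ} : Gen n →
    Matrix (Fin (X.dimV n) × Fin (X.dimV n)) (Fin (X.dimV n) × Fin (X.dimV n)) QV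
  | .e i => natGen X (.e i) ⊗ₖ 1 + natGen X (.k i) ⊗ₖ natGen X (.e i)
  | .f i => natGen X (.f i) ⊗ₖ natGen X (.kinv i) + 1 ⊗ₖ natGen X (.f i)
  | .k i => natGen X (.k i) ⊗ₖ natGen X (.k i)
  | .kinv i => natGen X (.kinv i) ⊗ₖ natGen X (.kinv i)

theorem commute_pairGen_aux (hn : X.minRank ≤ n) (g : Gen n) :
    Commute (pairMat (braidVec (gc QV) (qU X QV : QV))) (pairGen X g) ∧
    Commute (pairMat (contractVec (gc (X := X) QV))) (pairGen X g) := by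
  cases g with
  | e i =>
    obtain ⟨c, φ, he, h⟩ := exists_arrows hn i
    rw [pairGen, natGen_k, he]
    exact h.commute
  | f i =>
    obtain ⟨c, φ, he, h⟩ := exists_arrows hn i
    have hf := natGen_f hn i
    rw [he] at hf
    rw [pairGen, natGen_kinv]
    exact ⟨commute_lowering (pairMat_submatrix (braidVec_rev _ _)) h.commute.1 hf fun _ => rfl,
      commute_lowering (pairMat_submatrix (contractVec_rev _)) h.commute.2 hf fun _ => rfl⟩
  | k i =>
    rw [pairGen, natGen_k]
    exact commute_diagonal
      (fun j => by rw [kEig_rev, inv_mul_cancel₀ (kEig_ne_zero i j)]) _ _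
  | kinv i =>
    rw [pairGen, natGen_kinv]
    exact commute_diagonal
      (fun j => by rw [Fin.rev_rev, kEig_rev, mul_inv_cancel₀ (kEig_ne_zero i j)])
      _ _

theorem commute_pairGen (hn : X.minRank ≤ n) (g : Gen n) :
    Commute (pairMat (imageR (X := X) QV)) (pairGen X g) ∧
    Commute (pairMat (imageE (X := X) QV)) (pairGen X g) := by
  have h1 : imageR (X := X) (n := n) QV = braidVec (gc QV) (qU X QV : QV) := by
    funext k l; exact imageR_eq QV k l
  have h2 : imageE (X := X) (n := n) QV = contractVec (gc QV) := by
    funext k l; exact imageE_eq QV k l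
  rw [h1, h2]
  exact commute_pairGen_aux hn g

theorem tensorRep_succ (hn : X.minRank ≤ n) (r : ℕ) (a b : Uq X n) :
    (Matrix.reindexAlgEquiv QV QV (Fin.consEquiv fun _ : Fin (r + 1) => Fin (X.dimV n))).toAlgHom
      ((Matrix.kroneckerAlgEquiv (Fin (X.dimV n)) (Fin r → Fin (X.dimV n)) QV).toAlgHom
        (Algebra.TensorProduct.map (natRep hn) (tensorRep hn r) (a ⊗ₜ b))) =
      glue (split1 _ r) (natRep hn a) (tensorRep hn r b) := by
  ext x y
  rfl

theorem natRep_gen (hn : X.minRank ≤ n) (g : Gen n) : natRep hn (gen X g) = natGen X g :=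
  liftUq_gen _ _ _

theorem tensorRep_succ_apply (hn : X.minRank ≤ n) (r : ℕ) (u : Uq X n) : tensorRep hn (r + 1) u =
    (Matrix.reindexAlgEquiv QV QV (Fin.consEquiv fun _ : Fin (r + 1) => Fin (X.dimV n))).toAlgHom
      ((Matrix.kroneckerAlgEquiv (Fin (X.dimV n)) (Fin r → Fin (X.dimV n)) QV).toAlgHom
        (Algebra.TensorProduct.map (natRep hn) (tensorRep hn r) (comul X u))) := rfl

theorem comul_gen (g : Gen n) : comul X (gen X g) = comulGen X g := liftUq_gen _ _ _

theorem tensorRep_e (hn : X.minRank ≤ n) (r : ℕ) (i : Fin n) :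
    tensorRep hn (r + 1) (gen X (.e i)) = glue (split1 _ r) (natGen X (.e i)) 1 +
      glue (split1 _ r) (natGen X (.k i)) (tensorRep hn r (gen X (.e i))) := by
  rw [tensorRep_succ_apply, comul_gen, comulGen, map_add, map_add, map_add, tensorRep_succ,
    tensorRep_succ, natRep_gen, natRep_gen, map_one]

theorem tensorRep_f (hn : X.minRank ≤ n) (r : ℕ) (i : Fin n) :
    tensorRep hn (r + 1) (gen X (.f i)) =
      glue (split1 _ r) (natGen X (.f i)) (tensorRep hn r (gen X (.kinv i))) +
      glue (split1 _ r) 1 (tensorRep hn r (gen X (.f i))) := by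
  rw [tensorRep_succ_apply, comul_gen, comulGen, map_add, map_add, map_add, tensorRep_succ,
    tensorRep_succ, natRep_gen, map_one]

theorem tensorRep_k (hn : X.minRank ≤ n) (r : ℕ) (i : Fin n) :
    tensorRep hn (r + 1) (gen X (.k i)) =
      glue (split1 _ r) (natGen X (.k i)) (tensorRep hn r (gen X (.k i))) := by
  rw [tensorRep_succ_apply, comul_gen, comulGen, tensorRep_succ, natRep_gen]

theorem tensorRep_kinv (hn : X.minRank ≤ n) (r : ℕ) (i : Fin n) :
    tensorRep hn (r + 1) (gen X (.kinv i)) =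
      glue (split1 _ r) (natGen X (.kinv i)) (tensorRep hn r (gen X (.kinv i))) := by
  rw [tensorRep_succ_apply, comul_gen, comulGen, tensorRep_succ, natRep_gen]

theorem commute_glue {R : Type*} [CommRing R] {α β γ : Type*} [Fintype α] [Fintype β] [Fintype γ]
    {σ : γ ≃ α × β} {A A' : Matrix α α R} {M M' : Matrix β β R} (h : Commute A A')
    (h' : Commute M M') : Commute (glue σ A M) (glue σ A' M') := by
  classical
  rw [Commute, SemiconjBy, glue_mul, glue_mul, h.eq, h'.eq]

/-- Induction on r. If P acts away from the first factor, the coproduct is split once; if it acts on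
the first two factors, the coproduct is split twice and bracketed as V ⊗ V against the rest, so that
only the hypothesis on two factors is needed. -/
theorem commute_opMat (hn : X.minRank ≤ n)
    {P : Matrix (Fin (X.dimV n) × Fin (X.dimV n)) (Fin (X.dimV n) × Fin (X.dimV n)) QV}
    (hP : ∀ g, Commute P (pairGen X g)) (r m : ℕ) (g : Gen n) :
    Commute (opMat P r m) (tensorRep hn r (gen X g)) := by
  induction r generalizing m g with
  | zero => rw [opMat]; exact Commute.zero_left _
  | succ r ih =>
    cases m with
    | succ m =>
      rw [opMat_succ]
      cases g with
      | e i =>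
        rw [tensorRep_e]
        exact (commute_glue (Commute.one_left _) (Commute.one_right _)).add_right
          (commute_glue (Commute.one_left _) (ih m _))
      | f i =>
        rw [tensorRep_f]
        exact (commute_glue (Commute.one_left _) (ih m _)).add_right
          (commute_glue (Commute.one_left _) (ih m _))
      | k i =>
        rw [tensorRep_k]
        exact commute_glue (Commute.one_left _) (ih m _)
      | kinv i =>
        rw [tensorRep_kinv]
        exact commute_glue (Commute.one_left _) (ih m _)
    | zero =>
      cases r with
      | zero => rw [opMat]; exact Commute.zero_left _
      | succ r =>
        rw [opMat_zero]
        cases g with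
        | e i =>
          -- The result is Δ(e) ⊗ 1 + (k ⊗ k) ⊗ e, with the last tensor sign separating the first
          -- two factors from the others.
          rw [tensorRep_e, tensorRep_e, glue_add_right, ← glue_one (split1 _ r), glue1_glue1,
            glue1_glue1, glue1_glue1, ← add_assoc, ← glue_add_left]
          exact (commute_glue (hP (.e i)) (Commute.one_left _)).add_right
            (commute_glue (hP (.k i)) (Commute.one_left _))
        | f i =>
          rw [tensorRep_f, tensorRep_kinv, tensorRep_f, glue_add_right, glue1_glue1,
            glue1_glue1, glue1_glue1, ← add_assoc, ← glue_add_left, Matrix.one_kronecker_one]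
          exact (commute_glue (hP (.f i)) (Commute.one_left _)).add_right
            (commute_glue (Commute.one_right _) (Commute.one_left _))
        | k i =>
          rw [tensorRep_k, tensorRep_k, glue1_glue1]
          exact commute_glue (hP (.k i)) (Commute.one_left _)
        | kinv i =>
          rw [tensorRep_kinv, tensorRep_kinv, glue1_glue1]
          exact commute_glue (hP (.kinv i)) (Commute.one_left _)

/-- Induction on the elements of the quantum group. -/
theorem Uq.induction {p : Uq X n → Prop} (h0 : ∀ c : QV, p (algebraMap QV _ c))
    (hg : ∀ g, p (gen X g)) (hadd : ∀ a b, p a → p b → p (a + b))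
    (hmul : ∀ a b, p a → p b → p (a * b)) (u : Uq X n) : p u := by
  obtain ⟨w, rfl⟩ := RingQuot.mkAlgHom_surjective QV (Rel X n) u
  induction w using FreeAlgebra.induction with
  | grade0 c => rw [AlgHom.commutes]; exact h0 c
  | grade1 g => exact hg g
  | mul a b ha hb => rw [map_mul]; exact hmul _ _ ha hb
  | add a b ha hb => rw [map_add]; exact hadd _ _ ha hb

theorem commute_tensorRep (hn : X.minRank ≤ n)
    {P : Matrix (Fin (X.dimV n) × Fin (X.dimV n)) (Fin (X.dimV n) × Fin (X.dimV n)) QV}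
    (hP : ∀ g, Commute P (pairGen X g)) (r m : ℕ) (u : Uq X n) :
    Commute (opMat P r m) (tensorRep hn r u) := by
  induction u using Uq.induction with
  | h0 c => rw [AlgHom.commutes]; exact (Algebra.commutes c _).symm
  | hg g => exact commute_opMat hn hP r m g
  | hadd a b ha hb => rw [map_add]; exact ha.add_right hb
  | hmul a b ha hb => rw [map_mul]; exact ha.mul_right hb

end NaturalRep

/-! ### Generating vectors of V ⊗ V and of V ⊗ V ⊗ V -/

section Cyclic
open scoped Kronecker
variable {F : Type*} [Field F] {ι β : Type*} [Fintype ι] [Fintype β] [DecidableEq ι] [DecidableEq β]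

/-- Apply Y to Δ(e)(v_j ⊗ w) = c v_{j'} ⊗ w + K_j v_j ⊗ M w. The left side gives 0 by commutation
and the last term gives 0 by hypothesis, so Y kills v_{j'} ⊗ w. -/
theorem col_raise {Y : Matrix (ι × β) (ι × β) F} {e : Matrix ι ι F} {K : ι → F}
    {M : Matrix β β F} (h : Commute Y (e ⊗ₖ 1 + Matrix.diagonal K ⊗ₖ M)) {j j' : ι} {c : F}
    (hc : c ≠ 0) (he : ∀ a, e a j = if a = j' then c else 0) (h0 : ∀ b p, Y p (j, b) = 0)
    (b : β) (p : ι × β) : Y p (j', b) = 0 := by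
  have h1 := congrFun (congrFun h.eq p) (j, b)
  rw [Matrix.mul_apply, Matrix.mul_apply] at h1
  simp only [h0, mul_zero, Finset.sum_const_zero, Fintype.sum_prod_type, Matrix.add_apply,
    Matrix.kroneckerMap_apply, he, Matrix.one_apply, Matrix.diagonal_apply, mul_add,
    Finset.sum_add_distrib] at h1
  have h2 : ∑ a, ∑ d, Y p (a, d) * ((if a = j then K a else 0) * M d b) = 0 := by
    refine Finset.sum_eq_zero fun a _ => Finset.sum_eq_zero fun d _ => ?_
    by_cases ha : a = j
    · subst ha; rw [h0, zero_mul]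
    · rw [if_neg ha, zero_mul, mul_zero]
  rw [h2, add_zero] at h1
  simp only [zero_mul, mul_ite, mul_zero, mul_one, Finset.sum_ite_eq', Finset.mem_univ,
    if_true] at h1
  exact (mul_eq_zero.1 h1).resolve_right hc

/-- As f kills v_j, its coproduct sends v_j ⊗ w to v_j ⊗ M w, and Y kills the image of a vector that
it kills. -/
theorem col_lower {Y : Matrix (ι × β) (ι × β) F} {f : Matrix ι ι F} {K M : Matrix β β F}
    (h : Commute Y (f ⊗ₖ K + 1 ⊗ₖ M)) {j : ι} (hf : ∀ a, f a j = 0) {b : β}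
    (h0 : ∀ p, Y p (j, b) = 0) (p : ι × β) : ∑ d, Y p (j, d) * M d b = 0 := by
  have h1 := congrFun (congrFun h.eq p) (j, b)
  rw [Matrix.mul_apply, Matrix.mul_apply] at h1
  simp only [h0, mul_zero, Finset.sum_const_zero, Fintype.sum_prod_type, Matrix.add_apply,
    Matrix.kroneckerMap_apply, hf, Matrix.one_apply, zero_mul, zero_add] at h1
  rw [Finset.sum_eq_single j] at h1
  · simpa using h1
  · intro a _ ha
    simp [ha]
  · simp

end Cyclic

section CyclicNatural
open scoped Kronecker
variable {X : Ty} {n : ℕ}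

/-- Every basis vector except the last is, up to a nonzero scalar, obtained by one raising operator
from a later one. The later index is the next one, except for k = n in type D, where no arrow joins
the two middle indices and the step has length 2. -/
theorem exists_raise (hn : X.minRank ≤ n) (k : Fin (X.dimV n)) (hk : k.val + 1 < X.dimV n) :
    ∃ (i : Fin n) (j : Fin (X.dimV n)) (c : QV), k < j ∧ c ≠ 0 ∧
      ∀ a, natGen X (.e i) a j = if a = k then c else 0 := by
  have hN := dimV_eq X n
  have hN2 := two_mul_le_dimV X n
  have h1 : (-1 : QV) ≠ 0 := neg_ne_zero.2 one_ne_zero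
  by_cases h : k.val + 1 < n
  · refine ⟨⟨k.val, by omega⟩, ⟨k.val + 1, hk⟩, 1, by simp [Fin.lt_def], one_ne_zero, fun a => ?_⟩
    simp only [natGen, h, if_true, Matrix.add_apply, matUnit, Fin.ext_iff, and_true]
    split_ifs <;> first | omega | simp
  by_cases h' : X.dimV n ≤ k.val + n
  · refine ⟨⟨X.dimV n - 2 - k.val, by omega⟩, ⟨k.val + 1, hk⟩, -1, by simp [Fin.lt_def], h1,
      fun a => ?_⟩
    have h2 : X.dimV n - 2 - k.val + 1 < n := by omega
    simp only [natGen, h2, if_true, Matrix.add_apply, matUnit, Fin.ext_iff, and_true]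
    split_ifs <;> first | omega | simp
  cases X <;> simp only [Ty.minRank] at hn <;> simp only [] at hN
  · have h2 : ¬ n - 1 + 1 < n := by omega
    by_cases h3 : k.val = n
    · refine ⟨⟨n - 1, by omega⟩, ⟨k.val + 1, hk⟩, -v⁻¹, by simp [Fin.lt_def],
        neg_ne_zero.2 (inv_ne_zero v_ne_zero), fun a => ?_⟩
      simp only [natGen, h2, if_false, Matrix.add_apply, matUnit, Fin.ext_iff]
      split_ifs <;> first | omega | simp
    · refine ⟨⟨n - 1, by omega⟩, ⟨k.val + 1, hk⟩, 1, by simp [Fin.lt_def], one_ne_zero, fun a => ?_⟩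
      simp only [natGen, h2, if_false, Matrix.add_apply, matUnit, Fin.ext_iff]
      split_ifs <;> first | omega | simp
  · have h2 : ¬ n - 1 + 1 < n := by omega
    refine ⟨⟨n - 1, by omega⟩, ⟨k.val + 1, hk⟩, 1, by simp [Fin.lt_def], one_ne_zero, fun a => ?_⟩
    simp only [natGen, h2, if_false, matUnit, Fin.ext_iff]
    split_ifs <;> first | omega | simp
  · have h2 : ¬ n - 1 + 1 < n := by omega
    refine ⟨⟨n - 1, by omega⟩, ⟨k.val + 2, by omega⟩, -1, by simp [Fin.lt_def], h1, fun a => ?_⟩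
    simp only [natGen, h2, if_false, Matrix.add_apply, matUnit, Fin.ext_iff]
    split_ifs <;> first | omega | simp

/-- The reversal of `exists_raise`, by `natGen_f`. -/
theorem exists_lower (hn : X.minRank ≤ n) (k : Fin (X.dimV n)) (hk : 0 < k.val) :
    ∃ (i : Fin n) (j : Fin (X.dimV n)) (c : QV), j < k ∧ c ≠ 0 ∧
      ∀ a, natGen X (.f i) a j = if a = k then c else 0 := by
  obtain ⟨i, j, c, h1, h2, h3⟩ := exists_raise hn k.rev (by rw [Fin.val_rev]; omega)
  refine ⟨i, j.rev, lowerCoef X i * c, ?_, mul_ne_zero (lowerCoef_ne_zero i) h2, fun a => ?_⟩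
  · rw [← Fin.rev_lt_rev, Fin.rev_rev]; exact h1
  · rw [natGen_f hn, Matrix.smul_apply, Matrix.submatrix_apply, Fin.rev_rev, h3, smul_eq_mul,
      mul_ite, mul_zero]
    simp only [Fin.rev_inj]

theorem natGen_e_zero (hn : X.minRank ≤ n) (i : Fin n) (a : Fin (X.dimV n)) {o : Fin (X.dimV n)}
    (ho : o.val = 0) : natGen X (.e i) a o = 0 := by
  have hN := dimV_eq X n
  have hN2 := two_mul_le_dimV X n
  have hi := i.2
  by_cases h : i.val + 1 < n
  · simp only [natGen, h, if_true, Matrix.add_apply, matUnit]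
    split_ifs <;> first | omega | simp
  · cases X <;> simp only [Ty.minRank] at hn <;> simp only [] at hN <;>
      simp only [natGen, h, if_false, Matrix.add_apply, matUnit] <;>
      split_ifs <;> first | omega | simp

theorem natGen_f_last (hn : X.minRank ≤ n) (i : Fin n) (a : Fin (X.dimV n)) {z : Fin (X.dimV n)}
    (hz : z.val + 1 = X.dimV n) : natGen X (.f i) a z = 0 := by
  rw [natGen_f hn, Matrix.smul_apply, Matrix.submatrix_apply,
    natGen_e_zero hn i _ (by rw [Fin.val_rev]; omega), smul_zero]

/-- An operator on `V ⊗ M` that commutes with the raising operators vanishes if it kills `v_z ⊗ M`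
for the last index `z`. -/
theorem eq_zero_of_last (hn : X.minRank ≤ n) {β : Type*} [Fintype β] [DecidableEq β]
    {Y : Matrix (Fin (X.dimV n) × β) (Fin (X.dimV n) × β) QV} (M : Fin n → Matrix β β QV)
    (h : ∀ i, Commute Y (natGen X (.e i) ⊗ₖ 1 + natGen X (.k i) ⊗ₖ M i)) {z : Fin (X.dimV n)}
    (hz : z.val + 1 = X.dimV n) (h0 : ∀ b p, Y p (z, b) = 0) : Y = 0 := by
  -- Strong induction on the distance m to the last index; ordinary induction would fail for the
  -- steps of length 2.
  have key : ∀ (m : ℕ) (k : Fin (X.dimV n)), k.val + m + 1 = X.dimV n →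
      ∀ b p, Y p (k, b) = 0 := by
    intro m
    induction m using Nat.strong_induction_on with
    | _ m ih =>
      intro k hk
      by_cases hm : m = 0
      · have : k = z := Fin.ext (by omega)
        rw [this]; exact h0
      · obtain ⟨i, j, c, h1, h2, h3⟩ := exists_raise hn k (by omega)
        rw [Fin.lt_def] at h1
        have hj := j.2
        exact col_raise (h i) h2 h3 (ih (X.dimV n - 1 - j.val) (by omega) j (by omega))
  ext p ⟨k, b⟩
  exact key (X.dimV n - 1 - k.val) k (by have := k.2; omega) b p

/-- Starting from v_N ⊗ v_1, the lowering operators move only the second factor, because v_N is a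
lowest weight vector; this gives v_N ⊗ V. The raising operators then give V ⊗ V. -/
theorem pair_eq_zero (hn : X.minRank ≤ n)
    {Y : Matrix (Fin (X.dimV n) × Fin (X.dimV n)) (Fin (X.dimV n) × Fin (X.dimV n)) QV}
    (h : ∀ g, Commute Y (pairGen X g)) {z : Fin (X.dimV n)}
    (hz : z.val + 1 = X.dimV n) (h0 : ∀ p, Y p (z, z.rev) = 0) : Y = 0 := by
  refine eq_zero_of_last hn (fun i => natGen X (.e i)) (fun i => h (.e i)) hz ?_
  have key : ∀ (m : ℕ) (k : Fin (X.dimV n)), k.val = m → ∀ p, Y p (z, k) = 0 := by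
    intro m
    induction m using Nat.strong_induction_on with
    | _ m ih =>
      intro k hk p
      by_cases hm : m = 0
      · have : k = z.rev := Fin.ext (by rw [Fin.val_rev]; omega)
        rw [this]; exact h0 p
      · obtain ⟨i, j, c, h1, h2, h3⟩ := exists_lower hn k (by omega)
        rw [Fin.lt_def] at h1
        have h4 := col_lower (h (.f i)) (fun a => natGen_f_last hn i a hz)
          (ih j.val (by omega) j rfl) p
        simpa [h3, h2] using h4
  exact fun b p => key _ b rfl p

/-- The matrices of the generators on `V ⊗ V ⊗ V`. -/
noncomputable def tripleGen (X : Ty) {n : ℕ} : Gen n →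
    Matrix (Fin (X.dimV n) × Fin (X.dimV n) × Fin (X.dimV n))
      (Fin (X.dimV n) × Fin (X.dimV n) × Fin (X.dimV n)) QV
  | .e i => natGen X (.e i) ⊗ₖ 1 + natGen X (.k i) ⊗ₖ pairGen X (.e i)
  | .f i => natGen X (.f i) ⊗ₖ pairGen X (.kinv i) + 1 ⊗ₖ pairGen X (.f i)
  | .k i => natGen X (.k i) ⊗ₖ pairGen X (.k i)
  | .kinv i => natGen X (.kinv i) ⊗ₖ pairGen X (.kinv i)

/-- Since V ⊗ V is not generated by a vector of the form v_a ⊗ v_1 with fixed a, the middle factor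
is kept arbitrary: lowering acts on the last factor modulo vectors already treated, and raising then
frees the first. -/
theorem triple_eq_zero (hn : X.minRank ≤ n)
    {Y : Matrix (Fin (X.dimV n) × Fin (X.dimV n) × Fin (X.dimV n))
      (Fin (X.dimV n) × Fin (X.dimV n) × Fin (X.dimV n)) QV}
    (h : ∀ g, Commute Y (tripleGen X g)) {z : Fin (X.dimV n)}
    (hz : z.val + 1 = X.dimV n) (h0 : ∀ a p, Y p (z, a, z.rev) = 0) : Y = 0 := by
  refine eq_zero_of_last hn (fun i => pairGen X (.e i)) (fun i => h (.e i)) hz ?_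
  have key : ∀ (m : ℕ) (k : Fin (X.dimV n)), k.val = m → ∀ a p, Y p (z, a, k) = 0 := by
    intro m
    induction m using Nat.strong_induction_on with
    | _ m ih =>
      intro k hk a p
      by_cases hm : m = 0
      · have : k = z.rev := Fin.ext (by rw [Fin.val_rev]; omega)
        rw [this]; exact h0 a p
      · obtain ⟨i, j, c, h1, h2, h3⟩ := exists_lower hn k (by omega)
        rw [Fin.lt_def] at h1
        have h4 := col_lower (h (.f i)) (fun a => natGen_f_last hn i a hz) (b := (a, j))
          (ih j.val (by omega) j rfl a) p
        -- The summand f ⊗ k⁻¹ moves the middle factor and keeps the last index j, where Y vanishes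
        -- for every middle index.
        have h5 : ∑ d : Fin (X.dimV n) × Fin (X.dimV n), Y p (z, d) *
            (natGen X (.f i) ⊗ₖ natGen X (.kinv i)) d (a, j) = 0 := by
          refine Finset.sum_eq_zero fun ⟨d, d'⟩ _ => ?_
          rw [natGen_kinv, Matrix.kroneckerMap_apply, Matrix.diagonal_apply]
          by_cases hd : d' = j
          · rw [hd, ih j.val (by omega) j rfl d p, zero_mul]
          · rw [if_neg hd, mul_zero, mul_zero]
        simp only [pairGen, Matrix.add_apply, mul_add, Finset.sum_add_distrib, h5, zero_add] at h4
        rw [Fintype.sum_prod_type, Finset.sum_eq_single a] at h4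
        · simpa [h3, h2] using h4
        · intro d _ hd
          simp [hd]
        · simp
  exact fun b p => key _ b.2 rfl b.1 p

/-- Coassociativity on generators: the coproduct on three factors is rebracketed so that the first
two factors form a pair. -/
theorem commute_firstTwo
    {P : Matrix (Fin (X.dimV n) × Fin (X.dimV n)) (Fin (X.dimV n) × Fin (X.dimV n)) QV}
    (hP : ∀ g, Commute P (pairGen X g)) (g : Gen n) : Commute (firstTwo P) (tripleGen X g) := by
  let σ := (Equiv.prodAssoc (Fin (X.dimV n)) (Fin (X.dimV n)) (Fin (X.dimV n))).symm
  have h1 : ∀ A B C : Matrix (Fin (X.dimV n)) (Fin (X.dimV n)) QV,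
      A ⊗ₖ (B ⊗ₖ C) = glue σ (A ⊗ₖ B) C := fun A B C => by
    ext a b; exact (mul_assoc _ _ _).symm
  have hr : ∀ A : Matrix (Fin (X.dimV n)) (Fin (X.dimV n)) QV, Commute 1 A := Commute.one_left
  cases g with
  | e i =>
    rw [tripleGen, pairGen, Matrix.kronecker_add, ← Matrix.one_kronecker_one, h1, h1, h1,
      ← add_assoc, ← glue_add_left]
    exact (commute_glue (hP (.e i)) (hr _)).add_right (commute_glue (hP (.k i)) (hr _))
  | f i =>
    rw [tripleGen, pairGen, pairGen, Matrix.kronecker_add, h1, h1, h1, ← add_assoc,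
      ← glue_add_left, Matrix.one_kronecker_one]
    exact (commute_glue (hP (.f i)) (hr _)).add_right (commute_glue (Commute.one_right _) (hr _))
  | k i => rw [tripleGen, pairGen, h1]; exact commute_glue (hP (.k i)) (hr _)
  | kinv i => rw [tripleGen, pairGen, h1]; exact commute_glue (hP (.kinv i)) (hr _)

theorem commute_lastTwo
    {P : Matrix (Fin (X.dimV n) × Fin (X.dimV n)) (Fin (X.dimV n) × Fin (X.dimV n)) QV}
    (hP : ∀ g, Commute P (pairGen X g)) (g : Gen n) : Commute (lastTwo P) (tripleGen X g) := by
  have hl : ∀ A : Matrix (Fin (X.dimV n)) (Fin (X.dimV n)) QV, Commute 1 A := Commute.one_left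
  cases g with
  | e i =>
    change Commute (glue (.refl _) 1 P) (glue (.refl _) (natGen X (.e i)) 1 +
      glue (.refl _) (natGen X (.k i)) (pairGen X (.e i)))
    exact (commute_glue (hl _) (Commute.one_right _)).add_right (commute_glue (hl _) (hP (.e i)))
  | f i =>
    change Commute (glue (.refl _) 1 P) (glue (.refl _) (natGen X (.f i)) (pairGen X (.kinv i)) +
      glue (.refl _) 1 (pairGen X (.f i)))
    exact (commute_glue (hl _) (hP (.kinv i))).add_right (commute_glue (hl _) (hP (.f i)))
  | k i =>
    change Commute (glue (.refl _) 1 P) (glue (.refl _) (natGen X (.k i)) (pairGen X (.k i)))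
    exact commute_glue (hl _) (hP (.k i))
  | kinv i =>
    change Commute (glue (.refl _) 1 P) (glue (.refl _) (natGen X (.kinv i)) (pairGen X (.kinv i)))
    exact commute_glue (hl _) (hP (.kinv i))

end CyclicNatural

/-! ### The relations on two and three tensor factors, and their change of rings -/

section PairRelations
variable {R : Type*} [CommRing R] {ι : Type*} [Fintype ι] [DecidableEq ι]

/-- The relations between braiding and contraction on two and three tensor factors. -/
structure PairRel (T E : Matrix (ι × ι) (ι × ι) R) (ϱ q : Rˣ) : Prop where
  TT : T * T = 1 + ((q : R) - (q⁻¹ : Rˣ)) • T - (((q : R) - (q⁻¹ : Rˣ)) * (ϱ⁻¹ : Rˣ)) • E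
  ET : E * T = ((ϱ⁻¹ : Rˣ) : R) • E
  TE : T * E = ((ϱ⁻¹ : Rˣ) : R) • E
  braid : firstTwo T * lastTwo T * firstTwo T = lastTwo T * firstTwo T * lastTwo T
  ETE₁ : firstTwo E * lastTwo T * firstTwo E = (ϱ : R) • firstTwo E
  ETE₂ : lastTwo E * firstTwo T * lastTwo E = (ϱ : R) • lastTwo E
  EEE₁ : firstTwo E * lastTwo E * firstTwo E = firstTwo E
  EEE₂ : lastTwo E * firstTwo E * lastTwo E = lastTwo E

theorem map_firstTwo {S : Type*} [CommRing S] (f : R →+* S) (P : Matrix (ι × ι) (ι × ι) R) :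
    f.mapMatrix (firstTwo P) = firstTwo (f.mapMatrix P) := by
  ext a b
  simp only [firstTwo, glue_apply, RingHom.mapMatrix_apply, Matrix.map_apply, map_mul,
    Matrix.one_apply]
  split_ifs <;> simp

theorem map_lastTwo {S : Type*} [CommRing S] (f : R →+* S) (P : Matrix (ι × ι) (ι × ι) R) :
    f.mapMatrix (lastTwo P) = lastTwo (f.mapMatrix P) := by
  ext a b
  simp only [lastTwo, glue_apply, RingHom.mapMatrix_apply, Matrix.map_apply, map_mul,
    Matrix.one_apply]
  split_ifs <;> simp

theorem mapMatrix_smul {S : Type*} [CommRing S] (f : R →+* S) {α : Type*} [Fintype α]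
    [DecidableEq α] (c : R) (M : Matrix α α R) :
    f.mapMatrix (c • M) = f c • f.mapMatrix M := by
  ext a b
  simp

theorem PairRel.map {S : Type*} [CommRing S] (f : R →+* S) {T E : Matrix (ι × ι) (ι × ι) R}
    {ϱ q : Rˣ} (h : PairRel T E ϱ q) : PairRel (f.mapMatrix T) (f.mapMatrix E)
      (Units.map f ϱ) (Units.map f q) := by
  obtain ⟨h1, h2, h3, h4, h5, h6, h7, h8⟩ := h
  replace h1 := congrArg f.mapMatrix h1
  replace h2 := congrArg f.mapMatrix h2
  replace h3 := congrArg f.mapMatrix h3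
  replace h4 := congrArg f.mapMatrix h4
  replace h5 := congrArg f.mapMatrix h5
  replace h6 := congrArg f.mapMatrix h6
  replace h7 := congrArg f.mapMatrix h7
  replace h8 := congrArg f.mapMatrix h8
  simp only [map_mul, map_sub, map_add, map_one, map_firstTwo, map_lastTwo, mapMatrix_smul]
    at h1 h2 h3 h4 h5 h6 h7 h8
  exact ⟨h1, h2, h3, h4, h5, h6, h7, h8⟩

theorem mapMatrix_injective {S : Type*} [CommRing S] {f : R →+* S} (hf : Function.Injective f)
    (α : Type*) [Fintype α] [DecidableEq α] :
    Function.Injective (f.mapMatrix : Matrix α α R →+* Matrix α α S) := by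
  intro a b hab
  ext i j
  exact hf (congrFun (congrFun hab i) j)

/-- Together with `PairRel.map` this passes the relations from ℚ(v) down to ℤ[v, v⁻¹] and on to any
κ. -/
theorem PairRel.of_map {S : Type*} [CommRing S] (f : R →+* S) (hf : Function.Injective f)
    {T E : Matrix (ι × ι) (ι × ι) R} {ϱ q : Rˣ}
    (h : PairRel (f.mapMatrix T) (f.mapMatrix E) (Units.map f ϱ) (Units.map f q)) :
    PairRel T E ϱ q := by
  obtain ⟨h1, h2, h3, h4, h5, h6, h7, h8⟩ := h
  constructor
  · apply mapMatrix_injective hf (ι × ι)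
    simp only [map_mul, map_sub, map_add, map_one, map_firstTwo, map_lastTwo, mapMatrix_smul]
    exact h1
  · apply mapMatrix_injective hf (ι × ι)
    simp only [map_mul, map_sub, map_add, map_one, map_firstTwo, map_lastTwo, mapMatrix_smul]
    exact h2
  · apply mapMatrix_injective hf (ι × ι)
    simp only [map_mul, map_sub, map_add, map_one, map_firstTwo, map_lastTwo, mapMatrix_smul]
    exact h3
  · apply mapMatrix_injective hf (ι × ι × ι)
    simp only [map_mul, map_sub, map_add, map_one, map_firstTwo, map_lastTwo, mapMatrix_smul]
    exact h4
  · apply mapMatrix_injective hf (ι × ι × ι)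
    simp only [map_mul, map_sub, map_add, map_one, map_firstTwo, map_lastTwo, mapMatrix_smul]
    exact h5
  · apply mapMatrix_injective hf (ι × ι × ι)
    simp only [map_mul, map_sub, map_add, map_one, map_firstTwo, map_lastTwo, mapMatrix_smul]
    exact h6
  · apply mapMatrix_injective hf (ι × ι × ι)
    simp only [map_mul, map_sub, map_add, map_one, map_firstTwo, map_lastTwo, mapMatrix_smul]
    exact h7
  · apply mapMatrix_injective hf (ι × ι × ι)
    simp only [map_mul, map_sub, map_add, map_one, map_firstTwo, map_lastTwo, mapMatrix_smul]
    exact h8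

end PairRelations

/-! ### Braiding and contraction on vectors with extremal factors -/

section ExtremalVectors
variable {F : Type*} [Field F] {N : ℕ} {g : Fin N → F} {q : F} {z o : Fin N}

/-- The vector `w ⊗ v_c`. -/
def padRight (c : Fin N) : (Fin N × Fin N → F) →ₗ[F] (Fin N × Fin N × Fin N → F) where
  toFun w p := if p.2.2 = c then w (p.1, p.2.1) else 0
  map_add' x y := by ext p; by_cases h : p.2.2 = c <;> simp [h]
  map_smul' x y := by ext p; by_cases h : p.2.2 = c <;> simp [h]

/-- The vector `v_c ⊗ w`. -/
def padLeft (c : Fin N) : (Fin N × Fin N → F) →ₗ[F] (Fin N × Fin N × Fin N → F) where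
  toFun w p := if p.1 = c then w p.2 else 0
  map_add' x y := by ext p; by_cases h : p.1 = c <;> simp [h]
  map_smul' x y := by ext p; by_cases h : p.1 = c <;> simp [h]

theorem padLeft_pv (a b c : Fin N) : padLeft a (pv F b c) = padRight c (pv F a b) := by
  ext ⟨x, y, t⟩
  simp only [padLeft, padRight, LinearMap.coe_mk, AddHom.coe_mk, pv_apply]
  by_cases h1 : x = a <;> by_cases h2 : y = b <;> by_cases h3 : t = c <;> simp [h1, h2, h3]

theorem firstTwo_padRight (P : Matrix (Fin N × Fin N) (Fin N × Fin N) F) (c : Fin N)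
    (w : Fin N × Fin N → F) : (firstTwo P).mulVec (padRight c w) = padRight c (P.mulVec w) := by
  ext ⟨x, y, t⟩
  simp only [Matrix.mulVec, dotProduct, firstTwo, glue_apply, padRight, LinearMap.coe_mk,
    AddHom.coe_mk, Fintype.sum_prod_type, Equiv.prodAssoc_symm_apply, Matrix.one_apply]
  by_cases h : t = c
  · subst h
    simp
  · simp [h]

theorem lastTwo_padLeft (P : Matrix (Fin N × Fin N) (Fin N × Fin N) F) (c : Fin N)
    (w : Fin N × Fin N → F) : (lastTwo P).mulVec (padLeft c w) = padLeft c (P.mulVec w) := by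
  ext ⟨x, y, t⟩
  simp only [Matrix.mulVec, dotProduct, lastTwo, glue_apply, padLeft, LinearMap.coe_mk,
    AddHom.coe_mk, Fintype.sum_prod_type, Equiv.refl_apply, Matrix.one_apply]
  by_cases h : x = c
  · subst h
    rw [Finset.sum_eq_single x]
    · simp
    · intro a _ ha
      simp [ha.symm]
    · simp
  · simp [h]

theorem rev_eq_of_extremal (hz : z.val + 1 = N) (ho : o.val = 0) : z.rev = o ∧ o.rev = z := by
  constructor <;> ext <;> rw [Fin.val_rev] <;> omega

theorem tailVec_last (hz : z.val + 1 = N) : tailVec g z = 0 := by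
  ext ⟨a, b⟩
  rw [tailVec_apply, if_neg]; · rfl
  have := b.2
  rw [Fin.lt_def]; omega

/-- No index follows the last one, so there is neither a triangular term nor a tail. The same
reason, with the first index on the right, gives `braidVec_first_right`. -/
theorem braidVec_last_left (hz : z.val + 1 = N) (b : Fin N) :
    braidVec g q z b = flipCoef q z b • pv F b z := by
  have h : ¬ z < b := by have := b.2; rw [Fin.lt_def]; omega
  rw [braidVec, tailVec_last hz, if_neg h]
  simp

theorem braidVec_first_right (hz : z.val + 1 = N) (ho : o.val = 0) (a : Fin N) :
    braidVec g q a o = flipCoef q a o • pv F o a := by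
  have h : ¬ a < o := by rw [Fin.lt_def]; omega
  rw [braidVec, if_neg h]
  by_cases h1 : a = o.rev
  · rw [(rev_eq_of_extremal hz ho).2] at h1
    subst h1
    rw [tailVec_last hz]; simp
  · rw [if_neg h1]; simp

/-- The tail beyond the first index omits only the term of that index from the invariant vector. -/
theorem tailVec_first (hz : z.val + 1 = N) (ho : o.val = 0) : tailVec g o = invVec g - g o • pv F z o := by
  ext ⟨a, b⟩
  rw [Pi.sub_apply, Pi.smul_apply, tailVec_apply, invVec_apply, pv_apply, smul_eq_mul]
  have h1 : o < b ↔ b ≠ o := by rw [Fin.lt_def, Ne, Fin.ext_iff]; omega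
  by_cases h : b = o
  · subst h
    rw [(rev_eq_of_extremal hz ho).2]
    simp
  · simp [h1, h]

end ExtremalVectors

section ExtremalRelations
variable {F : Type*} [Field F] {N : ℕ} {g : Fin N → F} {q : F} {z o : Fin N}

theorem braid_first_last (hz : z.val + 1 = N) (ho : o.val = 0) (hne : z ≠ o) :
    braidVec g q o z = q⁻¹ • pv F z o + (q - q⁻¹) • pv F o z -
      ((q - q⁻¹) * (g o)⁻¹) • (invVec g - g o • pv F z o) := by
  have h : o < z := by
    have : z.val ≠ o.val := fun h => hne (Fin.ext h)
    rw [Fin.lt_def]; omega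
  rw [braidVec, tailVec_first hz ho, flipCoef, if_pos h, (rev_eq_of_extremal hz ho).1, if_pos rfl,
    if_pos rfl, if_neg hne.symm]

theorem flipCoef_extremal (hz : z.val + 1 = N) (ho : o.val = 0) (hne : z ≠ o) :
    flipCoef q z o = q⁻¹ ∧ flipCoef q z z = q ∧ flipCoef q o o = q := by
  obtain ⟨h1, h2⟩ := rev_eq_of_extremal hz ho
  refine ⟨?_, ?_, ?_⟩ <;> simp [flipCoef, h1, h2, hne, hne.symm]

theorem contractVec_last_left (hz : z.val + 1 = N) (ho : o.val = 0) (b : Fin N) :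
    contractVec g z b = if b = o then (g z)⁻¹ • invVec g else 0 := by
  rw [contractVec]
  have : z = b.rev ↔ b = o := by
    rw [← (rev_eq_of_extremal hz ho).1]
    constructor <;> rintro rfl <;> simp
  simp only [this]
  split_ifs <;> simp

theorem contractVec_first_left (hz : z.val + 1 = N) (ho : o.val = 0) (b : Fin N) :
    contractVec g o b = if b = z then (g o)⁻¹ • invVec g else 0 := by
  rw [contractVec]
  have : o = b.rev ↔ b = z := by
    rw [← (rev_eq_of_extremal hz ho).2]
    constructor <;> rintro rfl <;> simp
  simp only [this]
  split_ifs <;> simp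

theorem contractVec_last_right (hz : z.val + 1 = N) (ho : o.val = 0) (a : Fin N) :
    contractVec g a z = if a = o then (g o)⁻¹ • invVec g else 0 := by
  rw [contractVec, (rev_eq_of_extremal hz ho).1]
  split_ifs with h
  · rw [h]
  · simp

theorem contractVec_first_right (hz : z.val + 1 = N) (ho : o.val = 0) (a : Fin N) :
    contractVec g a o = if a = z then (g z)⁻¹ • invVec g else 0 := by
  rw [contractVec, (rev_eq_of_extremal hz ho).2]
  split_ifs with h
  · rw [h]
  · simp

/-- S will be the centralizer of the quantum group and V a set of generating vectors: identities in
S need only be tested on V. -/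
theorem mul_of_mem_of_last {M : Type*} [Fintype M] [DecidableEq M]
    {S : Subring (Matrix M M F)} {V : Set (M → F)}
    (h0 : ∀ Y ∈ S, (∀ w ∈ V, Y.mulVec w = 0) → Y = 0) {A B : Matrix M M F} (hA : A ∈ S)
    (hB : B ∈ S) (h : ∀ w ∈ V, A.mulVec w = B.mulVec w) : A = B := by
  refine sub_eq_zero.1 (h0 _ (S.sub_mem hA hB) fun w hw => ?_)
  rw [Matrix.sub_mulVec, h w hw, sub_self]

/-- Both sides of the first two relations are compared on v_N ⊗ v_1, whose image under the braiding
is q⁻¹ v_1 ⊗ v_N. The third relation follows, because the quadratic relation makes E a polynomial in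
T. -/
theorem two_relations (hz : z.val + 1 = N) (ho : o.val = 0) (hne : z ≠ o) {ϱ : F}
    (hg : ∀ i, g i ≠ 0) (hq : q ≠ 0) (hδ : q - q⁻¹ ≠ 0) (hϱ : ϱ = q * g o * (g z)⁻¹)
    {S : Subring (Matrix (Fin N × Fin N) (Fin N × Fin N) F)}
    (hS : ∀ (c : F), ∀ Y ∈ S, c • Y ∈ S) (hT : pairMat (braidVec g q) ∈ S)
    (hE : pairMat (contractVec g) ∈ S)
    (h0 : ∀ Y ∈ S, (∀ w ∈ ({pv F z o} : Set _), Y.mulVec w = 0) → Y = 0) :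
    (pairMat (braidVec g q) * pairMat (braidVec g q) =
      1 + (q - q⁻¹) • pairMat (braidVec g q) - ((q - q⁻¹) * ϱ⁻¹) • pairMat (contractVec g)) ∧
    (pairMat (contractVec g) * pairMat (braidVec g q) = ϱ⁻¹ • pairMat (contractVec g)) ∧
    pairMat (braidVec g q) * pairMat (contractVec g) = ϱ⁻¹ • pairMat (contractVec g) := by
  have hgz := hg z
  have hgo := hg o
  have hϱ0 : ϱ ≠ 0 := by rw [hϱ]; positivity
  have hTT : pairMat (braidVec g q) * pairMat (braidVec g q) =
      1 + (q - q⁻¹) • pairMat (braidVec g q) - ((q - q⁻¹) * ϱ⁻¹) • pairMat (contractVec g) := by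
    refine mul_of_mem_of_last h0 (S.mul_mem hT hT)
      (S.sub_mem (S.add_mem S.one_mem (hS _ _ hT)) (hS _ _ hE)) ?_
    rintro w rfl
    rw [← Matrix.mulVec_mulVec, Matrix.sub_mulVec, Matrix.add_mulVec, Matrix.one_mulVec,
      Matrix.smul_mulVec, Matrix.smul_mulVec, pairMat_mulVec, pairMat_mulVec,
      braidVec_last_left hz, contractVec_last_left hz ho, if_pos rfl, Matrix.mulVec_smul,
      pairMat_mulVec, braid_first_last hz ho hne, (flipCoef_extremal hz ho hne).1, hϱ]
    match_scalars <;> field_simp <;> ring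
  have hET : pairMat (contractVec g) * pairMat (braidVec g q) = ϱ⁻¹ • pairMat (contractVec g) := by
    refine mul_of_mem_of_last h0 (S.mul_mem hE hT) (hS _ _ hE) ?_
    rintro w rfl
    rw [← Matrix.mulVec_mulVec, Matrix.smul_mulVec, pairMat_mulVec, pairMat_mulVec,
      braidVec_last_left hz, contractVec_last_left hz ho, if_pos rfl, Matrix.mulVec_smul,
      pairMat_mulVec, contractVec_first_left hz ho, if_pos rfl, (flipCoef_extremal hz ho hne).1, hϱ]
    match_scalars
    field_simp
  refine ⟨hTT, hET, ?_⟩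
  -- The multiple of E by (q - q⁻¹) ϱ⁻¹ is a polynomial in T; the scalar is nonzero here and is
  -- cancelled at the end.
  have hc : Commute (pairMat (braidVec g q)) (((q - q⁻¹) * ϱ⁻¹) • pairMat (contractVec g)) := by
    have h1 : ((q - q⁻¹) * ϱ⁻¹) • pairMat (contractVec g) =
        1 + (q - q⁻¹) • pairMat (braidVec g q) - pairMat (braidVec g q) * pairMat (braidVec g q) := by
      rw [hTT]; abel
    rw [h1]
    exact ((Commute.one_right _).add_right ((Commute.refl _).smul_right _)).sub_right
      ((Commute.refl _).mul_right (Commute.refl _))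
  have hc2 := hc.eq
  rw [mul_smul_comm, smul_mul_assoc] at hc2
  rw [← hET]
  exact smul_right_injective _ (mul_ne_zero hδ (inv_ne_zero hϱ0)) hc2

/-- On v_N ⊗ v_a ⊗ v_1 every braiding that occurs has v_N on its left or v_1 on its right, so it is
a flip up to a scalar. A contraction leaves a sum over the invariant vector, of which the next
contraction keeps a single term. -/
theorem three_relations (hz : z.val + 1 = N) (ho : o.val = 0) (hne : z ≠ o) {ϱ : F}
    (hg : ∀ i, g i ≠ 0) (hϱ : ϱ = q * g o * (g z)⁻¹)
    {S : Subring (Matrix (Fin N × Fin N × Fin N) (Fin N × Fin N × Fin N) F)}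
    (hS : ∀ (c : F), ∀ Y ∈ S, c • Y ∈ S)
    (hT₁ : firstTwo (pairMat (braidVec g q)) ∈ S) (hT₂ : lastTwo (pairMat (braidVec g q)) ∈ S)
    (hE₁ : firstTwo (pairMat (contractVec g)) ∈ S) (hE₂ : lastTwo (pairMat (contractVec g)) ∈ S)
    (h0 : ∀ Y ∈ S, (∀ w ∈ Set.range fun a => padRight o (pv F z a), Y.mulVec w = 0) → Y = 0)
    {T E : Matrix (Fin N × Fin N) (Fin N × Fin N) F} (hT : T = pairMat (braidVec g q))
    (hE : E = pairMat (contractVec g)) :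
    (firstTwo T * lastTwo T * firstTwo T = lastTwo T * firstTwo T * lastTwo T) ∧
    (firstTwo E * lastTwo T * firstTwo E = ϱ • firstTwo E) ∧
    (lastTwo E * firstTwo T * lastTwo E = ϱ • lastTwo E) ∧
    (firstTwo E * lastTwo E * firstTwo E = firstTwo E) ∧
    lastTwo E * firstTwo E * lastTwo E = lastTwo E := by
  have hgz := hg z
  have hgo := hg o
  rw [← hT] at hT₁ hT₂
  rw [← hE] at hE₁ hE₂
  obtain ⟨hzr, hor⟩ := rev_eq_of_extremal hz ho
  obtain ⟨s1, s2, s3⟩ := flipCoef_extremal (q := q) hz ho hne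
  have T₁ : ∀ a b c, (firstTwo T).mulVec (padRight c (pv F a b)) = padRight c (braidVec g q a b) := by
    intro a b c; rw [firstTwo_padRight, hT, pairMat_mulVec]
  have E₁ : ∀ a b c, (firstTwo E).mulVec (padRight c (pv F a b)) = padRight c (contractVec g a b) := by
    intro a b c; rw [firstTwo_padRight, hE, pairMat_mulVec]
  have T₂ : ∀ a b c, (lastTwo T).mulVec (padRight c (pv F a b)) = padLeft a (braidVec g q b c) := by
    intro a b c; rw [← padLeft_pv, lastTwo_padLeft, hT, pairMat_mulVec]
  have E₂ : ∀ a b c, (lastTwo E).mulVec (padRight c (pv F a b)) = padLeft a (contractVec g b c) := by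
    intro a b c; rw [← padLeft_pv, lastTwo_padLeft, hE, pairMat_mulVec]
  have hR : ∀ c, padRight c (invVec g) = ∑ i, g i • padRight c (pv F i.rev i) := by
    intro c; rw [invVec, map_sum]; simp only [map_smul]
  have hL : ∀ c, padLeft c (invVec g) = ∑ i, g i • padRight i (pv F c i.rev) := by
    intro c; rw [invVec, map_sum]; simp only [map_smul, padLeft_pv]
  have hrz : ∀ i : Fin N, i.rev = z ↔ i = o := fun i => by rw [← hor, Fin.rev_inj]
  have hro : ∀ i : Fin N, i.rev = o ↔ i = z := fun i => by rw [← hzr, Fin.rev_inj]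
  refine ⟨?_, ?_, ?_, ?_, ?_⟩
  · refine mul_of_mem_of_last h0 (S.mul_mem (S.mul_mem hT₁ hT₂) hT₁)
      (S.mul_mem (S.mul_mem hT₂ hT₁) hT₂) ?_
    rintro _ ⟨a, rfl⟩
    simp only [← Matrix.mulVec_mulVec]
    simp only [T₁, T₂, braidVec_last_left hz, braidVec_first_right hz ho, map_smul,
      Matrix.mulVec_smul, padLeft_pv, smul_smul]
    -- Both sides are multiples of v_1 ⊗ v_a ⊗ v_N, with the same three flip coefficients in
    -- opposite order.
    congr 1
    ring
  · refine mul_of_mem_of_last h0 (S.mul_mem (S.mul_mem hE₁ hT₂) hE₁) (hS _ _ hE₁) ?_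
    rintro _ ⟨a, rfl⟩
    simp only [← Matrix.mulVec_mulVec, Matrix.smul_mulVec]
    rw [E₁, contractVec_last_left hz ho]
    by_cases ha : a = o
    · rw [if_pos ha, map_smul, hR, Matrix.mulVec_smul, Matrix.mulVec_smul, Matrix.mulVec_sum,
        Matrix.mulVec_sum]
      simp only [Matrix.mulVec_smul, T₂, braidVec_first_right hz ho, map_smul, padLeft_pv, E₁,
        contractVec_first_right hz ho, hrz]
      -- The second contraction needs i' to be the last index. The surviving scalar is g_1 g_N⁻¹
      -- times the flip coefficient q, which is ϱ.
      rw [Finset.sum_eq_single o]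
      · simp only [if_true, map_smul, s3, ← hR, hϱ, smul_smul]
        congr 1
        field_simp
      · intro i _ hi
        simp [hi]
      · simp
    · simp [ha]
  · refine mul_of_mem_of_last h0 (S.mul_mem (S.mul_mem hE₂ hT₁) hE₂) (hS _ _ hE₂) ?_
    rintro _ ⟨a, rfl⟩
    simp only [← Matrix.mulVec_mulVec, Matrix.smul_mulVec]
    rw [E₂, contractVec_first_right hz ho]
    by_cases ha : a = z
    · rw [if_pos ha, map_smul, hL, Matrix.mulVec_smul, Matrix.mulVec_smul, Matrix.mulVec_sum,
        Matrix.mulVec_sum]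
      simp only [Matrix.mulVec_smul, T₁, braidVec_last_left hz, map_smul, E₂,
        contractVec_last_left hz ho]
      rw [Finset.sum_eq_single o]
      · simp only [if_true, map_smul, hor, s2, ← hL, hϱ, smul_smul]
        congr 1
        field_simp
      · intro i _ hi
        simp [hi]
      · simp
    · simp [ha]
  · refine mul_of_mem_of_last h0 (S.mul_mem (S.mul_mem hE₁ hE₂) hE₁) hE₁ ?_
    rintro _ ⟨a, rfl⟩
    simp only [← Matrix.mulVec_mulVec]
    rw [E₁, contractVec_last_left hz ho]
    by_cases ha : a = o
    · rw [if_pos ha, map_smul, hR, Matrix.mulVec_smul, Matrix.mulVec_smul, Matrix.mulVec_sum,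
        Matrix.mulVec_sum]
      simp only [Matrix.mulVec_smul, E₂, contractVec_first_right hz ho]
      -- Contracting v_i with v_1 forces i = N, and the third contraction then leaves the index 1.
      rw [Finset.sum_eq_single z]
      · rw [if_pos rfl, map_smul, hzr, hL, Matrix.mulVec_smul, Matrix.mulVec_sum]
        simp only [Matrix.mulVec_smul, E₁, contractVec_first_left hz ho, hrz]
        rw [Finset.sum_eq_single o]
        · simp only [if_true, map_smul, ← hR, smul_smul]
          congr 1
          field_simp
        · intro i _ hi
          simp [hi]
        · simp
      · intro i _ hi
        simp [hi]
      · simp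
    · simp [ha]
  · refine mul_of_mem_of_last h0 (S.mul_mem (S.mul_mem hE₂ hE₁) hE₂) hE₂ ?_
    rintro _ ⟨a, rfl⟩
    simp only [← Matrix.mulVec_mulVec]
    rw [E₂, contractVec_first_right hz ho]
    by_cases ha : a = z
    · rw [if_pos ha, map_smul, hL, Matrix.mulVec_smul, Matrix.mulVec_smul, Matrix.mulVec_sum,
        Matrix.mulVec_sum]
      simp only [Matrix.mulVec_smul, E₁, contractVec_last_left hz ho, hro]
      rw [Finset.sum_eq_single z]
      · rw [if_pos rfl, map_smul, hR, Matrix.mulVec_smul, Matrix.mulVec_sum]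
        simp only [Matrix.mulVec_smul, E₂, contractVec_last_right hz ho]
        rw [Finset.sum_eq_single o]
        · simp only [if_true, map_smul, hor, ← hL, smul_smul]
          congr 1
          field_simp
        · intro i _ hi
          simp [hi]
        · simp
      · intro i _ hi
        simp [hi]
      · simp
    · simp [ha]

end ExtremalRelations

/-! ### The relations over ℤ[v, v⁻¹] and over κ -/

section Integral
variable {X : Ty} {n : ℕ}

/-- The indeterminate as a unit of `ℤ[v, v⁻¹]`. -/
noncomputable def vL : LAˣ where
  val := T 1
  inv := T (-1)
  val_inv := by rw [← T_add]; simp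
  inv_val := by rw [← T_add]; simp

variable (X) in
/-- The element `q` of `ℤ[v, v⁻¹]`. -/
noncomputable def qL : LAˣ := vL ^ qExp X

variable (X n) in
/-- The parameter `ϱ` over `ℤ[v, v⁻¹]`. -/
noncomputable def varrhoL : LAˣ :=
  match X with
  | .B => qL .B ^ (2 * n : ℤ)
  | .C => -qL .C ^ (2 * n + 1 : ℤ)
  | .D => qL .D ^ (2 * n - 1 : ℤ)

/-- The coefficient `q^{ρ_b - ρ_k} ε_b ε_k` over `ℤ[v, v⁻¹]`. -/
noncomputable def contractCoefL (k b : Fin (X.dimV n)) : LA :=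
  ((vL ^ (rhoV X n b - rhoV X n k) : LAˣ) : LA) * (eps X n b * eps X n k : ℤ)

variable (X n) in
/-- The matrix of the braiding over `ℤ[v, v⁻¹]`. -/
noncomputable def braidL :
    Matrix (Fin (X.dimV n) × Fin (X.dimV n)) (Fin (X.dimV n) × Fin (X.dimV n)) LA :=
  Matrix.of fun p i =>
    (if p.1 = i.2 ∧ p.2 = i.1 then (if i.1 = i.2.rev then (if i.1 = i.2 then (1 : LA) else
      ((qL X)⁻¹ : LAˣ)) else if i.1 = i.2 then (qL X : LA) else (1 : LA)) else (0 : LA)) +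
      (if p.1 = i.1 ∧ p.2 = i.2 ∧ i.1 < i.2 then (qL X : LA) - ((qL X)⁻¹ : LAˣ) else 0) -
      if i.1 = i.2.rev ∧ p.1 = p.2.rev ∧ i.1 < p.2 then
        ((qL X : LA) - ((qL X)⁻¹ : LAˣ)) * contractCoefL i.1 p.2 else 0

variable (X n) in
/-- The matrix of the contraction over `ℤ[v, v⁻¹]`. -/
noncomputable def contractL :
    Matrix (Fin (X.dimV n) × Fin (X.dimV n)) (Fin (X.dimV n) × Fin (X.dimV n)) LA :=
  Matrix.of fun p i => if i.1 = i.2.rev ∧ p.1 = p.2.rev then contractCoefL i.1 p.2 else 0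

section Specialization
variable (κ : Type*) [Field κ] [Algebra LA κ]

variable (X n) in
/-- The matrix of the braiding. -/
noncomputable def braidMat :
    Matrix (Fin (X.dimV n) × Fin (X.dimV n)) (Fin (X.dimV n) × Fin (X.dimV n)) κ :=
  pairMat (imageR κ)

variable (X n) in
/-- The matrix of the contraction. -/
noncomputable def contractMat :
    Matrix (Fin (X.dimV n) × Fin (X.dimV n)) (Fin (X.dimV n) × Fin (X.dimV n)) κ :=
  pairMat (imageE κ)

theorem braidMat_eq : braidMat X n κ = pairMat (braidVec (gc κ) (qU X κ : κ)) := by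
  rw [braidMat]
  congr 1
  funext k l
  exact imageR_eq κ k l

theorem contractMat_eq : contractMat X n κ = pairMat (contractVec (gc κ)) := by
  rw [contractMat]
  congr 1
  funext k l
  exact imageE_eq κ k l

theorem map_vL : Units.map (algebraMap LA κ) vL = vU κ := Units.ext rfl

theorem map_qL : Units.map (algebraMap LA κ) (qL X) = qU X κ := by
  rw [qL, map_pow, map_vL, qU]

theorem map_varrhoL : Units.map (algebraMap LA κ) (varrhoL X n) = varrho X n κ := by
  have hneg : ∀ u : LAˣ, Units.map (algebraMap LA κ : LA →* κ) (-u) =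
      -Units.map (algebraMap LA κ : LA →* κ) u := fun u => Units.ext (by simp)
  cases X
  · rw [varrhoL, map_zpow, map_qL, varrho]
  · rw [varrhoL, hneg, map_zpow, map_qL, varrho]
  · rw [varrhoL, map_zpow, map_qL, varrho]

theorem map_qL_val : algebraMap LA κ (qL X : LA) = (qU X κ : κ) := by
  rw [← map_qL]; rfl

theorem map_qL_inv : algebraMap LA κ ((qL X)⁻¹ : LAˣ) = (qU X κ : κ)⁻¹ := by
  rw [← Units.val_inv_eq_inv_val, ← map_qL]; rfl

theorem map_contractCoefL (k b : Fin (X.dimV n)) :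
    algebraMap LA κ (contractCoefL k b) = (gc κ k)⁻¹ * gc κ b := by
  rw [← contractCoef_eq, contractCoef, contractCoefL, map_mul, map_intCast, ← map_vL, ← map_zpow]
  rfl

theorem map_braidL : (algebraMap LA κ).mapMatrix (braidL X n) = braidMat X n κ := by
  ext ⟨a, b⟩ ⟨k, l⟩
  rw [RingHom.mapMatrix_apply, Matrix.map_apply, braidL, Matrix.of_apply, braidMat_eq, pairMat,
    Matrix.of_apply, braidVec_apply, flipCoef]
  simp only [map_sub, map_add, apply_ite (algebraMap LA κ), map_zero, map_one, map_mul, map_qL_val,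
    map_qL_inv, map_contractCoefL, mul_assoc]

theorem map_contractL : (algebraMap LA κ).mapMatrix (contractL X n) = contractMat X n κ := by
  ext ⟨a, b⟩ ⟨k, l⟩
  rw [RingHom.mapMatrix_apply, Matrix.map_apply, contractL, Matrix.of_apply, contractMat_eq,
    pairMat, Matrix.of_apply, contractVec_apply]
  simp only [apply_ite (algebraMap LA κ), map_zero, map_contractCoefL]

end Specialization

/-- The identity that ties ϱ to ρ: since ρ_N = -ρ_1, it reads ϱ = ± q^{1 + 2ρ_1}, with the sign ε_1
ε_N. In type B exponents count powers of v with q = v². -/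
theorem varrho_eq (hn : X.minRank ≤ n) {z o : Fin (X.dimV n)} (hz : z.val + 1 = X.dimV n)
    (ho : o.val = 0) :
    (varrho X n QV : QV) = (qU X QV : QV) * gc QV o * (gc QV z)⁻¹ := by
  have hu : (vU QV : QV) ≠ 0 := Units.ne_zero _
  rw [mul_assoc, mul_comm (gc QV o), ← contractCoef_eq, contractCoef]
  have h : (rhoV X n o - rhoV X n z = match X with
      | .B => 4 * n - 2
      | .C => 2 * n
      | .D => 2 * n - 2) ∧ eps X n o * eps X n z = match X with
      | .B => 1
      | .C => -1
      | .D => 1 := by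
    have hN := dimV_eq X n
    cases X <;> simp only [Ty.minRank] at hn <;> simp only [] at hN <;>
      simp only [rhoV, eps] <;> constructor <;> (try split_ifs) <;> omega
  rw [h.1, h.2]
  cases X <;> simp only [varrho, qU, qExp, Units.val_zpow_eq_zpow_val, Units.val_pow_eq_pow_val,
    Units.val_neg, Int.cast_one, Int.cast_neg, mul_one, mul_neg, pow_one, neg_inj]
  · rw [← zpow_natCast, ← zpow_mul, ← zpow_add₀ hu]
    congr 1
    push_cast
    ring
  · rw [← zpow_one_add₀ hu]
    congr 1
    ring
  · rw [← zpow_one_add₀ hu]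
    congr 1
    ring

/-- `two_relations` and `three_relations` are applied with the centralizers of the quantum group on
V ⊗ V and on V ⊗ V ⊗ V. -/
theorem pairRel_QV (hn : X.minRank ≤ n) :
    PairRel (braidMat X n QV) (contractMat X n QV) (varrho X n QV) (qU X QV) := by
  have hN := two_mul_le_dimV X n
  have hn1 : 1 ≤ n := by cases X <;> simp only [Ty.minRank] at hn <;> omega
  let z : Fin (X.dimV n) := ⟨X.dimV n - 1, by omega⟩
  let o : Fin (X.dimV n) := ⟨0, by omega⟩
  have hz : z.val + 1 = X.dimV n := by simp only [z]; omega
  have ho : o.val = 0 := rfl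
  have hne : z ≠ o := by simp only [z, o, ne_eq, Fin.ext_iff]; omega
  have hzr := (rev_eq_of_extremal hz ho).1
  have hϱ := varrho_eq hn hz ho
  have hq : (qU X QV : QV) ≠ 0 := Units.ne_zero _
  -- Over ℚ(v) this holds because v is an indeterminate.
  have hδ : (qU X QV : QV) - (qU X QV : QV)⁻¹ ≠ 0 := by
    have h1 := qU_zpow (X := X) (-1)
    rw [zpow_neg_one] at h1
    rw [h1, qU_QV]
    have := v_sub_ne (d := qExp X) (by cases X <;> simp [qExp])
    simpa using this
  have hR := braidMat_eq (X := X) (n := n) QV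
  have hE := contractMat_eq (X := X) (n := n) QV
  have hcR : ∀ g, Commute (braidMat X n QV) (pairGen X g) := fun g => (commute_pairGen hn g).1
  have hcE : ∀ g, Commute (contractMat X n QV) (pairGen X g) := fun g => (commute_pairGen hn g).2
  rw [hR] at hcR
  rw [hE] at hcE
  have hcent : ∀ {α : Type} [Fintype α] [DecidableEq α] (s : Gen n → Matrix α α QV)
      (Y : Matrix α α QV), Y ∈ Subring.centralizer (Set.range s) ↔ ∀ g, Commute Y (s g) := by
    intro α _ _ s Y
    rw [Subring.mem_centralizer_iff]
    constructor
    · exact fun h g => (h _ ⟨g, rfl⟩).symm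
    · rintro h _ ⟨g, rfl⟩
      exact (h g).eq.symm
  have hsmul : ∀ {α : Type} [Fintype α] [DecidableEq α] (s : Gen n → Matrix α α QV) (c : QV),
      ∀ Y ∈ Subring.centralizer (Set.range s), c • Y ∈ Subring.centralizer (Set.range s) := by
    intro α _ _ s c Y hY
    rw [hcent] at hY ⊢
    exact fun g => (hY g).smul_left c
  have h2 := two_relations (S := Subring.centralizer (Set.range (pairGen X (n := n)))) hz ho hne
    (gc_ne_zero QV) hq hδ hϱ (hsmul _) ((hcent _ _).2 hcR) ((hcent _ _).2 hcE) (by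
      intro Y hY h
      refine pair_eq_zero hn ((hcent _ _).1 hY) hz fun p => ?_
      have := congrFun (h _ rfl) p
      rw [pv, Matrix.mulVec_single_one, ← hzr] at this
      exact this)
  have h3 := three_relations (S := Subring.centralizer (Set.range (tripleGen X (n := n)))) hz ho
    hne (gc_ne_zero QV) hϱ (hsmul _) ((hcent _ _).2 (commute_firstTwo hcR))
    ((hcent _ _).2 (commute_lastTwo hcR)) ((hcent _ _).2 (commute_firstTwo hcE))
    ((hcent _ _).2 (commute_lastTwo hcE)) (by
      intro Y hY h
      refine triple_eq_zero hn ((hcent _ _).1 hY) hz fun a p => ?_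
      have : Y.mulVec (padRight o (pv QV z a)) p = 0 := congrFun (h _ ⟨a, rfl⟩) p
      -- A product with a basis vector reads off a column of Y, which is the form that
      -- `triple_eq_zero` uses.
      have hs : padRight o (pv QV z a) = Pi.single (z, a, o) 1 := by
        ext ⟨x, y, t⟩
        simp only [padRight, LinearMap.coe_mk, AddHom.coe_mk, pv_apply, Pi.single_apply,
          Prod.mk.injEq]
        by_cases h1 : x = z <;> by_cases h2 : y = a <;> by_cases h3 : t = o <;> simp [h1, h2, h3]
      rw [hs, Matrix.mulVec_single_one, ← hzr] at this
      exact this) hR hE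
  rw [← hR, ← hE] at h2
  simp only [← Units.val_inv_eq_inv_val] at h2
  exact ⟨h2.1, h2.2.1, h2.2.2, h3.1, h3.2.1, h3.2.2.1, h3.2.2.2.1, h3.2.2.2.2⟩

theorem pairRel_L (hn : X.minRank ≤ n) :
    PairRel (braidL X n) (contractL X n) (varrhoL X n) (qL X) := by
  refine PairRel.of_map (algebraMap LA QV) (IsFractionRing.injective LA QV) ?_
  rw [map_braidL, map_contractL, map_varrhoL, map_qL]
  exact pairRel_QV hn

/-- As the relations hold over ℤ[v, v⁻¹], they hold for every image of v in κ. -/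
theorem pairRel (κ : Type*) [Field κ] [Algebra LA κ] (hn : X.minRank ≤ n) :
    PairRel (braidMat X n κ) (contractMat X n κ) (varrho X n κ) (qU X κ) := by
  rw [← map_braidL, ← map_contractL, ← map_varrhoL, ← map_qL]
  exact (pairRel_L hn).map _

end Integral

/-! ### Operators on neighbouring factors of a tensor power -/

section TensorPower
variable {R : Type*} [CommRing R] {ι : Type*} [Fintype ι] [DecidableEq ι]

/-- The action of a matrix on the tensor factors `m`, `m + 1` and `m + 2`. -/
def opMat₃ (P : Matrix (ι × ι × ι) (ι × ι × ι) R) :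
    (r m : ℕ) → Matrix (Fin r → ι) (Fin r → ι) R
  | r + 3, 0 => glue (split3 ι r) P 1
  | r + 1, m + 1 => glue (split1 ι r) 1 (opMat₃ P r m)
  | 2, 0 => 0
  | 1, 0 => 0
  | 0, _ => 0

theorem opMat₃_zero (P : Matrix (ι × ι × ι) (ι × ι × ι) R) (r : ℕ) :
    opMat₃ P (r + 3) 0 = glue (split3 ι r) P 1 := rfl

theorem opMat₃_succ (P : Matrix (ι × ι × ι) (ι × ι × ι) R) (r m : ℕ) :
    opMat₃ P (r + 1) (m + 1) = glue (split1 ι r) 1 (opMat₃ P r m) := by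
  rw [opMat₃]

theorem opMat_mul (P Q : Matrix (ι × ι) (ι × ι) R) {r m : ℕ} (h : m + 1 < r) :
    opMat P r m * opMat Q r m = opMat (P * Q) r m := by
  induction m generalizing r with
  | zero =>
    obtain ⟨r, rfl⟩ := Nat.exists_eq_add_of_le' h
    rw [opMat_zero, opMat_zero, opMat_zero, glue_mul, one_mul]
  | succ m ih =>
    obtain ⟨r, rfl⟩ := Nat.exists_eq_add_of_le' (show 1 ≤ r by omega)
    rw [opMat_succ, opMat_succ, opMat_succ, glue_mul, ih (by omega), one_mul]

/-- The bound on m excludes the default value 0 of `opMat`. -/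
theorem opMat_one {r m : ℕ} (h : m + 1 < r) : opMat (1 : Matrix (ι × ι) (ι × ι) R) r m = 1 := by
  induction m generalizing r with
  | zero =>
    obtain ⟨r, rfl⟩ := Nat.exists_eq_add_of_le' h
    rw [opMat_zero, glue_one]
  | succ m ih =>
    obtain ⟨r, rfl⟩ := Nat.exists_eq_add_of_le' (show 1 ≤ r by omega)
    rw [opMat_succ, ih (by omega), glue_one]

theorem opMat_add (P Q : Matrix (ι × ι) (ι × ι) R) {r m : ℕ} (h : m + 1 < r) :
    opMat (P + Q) r m = opMat P r m + opMat Q r m := by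
  induction m generalizing r with
  | zero =>
    obtain ⟨r, rfl⟩ := Nat.exists_eq_add_of_le' h
    rw [opMat_zero, opMat_zero, opMat_zero, glue_add_left]
  | succ m ih =>
    obtain ⟨r, rfl⟩ := Nat.exists_eq_add_of_le' (show 1 ≤ r by omega)
    rw [opMat_succ, opMat_succ, opMat_succ, ih (by omega), glue_add_right]

theorem opMat_smul (c : R) (P : Matrix (ι × ι) (ι × ι) R) {r m : ℕ} (h : m + 1 < r) :
    opMat (c • P) r m = c • opMat P r m := by
  induction m generalizing r with
  | zero =>
    obtain ⟨r, rfl⟩ := Nat.exists_eq_add_of_le' h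
    rw [opMat_zero, opMat_zero, glue_smul_left]
  | succ m ih =>
    obtain ⟨r, rfl⟩ := Nat.exists_eq_add_of_le' (show 1 ≤ r by omega)
    rw [opMat_succ, opMat_succ, ih (by omega), glue_smul_right]

theorem opMat₃_mul (P Q : Matrix (ι × ι × ι) (ι × ι × ι) R) {r m : ℕ} (h : m + 2 < r) :
    opMat₃ P r m * opMat₃ Q r m = opMat₃ (P * Q) r m := by
  induction m generalizing r with
  | zero =>
    obtain ⟨r, rfl⟩ := Nat.exists_eq_add_of_le' h
    rw [opMat₃_zero, opMat₃_zero, opMat₃_zero, glue_mul, one_mul]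
  | succ m ih =>
    obtain ⟨r, rfl⟩ := Nat.exists_eq_add_of_le' (show 1 ≤ r by omega)
    rw [opMat₃_succ, opMat₃_succ, opMat₃_succ, glue_mul, ih (by omega), one_mul]

theorem opMat₃_smul (c : R) (P : Matrix (ι × ι × ι) (ι × ι × ι) R) {r m : ℕ} (h : m + 2 < r) :
    opMat₃ (c • P) r m = c • opMat₃ P r m := by
  induction m generalizing r with
  | zero =>
    obtain ⟨r, rfl⟩ := Nat.exists_eq_add_of_le' h
    rw [opMat₃_zero, opMat₃_zero, glue_smul_left]
  | succ m ih =>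
    obtain ⟨r, rfl⟩ := Nat.exists_eq_add_of_le' (show 1 ≤ r by omega)
    rw [opMat₃_succ, opMat₃_succ, ih (by omega), glue_smul_right]

/-- Operators at positions m and m + 1 are both seen as operators on the same three factors, so an
identity on V ⊗ V ⊗ V holds at every position. -/
theorem opMat_eq_firstTwo (P : Matrix (ι × ι) (ι × ι) R) {r m : ℕ} (h : m + 2 < r) :
    opMat P r m = opMat₃ (firstTwo P) r m := by
  induction m generalizing r with
  | zero =>
    obtain ⟨r, rfl⟩ := Nat.exists_eq_add_of_le' h
    rw [opMat₃_zero, ← glue2_glue1, glue_one]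
    rfl
  | succ m ih =>
    obtain ⟨r, rfl⟩ := Nat.exists_eq_add_of_le' (show 1 ≤ r by omega)
    rw [opMat_succ, opMat₃_succ, ih (by omega)]

theorem opMat_eq_lastTwo (P : Matrix (ι × ι) (ι × ι) R) {r m : ℕ} (h : m + 2 < r) :
    opMat P r (m + 1) = opMat₃ (lastTwo P) r m := by
  induction m generalizing r with
  | zero =>
    obtain ⟨r, rfl⟩ := Nat.exists_eq_add_of_le' h
    rw [opMat₃_zero, opMat_succ, opMat_zero, glue1_glue2]
    rfl
  | succ m ih =>
    obtain ⟨r, rfl⟩ := Nat.exists_eq_add_of_le' (show 1 ≤ r by omega)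
    rw [opMat_succ, opMat₃_succ, ih (by omega)]

/-- After removal of the factors before m, one operator acts on the first two factors and the other
only on the rest. -/
theorem opMat_far (P Q : Matrix (ι × ι) (ι × ι) R) {r m k : ℕ} (h : m + 1 < k) (hk : k + 1 < r) :
    Commute (opMat P r m) (opMat Q r k) := by
  induction m generalizing r k with
  | zero =>
    obtain ⟨r, rfl⟩ := Nat.exists_eq_add_of_le' (show 2 ≤ r by omega)
    obtain ⟨k, rfl⟩ := Nat.exists_eq_add_of_le' (show 2 ≤ k by omega)
    rw [opMat_zero, opMat_succ, opMat_succ, glue1_glue1, Matrix.one_kronecker_one]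
    exact commute_glue (Commute.one_right _) (Commute.one_left _)
  | succ m ih =>
    obtain ⟨r, rfl⟩ := Nat.exists_eq_add_of_le' (show 1 ≤ r by omega)
    obtain ⟨k, rfl⟩ := Nat.exists_eq_add_of_le' (show 1 ≤ k by omega)
    rw [opMat_succ, opMat_succ]
    exact commute_glue (Commute.one_right _) (ih (by omega) (by omega))

theorem glue_map {S : Type*} [CommRing S] (f : R →+* S) {α β γ : Type*} [Fintype α] [Fintype β]
    [Fintype γ] [DecidableEq α] [DecidableEq β] [DecidableEq γ] (σ : γ ≃ α × β)
    (A : Matrix α α R) (M : Matrix β β R) :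
    f.mapMatrix (glue σ A M) = glue σ (f.mapMatrix A) (f.mapMatrix M) := by
  ext a b
  exact map_mul f _ _

theorem opMat_map {S : Type*} [CommRing S] (f : R →+* S) (P : Matrix (ι × ι) (ι × ι) R) {r m : ℕ}
    (h : m + 1 < r) : f.mapMatrix (opMat P r m) = opMat (f.mapMatrix P) r m := by
  induction m generalizing r with
  | zero =>
    obtain ⟨r, rfl⟩ := Nat.exists_eq_add_of_le' h
    rw [opMat_zero, opMat_zero, glue_map, map_one]
  | succ m ih =>
    obtain ⟨r, rfl⟩ := Nat.exists_eq_add_of_le' (show 1 ≤ r by omega)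
    rw [opMat_succ, opMat_succ, glue_map, map_one, ih (by omega)]

end TensorPower

/-! ### The defining relations of the Birman–Murakami–Wenzl algebra from those on few factors -/

section BirmanMurakamiWenzl
variable {R : Type*} [CommRing R] {ι : Type*} [Fintype ι] [DecidableEq ι]

/-- The quadratic relation says that (t - q)(t + q⁻¹) is a multiple of e, and e is killed by t -
ϱ⁻¹. -/
theorem cubic_of_quadratic {B : Type*} [Ring B] [Algebra R B] {ϱ q : Rˣ} {t e : B}
    (tt : t * t = 1 + ((q : R) - (q⁻¹ : Rˣ)) • t - (((q : R) - (q⁻¹ : Rˣ)) * (ϱ⁻¹ : Rˣ)) • e)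
    (et : e * t = ((ϱ⁻¹ : Rˣ) : R) • e) :
    (t - algebraMap R B q) * (t + algebraMap R B (q⁻¹ : Rˣ)) * (t - algebraMap R B (ϱ⁻¹ : Rˣ)) = 0 := by
  have h : (t - algebraMap R B q) * (t + algebraMap R B (q⁻¹ : Rˣ)) =
      -(((q : R) - (q⁻¹ : Rˣ)) * (ϱ⁻¹ : Rˣ)) • e := by
    simp only [Algebra.algebraMap_eq_smul_one, sub_mul, mul_add, tt, smul_mul_assoc, mul_smul_comm,
      one_mul, mul_one, smul_sub, smul_smul, q.inv_mul, q.mul_inv]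
    module
  rw [h, mul_sub, smul_mul_assoc, et, Algebra.algebraMap_eq_smul_one, mul_smul_comm, mul_one]
  module

/-- The inverse of `t` in the presence of the relations between braiding and contraction. -/
def skeinInv {B : Type*} [Ring B] [Algebra R B] (q : Rˣ) (t e : B) : B :=
  t - ((q : R) - (q⁻¹ : Rˣ)) • (1 - e)

theorem mul_skeinInv {B : Type*} [Ring B] [Algebra R B] {ϱ q : Rˣ} {t e : B}
    (tt : t * t = 1 + ((q : R) - (q⁻¹ : Rˣ)) • t - (((q : R) - (q⁻¹ : Rˣ)) * (ϱ⁻¹ : Rˣ)) • e)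
    (et : e * t = ((ϱ⁻¹ : Rˣ) : R) • e) (te : t * e = ((ϱ⁻¹ : Rˣ) : R) • e) :
    t * skeinInv q t e = 1 ∧ skeinInv q t e * t = 1 := by
  constructor
  · simp only [skeinInv, mul_sub, mul_smul_comm, tt, te, mul_one]
    module
  · simp only [skeinInv, sub_mul, smul_mul_assoc, tt, et, one_mul]
    module

/-- Expanding the inverse by the skein relation leaves ϱ e + δ e - δ e² with δ = q - q⁻¹. The same
expression times ϱ⁻¹ arises when e t² is computed through e t = ϱ⁻¹ e and through the quadratic
relation. Thus neither a formula for e² nor division by δ is needed. -/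
theorem mul_skeinInv_mul {B : Type*} [Ring B] [Algebra R B] {ϱ q : Rˣ} {t e t' e' : B}
    (tt : t * t = 1 + ((q : R) - (q⁻¹ : Rˣ)) • t - (((q : R) - (q⁻¹ : Rˣ)) * (ϱ⁻¹ : Rˣ)) • e)
    (et : e * t = ((ϱ⁻¹ : Rˣ) : R) • e) (ete : e * t' * e = (ϱ : R) • e) (eee : e * e' * e = e) :
    e * skeinInv q t' e' * e = ((ϱ⁻¹ : Rˣ) : R) • e := by
  have hϱ : (ϱ : R) * ((ϱ⁻¹ : Rˣ) : R) = 1 := ϱ.mul_inv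
  have h1 : e * t * t = ((ϱ⁻¹ : Rˣ) * (ϱ⁻¹ : Rˣ) : R) • e := by
    rw [et, smul_mul_assoc, et, smul_smul]
  have h2 : e * (t * t) = e + (((q : R) - (q⁻¹ : Rˣ)) * (ϱ⁻¹ : Rˣ)) • e -
      (((q : R) - (q⁻¹ : Rˣ)) * (ϱ⁻¹ : Rˣ)) • (e * e) := by
    rw [tt, mul_sub, mul_add, mul_smul_comm, mul_smul_comm, et, smul_smul, mul_one]
  -- The two values of e t² are equated and multiplied by ϱ.
  have h3 := congrArg ((ϱ : R) • ·) (h1.symm.trans ((mul_assoc e t t).trans h2))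
  simp only [smul_add, smul_sub, smul_smul] at h3
  have h4 : (ϱ : R) * (((q : R) - (q⁻¹ : Rˣ)) * (ϱ⁻¹ : Rˣ)) = (q : R) - (q⁻¹ : Rˣ) := by
    linear_combination ((q : R) - (q⁻¹ : Rˣ)) * hϱ
  have h5 : (ϱ : R) * ((ϱ⁻¹ : Rˣ) * (ϱ⁻¹ : Rˣ)) = (ϱ⁻¹ : Rˣ) := by
    linear_combination ((ϱ⁻¹ : Rˣ) : R) * hϱ
  rw [h4, h5] at h3
  rw [h3, skeinInv, mul_sub, sub_mul, ete, mul_smul_comm, smul_mul_assoc, mul_sub, sub_mul, eee,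
    mul_one]
  module

/-- The operators of the generators of the Birman-Murakami-Wenzl algebra. -/
def opGen (T E : Matrix (ι × ι) (ι × ι) R) (q : Rˣ) {r : ℕ} :
    BGen r → Matrix (Fin r → ι) (Fin r → ι) R
  | .T m => opMat T r m
  | .Tinv m => skeinInv q (opMat T r m) (opMat E r m)
  | .E m => opMat E r m

/-- Relations on one pair of factors come from V ⊗ V, those on adjacent pairs from V ⊗ V ⊗ V, and
distant pairs commute by `opMat_far`. -/
theorem PairRel.bRelOf {T E : Matrix (ι × ι) (ι × ι) R} {ϱ q : Rˣ} (h : PairRel T E ϱ q) {r : ℕ}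
    {x y : Matrix (Fin r → ι) (Fin r → ι) R} (hxy : BRelOf ϱ q (opGen T E q) x y) : x = y := by
  have tt : ∀ m : Fin (r - 1), opMat T r m * opMat T r m = 1 + ((q : R) - (q⁻¹ : Rˣ)) • opMat T r m -
      (((q : R) - (q⁻¹ : Rˣ)) * (ϱ⁻¹ : Rˣ)) • opMat E r m := by
    intro m
    have hm : m.val + 1 < r := by omega
    rw [opMat_mul _ _ hm, h.TT, sub_eq_add_neg, ← neg_smul, opMat_add _ _ hm, opMat_add _ _ hm,
      opMat_one hm, opMat_smul _ _ hm, opMat_smul _ _ hm, neg_smul, ← sub_eq_add_neg]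
  have et : ∀ m : Fin (r - 1), opMat E r m * opMat T r m = ((ϱ⁻¹ : Rˣ) : R) • opMat E r m := by
    intro m
    have hm : m.val + 1 < r := by omega
    rw [opMat_mul _ _ hm, h.ET, opMat_smul _ _ hm]
  have te : ∀ m : Fin (r - 1), opMat T r m * opMat E r m = ((ϱ⁻¹ : Rˣ) : R) • opMat E r m := by
    intro m
    have hm : m.val + 1 < r := by omega
    rw [opMat_mul _ _ hm, h.TE, opMat_smul _ _ hm]
  have ete : ∀ i j : Fin (r - 1), i.val + 1 = j.val ∨ j.val + 1 = i.val →
      opMat E r i * opMat T r j * opMat E r i = (ϱ : R) • opMat E r i := by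
    rintro i j (hij | hij)
    · have hm : i.val + 2 < r := by omega
      rw [← hij, opMat_eq_firstTwo _ hm, opMat_eq_lastTwo _ hm, opMat₃_mul _ _ hm,
        opMat₃_mul _ _ hm, h.ETE₁, opMat₃_smul _ _ hm]
    · have hm : j.val + 2 < r := by omega
      rw [← hij, opMat_eq_firstTwo _ hm, opMat_eq_lastTwo _ hm, opMat₃_mul _ _ hm,
        opMat₃_mul _ _ hm, h.ETE₂, opMat₃_smul _ _ hm]
  have eee : ∀ i j : Fin (r - 1), i.val + 1 = j.val ∨ j.val + 1 = i.val →
      opMat E r i * opMat E r j * opMat E r i = opMat E r i := by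
    rintro i j (hij | hij)
    · have hm : i.val + 2 < r := by omega
      rw [← hij, opMat_eq_firstTwo _ hm, opMat_eq_lastTwo _ hm, opMat₃_mul _ _ hm,
        opMat₃_mul _ _ hm, h.EEE₁]
    · have hm : j.val + 2 < r := by omega
      rw [← hij, opMat_eq_firstTwo _ hm, opMat_eq_lastTwo _ hm, opMat₃_mul _ _ hm,
        opMat₃_mul _ _ hm, h.EEE₂]
  cases hxy with
  | T_Tinv i => exact (mul_skeinInv (tt i) (et i) (te i)).1
  | Tinv_T i => exact (mul_skeinInv (tt i) (et i) (te i)).2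
  | skein i => exact sub_sub_cancel _ _
  | cubic i => exact cubic_of_quadratic (tt i) (et i)
  | braid i j hij =>
    have hm : i.val + 2 < r := by omega
    simp only [opGen]
    rw [← hij, opMat_eq_firstTwo _ hm, opMat_eq_lastTwo _ hm, opMat₃_mul _ _ hm,
      opMat₃_mul _ _ hm, opMat₃_mul _ _ hm, opMat₃_mul _ _ hm, h.braid]
  | far i j hij =>
    rcases hij with hij | hij
    · exact opMat_far _ _ hij (by omega)
    · exact (opMat_far _ _ hij (by omega)).symm
  | ETE i j hij => exact ete i j hij
  | ETinvE i j hij => exact mul_skeinInv_mul (tt i) (et i) (ete i j hij) (eee i j hij)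
  | ET i => exact et i
  | TE i => exact te i

end BirmanMurakamiWenzl

/-! ### Passage from ℚ(v) to κ through the local ring -/

section Specialize
variable {X : Ty} {n : ℕ} {κ : Type*} [Field κ] [Algebra LA κ]

/-- The base change of an integral matrix. -/
noncomputable def baseMat (S : Type*) [CommRing S] [Algebra LA S] {α : Type*} [Fintype α]
    [DecidableEq α] (M : Matrix α α LA) : Matrix α α S := (algebraMap LA S).mapMatrix M

theorem val_latticeRep (hn : X.minRank ≤ n) (hq : (qU X κ : κ) ^ 2 ≠ 1) (r : ℕ)
    (u : AForm X n) : (algebraMap (locRing κ) QV).mapMatrix (latticeRep κ hn hq r u) =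
      tensorRep hn r (u : Uq X n) := rfl

theorem map_baseMat {S S' : Type*} [CommRing S] [Algebra LA S] [CommRing S'] [Algebra LA S']
    (f : S →+* S') (hf : f.comp (algebraMap LA S) = algebraMap LA S')
    {α : Type*} [Fintype α] [DecidableEq α] (M : Matrix α α LA) :
    f.mapMatrix (baseMat S M) = baseMat S' M := by
  ext a b
  exact congrArg (fun g : LA →+* S' => g (M a b)) hf

theorem specialize_baseMat {α : Type*} [Fintype α] [DecidableEq α] (M : Matrix α α LA) :
    ((specialize κ : locRing κ →ₐ[LA] κ) : locRing κ →+* κ).mapMatrix (baseMat (locRing κ) M) =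
      baseMat κ M :=
  map_baseMat _ (specialize κ).comp_algebraMap M

theorem val_baseMat {α : Type*} [Fintype α] [DecidableEq α] (M : Matrix α α LA) :
    (algebraMap (locRing κ) QV).mapMatrix (baseMat (locRing κ) M) = baseMat QV M :=
  map_baseMat _ rfl M

theorem val_injective {α : Type*} [Fintype α] [DecidableEq α] :
    Function.Injective ((algebraMap (locRing κ) QV).mapMatrix :
      Matrix α α (locRing κ) →+* Matrix α α QV) :=
  mapMatrix_injective Subtype.val_injective α

theorem matrixAction_tmul (hn : X.minRank ≤ n) (hq : (qU X κ : κ) ^ 2 ≠ 1) (r : ℕ) (c : κ)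
    (u : AForm X n) : matrixAction κ hn hq r (c ⊗ₜ u) =
      c • ((specialize κ : locRing κ →ₐ[LA] κ) : locRing κ →+* κ).mapMatrix
        (latticeRep κ hn hq r u) := by
  refine (Algebra.TensorProduct.lift_tmul _ _ _ _ _).trans ?_
  rw [Algebra.ofId_apply, Algebra.algebraMap_eq_smul_one, smul_mul_assoc, one_mul]
  rfl

/-- For integral A and u in the integral form both matrices have entries in `locRing κ`. The
identity holds there because that ring lies in ℚ(v), and it is then specialized entrywise. -/
theorem commute_matrixAction (hn : X.minRank ≤ n) (hq : (qU X κ : κ) ^ 2 ≠ 1) (r : ℕ)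
    {A : Matrix (Fin r → Fin (X.dimV n)) (Fin r → Fin (X.dimV n)) LA}
    (h : ∀ u, Commute (baseMat QV A) (tensorRep hn r u)) (w : UK X n κ) :
    Commute (baseMat κ A) (matrixAction κ hn hq r w) := by
  induction w using TensorProduct.induction_on with
  | zero => rw [map_zero]; exact Commute.zero_right _
  | add a b ha hb => rw [map_add]; exact ha.add_right hb
  | tmul c u =>
    rw [matrixAction_tmul, ← specialize_baseMat]
    refine Commute.smul_right (Commute.map ?_ (RingHom.mapMatrix _)) c
    refine val_injective ?_
    rw [map_mul, map_mul, val_baseMat, val_latticeRep]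
    exact h u

/-- The same descent for the adjointness identity. The base change of θ acts on c ⊗ u through u
only, so pure tensors suffice. -/
theorem transpose_matrixAction (hn : X.minRank ≤ n) (hq : (qU X κ : κ) ^ 2 ≠ 1) (r : ℕ)
    {J : Matrix (Fin r → Fin (X.dimV n)) (Fin r → Fin (X.dimV n)) LA}
    (θ : Uq X n →ₐ[QV] (Uq X n)ᵐᵒᵖ) (hθ : ∀ {u}, u ∈ AForm X n → (θ u).unop ∈ AForm X n)
    (h : ∀ u, (tensorRep hn r u).transpose * baseMat QV J =
      baseMat QV J * tensorRep hn r (θ u).unop) (w : UK X n κ) :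
    (matrixAction κ hn hq r w).transpose * baseMat κ J =
      baseMat κ J * matrixAction κ hn hq r (baseOp X n κ (restrictOp X n θ hθ) w).unop := by
  induction w using TensorProduct.induction_on with
  | zero => simp
  | add a b ha hb =>
    simp only [map_add, Matrix.transpose_add, MulOpposite.unop_add, add_mul, mul_add, ha, hb]
  | tmul c u =>
    have h1 : (baseOp X n κ (restrictOp X n θ hθ) (c ⊗ₜ u)).unop =
        c ⊗ₜ (⟨(θ u).unop, hθ u.2⟩ : AForm X n) := by
      refine (congrArg MulOpposite.unop (Algebra.TensorProduct.lift_tmul _ _ _ _ _)).trans ?_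
      rw [Algebra.ofId_apply, Algebra.algebraMap_eq_smul_one, smul_mul_assoc, one_mul,
        MulOpposite.unop_smul]
      change c • (1 : κ) ⊗ₜ[LA] (⟨(θ u).unop, hθ u.2⟩ : AForm X n) = _
      rw [TensorProduct.smul_tmul', smul_eq_mul, mul_one]
    rw [h1, matrixAction_tmul, matrixAction_tmul, Matrix.transpose_smul, smul_mul_assoc,
      mul_smul_comm, ← specialize_baseMat]
    congr 1
    have h2 : (latticeRep κ hn hq r u).transpose * baseMat (locRing κ) J =
        baseMat (locRing κ) J * latticeRep κ hn hq r ⟨(θ u).unop, hθ u.2⟩ := by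
      refine val_injective ?_
      rw [map_mul, map_mul, val_baseMat, val_latticeRep]
      exact h u
    have h3 := congrArg
      ((specialize κ : locRing κ →ₐ[LA] κ) : locRing κ →+* κ).mapMatrix h2
    rwa [map_mul, map_mul] at h3

/-- Transposition and θ both reverse products, so the adjointness identity is multiplicative and
need only be checked on generators. -/
theorem transpose_tensorRep (hn : X.minRank ≤ n) (r : ℕ)
    {J : Matrix (Fin r → Fin (X.dimV n)) (Fin r → Fin (X.dimV n)) QV}
    (θ : Uq X n →ₐ[QV] (Uq X n)ᵐᵒᵖ)
    (h : ∀ g, (tensorRep hn r (gen X g)).transpose * J = J * tensorRep hn r (θ (gen X g)).unop)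
    (u : Uq X n) : (tensorRep hn r u).transpose * J = J * tensorRep hn r (θ u).unop := by
  induction u using Uq.induction with
  | h0 c =>
    rw [AlgHom.commutes, AlgHom.commutes, MulOpposite.algebraMap_apply, MulOpposite.unop_op,
      AlgHom.commutes, Matrix.algebraMap_eq_diagonal, Matrix.diagonal_transpose,
      ← Matrix.algebraMap_eq_diagonal]
    exact Algebra.commutes c J
  | hg g => exact h g
  | hadd a b ha hb =>
    simp only [map_add, Matrix.transpose_add, MulOpposite.unop_add, add_mul, mul_add, ha, hb]
  | hmul a b ha hb =>
    rw [map_mul, map_mul, MulOpposite.unop_mul, map_mul, Matrix.transpose_mul, mul_assoc, ha,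
      ← mul_assoc, hb, mul_assoc]

end Specialize

/-! ### Columns of an operator on two neighbouring factors -/

section Operators
variable {R : Type*} [CommRing R] {ι : Type*} [Fintype ι] [DecidableEq ι]

/-- Connects the recursive matrix with the updating of two entries in `opAt`. A general φ lets the
induction absorb the first factor; it is later a basis (`toLin_opMat`) or an indicator function
(`opMat_apply`). -/
theorem sum_opMat_smul (P : Matrix (ι × ι) (ι × ι) R) {M : Type*} [AddCommGroup M] [Module R M]
    {r m : ℕ} (h : m + 1 < r) (i : Fin r → ι) (φ : (Fin r → ι) → M) :
    ∑ a, opMat P r m a i • φ a =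
      ∑ p, P p (i ⟨m, by omega⟩, i ⟨m + 1, h⟩) •
        φ (Function.update (Function.update i ⟨m, by omega⟩ p.1) ⟨m + 1, h⟩ p.2) := by
  induction m generalizing r with
  | zero =>
    obtain ⟨r, rfl⟩ := Nat.exists_eq_add_of_le' h
    rw [← (split2 ι r).symm.sum_comp, Fintype.sum_prod_type]
    refine Finset.sum_congr rfl fun p _ => ?_
    rw [Finset.sum_eq_single (split2 ι r i).2]
    · rw [opMat_zero, glue_apply, Equiv.apply_symm_apply, Matrix.one_apply_eq, mul_one]
      congr 2
      funext x
      refine Fin.cases ?_ (fun x => ?_) x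
      · rfl
      · refine Fin.cases ?_ (fun x => ?_) x
        · rfl
        · rfl
    · intro b _ hb
      rw [opMat_zero, glue_apply, Equiv.apply_symm_apply, Matrix.one_apply_ne hb, mul_zero,
        zero_smul]
    · simp
  | succ m ih =>
    obtain ⟨r, rfl⟩ := Nat.exists_eq_add_of_le' (show 1 ≤ r by omega)
    rw [← (split1 ι r).symm.sum_comp, Fintype.sum_prod_type, Finset.sum_eq_single (i 0)]
    · have h1 := ih (by omega) (fun x => i x.succ) fun b => φ (Fin.cons (i 0) b : Fin (r + 1) → ι)
      refine Eq.trans (Finset.sum_congr rfl fun b _ => ?_) (h1.trans ?_)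
      · rw [opMat_succ, glue_apply, Equiv.apply_symm_apply]
        change ((1 : Matrix ι ι R) (i 0) (i 0) * _) • _ = _
        rw [Matrix.one_apply_eq, one_mul]
        rfl
      · refine Finset.sum_congr rfl fun p _ => ?_
        congr 2
        funext x
        refine Fin.cases ?_ (fun x => ?_) x
        · rw [Fin.cons_zero, Function.update_of_ne (by simp [Fin.ext_iff]),
            Function.update_of_ne (by simp [Fin.ext_iff])]
        · rw [Fin.cons_succ]
          simp only [Function.update_apply, Fin.ext_iff, Fin.val_succ, Nat.add_right_cancel_iff]
    · intro a _ ha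
      refine Finset.sum_eq_zero fun b _ => ?_
      rw [opMat_succ, glue_apply, Equiv.apply_symm_apply]
      change ((1 : Matrix ι ι R) a (i 0) * _) • _ = _
      rw [Matrix.one_apply_ne ha, zero_mul, zero_smul]
    · simp

end Operators

/-! ### The bimodule structure, and a criterion for isomorphism with the dual -/

section TensorBimodule
variable {X : Ty} {n : ℕ} {κ : Type*} [Field κ] [Algebra LA κ] {r : ℕ}

theorem toLin_opMat (c : Fin (X.dimV n) → Fin (X.dimV n) → Fin (X.dimV n) × Fin (X.dimV n) → κ)
    (m : Fin (r - 1)) :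
    Matrix.toLinAlgEquiv (vBasis X n κ r) (opMat (pairMat c) r m) = opAt κ r c m := by
  refine (vBasis X n κ r).ext fun i => ?_
  rw [Matrix.toLinAlgEquiv_self, opAt, Module.Basis.constr_basis]
  exact sum_opMat_smul (pairMat c) (by omega) i fun a => vBasis X n κ r a

theorem baseMat_opMat (S : Type*) [CommRing S] [Algebra LA S]
    (P : Matrix (Fin (X.dimV n) × Fin (X.dimV n)) (Fin (X.dimV n) × Fin (X.dimV n)) LA) {m : ℕ}
    (h : m + 1 < r) : baseMat S (opMat P r m) = opMat (baseMat S P) r m := opMat_map _ _ h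

/-- Induction on the elements of the Birman-Murakami-Wenzl algebra. -/
theorem BMW.induction {R : Type*} [CommRing R] {ϱ q : Rˣ} {p : BMW R ϱ q r → Prop}
    (h0 : ∀ c : R, p (algebraMap R _ c)) (hg : ∀ g, p (bgen R ϱ q g))
    (hadd : ∀ a b, p a → p b → p (a + b)) (hmul : ∀ a b, p a → p b → p (a * b))
    (u : BMW R ϱ q r) : p u := by
  obtain ⟨w, rfl⟩ := RingQuot.mkAlgHom_surjective R (BRelOf ϱ q (FreeAlgebra.ι R (X := BGen r))) u
  induction w using FreeAlgebra.induction with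
  | grade0 c => rw [AlgHom.commutes]; exact h0 c
  | grade1 g => exact hg g
  | mul a b ha hb => rw [map_mul]; exact hmul _ _ ha hb
  | add a b ha hb => rw [map_add]; exact hadd _ _ ha hb

variable (κ r) in
/-- The matrices of the right action of the Birman-Murakami-Wenzl algebra. -/
noncomputable def bmwMat (hn : X.minRank ≤ n) :
    BMWK X n κ r →ₐ[κ] (Matrix (Fin r → Fin (X.dimV n)) (Fin r → Fin (X.dimV n)) κ)ᵐᵒᵖ :=
  liftBMW (fun z => .op (opGen (braidMat X n κ) (contractMat X n κ) (qU X κ) z))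
    -- A right action reverses products; the relations are stable under reversal, so they hold in
    -- the opposite matrix algebra as well.
    fun _ _ h => h.op fun _ _ h' => (pairRel κ hn).bRelOf h'

theorem bmwMat_bgen (hn : X.minRank ≤ n) (z : BGen r) : (bmwMat κ r hn (bgen κ _ _ z)).unop =
    opGen (braidMat X n κ) (contractMat X n κ) (qU X κ) z :=
  congrArg MulOpposite.unop (liftBMW_bgen _ _ z)

/-- Commutation is needed for T_m and E_m only, since the inverse of T_m is a combination of these
and 1; both are specializations of integral matrices that commute over ℚ(v). -/
theorem commute_bmwMat (hn : X.minRank ≤ n) (hq : (qU X κ : κ) ^ 2 ≠ 1) (b : BMWK X n κ r)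
    (w : UK X n κ) : Commute (bmwMat κ r hn b).unop (matrixAction κ hn hq r w) := by
  induction b using BMW.induction with
  | h0 c => rw [AlgHom.commutes]; exact Algebra.commutes c _
  | hadd a b ha hb => rw [map_add]; exact ha.add_left hb
  | hmul a b ha hb => rw [map_mul]; exact hb.mul_left ha
  | hg z =>
    have hT : ∀ m : Fin (r - 1), Commute (opMat (braidMat X n κ) r m)
        (matrixAction κ hn hq r w) := by
      intro m
      rw [← map_braidL]
      change Commute (opMat (baseMat κ (braidL X n)) r m) _
      rw [← baseMat_opMat _ _ (by omega)]
      refine commute_matrixAction hn hq r (fun u => ?_) w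
      rw [baseMat_opMat _ _ (by omega), baseMat, map_braidL]
      exact commute_tensorRep hn (fun g => (commute_pairGen hn g).1) r m u
    have hE : ∀ m : Fin (r - 1), Commute (opMat (contractMat X n κ) r m)
        (matrixAction κ hn hq r w) := by
      intro m
      rw [← map_contractL]
      change Commute (opMat (baseMat κ (contractL X n)) r m) _
      rw [← baseMat_opMat _ _ (by omega)]
      refine commute_matrixAction hn hq r (fun u => ?_) w
      rw [baseMat_opMat _ _ (by omega), baseMat, map_contractL]
      exact commute_tensorRep hn (fun g => (commute_pairGen hn g).2) r m u
    rw [bmwMat_bgen]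
    cases z with
    | T m => exact hT m
    | Tinv m => exact (hT m).sub_left (((Commute.one_left _).sub_left (hE m)).smul_left _)
    | E m => exact hE m

variable (κ r) in
/-- The right action of the Birman-Murakami-Wenzl algebra. -/
noncomputable def actBMW (hn : X.minRank ≤ n) :
    BMWK X n κ r →ₐ[κ] (Module.End κ (TV X n κ r))ᵐᵒᵖ :=
  (AlgHom.op (Matrix.toLinAlgEquiv (vBasis X n κ r)).toAlgHom).comp (bmwMat κ r hn)

theorem unop_actBMW (hn : X.minRank ≤ n) (b : BMWK X n κ r) : (actBMW κ r hn b).unop =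
    Matrix.toLinAlgEquiv (vBasis X n κ r) (bmwMat κ r hn b).unop := rfl

theorem actU_eq (hn : X.minRank ≤ n) (hq : (qU X κ : κ) ^ 2 ≠ 1) (w : UK X n κ) :
    actU κ r hn hq w = Matrix.toLinAlgEquiv (vBasis X n κ r) (matrixAction κ hn hq r w) := rfl

variable (κ r) in
/-- The bimodule structure on the tensor space. -/
noncomputable def tensorBimodule (hn : X.minRank ≤ n) (hq : (qU X κ : κ) ^ 2 ≠ 1) :
    Bimodule κ (UK X n κ) (BMWK X n κ r) (TV X n κ r) where
  left := actU κ r hn hq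
  right := actBMW κ r hn
  comm a b x := by
    rw [unop_actBMW, actU_eq, ← Module.End.mul_apply, ← Module.End.mul_apply, ← map_mul,
      ← map_mul, (commute_bmwMat hn hq b a).eq]

theorem isTensorBimodule (hn : X.minRank ≤ n) (hq : (qU X κ : κ) ^ 2 ≠ 1) :
    IsTensorBimodule hn hq (tensorBimodule κ r hn hq) := by
  refine ⟨rfl, fun m => ?_, fun m => ?_⟩
  · change (actBMW κ r hn _).unop = _
    rw [unop_actBMW, bmwMat_bgen]
    exact toLin_opMat _ m
  · change (actBMW κ r hn _).unop = _
    rw [unop_actBMW, bmwMat_bgen]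
    exact toLin_opMat _ m

theorem toBilin_eq_dotProduct {α M : Type*} [Fintype α] [DecidableEq α] [AddCommGroup M]
    [Module κ M] (b : Module.Basis α κ M) (J : Matrix α α κ) (x y : M) :
    Matrix.toBilin b J x y = b.repr x ⬝ᵥ J.mulVec (b.repr y) := by
  rw [Matrix.toBilin_apply]
  simp only [dotProduct, Matrix.mulVec, Finset.mul_sum, mul_assoc]

/-- The matrix identity says that A and A' are adjoint for the form with Gram matrix J. -/
theorem toBilin_toLin_left {α M : Type*} [Fintype α] [DecidableEq α] [AddCommGroup M]
    [Module κ M] (b : Module.Basis α κ M) {J A A' : Matrix α α κ}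
    (h : A.transpose * J = J * A') (x y : M) :
    Matrix.toBilin b J (Matrix.toLinAlgEquiv b A x) y =
      Matrix.toBilin b J x (Matrix.toLinAlgEquiv b A' y) := by
  have h1 : ∀ (C : Matrix α α κ) (z : M),
      (b.repr (Matrix.toLinAlgEquiv b C z) : α → κ) = C.mulVec (b.repr z) :=
    fun C z => Matrix.repr_toLin b b C z
  rw [toBilin_eq_dotProduct, toBilin_eq_dotProduct, h1, h1, Matrix.mulVec_mulVec, ← h,
    ← Matrix.mulVec_mulVec, Matrix.dotProduct_transpose_mulVec, dotProduct_comm]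

/-- The left and the right hypothesis express adjointness of each action with its twist by the
anti-homomorphism. For the Birman–Murakami–Wenzl algebra generators suffice, because the set of good
elements is closed under sums and products. -/
theorem exists_isHom_dual (hn : X.minRank ≤ n) (hq : (qU X κ : κ) ^ 2 ≠ 1)
    {J : Matrix (Fin r → Fin (X.dimV n)) (Fin r → Fin (X.dimV n)) κ}
    (hJ : (Matrix.toBilin (vBasis X n κ r) J).Nondegenerate)
    (θ : UK X n κ →ₐ[κ] (UK X n κ)ᵐᵒᵖ) (φ : BMWK X n κ r →ₐ[κ] (BMWK X n κ r)ᵐᵒᵖ)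
    (hθ : ∀ w, (matrixAction κ hn hq r w).transpose * J = J * matrixAction κ hn hq r (θ w).unop)
    (hφ : ∀ z, (bmwMat κ r hn (bgen κ _ _ z)).unop.transpose * J =
      J * (bmwMat κ r hn (φ (bgen κ _ _ z)).unop).unop) :
    ∃ Φ : TV X n κ r ≃ₗ[κ] Module.Dual κ (TV X n κ r),
      (∀ x y, Φ x y = Matrix.toBilin (vBasis X n κ r) J x y) ∧
      (tensorBimodule κ r hn hq).IsHom ((tensorBimodule κ r hn hq).dual θ φ) Φ.toLinearMap := by
  have : FiniteDimensional κ (TV X n κ r) := Module.Finite.of_basis (vBasis X n κ r)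
  have hφ' : ∀ b, (bmwMat κ r hn b).unop.transpose * J = J * (bmwMat κ r hn (φ b).unop).unop := by
    intro b
    induction b using BMW.induction with
    | h0 c =>
      rw [AlgHom.commutes, AlgHom.commutes, MulOpposite.algebraMap_apply,
        MulOpposite.algebraMap_apply, MulOpposite.unop_op, MulOpposite.unop_op, AlgHom.commutes,
        MulOpposite.algebraMap_apply, MulOpposite.unop_op, Matrix.algebraMap_eq_diagonal,
        Matrix.diagonal_transpose, ← Matrix.algebraMap_eq_diagonal]
      exact Algebra.commutes c J
    | hg z => exact hφ z
    | hadd a b ha hb =>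
      simp only [map_add, Matrix.transpose_add, MulOpposite.unop_add, add_mul, mul_add, ha, hb]
    | hmul a b ha hb =>
      -- Products are reversed by transposition and by φ, and once on each side by the right action,
      -- so the factors match up.
      rw [map_mul, map_mul, MulOpposite.unop_mul, MulOpposite.unop_mul, map_mul,
        MulOpposite.unop_mul, Matrix.transpose_mul, mul_assoc, hb, ← mul_assoc, ha, mul_assoc]
  refine ⟨(Matrix.toBilin (vBasis X n κ r) J).toDual hJ, fun x y => rfl, fun a x => ?_,
    fun b x => ?_⟩
  · refine LinearMap.ext fun y => ?_
    exact toBilin_toLin_left (vBasis X n κ r) (hθ a) x y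
  · refine LinearMap.ext fun y => ?_
    exact toBilin_toLin_left (vBasis X n κ r) (hφ' b) x y

end TensorBimodule

/-! ### Iterated coproducts of root vectors -/

section SkewPrimitive
variable {F : Type*} [Field F] {ι : Type*} [Fintype ι] [DecidableEq ι]

/-- The factor at position `t` of the summand `K ⊗ ⋯ ⊗ K ⊗ E ⊗ K' ⊗ ⋯ ⊗ K'` with `E` at
position `s`. -/
def leg (K K' : ι → F) (E : Matrix ι ι F) {r : ℕ} (s t : Fin r) : Matrix ι ι F :=
  if t < s then Matrix.diagonal K else if t = s then E else Matrix.diagonal K'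

/-- The sum of all `K ⊗ ⋯ ⊗ K ⊗ E ⊗ K' ⊗ ⋯ ⊗ K'`. -/
def skewSum (K K' : ι → F) (E : Matrix ι ι F) (r : ℕ) : Matrix (Fin r → ι) (Fin r → ι) F :=
  Matrix.of fun y x => ∑ s, ∏ t, leg K K' E s t (y t) (x t)

theorem prod_diagonal (K : ι → F) {r : ℕ} (y x : Fin r → ι) :
    ∏ t, Matrix.diagonal K (y t) (x t) = Matrix.diagonal (fun b : Fin r → ι => ∏ t, K (b t)) y x := by
  rw [Matrix.diagonal_apply]
  split_ifs with h
  · subst h; simp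
  · obtain ⟨t, ht⟩ := Function.ne_iff.1 h
    exact Finset.prod_eq_zero (Finset.mem_univ t) (Matrix.diagonal_apply_ne _ ht)

theorem skewSum_zero (K K' : ι → F) (E : Matrix ι ι F) : skewSum K K' E 0 = 0 := by
  ext y x
  simp [skewSum]

/-- The summand with E in the first place is split off. This matches the recursion of the coproduct
on V ⊗ V^{⊗ r}. -/
theorem skewSum_succ (K K' : ι → F) (E : Matrix ι ι F) (r : ℕ) : skewSum K K' E (r + 1) =
    glue (split1 ι r) E (Matrix.diagonal fun b => ∏ t, K' (b t)) +
      glue (split1 ι r) (Matrix.diagonal K) (skewSum K K' E r) := by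
  ext y x
  rw [Matrix.add_apply, glue_apply, glue_apply, ← prod_diagonal, skewSum, Matrix.of_apply,
    Fin.sum_univ_succ, Fin.prod_univ_succ, skewSum, Matrix.of_apply, Finset.mul_sum]
  simp only [Fin.prod_univ_succ]
  refine congrArg₂ (· + ·) rfl (Finset.sum_congr rfl fun s _ => congrArg₂ (· * ·) rfl ?_)
  refine Finset.prod_congr rfl fun t _ => ?_
  simp only [leg, Fin.succ_lt_succ_iff, Fin.succ_inj]
  rfl

/-- Factorwise comparison with L = K⁻¹: before position s one has 1 = L K, after it L' = L, and at s
the hypothesis on E supplies μ L. The ratio μ ∏ L is the same for every s, so it can be taken out of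
the sum over s. -/
theorem leg_transpose {K K' L L' : ι → F} {E : Matrix ι ι F} {μ : F} {r : ℕ}
    (hK : ∀ a, L a * K a = 1) (hK' : ∀ a, K' a = 1) (hL : ∀ a, L' a = L a)
    (hE : ∀ a b, E a b = μ * L b * E a b) (s : Fin r)
    (y x : Fin r → ι) : ∏ t, leg (fun _ => 1) L' E.transpose s t (x t) (y t) =
      μ * (∏ t, L (x t)) * ∏ t, leg K K' E s t (y t) (x t) := by
  -- The scalar μ is assigned to position s, so that both sides are products over positions.
  have h1 : μ = ∏ t, if t = s then μ else 1 := by simp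
  rw [h1, ← Finset.prod_mul_distrib, ← Finset.prod_mul_distrib]
  refine Finset.prod_congr rfl fun t _ => ?_
  simp only [leg]
  by_cases h2 : t < s
  · rw [if_pos h2, if_pos h2, if_neg h2.ne, Matrix.diagonal_apply, Matrix.diagonal_apply]
    by_cases h3 : x t = y t
    · rw [if_pos h3, if_pos h3.symm, one_mul, ← h3, hK]
    · rw [if_neg h3, if_neg (Ne.symm h3), mul_zero]
  · rw [if_neg h2, if_neg h2]
    by_cases h4 : t = s
    · rw [if_pos h4, if_pos h4, if_pos h4, Matrix.transpose_apply]
      exact hE _ _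
    · rw [if_neg h4, if_neg h4, if_neg h4, Matrix.diagonal_apply, Matrix.diagonal_apply]
      by_cases h3 : x t = y t
      · rw [if_pos h3, if_pos h3.symm, one_mul, ← h3, hK', hL, mul_one]
      · rw [if_neg h3, if_neg (Ne.symm h3), mul_zero]

/-- The coproducts of a raising operator and of its transpose. -/
theorem skewSum_transpose {K K' L L' : ι → F} {E : Matrix ι ι F} {μ : F}
    (hK : ∀ a, L a * K a = 1) (hK' : ∀ a, K' a = 1) (hL : ∀ a, L' a = L a)
    (hE : ∀ a b, E a b = μ * L b * E a b) {r : ℕ} (y x : Fin r → ι) :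
    skewSum (fun _ => 1) L' E.transpose r x y =
      μ * (∏ t, L (x t)) * skewSum K K' E r y x := by
  rw [skewSum, skewSum, Matrix.of_apply, Matrix.of_apply, Finset.mul_sum]
  exact Finset.sum_congr rfl fun s _ => leg_transpose hK hK' hL hE s y x

/-- In every summand one position raises φ by c and all other positions are diagonal. With φ the
weight or ρ, this describes the effect of a root vector on a tensor. -/
theorem skewSum_additive {A : Type*} [AddCommGroup A] {φ : ι → A} {c : A} {K K' : ι → F}
    {E : Matrix ι ι F} (h : ∀ a b, E a b ≠ 0 → φ a = φ b + c) {r : ℕ} {y x : Fin r → ι}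
    (hyx : skewSum K K' E r y x ≠ 0) : ∑ t, φ (y t) = ∑ t, φ (x t) + c := by
  rw [skewSum, Matrix.of_apply] at hyx
  obtain ⟨s, -, hs⟩ := Finset.exists_ne_zero_of_sum_ne_zero hyx
  rw [Finset.prod_ne_zero_iff] at hs
  have h1 : ∀ t, φ (y t) = φ (x t) + if t = s then c else 0 := by
    intro t
    have ht := hs t (Finset.mem_univ t)
    have hd : ∀ {D : ι → F}, Matrix.diagonal D (y t) (x t) ≠ 0 → φ (y t) = φ (x t) + 0 := by
      intro D hD
      by_contra hne
      exact hD (Matrix.diagonal_apply_ne _ fun h' => hne (by rw [h', add_zero]))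
    simp only [leg] at ht
    by_cases h2 : t < s
    · rw [if_neg h2.ne]; rw [if_pos h2] at ht; exact hd ht
    · rw [if_neg h2] at ht
      by_cases h3 : t = s
      · rw [if_pos h3]; rw [if_pos h3] at ht; exact h _ _ ht
      · rw [if_neg h3]; rw [if_neg h3] at ht; exact hd ht
  simp only [h1, Finset.sum_add_distrib, Finset.sum_ite_eq', Finset.mem_univ, if_true]

end SkewPrimitive

/-! ### Reversal of the tensor factors combined with duality of indices -/

section Reversal
variable {F : Type*} [Field F] {N : ℕ}

/-- The involution `(i_1, …, i_r) ↦ (i_r', …, i_1')`. -/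
def flipRev {r : ℕ} (i : Fin r → Fin N) : Fin r → Fin N := fun s => (i s.rev).rev

theorem flipRev_flipRev {r : ℕ} (i : Fin r → Fin N) : flipRev (flipRev i) = i := by
  funext s
  simp [flipRev]

theorem prod_flipRev {M : Type*} [CommMonoid M] (f : Fin N → M) {r : ℕ} (i : Fin r → Fin N) :
    ∏ s, f (flipRev i s) = ∏ s, f (i s).rev := by
  rw [← Equiv.prod_comp Fin.revPerm]
  simp [flipRev]

theorem leg_rev (K K' : Fin N → F) (E : Matrix (Fin N) (Fin N) F) {r : ℕ} (s t : Fin r)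
    (a b : Fin N) : leg K K' E s.rev t.rev a.rev b.rev =
      leg (fun c => K' c.rev) (fun c => K c.rev) (E.submatrix Fin.rev Fin.rev) s t a b := by
  simp only [leg, Fin.rev_lt_rev, Fin.rev_inj]
  by_cases h1 : t < s
  · rw [if_pos h1, if_neg h1.not_gt, if_neg h1.ne, Matrix.diagonal_apply, Matrix.diagonal_apply]
    simp only [Fin.rev_inj]
  · by_cases h2 : t = s
    · rw [if_neg h1, if_pos h2, if_pos h2, if_neg (by rw [h2]; exact lt_irrefl _)]
      rfl
    · rw [if_neg h1, if_neg h2, if_pos (lt_of_le_of_ne (not_lt.1 h1) (Ne.symm h2)), if_neg h2,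
        Matrix.diagonal_apply, Matrix.diagonal_apply]
      simp only [Fin.rev_inj]

/-- Reversal exchanges the factors before and after the distinguished position, hence the roles of K
and K'. -/
theorem skewSum_flipRev (K K' : Fin N → F) (E : Matrix (Fin N) (Fin N) F) {r : ℕ}
    (y x : Fin r → Fin N) : skewSum K K' E r (flipRev y) (flipRev x) =
      skewSum (fun c => K' c.rev) (fun c => K c.rev) (E.submatrix Fin.rev Fin.rev) r y x := by
  rw [skewSum, skewSum, Matrix.of_apply, Matrix.of_apply, ← Equiv.sum_comp Fin.revPerm]
  refine Finset.sum_congr rfl fun s _ => ?_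
  rw [← Equiv.prod_comp Fin.revPerm]
  refine Finset.prod_congr rfl fun t _ => ?_
  rw [Fin.revPerm_apply, Fin.revPerm_apply, ← leg_rev]
  simp [flipRev]

theorem skewSum_smul (K K' : Fin N → F) (E : Matrix (Fin N) (Fin N) F) (c : F) (r : ℕ) :
    skewSum K K' (c • E) r = c • skewSum K K' E r := by
  induction r with
  | zero => rw [skewSum_zero, skewSum_zero, smul_zero]
  | succ r ih => rw [skewSum_succ, skewSum_succ, ih, glue_smul_left, glue_smul_right, smul_add]

/-- The reversal of the coproduct of a root vector whose transpose is proportional to its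
reversal. -/
theorem skewSum_flipRev_swap {K K' L : Fin N → F} {E : Matrix (Fin N) (Fin N) F} {μ : F}
    (hK : ∀ a, K a.rev = L a) (hL : ∀ a, L a * K a = 1) (hK' : ∀ a, K' a = 1)
    (hE : ∀ a b, E b.rev a.rev = μ * L b * E a b) {r : ℕ} (y x : Fin r → Fin N) :
    skewSum K K' E r (flipRev x) (flipRev y) =
      μ * (∏ t, L (x t)) * skewSum K K' E r y x := by
  rw [skewSum_flipRev, skewSum, skewSum, Matrix.of_apply, Matrix.of_apply, Finset.mul_sum]
  refine Finset.sum_congr rfl fun s _ => ?_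
  have h1 : μ = ∏ t, if t = s then μ else 1 := by simp
  rw [h1, ← Finset.prod_mul_distrib, ← Finset.prod_mul_distrib]
  refine Finset.prod_congr rfl fun t _ => ?_
  simp only [leg]
  by_cases h2 : t < s
  · rw [if_pos h2, if_pos h2, if_neg h2.ne, Matrix.diagonal_apply, Matrix.diagonal_apply]
    by_cases h3 : x t = y t
    · rw [if_pos h3, if_pos h3.symm, one_mul, ← h3, hL, hK']
    · rw [if_neg h3, if_neg (Ne.symm h3), mul_zero]
  · rw [if_neg h2, if_neg h2]
    by_cases h4 : t = s
    · rw [if_pos h4, if_pos h4, if_pos h4, Matrix.submatrix_apply]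
      exact hE _ _
    · rw [if_neg h4, if_neg h4, if_neg h4, Matrix.diagonal_apply, Matrix.diagonal_apply]
      by_cases h3 : x t = y t
      · rw [if_pos h3, if_pos h3.symm, one_mul, ← h3, hK', hK, mul_one]
      · rw [if_neg h3, if_neg (Ne.symm h3), mul_zero]

end Reversal

/-! ### The generators on a tensor power in closed form -/

section TensorRep
variable {X : Ty} {n : ℕ}

theorem tensorRep_k_eq (hn : X.minRank ≤ n) (r : ℕ) (i : Fin n) :
    tensorRep hn r (gen X (.k i)) = Matrix.diagonal fun b => ∏ t, kEig i (b t) := by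
  induction r with
  | zero =>
    change algebraMap QV _ (counit X (gen X (.k i))) = _
    rw [counit, liftUq_gen]
    ext a b
    simp [counitGen, Matrix.one_apply, Matrix.diagonal_apply]
  | succ r ih =>
    rw [tensorRep_k, ih, natGen_k]
    ext a b
    rw [← prod_diagonal, glue_apply, ← prod_diagonal, Fin.prod_univ_succ]
    rfl

theorem tensorRep_kinv_eq (hn : X.minRank ≤ n) (r : ℕ) (i : Fin n) :
    tensorRep hn r (gen X (.kinv i)) =
      Matrix.diagonal fun b => ∏ t, kEig i (Fin.rev (b t)) := by
  induction r with
  | zero =>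
    change algebraMap QV _ (counit X (gen X (.kinv i))) = _
    rw [counit, liftUq_gen]
    ext a b
    simp [counitGen, Matrix.one_apply, Matrix.diagonal_apply]
  | succ r ih =>
    rw [tensorRep_kinv, ih, natGen_kinv]
    ext a b
    rw [← prod_diagonal (fun c => kEig i (Fin.rev c)), glue_apply,
      ← prod_diagonal (fun c => kEig i (Fin.rev c)), Fin.prod_univ_succ]
    rfl

theorem tensorRep_e_eq (hn : X.minRank ≤ n) (r : ℕ) (i : Fin n) :
    tensorRep hn r (gen X (.e i)) = skewSum (kEig i) (fun _ => 1) (natGen X (.e i)) r := by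
  induction r with
  | zero =>
    change algebraMap QV _ (counit X (gen X (.e i))) = _
    rw [counit, liftUq_gen, counitGen, map_zero, skewSum_zero]
  | succ r ih =>
    rw [tensorRep_e, ih, natGen_k, skewSum_succ]
    simp only [Finset.prod_const_one, Matrix.diagonal_one]

theorem tensorRep_f_eq (hn : X.minRank ≤ n) (r : ℕ) (i : Fin n) :
    tensorRep hn r (gen X (.f i)) =
      skewSum (fun _ => 1) (fun a => kEig i (Fin.rev a)) (natGen X (.f i)) r := by
  induction r with
  | zero =>
    change algebraMap QV _ (counit X (gen X (.f i))) = _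
    rw [counit, liftUq_gen, counitGen, map_zero, skewSum_zero]
  | succ r ih => rw [tensorRep_f, ih, tensorRep_kinv_eq, skewSum_succ, Matrix.diagonal_one]

end TensorRep

/-! ### Matrix entries of operators on neighbouring factors -/

section OpMatEntries
variable {R : Type*} [CommRing R] {ι : Type*} [Fintype ι] [DecidableEq ι]

/-- A column evaluated at an indicator function gives one entry; symmetry, grading and reversal of
`opMat` then follow from those of P. -/
theorem opMat_apply (P : Matrix (ι × ι) (ι × ι) R) {r m : ℕ} (h : m + 1 < r) (a i : Fin r → ι) :
    opMat P r m a i = if ∀ t : Fin r, t.val ≠ m → t.val ≠ m + 1 → a t = i t then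
      P (a ⟨m, by omega⟩, a ⟨m + 1, h⟩) (i ⟨m, by omega⟩, i ⟨m + 1, h⟩) else 0 := by
  have h1 := sum_opMat_smul P h i fun b => if b = a then (1 : R) else 0
  simp only [smul_eq_mul, mul_ite, mul_one, mul_zero, Finset.sum_ite_eq', Finset.mem_univ,
    if_true] at h1
  rw [h1]
  have h2 : ∀ p : ι × ι, Function.update (Function.update i ⟨m, by omega⟩ p.1) ⟨m + 1, h⟩ p.2 = a ↔
      p = (a ⟨m, by omega⟩, a ⟨m + 1, h⟩) ∧
        ∀ t : Fin r, t.val ≠ m → t.val ≠ m + 1 → a t = i t := by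
    intro p
    constructor
    · rintro rfl
      refine ⟨Prod.ext ?_ ?_, fun t ht ht' => ?_⟩
      · simp [Function.update_apply, Fin.ext_iff]
      · simp [Function.update_apply, Fin.ext_iff]
      · simp [Function.update_apply, Fin.ext_iff, ht, ht']
    · rintro ⟨rfl, ht⟩
      funext t
      by_cases h1 : t.val = m + 1
      · have : t = ⟨m + 1, h⟩ := Fin.ext h1
        subst this
        simp
      · by_cases h2 : t.val = m
        · have : t = ⟨m, by omega⟩ := Fin.ext h2
          simp [this, Function.update_apply, Fin.ext_iff]
        · simp [Function.update_apply, Fin.ext_iff, h1, h2, ht t h2 h1]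
  simp only [h2]
  split_ifs with h3
  · rw [Finset.sum_eq_single (a ⟨m, by omega⟩, a ⟨m + 1, h⟩)]
    · rw [if_pos ⟨rfl, h3⟩]
    · intro p _ hp
      rw [if_neg fun h' => hp h'.1]
    · simp
  · exact Finset.sum_eq_zero fun p _ => if_neg fun h' => h3 h'.2

theorem opMat_transpose {P : Matrix (ι × ι) (ι × ι) R} (hP : P.transpose = P) {r m : ℕ}
    (h : m + 1 < r) : (opMat P r m).transpose = opMat P r m := by
  ext a i
  rw [Matrix.transpose_apply, opMat_apply P h, opMat_apply P h, ← Matrix.transpose_apply P, hP]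
  simp only [eq_comm (a := i _)]

theorem opMat_additive {A : Type*} [AddCommGroup A] {φ : ι → A} {P : Matrix (ι × ι) (ι × ι) R}
    (hP : ∀ p p', P p p' ≠ 0 → φ p.1 + φ p.2 = φ p'.1 + φ p'.2) {r m : ℕ} (h : m + 1 < r)
    {a i : Fin r → ι} (hai : opMat P r m a i ≠ 0) : ∑ t, φ (a t) = ∑ t, φ (i t) := by
  rw [opMat_apply P h] at hai
  split_ifs at hai with h1
  · rw [← sub_eq_zero, ← Finset.sum_sub_distrib,
      Fintype.sum_eq_add (⟨m, by omega⟩ : Fin r) ⟨m + 1, h⟩ (by simp [Fin.ext_iff])]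
    · have := hP _ _ hai
      simp only at this
      rw [sub_add_sub_comm, this, sub_self]
    · rintro t ⟨ht, ht'⟩
      rw [h1 t (fun h' => ht (Fin.ext h')) (fun h' => ht' (Fin.ext h')), sub_self]
  · exact absurd rfl hai

/-- Reversal sends the positions m, m + 1 to another neighbouring pair in the opposite order, so P
is replaced by its conjugate under `swapRev`. -/
theorem opMat_flipRev {N : ℕ} {P : Matrix (Fin N × Fin N) (Fin N × Fin N) R}
    (hP : P.submatrix (swapRev N) (swapRev N) = P) {r : ℕ} (m : Fin (r - 1))
    (a i : Fin r → Fin N) : opMat P r m (flipRev a) (flipRev i) = opMat P r m.rev a i := by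
  have hm := m.2
  rw [opMat_apply P (by omega), opMat_apply P (by omega)]
  have h1 : (∀ t : Fin r, t.val ≠ m → t.val ≠ m + 1 → flipRev a t = flipRev i t) ↔
      ∀ t : Fin r, t.val ≠ m.rev → t.val ≠ m.rev + 1 → a t = i t := by
    simp only [flipRev, Fin.rev_inj]
    constructor
    · intro h t ht ht'
      have ht2 := t.2
      have := h t.rev (by rw [Fin.val_rev] at *; omega) (by rw [Fin.val_rev] at *; omega)
      rwa [Fin.rev_rev] at this
    · intro h t ht ht'
      have ht2 := t.2
      exact h t.rev (by rw [Fin.val_rev, Fin.val_rev]; omega) (by rw [Fin.val_rev, Fin.val_rev]; omega)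
  simp only [h1]
  have h2 : ∀ k : Fin r → Fin N, (flipRev k ⟨m, by omega⟩, flipRev k ⟨m + 1, by omega⟩) =
      swapRev N (k ⟨m.rev, by omega⟩, k ⟨m.rev + 1, by omega⟩) := by
    intro k
    rw [swapRev_apply]
    simp only [flipRev]
    congr 3 <;> ext <;> simp only [Fin.val_rev] <;> omega
  rw [h2, h2, ← Matrix.submatrix_apply P, hP]

end OpMatEntries

/-! ### Symmetry, grading and reversal of braiding and contraction -/

section PairSymmetry
variable {X : Ty} {n : ℕ} (κ : Type*) [Field κ] [Algebra LA κ]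

theorem rhoV_rev (a : Fin (X.dimV n)) : rhoV X n a.rev = -rhoV X n a := by
  have hN := dimV_eq X n
  have ha := a.2
  cases X <;> simp only [] at hN <;> simp only [rhoV, Fin.val_rev] <;> split_ifs <;> omega

theorem gc_mul_gc_rev (a : Fin (X.dimV n)) : gc κ a * gc κ a.rev = match X with
    | .B => 1
    | .C => -1
    | .D => 1 := by
  have h1 : gc κ a * gc κ a.rev = ((eps X n a * eps X n a.rev : ℤ) : κ) := by
    rw [gc, gc, rhoV_rev, zpow_neg, mul_mul_mul_comm, Units.mul_inv, one_mul, Int.cast_mul]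
  have h2 : eps X n a * eps X n a.rev = match X with
      | .B => 1
      | .C => -1
      | .D => 1 := by
    have hN := dimV_eq X n
    have ha := a.2
    cases X <;> simp only [] at hN <;> simp only [eps, Fin.val_rev] <;> (try split_ifs) <;> omega
  rw [h1, h2]
  cases X <;> simp

/-- g_a g_{a'} is a sign that depends only on the type, not on a. -/
theorem gc_ratio (a b : Fin (X.dimV n)) : (gc κ a)⁻¹ * gc κ b = (gc κ b.rev)⁻¹ * gc κ a.rev := by
  have h1 := gc_ne_zero κ a
  have h2 := gc_ne_zero κ b.rev
  have h3 : gc κ b * gc κ b.rev = gc κ a * gc κ a.rev := by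
    rw [gc_mul_gc_rev, gc_mul_gc_rev]
    cases X <;> rfl
  field_simp
  exact h3

/-- Flip and triangular term are visibly symmetric. For the tail, transposition replaces the
coefficient by its dual, which is equal by `gc_ratio`, and k < b by the equivalent b' < k'. -/
theorem braidMat_transpose : (braidMat X n κ).transpose = braidMat X n κ := by
  ext ⟨k, l⟩ ⟨a, b⟩
  rw [Matrix.transpose_apply, braidMat_eq, pairMat, Matrix.of_apply, Matrix.of_apply,
    braidVec_apply, braidVec_apply]
  dsimp only
  have h1 : flipCoef (qU X κ : κ) k l = flipCoef (qU X κ : κ) l k := by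
    have e1 : k = l.rev ↔ l = k.rev := ⟨fun h => by rw [h, Fin.rev_rev], fun h => by rw [h, Fin.rev_rev]⟩
    simp only [flipCoef, e1, eq_comm (a := k) (b := l)]
  congr 1
  · congr 1
    · by_cases h2 : a = l ∧ b = k
      · obtain ⟨rfl, rfl⟩ := h2
        simp [h1]
      · have : ¬ (k = b ∧ l = a) := fun h => h2 ⟨h.2.symm, h.1.symm⟩
        rw [if_neg h2, if_neg this]
    · by_cases h2 : a = k ∧ b = l
      · obtain ⟨rfl, rfl⟩ := h2
        simp
      · have h3 : ¬ (a = k ∧ b = l ∧ k < l) := fun h => h2 ⟨h.1, h.2.1⟩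
        have h4 : ¬ (k = a ∧ l = b ∧ a < b) := fun h => h2 ⟨h.1.symm, h.2.1.symm⟩
        rw [if_neg h3, if_neg h4]
  · by_cases h2 : k = l.rev ∧ a = b.rev
    · obtain ⟨rfl, rfl⟩ := h2
      have h3 : l.rev < b ↔ b.rev < l := by rw [← Fin.rev_lt_rev, Fin.rev_rev]
      simp only [true_and, h3, mul_assoc, gc_ratio κ l.rev b, Fin.rev_rev]
    · have h3 : ¬ (k = l.rev ∧ a = b.rev ∧ k < b) := fun h => h2 ⟨h.1, h.2.1⟩
      have h4 : ¬ (a = b.rev ∧ k = l.rev ∧ a < l) := fun h => h2 ⟨h.2.1, h.1⟩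
      rw [if_neg h3, if_neg h4]

theorem contractMat_transpose : (contractMat X n κ).transpose = contractMat X n κ := by
  ext ⟨k, l⟩ ⟨a, b⟩
  rw [Matrix.transpose_apply, contractMat_eq, pairMat, Matrix.of_apply, Matrix.of_apply,
    contractVec_apply, contractVec_apply]
  dsimp only
  by_cases h2 : k = l.rev ∧ a = b.rev
  · obtain ⟨rfl, rfl⟩ := h2
    simp only [true_and, if_true, gc_ratio κ l.rev b, Fin.rev_rev]
  · rw [if_neg h2, if_neg fun h => h2 h.symm]

/-- A flip preserves the total degree, and the tail joins pairs of dual indices, all of degree 0.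
The function φ will be the weight or ρ. -/
theorem braidMat_additive {A : Type*} [AddCommGroup A] {φ : Fin (X.dimV n) → A}
    (hφ : ∀ a, φ a.rev = -φ a) (p p' : Fin (X.dimV n) × Fin (X.dimV n))
    (h : braidMat X n κ p p' ≠ 0) : φ p.1 + φ p.2 = φ p'.1 + φ p'.2 := by
  obtain ⟨a, b⟩ := p
  obtain ⟨k, l⟩ := p'
  rw [braidMat_eq, pairMat, Matrix.of_apply, braidVec_apply] at h
  dsimp only at h ⊢
  by_cases h1 : a = l ∧ b = k
  · rw [h1.1, h1.2, add_comm]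
  by_cases h2 : a = k ∧ b = l ∧ k < l
  · rw [h2.1, h2.2.1]
  by_cases h3 : k = l.rev ∧ a = b.rev ∧ k < b
  · rw [h3.1, h3.2.1, hφ, hφ]; simp
  · rw [if_neg h1, if_neg h2, if_neg h3] at h
    simp at h

theorem contractMat_additive {A : Type*} [AddCommGroup A] {φ : Fin (X.dimV n) → A}
    (hφ : ∀ a, φ a.rev = -φ a) (p p' : Fin (X.dimV n) × Fin (X.dimV n))
    (h : contractMat X n κ p p' ≠ 0) : φ p.1 + φ p.2 = φ p'.1 + φ p'.2 := by
  obtain ⟨a, b⟩ := p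
  obtain ⟨k, l⟩ := p'
  rw [contractMat_eq, pairMat, Matrix.of_apply, contractVec_apply] at h
  dsimp only at h ⊢
  by_cases h3 : k = l.rev ∧ a = b.rev
  · rw [h3.1, h3.2, hφ, hφ]; simp
  · rw [if_neg h3] at h
    exact absurd rfl h

theorem braidMat_swapRev : (braidMat X n κ).submatrix (swapRev _) (swapRev _) = braidMat X n κ := by
  rw [braidMat_eq]
  exact pairMat_submatrix fun k l a b => braidVec_rev _ _ k l a b

theorem contractMat_swapRev :
    (contractMat X n κ).submatrix (swapRev _) (swapRev _) = contractMat X n κ := by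
  rw [contractMat_eq]
  exact pairMat_submatrix fun k l a b => contractVec_rev _ k l a b

end PairSymmetry

/-! ### Gram exponents in terms of weights -/

section WeightExponents
variable {X : Ty} {n : ℕ}

theorem rev_ne_self (hX : X = .C ∨ X = .D) (a : Fin (X.dimV n)) : a ≠ a.rev := by
  have hN := dimV_eq X n
  have ha := a.2
  rw [Ne, Fin.ext_iff, Fin.val_rev]
  rcases hX with rfl | rfl <;> simp only [] at hN <;> omega

/-- In types C and D the weights are the ±ε_i without repetition or zero; the zero weight is what
excludes type B. -/
theorem wt_dot (hX : X = .C ∨ X = .D) (a b : Fin (X.dimV n)) :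
    wt X a ⬝ᵥ wt X b = if a = b then 1 else if a = b.rev then -1 else 0 := by
  have hN : X.dimV n = 2 * n := by rcases hX with rfl | rfl <;> rfl
  have ha := a.2
  have hb := b.2
  have h2 : ∀ c : Fin (X.dimV n), ∀ h : c.val < n,
      wt X c = Pi.single (⟨c.val, h⟩ : Fin n) 1 := by
    intro c h
    funext m
    have hm := m.2
    simp only [wt, Pi.single_apply, Fin.ext_iff]
    split_ifs <;> omega
  have key : ∀ a b : Fin (X.dimV n), a.val < n →
      wt X a ⬝ᵥ wt X b = if a = b then 1 else if a = b.rev then -1 else 0 := by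
    intro a b h
    rw [h2 a h, single_dotProduct, one_mul]
    simp only [wt, Fin.ext_iff, Fin.val_rev]
    split_ifs <;> omega
  by_cases h : a.val < n
  · exact key a b h
  · have h3 := key a.rev b (by rw [Fin.val_rev]; omega)
    rw [wt_rev, neg_dotProduct] at h3
    rw [← neg_neg (wt X a ⬝ᵥ wt X b), h3]
    simp only [Fin.ext_iff, Fin.val_rev]
    split_ifs <;> omega

theorem sum_lt_of_symm {r : ℕ} (f : Fin r → Fin r → ℤ) (hf : ∀ s t, f s t = f t s)
    (h0 : ∀ s, f s s = 0) :
    ∑ p : Fin r × Fin r, f p.1 p.2 = 2 * ∑ p : Fin r × Fin r, if p.1 < p.2 then f p.1 p.2 else 0 := by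
  have h1 : ∑ p : Fin r × Fin r, (if p.1 < p.2 then f p.1 p.2 else 0) =
      ∑ p : Fin r × Fin r, if p.2 < p.1 then f p.1 p.2 else 0 := by
    rw [← (Equiv.prodComm (Fin r) (Fin r)).sum_comp]
    refine Finset.sum_congr rfl fun p _ => ?_
    simp only [Equiv.prodComm_apply, Prod.fst_swap, Prod.snd_swap, hf p.2 p.1]
  rw [two_mul]
  nth_rw 2 [h1]
  rw [← Finset.sum_add_distrib]
  refine Finset.sum_congr rfl fun p _ => ?_
  rcases lt_trichotomy p.1 p.2 with h | h | h
  · rw [if_pos h, if_neg h.not_gt, add_zero]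
  · rw [h, h0]; simp
  · rw [if_neg h.not_gt, if_pos h, zero_add]

/-- A pair of positions contributes 1 - (wt, wt) to β: this is 0 for equal, 2 for dual and 1 for
other indices. Summing over all ordered pairs gives r² minus the squared length of the total weight,
so β depends on the weight alone. -/
theorem two_mul_beta (hX : X = .C ∨ X = .D) {r : ℕ} (i : Fin r → Fin (X.dimV n)) :
    2 * (beta X i : ℤ) = r ^ 2 - (∑ t, wt X (i t)) ⬝ᵥ ∑ t, wt X (i t) := by
  have h1 : (beta X i : ℤ) = ∑ p : Fin r × Fin r,
      if p.1 < p.2 then 1 - wt X (i p.1) ⬝ᵥ wt X (i p.2) else 0 := by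
    rw [beta, Finset.card_filter, Finset.card_filter]
    push_cast
    rw [Finset.mul_sum, ← Finset.sum_add_distrib]
    refine Finset.sum_congr rfl fun p _ => ?_
    rw [wt_dot hX]
    by_cases h1 : p.1 < p.2
    · by_cases h2 : i p.1 = i p.2
      · have h3 : ¬ i p.1 = (i p.2).rev := by rw [h2]; exact rev_ne_self hX _
        simp [h1, h2, h3, rev_ne_self hX (i p.2)]
      · by_cases h3 : i p.1 = (i p.2).rev
        · simp [h1, h3, (rev_ne_self hX (i p.2)).symm]
        · simp [h1, h2, h3]
    · simp [h1]
  rw [h1, ← sum_lt_of_symm (fun s t => 1 - wt X (i s) ⬝ᵥ wt X (i t))]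
  · rw [Finset.sum_sub_distrib, Fintype.sum_prod_type, sum_dotProduct]
    congr 1
    · simp [pow_two]
    · rw [Fintype.sum_prod_type]
      simp only [dotProduct_sum]
  · intro s t
    rw [dotProduct_comm]
  · intro s
    rw [wt_dot hX, if_pos rfl, sub_self]

theorem simpleRoot_self_dot (hn : X.minRank ≤ n) (i : Fin n) :
    (dd X n i : ℤ) * 2 = qExp X * (simpleRoot X n i ⬝ᵥ simpleRoot X n i) := by
  rw [← cartan_spec hn, cartan_self]

/-- Weights of V have length 1, so |wt b + α_i|² = |wt b|² forces 2 (α_i, wt b) = -(α_i, α_i) = -2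
d_i. -/
theorem root_dot_wt (hX : X = .C ∨ X = .D) (hn : X.minRank ≤ n) {i : Fin n}
    {a b : Fin (X.dimV n)} (h : natGen X (.e i) a b ≠ 0) :
    simpleRoot X n i ⬝ᵥ wt X b = -dd X n i := by
  have h1 := e_weight hn i a b h
  have h2 := wt_dot hX a a
  have h3 := wt_dot hX b b
  have h4 := simpleRoot_self_dot hn i
  have h5 : qExp X = 1 := by rcases hX with rfl | rfl <;> rfl
  rw [if_pos rfl] at h2 h3
  rw [h1, add_dotProduct, dotProduct_add, dotProduct_add, h3,
    dotProduct_comm (wt X b)] at h2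
  rw [h5, Nat.cast_one, one_mul] at h4
  omega

theorem natGen_f_eq_transpose (hX : X = .C ∨ X = .D) (i : Fin n) :
    natGen X (.f i) = (natGen X (.e i)).transpose := by
  ext a b
  rcases hX with rfl | rfl <;> simp only [natGen, Matrix.transpose_apply] <;> split_ifs <;>
    simp only [Matrix.add_apply, matUnit, and_comm]

/-- Supplies the scalar of `skewSum_flipRev_swap`. For the last root the two arrows have different
coefficients, 1 and -v⁻¹, and the eigenvalue of k_i compensates for this. -/
theorem natGen_e_rev (i : Fin n) (a b : Fin (Ty.B.dimV n)) :
    natGen .B (.e i) b.rev a.rev =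
      -v ^ (-(dd .B n i) : ℤ) * kEig i b.rev * natGen .B (.e i) a b := by
  have hi := i.2
  have ha := a.2
  have hb := b.2
  have hN : Ty.B.dimV n = 2 * n + 1 := rfl
  have hv := v_ne_zero
  have hv2 : ∀ x : ℤ, x = 0 → v ^ x = 1 := fun x hx => by rw [hx, zpow_zero]
  by_cases h : i.val + 1 < n
  · have h1 : natGen .B (.e i) b.rev a.rev = -natGen .B (.e i) a b := by
      simp only [natGen, h, if_true, Matrix.add_apply, matUnit, Fin.val_rev, neg_add]
      rw [add_comm]
      congr 1 <;> split_ifs <;> first | omega | simp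
    rw [h1]
    by_cases h0 : natGen .B (.e i) a b = 0
    · rw [h0, neg_zero, mul_zero]
    · have h2 : simpleRoot .B n i ⬝ᵥ wt .B b = -1 := by
        simp only [natGen, h, if_true, Matrix.add_apply, matUnit] at h0
        rw [simpleRoot_dot, dif_pos h]
        simp only [wt, hN]
        split_ifs at h0 ⊢ <;> first | omega | simp at h0
      rw [kEig_rev, kEig, h2, dd]
      simp only [h, if_true, qExp]
      rw [← zpow_neg, neg_mul, ← zpow_add₀ hv, hv2 _ (by norm_num), neg_mul, one_mul]
  · have h2 : simpleRoot .B n i ⬝ᵥ wt .B b = if b.val = n - 1 then 1 else if b.val = n + 1 then -1 else 0 := by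
      rw [simpleRoot_dot, dif_neg h]
      simp only [wt, hN]
      split_ifs <;> omega
    rw [kEig_rev, kEig, h2]
    simp only [natGen, h, if_false, Matrix.add_apply, matUnit, Fin.val_rev, dd, qExp]
    have hn1 : (v ^ (2 : ℤ) : QV) = v * v := by rw [zpow_ofNat, pow_two]
    split_ifs <;> first
      | (exfalso; omega)
      | (norm_num; done)
      | (norm_num [hn1]; field_simp)

/-- ρ pairs with a simple root to half its squared length; measured in powers of v this is d_i. -/
theorem rhoV_root (i : Fin n) {a b : Fin (Ty.B.dimV n)} (h : natGen .B (.e i) a b ≠ 0) :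
    rhoV .B n a = rhoV .B n b + dd .B n i := by
  have hi := i.2
  have ha := a.2
  have hb := b.2
  have hN : Ty.B.dimV n = 2 * n + 1 := rfl
  by_cases h1 : i.val + 1 < n
  · simp only [natGen, h1, if_true, Matrix.add_apply, matUnit] at h
    simp only [rhoV, dd, h1, if_true]
    split_ifs at h ⊢ <;> first | omega | simp at h
  · simp only [natGen, h1, if_false, Matrix.add_apply, matUnit] at h
    simp only [rhoV, dd, h1, if_false]
    split_ifs at h ⊢ <;> first | omega | simp at h

end WeightExponents

/-! ### Gram matrices supported on an involution -/

section FormMatrices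
variable {R : Type*} [CommRing R] {ι : Type*} [Fintype ι] [DecidableEq ι]

/-- The monomial matrix with entries `d i` at the places `(i, j)` with `i = s j`. -/
def monoMat (s : ι → ι) (d : ι → R) : Matrix ι ι R :=
  Matrix.of fun i j => if i = s j then d i else 0

theorem monoMat_id (d : ι → R) : monoMat id d = Matrix.diagonal d := by
  ext i j
  simp [monoMat, Matrix.diagonal_apply]

/-- Each entry of either product has a single term, so adjointness becomes an identity between two
entries. The involution s is reversal in type B and the identity in types C and D. -/
theorem transpose_mul_monoMat {s : ι → ι} (hs : Function.Involutive s) (d : ι → R)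
    {M A : Matrix ι ι R} (h : ∀ y x, M y x * d y = d x * A (s x) (s y)) :
    M.transpose * monoMat s d = monoMat s d * A := by
  ext x y
  have h1 : ∀ j, x = s j ↔ j = s x := fun j => eq_comm.trans hs.eq_iff
  simp only [Matrix.mul_apply, monoMat, Matrix.of_apply, Matrix.transpose_apply, mul_ite, mul_zero,
    ite_mul, zero_mul, Finset.sum_ite_eq', Finset.mem_univ, if_true, h1]
  rw [h, hs]

theorem nondegenerate_monoMat {F : Type*} [Field F] {M : Type*} [AddCommGroup M] [Module F M]
    (b : Module.Basis ι F M) {s : ι → ι} (hs : Function.Involutive s) {d : ι → F}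
    (hd : ∀ i, d i ≠ 0) : (Matrix.toBilin b (monoMat s d)).Nondegenerate := by
  have h1 : monoMat s d * monoMat s (fun i => (d (s i))⁻¹) = 1 := by
    ext i j
    have h1 : ∀ j, i = s j ↔ j = s i := fun j => eq_comm.trans hs.eq_iff
    simp only [Matrix.mul_apply, monoMat, Matrix.of_apply, mul_ite, mul_zero, ite_mul, zero_mul, h1,
      Finset.sum_ite_eq', Finset.mem_univ, if_true]
    rw [hs, Matrix.one_apply]
    by_cases h : i = j
    · rw [if_pos h, if_pos (by rw [h]), ← h, mul_inv_cancel₀ (hd i)]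
    · rw [if_neg h, if_neg fun h' => h (hs.injective h').symm]
  refine (Matrix.nondegenerate_of_det_ne_zero ?_).toBilin b
  exact (Matrix.isUnit_det_of_right_inverse h1).ne_zero

theorem isSymm_toBilin_diagonal {F : Type*} [Field F] {M : Type*} [AddCommGroup M] [Module F M]
    (b : Module.Basis ι F M) (d : ι → F) : (Matrix.toBilin b (Matrix.diagonal d)).IsSymm := by
  refine ⟨fun x y => ?_⟩
  rw [Matrix.toBilin_apply, Matrix.toBilin_apply, Finset.sum_comm]
  refine Finset.sum_congr rfl fun i _ => Finset.sum_congr rfl fun j _ => ?_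
  rw [← Matrix.diagonal_transpose, Matrix.transpose_apply, Matrix.diagonal_transpose]
  ring

theorem baseMat_monoMat (S : Type*) [CommRing S] [Algebra LA S] (s : ι → ι) (d : ι → LA) :
    baseMat S (monoMat s d) = monoMat s fun i => algebraMap LA S (d i) := by
  ext i j
  simp only [baseMat, RingHom.mapMatrix_apply, Matrix.map_apply, monoMat, Matrix.of_apply]
  split_ifs <;> simp

end FormMatrices

/-! ### Compatibility of the form with the antipode in type B -/

section TypeB
variable {n : ℕ} {r : ℕ}

theorem tensorRep_e_flipRev (hn : Ty.B.minRank ≤ n) (i : Fin n)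
    (y x : Fin r → Fin (Ty.B.dimV n)) :
    tensorRep hn r (gen .B (.e i)) (flipRev x) (flipRev y) =
      -v ^ (-(dd .B n i) : ℤ) * (∏ t, kEig i (Fin.rev (x t))) *
        tensorRep hn r (gen .B (.e i)) y x := by
  rw [tensorRep_e_eq]
  exact skewSum_flipRev_swap (fun _ => rfl)
    (fun a => by rw [kEig_rev, inv_mul_cancel₀ (kEig_ne_zero i a)]) (fun _ => rfl)
    (natGen_e_rev i) y x

theorem sum_rhoV_root (hn : Ty.B.minRank ≤ n) (i : Fin n) {y x : Fin r → Fin (Ty.B.dimV n)}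
    (h : tensorRep hn r (gen .B (.e i)) y x ≠ 0) :
    ∑ s, rhoV .B n (y s) = ∑ s, rhoV .B n (x s) + dd .B n i := by
  rw [tensorRep_e_eq] at h
  exact skewSum_additive (φ := rhoV .B n) (c := (dd .B n i : ℤ)) (fun a b hab => rhoV_root i hab) h

/-- For e_i, reversal produces -v^{-d_i} and the eigenvalue of k_i⁻¹. The sign and the eigenvalue
are undone by S(e_i) = -k_i⁻¹ e_i, and v^{-d_i} is the change of the Gram entry by `sum_rhoV_root`.
The case of f_i reduces to e_i, as f_i is proportional to its reversal. -/
theorem antipode_tensorRep (hn : Ty.B.minRank ≤ n) (u : Uq .B n) :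
    (tensorRep hn r u).transpose * monoMat flipRev (fun i => v ^ (-∑ s, rhoV .B n (i s))) =
      monoMat flipRev (fun i => v ^ (-∑ s, rhoV .B n (i s))) *
        tensorRep hn r (antipode .B u).unop := by
  have hv := v_ne_zero
  have he := tensorRep_e_flipRev (r := r) hn
  have hr : ∀ (i : Fin n) (y x : Fin r → Fin (Ty.B.dimV n)),
      tensorRep hn r (gen .B (.e i)) y x ≠ 0 →
        v ^ (-∑ s, rhoV .B n (y s)) = v ^ (-∑ s, rhoV .B n (x s)) * v ^ (-(dd .B n i) : ℤ) := by
    intro i y x h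
    rw [sum_rhoV_root hn i h, neg_add]
    exact zpow_add₀ hv _ _
  have hf : ∀ (i : Fin n) (y x : Fin r → Fin (Ty.B.dimV n)),
      tensorRep hn r (gen .B (.f i)) y x =
        lowerCoef .B i * tensorRep hn r (gen .B (.e i)) (flipRev y) (flipRev x) := by
    intro i y x
    rw [tensorRep_f_eq, natGen_f hn, skewSum_smul, Matrix.smul_apply, tensorRep_e_eq,
      skewSum_flipRev, smul_eq_mul]
  have hL : ∀ (i : Fin n) (x : Fin r → Fin (Ty.B.dimV n)),
      (∏ t, kEig i (x t)) * (∏ t, kEig i (Fin.rev (x t))) = 1 := by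
    intro i x
    rw [← Finset.prod_mul_distrib]
    exact Finset.prod_eq_one fun t _ => by rw [kEig_rev, mul_inv_cancel₀ (kEig_ne_zero i _)]
  refine transpose_tensorRep hn r (antipode .B) (fun g => ?_) u
  refine transpose_mul_monoMat flipRev_flipRev _ fun y x => ?_
  rw [antipode, liftUq_gen]
  cases g with
  | e i =>
    rw [antipodeGen, MulOpposite.unop_op, map_neg, map_mul, tensorRep_kinv_eq, Matrix.neg_apply,
      Matrix.diagonal_mul, he, prod_flipRev (fun a => kEig i (Fin.rev a))]
    simp only [Fin.rev_rev]
    by_cases h : tensorRep hn r (gen .B (.e i)) y x = 0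
    · rw [h]; simp
    · rw [hr i y x h]
      -- By `hL` the eigenvalue from the antipode cancels the one from reversal.
      linear_combination (- (tensorRep hn r (gen .B (.e i)) y x * v ^ (-∑ s, rhoV .B n (x s)) * v ^ (-(dd .B n i) : ℤ))) * hL i x
  | f i =>
    rw [antipodeGen, MulOpposite.unop_op, map_neg, map_mul, tensorRep_k_eq, Matrix.neg_apply,
      Matrix.mul_diagonal, hf, hf, flipRev_flipRev, flipRev_flipRev, he, prod_flipRev (kEig i)]
    by_cases h : tensorRep hn r (gen .B (.e i)) x y = 0
    · rw [h]; simp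
    · rw [hr i x y h]; ring
  | k i =>
    rw [antipodeGen, MulOpposite.unop_op, tensorRep_k_eq, tensorRep_kinv_eq, Matrix.diagonal_apply,
      Matrix.diagonal_apply, prod_flipRev (fun a => kEig i (Fin.rev a))]
    simp only [Fin.rev_rev]
    by_cases h : y = x
    · rw [if_pos h, if_pos (by rw [h]), h, mul_comm]
    · rw [if_neg h, if_neg fun h' => h (Function.Involutive.injective flipRev_flipRev h').symm]; simp
  | kinv i =>
    rw [antipodeGen, MulOpposite.unop_op, tensorRep_k_eq, tensorRep_kinv_eq, Matrix.diagonal_apply,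
      Matrix.diagonal_apply, prod_flipRev (kEig i)]
    by_cases h : y = x
    · rw [if_pos h, if_pos (by rw [h]), h, mul_comm]
    · rw [if_neg h, if_neg fun h' => h (Function.Involutive.injective flipRev_flipRev h').symm]; simp

end TypeB

/-! ### Compatibility of the form with τ in types C and D -/

section TypeCD
variable {X : Ty} {n : ℕ} {r : ℕ}

/-- Expand the squared length of wt(x) + α_i in `two_mul_beta`, using (α_i, α_i) = 2 d_i. -/
theorem beta_root (hX : X = .C ∨ X = .D) (hn : X.minRank ≤ n) (i : Fin n)
    {y x : Fin r → Fin (X.dimV n)}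
    (h : ∑ t, wt X (y t) = ∑ t, wt X (x t) + simpleRoot X n i) :
    (beta X y : ℤ) = beta X x - simpleRoot X n i ⬝ᵥ ∑ t, wt X (x t) - dd X n i := by
  have h1 := two_mul_beta hX y
  have h2 := two_mul_beta hX x
  have h4 := simpleRoot_self_dot hn i
  have h5 : qExp X = 1 := by rcases hX with rfl | rfl <;> rfl
  rw [h5, Nat.cast_one, one_mul] at h4
  rw [h, add_dotProduct, dotProduct_add, dotProduct_add, dotProduct_comm _ (simpleRoot X n i)] at h1
  linarith

theorem prod_kEig_rev (hX : X = .C ∨ X = .D) (i : Fin n) (x : Fin r → Fin (X.dimV n)) :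
    ∏ t, kEig i (Fin.rev (x t)) = v ^ (-(simpleRoot X n i ⬝ᵥ ∑ t, wt X (x t))) := by
  have h5 : qExp X = 1 := by rcases hX with rfl | rfl <;> rfl
  have h1 : ∀ (s : Finset (Fin r)), ∏ t ∈ s, kEig i (Fin.rev (x t)) =
      v ^ (-(simpleRoot X n i ⬝ᵥ ∑ t ∈ s, wt X (x t))) := by
    intro s
    induction s using Finset.induction_on with
    | empty => simp
    | insert t s ht ih =>
      rw [Finset.prod_insert ht, Finset.sum_insert ht, ih, dotProduct_add, neg_add,
        zpow_add₀ v_ne_zero, kEig, wt_rev, dotProduct_neg, h5, Nat.cast_one, one_mul]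
  exact h1 _

/-- On V the matrix of f_i is the transpose of that of e_i. On tensors the two coproducts differ by
v^{-d_i} times the eigenvalue of k_i⁻¹, which is exactly the change of q^β along α_i. -/
theorem tau_tensorRep (hX : X = .C ∨ X = .D) (hn : X.minRank ≤ n) (u : Uq X n) :
    (tensorRep hn r u).transpose * monoMat id (fun i => v ^ (beta X i : ℤ)) =
      monoMat id (fun i => v ^ (beta X i : ℤ)) * tensorRep hn r (tau X u).unop := by
  have hv := v_ne_zero
  have h5 : qExp X = 1 := by rcases hX with rfl | rfl <;> rfl
  have key : ∀ (i : Fin n) (y x : Fin r → Fin (X.dimV n)),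
      tensorRep hn r (gen X (.e i)) y x * v ^ (beta X y : ℤ) =
        v ^ (beta X x : ℤ) * tensorRep hn r (gen X (.f i)) x y := by
    intro i y x
    have h1 : tensorRep hn r (gen X (.f i)) x y =
        v ^ (-(dd X n i) : ℤ) * (∏ t, kEig i (Fin.rev (x t))) *
          tensorRep hn r (gen X (.e i)) y x := by
      rw [tensorRep_f_eq, tensorRep_e_eq, natGen_f_eq_transpose hX]
      refine skewSum_transpose (fun a => ?_) (fun _ => rfl) (fun _ => rfl) (fun a b => ?_) y x
      · rw [kEig_rev, inv_mul_cancel₀ (kEig_ne_zero i a)]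
      · by_cases h : natGen X (.e i) a b = 0
        · rw [h, mul_zero]
        · have h2 : v ^ (-(dd X n i) : ℤ) * kEig i (Fin.rev b) = 1 := by
            rw [kEig, wt_rev, dotProduct_neg, root_dot_wt hX hn h, h5, Nat.cast_one, one_mul,
              neg_neg, ← zpow_add₀ hv, neg_add_cancel, zpow_zero]
          rw [h2, one_mul]
    rw [h1]
    by_cases h : tensorRep hn r (gen X (.e i)) y x = 0
    · rw [h]; simp
    · have h2 := h
      rw [tensorRep_e_eq] at h2
      rw [beta_root hX hn i (skewSum_additive (e_weight hn i) h2), prod_kEig_rev hX, sub_sub,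
        sub_eq_add_neg, zpow_add₀ hv, neg_add, zpow_add₀ hv]
      ring
  refine transpose_tensorRep hn r (tau X) (fun g => ?_) u
  refine transpose_mul_monoMat (fun _ => rfl) _ fun y x => ?_
  rw [tau, liftUq_gen]
  cases g with
  | e i => exact key i y x
  | f i =>
    have := key i x y
    simp only [tauGen, MulOpposite.unop_op, id_eq]
    rw [mul_comm, ← this, mul_comm]
  | k i =>
    simp only [tauGen, MulOpposite.unop_op, id_eq]
    rw [tensorRep_k_eq, Matrix.diagonal_apply, Matrix.diagonal_apply]
    by_cases h : y = x
    · rw [if_pos h, if_pos h.symm, h, mul_comm]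
    · rw [if_neg h, if_neg (Ne.symm h)]; simp
  | kinv i =>
    simp only [tauGen, MulOpposite.unop_op, id_eq]
    rw [tensorRep_kinv_eq, Matrix.diagonal_apply, Matrix.diagonal_apply]
    by_cases h : y = x
    · rw [if_pos h, if_pos h.symm, h, mul_comm]
    · rw [if_neg h, if_neg (Ne.symm h)]; simp

end TypeCD

/-! ### Compatibility of the forms with the Birman–Murakami–Wenzl algebra, and the two dualities -/

section Forms
variable {X : Ty} {n : ℕ} (κ : Type*) [Field κ] [Algebra LA κ] {r : ℕ}

/-- A symmetric operator that preserves the Gram entries is adjoint to its conjugate under s. -/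
theorem opGen_transpose_mul {s : (Fin r → Fin (X.dimV n)) → (Fin r → Fin (X.dimV n))}
    (hs : Function.Involutive s) (d : (Fin r → Fin (X.dimV n)) → κ) {z z' : BGen r}
    (h : ∀ y x, opGen (braidMat X n κ) (contractMat X n κ) (qU X κ) z' (s x) (s y) =
      opGen (braidMat X n κ) (contractMat X n κ) (qU X κ) z x y)
    (hT : (opGen (braidMat X n κ) (contractMat X n κ) (qU X κ) z).transpose =
      opGen (braidMat X n κ) (contractMat X n κ) (qU X κ) z)
    (hd : ∀ y x, opGen (braidMat X n κ) (contractMat X n κ) (qU X κ) z y x ≠ 0 → d y = d x) :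
    (opGen (braidMat X n κ) (contractMat X n κ) (qU X κ) z).transpose * monoMat s d =
      monoMat s d * opGen (braidMat X n κ) (contractMat X n κ) (qU X κ) z' := by
  refine transpose_mul_monoMat hs d fun y x => ?_
  rw [h]
  have h1 : opGen (braidMat X n κ) (contractMat X n κ) (qU X κ) z x y =
      opGen (braidMat X n κ) (contractMat X n κ) (qU X κ) z y x := by
    rw [← Matrix.transpose_apply (opGen (braidMat X n κ) (contractMat X n κ) (qU X κ) z), hT]
  rw [h1]
  by_cases h0 : opGen (braidMat X n κ) (contractMat X n κ) (qU X κ) z y x = 0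
  · rw [h0, zero_mul, mul_zero]
  · rw [hd y x h0, mul_comm]

theorem opGen_transpose (z : BGen r) :
    (opGen (braidMat X n κ) (contractMat X n κ) (qU X κ) z).transpose =
      opGen (braidMat X n κ) (contractMat X n κ) (qU X κ) z := by
  have hT := braidMat_transpose (X := X) (n := n) κ
  have hE := contractMat_transpose (X := X) (n := n) κ
  cases z with
  | T m => exact opMat_transpose hT (by omega)
  | E m => exact opMat_transpose hE (by omega)
  | Tinv m =>
    rw [opGen, skeinInv, Matrix.transpose_sub, Matrix.transpose_smul, Matrix.transpose_sub,
      Matrix.transpose_one, opMat_transpose hT (by omega), opMat_transpose hE (by omega)]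

theorem opGen_additive {A : Type*} [AddCommGroup A] {φ : Fin (X.dimV n) → A}
    (hφ : ∀ a, φ a.rev = -φ a) (z : BGen r) {y x : Fin r → Fin (X.dimV n)}
    (h : opGen (braidMat X n κ) (contractMat X n κ) (qU X κ) z y x ≠ 0) :
    ∑ t, φ (y t) = ∑ t, φ (x t) := by
  have hT := braidMat_additive κ hφ
  have hE := contractMat_additive κ hφ
  cases z with
  | T m => exact opMat_additive hT (by omega) h
  | E m => exact opMat_additive hE (by omega) h
  | Tinv m =>
    by_contra hne
    have h1 : opMat (braidMat X n κ) r m y x = 0 := by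
      by_contra h'
      exact hne (opMat_additive hT (by omega) h')
    have h2 : opMat (contractMat X n κ) r m y x = 0 := by
      by_contra h'
      exact hne (opMat_additive hE (by omega) h')
    refine h ?_
    rw [opGen, skeinInv, Matrix.sub_apply, Matrix.smul_apply, Matrix.sub_apply, h1, h2,
      Matrix.one_apply_ne fun h' => hne (by rw [h'])]
    simp

/-- Reversal of the factors realizes T_i ↦ T_{r-i} and E_i ↦ E_{r-i}, which is why the form of type
B is paired with `sigmaTilde`. -/
theorem opGen_flipRev (z : BGen r) (y x : Fin r → Fin (X.dimV n)) :
    opGen (braidMat X n κ) (contractMat X n κ) (qU X κ) z.flip (flipRev x) (flipRev y) =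
      opGen (braidMat X n κ) (contractMat X n κ) (qU X κ) z x y := by
  have hT := braidMat_swapRev (X := X) (n := n) κ
  have hE := contractMat_swapRev (X := X) (n := n) κ
  cases z with
  | T m => simp only [BGen.flip, opGen, opMat_flipRev hT, Fin.rev_rev]
  | E m => simp only [BGen.flip, opGen, opMat_flipRev hE, Fin.rev_rev]
  | Tinv m =>
    simp only [BGen.flip, opGen, skeinInv, Matrix.sub_apply, Matrix.smul_apply,
      opMat_flipRev hT, opMat_flipRev hE, Fin.rev_rev, Matrix.one_apply,
      (Function.Involutive.injective flipRev_flipRev).eq_iff]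

variable (n r) in
/-- The Gram matrix of the form on the tensor space in type `B`. -/
noncomputable def gramB : Matrix (Fin r → Fin (Ty.B.dimV n)) (Fin r → Fin (Ty.B.dimV n)) κ :=
  monoMat flipRev fun i => ((vU κ ^ (-∑ s, rhoV .B n (i s)) : κˣ) : κ)

theorem baseMat_gramB (F : Type*) [Field F] [Algebra LA F] :
    baseMat F (monoMat flipRev fun i : Fin r → Fin (Ty.B.dimV n) =>
      ((vL ^ (-∑ s, rhoV .B n (i s)) : LAˣ) : LA)) = gramB n F r := by
  rw [baseMat_monoMat, gramB]
  congr 1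
  funext i
  rw [← map_vL F, ← map_zpow]
  rfl

theorem gramB_QV : gramB n QV r =
    monoMat flipRev (fun i => v ^ (-∑ s, rhoV .B n (i s))) := by
  rw [gramB]
  congr 1
  funext i
  rw [Units.val_zpow_eq_zpow_val, vU_QV]

theorem exists_isHom_dual_B (hn : Ty.B.minRank ≤ n) (hq : (qU .B κ : κ) ^ 2 ≠ 1) :
    (formB n κ r).Nondegenerate ∧
    ∃ Φ : TV .B n κ r ≃ₗ[κ] Module.Dual κ (TV .B n κ r),
      (∀ x y, Φ x y = formB n κ r x y) ∧
      (tensorBimodule κ r hn hq).IsHom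
        ((tensorBimodule κ r hn hq).dual (antipodeK .B n κ) (sigmaTilde κ _ _ r))
        Φ.toLinearMap := by
  have h1 : (formB n κ r).Nondegenerate :=
    nondegenerate_monoMat _ flipRev_flipRev fun i => Units.ne_zero _
  refine ⟨h1, exists_isHom_dual hn hq h1 _ _ (fun w => ?_) (fun z => ?_)⟩
  · have h2 := transpose_matrixAction hn hq r (J := monoMat flipRev fun i =>
      ((vL ^ (-∑ s, rhoV .B n (i s)) : LAˣ) : LA)) (antipode .B) antipode_mem
      (fun u => by rw [baseMat_gramB, gramB_QV]; exact antipode_tensorRep hn u) w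
    rw [baseMat_gramB] at h2
    exact h2
  · have h2 : sigmaTilde κ (varrho .B n κ) (qU .B κ) r (bgen κ _ _ z) =
        MulOpposite.op (bgen κ _ _ z.flip) := by
      rw [sigmaTilde, AlgHom.comp_apply, gamma, liftBMW_bgen, Function.comp_apply, sigma,
        liftBMW_bgen]
    rw [h2, MulOpposite.unop_op, bmwMat_bgen, bmwMat_bgen]
    refine opGen_transpose_mul κ flipRev_flipRev _ (fun y x => opGen_flipRev κ z y x)
      (opGen_transpose κ z) fun y x h => ?_
    -- The Gram entry depends on the sum of the ρ only, and ρ is odd under duality of indices.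
    rw [opGen_additive κ rhoV_rev z h]

variable (X n r) in
/-- The Gram matrix of the form on the tensor space in types `C` and `D`. -/
noncomputable def gramCD : Matrix (Fin r → Fin (X.dimV n)) (Fin r → Fin (X.dimV n)) κ :=
  monoMat id fun i => (qU X κ : κ) ^ beta X i

variable (X n r) in
theorem formCD_eq : formCD X n κ r = Matrix.toBilin (vBasis X n κ r) (gramCD X n κ r) := by
  rw [gramCD, monoMat_id]
  rfl

theorem baseMat_gramCD (F : Type*) [Field F] [Algebra LA F] :
    baseMat F (monoMat id fun i : Fin r → Fin (X.dimV n) => (qL X : LA) ^ beta X i) =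
      gramCD X n F r := by
  rw [baseMat_monoMat, gramCD]
  congr 1
  funext i
  rw [map_pow, map_qL_val]

theorem gramCD_QV (hX : X = .C ∨ X = .D) : gramCD X n QV r =
    monoMat id (fun i => v ^ (beta X i : ℤ)) := by
  rw [gramCD]
  congr 1
  funext i
  have h5 : qExp X = 1 := by rcases hX with rfl | rfl <;> rfl
  rw [qU_QV, h5, pow_one, zpow_natCast]

theorem exists_isHom_dual_CD (hX : X = .C ∨ X = .D) (hn : X.minRank ≤ n)
    (hq : (qU X κ : κ) ^ 2 ≠ 1) :
    (formCD X n κ r).Nondegenerate ∧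
    ∃ Φ : TV X n κ r ≃ₗ[κ] Module.Dual κ (TV X n κ r),
      (∀ x y, Φ x y = formCD X n κ r x y) ∧
      (tensorBimodule κ r hn hq).IsHom
        ((tensorBimodule κ r hn hq).dual (tauK X n κ) (sigma κ _ _ r)) Φ.toLinearMap := by
  rw [formCD_eq]
  have h1 : (Matrix.toBilin (vBasis X n κ r) (gramCD X n κ r)).Nondegenerate :=
    nondegenerate_monoMat _ (fun _ => rfl) fun i => pow_ne_zero _ (Units.ne_zero _)
  refine ⟨h1, exists_isHom_dual hn hq h1 _ _ (fun w => ?_) (fun z => ?_)⟩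
  · have h2 := transpose_matrixAction hn hq r (J := monoMat id fun i =>
      (qL X : LA) ^ beta X i) (tau X) tau_mem
      (fun u => by rw [baseMat_gramCD, gramCD_QV hX]; exact tau_tensorRep hX hn u) w
    rw [baseMat_gramCD] at h2
    exact h2
  · rw [sigma, liftBMW_bgen, MulOpposite.unop_op, bmwMat_bgen]
    refine opGen_transpose_mul κ (fun _ => rfl) _ (fun y x => rfl)
      (opGen_transpose κ z) fun y x h => ?_
    -- The operator preserves the total weight, and that determines β.
    have h2 : (beta X y : ℤ) = beta X x := by
      have h3 := two_mul_beta hX y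
      rw [opGen_additive κ wt_rev z h, ← two_mul_beta hX x] at h3
      omega
    rw [Int.ofNat_inj.1 h2]

end Forms

end QG

/-! ### The theorem for all three types -/

theorem mainTheorem5 {κ : Type*} [Field κ] [Algebra QG.LA κ] (n r : ℕ) (hr : 0 < r) :
    (∀ (hn : QG.Ty.B.minRank ≤ n) (hq : (QG.qU .B κ : κ) ^ 2 ≠ 1),
      ∃ P : QG.Bimodule κ (QG.UK .B n κ) (QG.BMWK .B n κ r) (QG.TV .B n κ r),
        QG.IsTensorBimodule hn hq P ∧
        (QG.formB n κ r).Nondegenerate ∧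
        ∃ Φ : QG.TV .B n κ r ≃ₗ[κ] Module.Dual κ (QG.TV .B n κ r),
          (∀ x y, Φ x y = QG.formB n κ r x y) ∧
          P.IsHom (P.dual (QG.antipodeK .B n κ) (QG.sigmaTilde κ _ _ r)) Φ.toLinearMap) ∧
    ∀ X : QG.Ty, X = .C ∨ X = .D →
      ∀ (hn : X.minRank ≤ n) (hq : (QG.qU X κ : κ) ^ 2 ≠ 1),
      ∃ P : QG.Bimodule κ (QG.UK X n κ) (QG.BMWK X n κ r) (QG.TV X n κ r),
        QG.IsTensorBimodule hn hq P ∧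
        (QG.formCD X n κ r).IsSymm ∧ (QG.formCD X n κ r).Nondegenerate ∧
        ∃ Φ : QG.TV X n κ r ≃ₗ[κ] Module.Dual κ (QG.TV X n κ r),
          (∀ x y, Φ x y = QG.formCD X n κ r x y) ∧
          P.IsHom (P.dual (QG.tauK X n κ) (QG.sigma κ _ _ r)) Φ.toLinearMap := by
  refine ⟨fun hn hq => ⟨QG.tensorBimodule κ r hn hq, QG.isTensorBimodule hn hq,
    QG.exists_isHom_dual_B κ hn hq⟩, fun X hX hn hq => ⟨QG.tensorBimodule κ r hn hq,
    QG.isTensorBimodule hn hq, QG.isSymm_toBilin_diagonal _ _, QG.exists_isHom_dual_CD κ hX hn hq⟩⟩
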